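/- **Setting.** Let $n_1,n_2\ge 0$, $n=n_1+n_2$, $m\ge1$, $A\subset\mathbb R^n$. Coordinates are $I=(I_1,I_2)\in\mathbb C^{n_1}\times\mathbb C^{n_2}$, $\varphi\in(\mathbb C/2\pi\mathbb Z)^n$, $p,q\in\mathbb C^m$, with symplectic form $dI\wedge d\varphi+dp\wedge dq$. We consider two cases. * *Elliptic case* ($m\ge 1$ and a subgroup $\mathbb L\subset\mathbb Z^{n+m}$ are arbitrary): $J_j=\frac{p_j^2+q_j^2}{2}$, $z_j=\frac{p_j-iq_j}{\sqrt2}$, $w_j=\frac{p_j+iq_j}{i\sqrt2}$. * *Hyperbolic case* ($m=1$, $\mathbb L=\{0\}$): $J=pq$, $z=p$, $w=q$. For $r,s,\varepsilon>0$ put $A_r=\{I\in\mathbb C^n:\ |I-I^0|_1<r \text{ for some } I^0\in A\}$, $B_\varepsilon=\{(p,q):|z_j|<\varepsilon,\ |w_j|<\varepsilon\ \forall j\}$, $U_{r,\varepsilon}=A_r\times B_\varepsilon$ and $W_{r,s,\varepsilon}=A_r\times\{|\mathrm{Im}\,\varphi_i|<s\ \forall i\}\times B_\varepsilon$. *Real-analytic*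 means holomorphic on the indicated complex domain and real at real points. A function $f$ real-analytic on $W_{r,s,\varepsilon}$ is expanded as $$f=\sum_{k\in\mathbb Z^n}\ \sum_{\alpha,\beta\in\mathbb N^m,\ \alpha_j\beta_j=0\,\forall j} f_{k,\alpha,\beta}(I,z_1w_1,\dots,z_mw_m)\,e^{ik\cdot\varphi}z^\alpha w^\beta ,$$ and $$\|f\|_{r,s,\varepsilon}=\sum_{k,\alpha,\beta}\ \sup_{U_{r,\varepsilon}}|f_{k,\alpha,\beta}|\;e^{|k|_1s}\,\varepsilon^{|\alpha|_1+|\beta|_1}\in[0,\infty].$$ $T_Kf$ is the sum of the terms with $|k|_1+|\beta-\alpha|_1\le K$, and $\Pi_{\mathbb L}f$ is the sum of the terms with $(k,\beta-\alpha)\in\mathbb L$; $f$ is in $(K,\mathbb L)$ normal form if $f=\Pi_{\mathbb L}T_Kf$. Let $c_m$ be (in each of the two cases) the smallest number such that $$\|\{f,g\}\|_{r-\hat r,s-\hat s,\varepsilon-\hat\varepsilon}\le\frac{c_m}{\min\{\hat r\hat s,\hat\varepsilon^2\}}\|f\|_{r,s,\varepsilon}\|g\|_{r,s,\varepsilon}$$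 for all $n$, $A$, all $0<\hat r<r$, $0<\hat s<s$, $0<\hat\varepsilon<\varepsilon$ and all $f,g$ real-analytic on $W_{r,s,\varepsilon}$. **Proposition.** Let $K,r,s,\varepsilon>0$, $0<\hat r<r/4$, $0<\hat s<s/4$, $0<\hat\varepsilon<\varepsilon/4$, and put $\hat\sigma=\min\{\hat s,\hat\varepsilon/\varepsilon\}$, $\delta=\min\{\hat r\hat s,\hat\varepsilon^2\}$. Let $$H(I,\varphi,p,q)=h(I_1,I_2,J(p,q))+f(I,\varphi,p,q),$$ with $f$ real-analytic on $W_{r,s,\varepsilon}$, $\|f\|_{r,s,\varepsilon}<\infty$, and $h=h(I,J)$ real-analytic on $A_r\times\{J\in\mathbb C^m:|J_j|<\varepsilon^2\ \forall j\}$. Let $\omega=\partial_Ih$ and $\nu=\partial_Jh$, evaluated at $(I,J(p,q))$. Assume that there are $\alpha_1\ge\alpha_2>0$ such that, for all $(k,l)=(k_1,k_2,l)\in(\mathbb Z^{n_1}\times\mathbb Z^{n_2}\times\mathbb Z^m)\setminus\mathbb L$ with $|k|_1+|l|_1\le K$ and all $(I,p,q)\in U_{r,\varepsilon}$, the number $$d_{k,l}=\omega\cdot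 k+\nu\cdot l\ \text{ (elliptic case)},\qquad d_{k,l}=\omega\cdot k-i\,\nu\, l\ \text{ (hyperbolic case)}$$ satisfies $|d_{k,l}|\ge\alpha_1$ if $k_1\ne0$ and $|d_{k,l}|\ge\alpha_2$ if $k_1=0$. Assume also $$K\hat\sigma\ge 8\log 2,\qquad \frac{2^3c_mK\hat\sigma}{\alpha_2\delta}\,\|f\|_{r,s,\varepsilon}<1 .$$ Then, with $r_*=r-4\hat r$, $s_*=s-4\hat s$, $\varepsilon_*=\varepsilon-4\hat\varepsilon$, there are an injective, real-analytic and symplectic map $\Phi_*:W_{r_*,s_*,\varepsilon_*}\to W_{r,s,\varepsilon}$ and functions $g,f_*$ real-analytic on $W_{r_*,s_*,\varepsilon_*}$ such that $$H\circ\Phi_*=h(I,J(p,q))+g+f_*,$$ where $g$ is in $(K,\mathbb L)$ normal form and $$\|g-\Pi_{\mathbb L}T_Kf\|_{r_*,s_*,\varepsilon_*}\le\frac{8c_m\|f\|_{r,s,\varepsilon}^2}{\alpha_2\delta},\qquad \|f_*\|_{r_*,s_*,\varepsilon_*}\le e^{-K\hat\sigma/4}\|f\|_{r,s,\varepsilon}.$$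 Moreover, writing $(I',\varphi',p',q')=\Phi_*(I,\varphi,p,q)$, on $W_{r_*,s_*,\varepsilon_*}$ $$\max\big\{\alpha_1\hat s|I_1-I_1'|_1,\ \alpha_2\hat s|I_2-I_2'|_1,\ \alpha_2\hat r|\varphi-\varphi'|_\infty,\ \alpha_2\hat\varepsilon|p-p'|_\infty,\ \alpha_2\hat\varepsilon|q-q'|_\infty\big\}\le 2c_m\|f\|_{r,s,\varepsilon}.$$ -/

import Mathlib

open scoped BigOperators ENNReal

noncomputable section

namespace Averaging

/-- The two kinds of rectangular coordinates: `hyperbolic`, with actions `p_j q_j`, and `elliptic`,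
with actions `(p_j ^ 2 + q_j ^ 2) / 2`. -/
inductive Kind where
  | hyperbolic : Kind
  | elliptic : Kind

/-- First normal coordinate: `z = p` (hyperbolic) or `z = (p - i q) / √2` (elliptic). -/
def zCoord : Kind → ℂ → ℂ → ℂ
  | .hyperbolic, p, _ => p
  | .elliptic, p, q => (p - Complex.I * q) / (Real.sqrt 2 : ℂ)

/-- Second normal coordinate: `w = q` (hyperbolic) or `w = (p + i q) / (i √2)` (elliptic). -/
def wCoord : Kind → ℂ → ℂ → ℂ
  | .hyperbolic, _, q => q
  | .elliptic, p, q => (p + Complex.I * q) / (Complex.I * (Real.sqrt 2 : ℂ))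

/-- The coordinate `p` as a function of `(z, w)`. -/
def pCoord : Kind → ℂ → ℂ → ℂ
  | .hyperbolic, z, _ => z
  | .elliptic, z, w => (z + Complex.I * w) / (Real.sqrt 2 : ℂ)

/-- The coordinate `q` as a function of `(z, w)`. -/
def qCoord : Kind → ℂ → ℂ → ℂ
  | .hyperbolic, _, w => w
  | .elliptic, z, w => (Complex.I * z + w) / (Real.sqrt 2 : ℂ)

/-- The action of one pair `(p, q)`. -/
def action : Kind → ℂ → ℂ → ℂ
  | .hyperbolic, p, q => p * q
  | .elliptic, p, q => (p ^ 2 + q ^ 2) / 2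

lemma pCoord_z_w (kd : Kind) (p q : ℂ) :
    pCoord kd (zCoord kd p q) (wCoord kd p q) = p := by
  have h2 : (Real.sqrt 2 : ℂ) ^ 2 = 2 := by
    rw [← Complex.ofReal_pow, Real.sq_sqrt (by norm_num)]; norm_num
  have h0 : (Real.sqrt 2 : ℂ) ≠ 0 := by
    intro h; rw [h] at h2; norm_num at h2
  cases kd
  · rfl
  · simp only [pCoord, zCoord, wCoord]
    field_simp
    rw [h2]; ring

lemma qCoord_z_w (kd : Kind) (p q : ℂ) :
    qCoord kd (zCoord kd p q) (wCoord kd p q) = q := by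
  have h2 : (Real.sqrt 2 : ℂ) ^ 2 = 2 := by
    rw [← Complex.ofReal_pow, Real.sq_sqrt (by norm_num)]; norm_num
  have h0 : (Real.sqrt 2 : ℂ) ≠ 0 := by
    intro h; rw [h] at h2; norm_num at h2
  cases kd
  · rfl
  · simp only [qCoord, zCoord, wCoord]
    field_simp
    rw [h2, Complex.I_sq]; ring

/-- Complexified phase space with coordinates `(I, φ, p, q)`; the angles `φ` are lifted to the
universal cover of the torus, and functions on the torus are periodic functions. -/
abbrev Phase (ι : Type) (m : ℕ) : Type :=
  (ι → ℂ) × (ι → ℂ) × (Fin m → ℂ) × (Fin m → ℂ)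

/-- The points `(I, p, q)`. -/
abbrev Base (ι : Type) (m : ℕ) : Type := (ι → ℂ) × (Fin m → ℂ) × (Fin m → ℂ)

/-- Fourier indices `(k, l)`; `k` is dual to the angles `φ`, `l` to the rotations of the pairs
`(p_j, q_j)`. -/
abbrev Mode (ι : Type) (m : ℕ) : Type := (ι → ℤ) × (Fin m → ℤ)

section Domains

variable {ι : Type} [Fintype ι] {m : ℕ}

/-- `A_r`: the complex `r`-neighbourhood, in the `1`-norm, of a set `A` of real points. -/
def nbhd (A : Set (ι → ℝ)) (r : ℝ) : Set (ι → ℂ) :=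
  {I | ∃ a ∈ A, ∑ i, ‖I i - (a i : ℂ)‖ < r}

/-- `B_ε`: the complex ball of radius `ε` centred at `0`, for the sup norm of the normal
coordinates `(z, w)`; in the hyperbolic case this is the sup norm of `(p, q)`. -/
def polyball (kd : Kind) (m : ℕ) (ε : ℝ) : Set ((Fin m → ℂ) × (Fin m → ℂ)) :=
  {y | ∀ j, ‖zCoord kd (y.1 j) (y.2 j)‖ < ε ∧ ‖wCoord kd (y.1 j) (y.2 j)‖ < ε}

/-- `U_{r,ε} = A_r × B_ε`. -/
def baseDomain (kd : Kind) (A : Set (ι → ℝ)) (r ε : ℝ) : Set (Base ι m) :=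
  {u | u.1 ∈ nbhd A r ∧ u.2 ∈ polyball kd m ε}

/-- `W_{r,s,ε} = A_r × 𝕋_s × B_ε`, with the angles lifted to the strip `|Im φ_i| < s`. -/
def domain (kd : Kind) (A : Set (ι → ℝ)) (r s ε : ℝ) : Set (Phase ι m) :=
  {x | x.1 ∈ nbhd A r ∧ (∀ i, |(x.2.1 i).im| < s) ∧ x.2.2 ∈ polyball kd m ε}

/-- The image of `U_{r,ε}` under `(I, p, q) ↦ (I, J)`, where `J` are the actions. -/
def actionDomain (A : Set (ι → ℝ)) (m : ℕ) (r ε : ℝ) : Set ((ι → ℂ) × (Fin m → ℂ)) :=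
  {y | y.1 ∈ nbhd A r ∧ ∀ j, ‖y.2 j‖ < ε ^ 2}

/-- The actions `J(p, q)`. -/
def actions (kd : Kind) (y : (Fin m → ℂ) × (Fin m → ℂ)) : Fin m → ℂ :=
  fun j => action kd (y.1 j) (y.2 j)

/-- The translation of the angles by `2π k`. -/
def shift (k : ι → ℤ) (x : Phase ι m) : Phase ι m :=
  (x.1, fun i => x.2.1 i + 2 * (Real.pi : ℂ) * (k i : ℂ), x.2.2)

/-- All coordinates are real. -/
def IsRealPoint (x : Phase ι m) : Prop :=
  (∀ i, (x.1 i).im = 0) ∧ (∀ i, (x.2.1 i).im = 0) ∧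
    (∀ j, (x.2.2.1 j).im = 0) ∧ (∀ j, (x.2.2.2 j).im = 0)

/-- Real-analytic functions on a complex domain: holomorphic, `2π`-periodic in the angles, real at
the real points. -/
structure RealAnalyticFun (f : Phase ι m → ℂ) (W : Set (Phase ι m)) : Prop where
  holo : DifferentiableOn ℂ f W
  periodic : ∀ k : ι → ℤ, ∀ x ∈ W, f (shift k x) = f x
  real : ∀ x ∈ W, IsRealPoint x → (f x).im = 0

/-- Real-analytic integrable parts `h(I, J)`. -/
structure RealAnalyticIntegrable (h : (ι → ℂ) × (Fin m → ℂ) → ℂ)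
    (D : Set ((ι → ℂ) × (Fin m → ℂ))) : Prop where
  holo : DifferentiableOn ℂ h D
  real : ∀ y ∈ D, (∀ i, (y.1 i).im = 0) → (∀ j, (y.2 j).im = 0) → (h y).im = 0

end Domains

section Fourier

variable {ι : Type} [Fintype ι] {m : ℕ}

/-- The rotation `z_j ↦ e^{-i ψ_j} z_j`, `w_j ↦ e^{i ψ_j} w_j`, in the coordinates `(p, q)`. -/
def rot (kd : Kind) (ψ : Fin m → ℝ) (y : (Fin m → ℂ) × (Fin m → ℂ)) :
    (Fin m → ℂ) × (Fin m → ℂ) :=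
  (fun j => pCoord kd
      (Complex.exp (-(Complex.I * (ψ j : ℂ))) * zCoord kd (y.1 j) (y.2 j))
      (Complex.exp (Complex.I * (ψ j : ℂ)) * wCoord kd (y.1 j) (y.2 j)),
   fun j => qCoord kd
      (Complex.exp (-(Complex.I * (ψ j : ℂ))) * zCoord kd (y.1 j) (y.2 j))
      (Complex.exp (Complex.I * (ψ j : ℂ)) * wCoord kd (y.1 j) (y.2 j)))

/-- The part of frequency `(k, l)` of `f`, as a function of `(I, p, q)`: the average of
`f(I, θ, rot ψ (p, q)) e^{-i (k·θ + l·ψ)}` over the real tori. It collects all the terms of the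
Taylor-Fourier expansion of `f` with `e^{i k·φ} z^α w^β`, `β - α = l`. -/
def fourierPart (kd : Kind) (f : Phase ι m → ℂ) (κ : Mode ι m) (u : Base ι m) : ℂ :=
  ((2 * Real.pi : ℝ) : ℂ)⁻¹ ^ (Fintype.card ι + m) *
    ∫ θ in Set.Icc (0 : ι → ℝ) (fun _ => 2 * Real.pi),
      ∫ ψ in Set.Icc (0 : Fin m → ℝ) (fun _ => 2 * Real.pi),
        f (u.1, fun i => (θ i : ℂ), rot kd ψ u.2) *
          Complex.exp (-(Complex.I *
            (∑ i, (κ.1 i : ℂ) * (θ i : ℂ) + ∑ j, (κ.2 j : ℂ) * (ψ j : ℂ))))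

/-- The monomial `z^α w^β` with `α_j β_j = 0` and `β - α = l`, that is `α_j = max(-l_j, 0)` and
`β_j = max(l_j, 0)`. -/
def monomial (kd : Kind) (l : Fin m → ℤ) (y : (Fin m → ℂ) × (Fin m → ℂ)) : ℂ :=
  ∏ j, (zCoord kd (y.1 j) (y.2 j)) ^ (-l j).toNat * (wCoord kd (y.1 j) (y.2 j)) ^ (l j).toNat

/-- The coefficient `f_{k,α,β}` (a function of `I` and of the products `z_j w_j`) of the expansion
`f = ∑ f_{k,α,β} e^{i k·φ} z^α w^β` over `k` and over the `α, β` with `α_j β_j = 0` for all `j`.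
Where the monomial vanishes this formula gives `0`, which does not change the suprema below. -/
def coeff (kd : Kind) (f : Phase ι m → ℂ) (κ : Mode ι m) (u : Base ι m) : ℂ :=
  fourierPart kd f κ u / monomial kd κ.2 u.2

/-- The sup-Taylor-Fourier norm
`‖f‖_{r,s,ε} = ∑ sup_{U_{r,ε}} |f_{k,α,β}| e^{|k|₁ s} ε^{|α|₁ + |β|₁}`, possibly `∞`. -/
def tfNorm (kd : Kind) (A : Set (ι → ℝ)) (r s ε : ℝ) (f : Phase ι m → ℂ) : ℝ≥0∞ :=
  ∑' κ : Mode ι m, (⨆ u ∈ baseDomain (m := m) kd A r ε, ‖coeff kd f κ u‖ₑ) *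
    ENNReal.ofReal (Real.exp ((∑ i, |(κ.1 i : ℝ)|) * s)) *
    ENNReal.ofReal (ε ^ (∑ j, (κ.2 j).natAbs))

/-- `|(k, l)|₁`. -/
def modeNorm (κ : Mode ι m) : ℝ := ∑ i, |(κ.1 i : ℝ)| + ∑ j, |(κ.2 j : ℝ)|

open Classical in
/-- The sum of the terms of the expansion of `f` with indices `(k, β - α)` in `S`. -/
def harmonicProj (kd : Kind) (S : Set (Mode ι m)) (f : Phase ι m → ℂ) (x : Phase ι m) : ℂ :=
  ∑' κ : Mode ι m, if κ ∈ S then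
    fourierPart kd f κ (x.1, x.2.2) * Complex.exp (Complex.I * ∑ i, (κ.1 i : ℂ) * x.2.1 i) else 0

/-- The `K`-truncation `T_K`. -/
def truncation (kd : Kind) (K : ℝ) (f : Phase ι m → ℂ) : Phase ι m → ℂ :=
  harmonicProj kd {κ | modeNorm κ ≤ K} f

/-- The projection `Π_𝕃` on a sub-lattice `𝕃` of indices. -/
def latticeProj (kd : Kind) (L : AddSubgroup (Mode ι m)) (f : Phase ι m → ℂ) : Phase ι m → ℂ :=
  harmonicProj kd (L : Set (Mode ι m)) f

/-- `f` is in `(K, 𝕃)` normal form on `W`: `f = Π_𝕃 T_K f` there. -/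
def InNormalForm (kd : Kind) (K : ℝ) (L : AddSubgroup (Mode ι m)) (f : Phase ι m → ℂ)
    (W : Set (Phase ι m)) : Prop :=
  ∀ x ∈ W, f x = latticeProj kd L (truncation kd K f) x

end Fourier

section Symplectic

variable {ι : Type} [Fintype ι] [DecidableEq ι] {m : ℕ}

/-- Unit vector in the direction of `I_i`. -/
def dirI (m : ℕ) (i : ι) : Phase ι m := (Pi.single i 1, 0, 0, 0)
/-- Unit vector in the direction of `φ_i`. -/
def dirφ (m : ℕ) (i : ι) : Phase ι m := (0, Pi.single i 1, 0, 0)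
/-- Unit vector in the direction of `p_j`. -/
def dirp (ι : Type) {m : ℕ} (j : Fin m) : Phase ι m := (0, 0, Pi.single j 1, 0)
/-- Unit vector in the direction of `q_j`. -/
def dirq (ι : Type) {m : ℕ} (j : Fin m) : Phase ι m := (0, 0, 0, Pi.single j 1)

/-- The Poisson bracket of `dI ∧ dφ + dp ∧ dq`. -/
def poisson (f g : Phase ι m → ℂ) (x : Phase ι m) : ℂ :=
  ∑ i, (fderiv ℂ f x (dirI m i) * fderiv ℂ g x (dirφ m i) -
      fderiv ℂ f x (dirφ m i) * fderiv ℂ g x (dirI m i)) +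
  ∑ j, (fderiv ℂ f x (dirp ι j) * fderiv ℂ g x (dirq ι j) -
      fderiv ℂ f x (dirq ι j) * fderiv ℂ g x (dirp ι j))

/-- The symplectic form `dI ∧ dφ + dp ∧ dq`. -/
def symplForm (u v : Phase ι m) : ℂ :=
  ∑ i, (u.1 i * v.2.1 i - u.2.1 i * v.1 i) +
  ∑ j, (u.2.2.1 j * v.2.2.2 j - u.2.2.2 j * v.2.2.1 j)

/-- A real-analytic symplectic transformation of `W` into `W'`: a holomorphic injective map,
compatible with the torus structure of the angles, sending real points to real points, and
preserving the symplectic form. -/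
structure RealSymplecticMap (Φ : Phase ι m → Phase ι m) (W W' : Set (Phase ι m)) : Prop where
  mapsTo : Set.MapsTo Φ W W'
  holo : DifferentiableOn ℂ Φ W
  injOn : Set.InjOn Φ W
  equivariant : ∀ k : ι → ℤ, ∀ x ∈ W, Φ (shift k x) = shift k (Φ x)
  real : ∀ x ∈ W, IsRealPoint x → IsRealPoint (Φ x)
  symplectic : ∀ x ∈ W, ∀ u v : Phase ι m,
    symplForm (fderiv ℂ Φ x u) (fderiv ℂ Φ x v) = symplForm u v

/-- The divisor of index `(k, l)` at `(I, p, q)`, with `ω = ∂_I h` and `ν = ∂_J h` evaluated at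
`(I, J(p, q))`: it is `ω·k + ν·l` (elliptic) or `ω·k - i ν·l` (hyperbolic). -/
def divisor (kd : Kind) (h : (ι → ℂ) × (Fin m → ℂ) → ℂ) (κ : Mode ι m) (u : Base ι m) : ℂ :=
  let D := fderiv ℂ h (u.1, actions kd u.2)
  let ωk := ∑ i, D (Pi.single i 1, 0) * (κ.1 i : ℂ)
  let νl := ∑ j, D (0, Pi.single j 1) * (κ.2 j : ℂ)
  match kd with
  | .hyperbolic => ωk - Complex.I * νl
  | .elliptic => ωk + νl

end Symplectic

/-- `c_m`: the smallest number `c` such that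
`‖{f, g}‖_{r - r̂, s - ŝ, ε - ε̂} ≤ (c / δ) ‖f‖_{r,s,ε} ‖g‖_{r,s,ε}` with `δ = min(r̂ ŝ, ε̂²)`, for all
real-analytic `f, g` on `W_{r,s,ε}` and all `r̂ < r`, `ŝ < s`, `ε̂ < ε`. -/
def bracketConst (kd : Kind) (m : ℕ) : ℝ :=
  sInf {c : ℝ | 0 ≤ c ∧ ∀ (n : ℕ) (A : Set (Fin n → ℝ)) (r s ε r' s' ε' : ℝ),
    0 < r' → r' < r → 0 < s' → s' < s → 0 < ε' → ε' < ε →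
    ∀ f g : Phase (Fin n) m → ℂ,
      RealAnalyticFun f (domain kd A r s ε) → RealAnalyticFun g (domain kd A r s ε) →
      tfNorm kd A (r - r') (s - s') (ε - ε') (poisson f g) ≤
        ENNReal.ofReal (c / min (r' * s') (ε' ^ 2)) *
          tfNorm kd A r s ε f * tfNorm kd A r s ε g}

end Averaging

end

/-! The real torus acts on phase space by translating `φ` and multiplying `z_j`, `w_j` by inverse
phases, and the part of `f` of frequency `(k, l)` is its component for the corresponding character.
Such a mode is equivariant under the complexified torus as long as the orbit stays in the domain.
Pushing points along complex orbits to the boundary shows that the weighted supremum of a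
coefficient equals the plain supremum of the mode over `W` (`ModeFun.sup_eq`). So the norm is the
`ℓ¹` sum of the sup norms of the modes. Brackets of modes are again modes, and brackets of functions
become convolutions.

In coordinates rescaled by the losses, level `t` is the domain with parameters `r - t r'`, `s - t
s'`, `ε - t ε'`, and it has distance at least `t - a` from the complement of level `a`. The Poisson
tensor has norm at most `1/δ` there, because the `1`-norm of the actions and the sup norm of the
angles are dual. Cauchy's estimate then bounds a bracket by `1/δ` times the inverse losses
(`nrm_conv_le`). The averaging itself takes place in an abstract `ModeSystem`, where only these
facts are used.

The integrable part depends on invariants of the torus, so its Hamiltonian field is tangent to the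
complex orbits and `{·, h}` multiplies a mode by `-i` times its divisor (`ham_hamC`,
`ModeFun.fderiv_gen`). Let `N` be the set of modes outside `𝕃` of order at most `K`. The homological
equation on `N` is solved by division, and composition with the time-one map of the solution `χ` is
a Lie series. The series converges because a loss split into `n` equal parts gives `n ^ n / n! ≤ 3 ^
n` (`nrm_adIter_le`). This is `exists_averaging_step`.

Write `η` for the norm of `f`, `μ = η / (α₂ δ)` and `X = K σ`. A first step costs `5/2` levels and
replaces the `N`-part of `f` by a remainder of size about `μ η`. Then `n = ⌈X / 8⌉` steps share one
further level, and each divides the `N`-part of the remainder by at least eight. This is possible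
with only `n μ` small: the part of `f` that is kept is still known at level `0`, so a bracket with
it costs one factor `n`, while the factor `n ^ 2` in brackets with the remainder meets two factors
of size `μ`. Since `8 ^ (-n) ≤ e^{-X/4}`, the `N`-part becomes exponentially small
(`exists_averaging`). Modes of order above `K` are never averaged; the last half level damps them by
`e^{-X/2}` (`ModeFun.supN_four_le`).

Two further points complete the proof. Testing the bracket estimate on `p_j` and `q_j` gives `c_m ≥
1/2` (`half_le_bracketConst`), so the hypothesis on `c_m` yields `4 X μ ≤ 1`, and the displacement
bound `η` is at most `2 c_m η`. And a mode with `k₁ = 0` generates a field that does not move `I₁`,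
so only divisors bounded below by `α₁` enter the displacement of `I₁`. -/

section

open Set Metric Filter Topology MeasureTheory
open scoped Nat NNReal ENNReal

set_option linter.unusedSectionVars false

namespace Averaging

/-! ### Cauchy estimates, and holomorphy of series, parameter integrals and derivatives. -/

section Holomorphic

variable {E W : Type*} [NormedAddCommGroup E] [NormedSpace ℂ E]
  [NormedAddCommGroup W] [NormedSpace ℂ W]

/-- Cauchy's estimate along a line. -/
lemma norm_fderiv_apply_le {F : E → W} {U : Set E} (hU : IsOpen U) (hF : DifferentiableOn ℂ F U)
    {x v : E} {ρ C : ℝ} (hρ : 0 < ρ) (hx : x ∈ U)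
    (hmem : ∀ τ : ℂ, ‖τ‖ < ρ → x + τ • v ∈ U)
    (hC : ∀ τ : ℂ, ‖τ‖ < ρ → ‖F (x + τ • v)‖ ≤ C) :
    ‖fderiv ℂ F x v‖ ≤ C / ρ := by
  set g : ℂ → W := fun τ => F (x + τ • v) with hg
  have hgd : ∀ τ : ℂ, ‖τ‖ < ρ → DifferentiableAt ℂ g τ := fun τ hτ =>
    (hF.differentiableAt (hU.mem_nhds (hmem τ hτ))).comp τ (by fun_prop)
  have hder : deriv g 0 = fderiv ℂ F x v := by
    have h1 : HasDerivAt (fun τ : ℂ => x + τ • v) v 0 := by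
      simpa using ((hasDerivAt_id (0 : ℂ)).smul_const v).const_add x
    have h2 : HasFDerivAt F (fderiv ℂ F x) (x + (0 : ℂ) • v) := by
      simpa using (hF.differentiableAt (hU.mem_nhds hx)).hasFDerivAt
    exact (h2.comp_hasDerivAt 0 h1).deriv
  rw [← hder]
  -- The bound is known on the open disc only, so Cauchy's estimate is applied on smaller circles
  -- and `R` tends to `ρ`.
  have key : ∀ R : ℝ, 0 < R → R < ρ → ‖deriv g 0‖ ≤ C / R := by
    intro R hR hRρ
    refine Complex.norm_deriv_le_of_forall_mem_sphere_norm_le hR ?_ ?_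
    · refine DifferentiableOn.diffContOnCl fun τ hτ => ?_
      rw [closure_ball _ hR.ne'] at hτ
      exact (hgd τ (by simpa using lt_of_le_of_lt (mem_closedBall_zero_iff.1 hτ) hRρ)).differentiableWithinAt
    · intro τ hτ
      exact hC τ (by simpa [mem_sphere_zero_iff_norm.1 hτ] using hRρ)
  have hlim : Tendsto (fun R : ℝ => C / R) (𝓝[<] ρ) (𝓝 (C / ρ)) :=
    ((tendsto_const_nhds.div tendsto_id hρ.ne').mono_left nhdsWithin_le_nhds)
  refine ge_of_tendsto hlim ?_
  filter_upwards [Ioo_mem_nhdsLT hρ] with R hR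
  exact key R hR.1 hR.2

/-- Cauchy's estimate for the derivative. -/
lemma norm_fderiv_le {F : E → W} {U : Set E} (hU : IsOpen U) (hF : DifferentiableOn ℂ F U)
    {x : E} {ρ C : ℝ} (hρ : 0 < ρ) (hball : ball x ρ ⊆ U)
    (hC : ∀ y ∈ ball x ρ, ‖F y‖ ≤ C) : ‖fderiv ℂ F x‖ ≤ C / ρ := by
  have hC0 : 0 ≤ C := (norm_nonneg _).trans (hC x (mem_ball_self hρ))
  refine ContinuousLinearMap.opNorm_le_bound _ (by positivity) fun v => ?_
  rcases eq_or_ne v 0 with rfl | hv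
  · simp
  have hv' : 0 < ‖v‖ := norm_pos_iff.2 hv
  have hin : ∀ τ : ℂ, ‖τ‖ < ρ / ‖v‖ → x + τ • v ∈ ball x ρ := by
    intro τ hτ
    rw [mem_ball_iff_norm, add_sub_cancel_left, norm_smul]
    exact (lt_div_iff₀ hv').1 hτ
  have := norm_fderiv_apply_le hU hF (x := x) (v := v) (ρ := ρ / ‖v‖) (C := C) (by positivity)
    (hball (mem_ball_self hρ)) (fun τ hτ => hball (hin τ hτ)) (fun τ hτ => hC _ (hin τ hτ))
  rwa [div_div_eq_mul_div, mul_div_right_comm] at this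

/-- Series of holomorphic functions with summable bounds can be differentiated term by term. -/
lemma hasFDerivAt_tsum_of_bound {ι : Type*} [CompleteSpace W] {F : ι → E → W} {U : Set E}
    (hU : IsOpen U) (hF : ∀ i, DifferentiableOn ℂ (F i) U) {u : ι → ℝ} (hu : Summable u)
    (hb : ∀ i, ∀ x ∈ U, ‖F i x‖ ≤ u i) {x : E} (hx : x ∈ U) :
    HasFDerivAt (fun y => ∑' i, F i y) (∑' i, fderiv ℂ (F i) x) x := by
  obtain ⟨ρ, hρ, hball⟩ := Metric.isOpen_iff.1 hU x hx
  have hsub : ∀ y ∈ ball x (ρ / 2), ball y (ρ / 2) ⊆ ball x ρ := fun y hy =>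
    ball_subset_ball' (by have := mem_ball.1 hy; linarith)
  refine hasFDerivAt_tsum_of_isPreconnected (u := fun i => u i / (ρ / 2)) (hu.div_const _)
    (isOpen_ball (x := x) (ε := ρ / 2)) ((convex_ball x (ρ / 2)).isPreconnected) ?_ ?_
    (mem_ball_self (by positivity)) ?_ (mem_ball_self (by positivity))
  · intro i y hy
    have hyU : y ∈ U := hball (ball_subset_ball (by linarith) hy)
    exact ((hF i).differentiableAt (hU.mem_nhds hyU)).hasFDerivAt
  · intro i y hy
    exact norm_fderiv_le hU (hF i) (by positivity) ((hsub y hy).trans hball)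
      fun z hz => hb i z (hball (hsub y hy hz))
  · exact Summable.of_norm_bounded hu fun i => hb i x hx

lemma differentiableOn_tsum_of_bound {ι : Type*} [CompleteSpace W] {F : ι → E → W} {U : Set E}
    (hU : IsOpen U) (hF : ∀ i, DifferentiableOn ℂ (F i) U) {u : ι → ℝ} (hu : Summable u)
    (hb : ∀ i, ∀ x ∈ U, ‖F i x‖ ≤ u i) : DifferentiableOn ℂ (fun y => ∑' i, F i y) U :=
  fun _ hx => (hasFDerivAt_tsum_of_bound hU hF hu hb hx).differentiableAt.differentiableWithinAt

variable [FiniteDimensional ℂ E]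

/-- Integrals of holomorphic functions over a compact set of parameters are holomorphic. -/
lemma differentiableOn_integral_param {Θ : Type*} [MetricSpace Θ] [MeasurableSpace Θ]
    [BorelSpace Θ] [SecondCountableTopology Θ] {μ : Measure Θ} [IsFiniteMeasureOnCompacts μ]
    [NormedSpace ℝ W] [SMulCommClass ℝ ℂ W]
    {K : Set Θ} (hK : IsCompact K) (hKm : MeasurableSet K) {F : E → Θ → W} {U : Set E}
    (hU : IsOpen U) (hc : ContinuousOn (fun p : E × Θ => F p.1 p.2) (U ×ˢ K))
    (hd : ∀ θ ∈ K, DifferentiableOn ℂ (fun x => F x θ) U) :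
    DifferentiableOn ℂ (fun x => ∫ θ in K, F x θ ∂μ) U := by
  have : ProperSpace E := FiniteDimensional.proper ℂ E
  intro x hx
  obtain ⟨ρ, hρ, hball⟩ := Metric.isOpen_iff.1 hU x hx
  set B := closedBall x (ρ / 2)
  have hB : IsCompact B := isCompact_closedBall _ _
  have hBU : B ⊆ U := (closedBall_subset_ball (by linarith)).trans hball
  have hBK : IsCompact (B ×ˢ K) := hB.prod hK
  have hcB := hc.mono (prod_mono hBU subset_rfl)
  obtain ⟨C, hC⟩ := hBK.exists_bound_of_continuousOn hcB
  have hx_cont : ∀ y ∈ U, ContinuousOn (F y) K := fun y hy =>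
    hc.comp (f := fun θ => (y, θ)) (by fun_prop) fun θ hθ => ⟨hy, hθ⟩
  have hfin : μ K ≠ ⊤ := hK.measure_lt_top.ne
  have hmem : ∀ y ∈ ball x (ρ / 4), ball y (ρ / 4) ⊆ B := fun y hy =>
    (ball_subset_ball' (by have := mem_ball.1 hy; linarith)).trans ball_subset_closedBall
  have hunif := hBK.uniformContinuousOn_of_continuous hcB
  -- Measurability of the derivative in the parameter: `F` is uniformly continuous on a compact
  -- product, and Cauchy's estimate for the difference at two parameters transfers this to the
  -- derivative at `x`.
  have hd' : ContinuousOn (fun θ => fderiv ℂ (fun y => F y θ) x) K := by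
    rw [Metric.continuousOn_iff]
    intro θ hθ e he
    obtain ⟨δ, hδ, h⟩ := Metric.uniformContinuousOn_iff.1 hunif (e * (ρ / 4) / 2) (by positivity)
    refine ⟨δ, hδ, fun θ' hθ' hdist => ?_⟩
    have hdx : ∀ θ ∈ K, DifferentiableAt ℂ (fun y => F y θ) x := fun θ hθ =>
      (hd θ hθ).differentiableAt (hU.mem_nhds hx)
    rw [dist_eq_norm, ← fderiv_fun_sub (hdx θ' hθ') (hdx θ hθ)]
    refine lt_of_le_of_lt (norm_fderiv_le hU ((hd θ' hθ').sub (hd θ hθ)) (ρ := ρ / 4)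
      (C := e * (ρ / 4) / 2) (by positivity)
      ((hmem x (mem_ball_self (by positivity))).trans hBU) ?_) ?_
    · intro y hy
      have hyB := hmem x (mem_ball_self (by positivity)) hy
      have := h (y, θ') ⟨hyB, hθ'⟩ (y, θ) ⟨hyB, hθ⟩ (by simpa [Prod.dist_eq, hδ] using hdist)
      rw [dist_eq_norm] at this
      exact this.le
    · rw [div_lt_iff₀ (by positivity)]
      nlinarith [mul_pos he hρ]
  refine (hasFDerivAt_integral_of_dominated_of_fderiv_le (𝕜 := ℂ) (μ := μ.restrict K)
    (F' := fun y θ => fderiv ℂ (fun y => F y θ) y) (s := ball x (ρ / 4))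
    (bound := fun _ => C / (ρ / 4)) (ball_mem_nhds _ (by positivity)) ?_ ?_ ?_ ?_ ?_ ?_
    ).differentiableAt.differentiableWithinAt
  · filter_upwards [hU.mem_nhds hx] with y hy
    exact (hx_cont y hy).aestronglyMeasurable hKm
  · exact (hx_cont x hx).integrableOn_compact hK
  · exact hd'.aestronglyMeasurable hKm
  · refine (ae_restrict_iff' hKm).2 (Eventually.of_forall fun θ hθ y hy => ?_)
    exact norm_fderiv_le hU (hd θ hθ) (by positivity) ((hmem y hy).trans hBU)
      fun z hz => hC (z, θ) ⟨hmem y hy hz, hθ⟩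
  · exact (integrable_const_iff.2 (Or.inr ⟨by simpa using hfin.lt_top⟩))
  · refine (ae_restrict_iff' hKm).2 (Eventually.of_forall fun θ hθ y hy => ?_)
    exact ((hd θ hθ).differentiableAt
      (hU.mem_nhds (hBU (hmem y hy (mem_ball_self (by positivity)))))).hasFDerivAt

/-- The derivative of a holomorphic function is holomorphic. -/
lemma differentiableOn_fderiv [CompleteSpace W] {F : E → W} {U : Set E} (hU : IsOpen U)
    (hF : DifferentiableOn ℂ F U) : DifferentiableOn ℂ (fderiv ℂ F) U := by
  -- A directional derivative is a Cauchy integral of `F` over a circle in the direction `v`, hence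
  -- a parameter integral of holomorphic functions. The radius `R` makes the disc of radius `2 R`
  -- fit into `U` for all base points in a small ball.
  have key : ∀ v : E, DifferentiableOn ℂ (fun x => fderiv ℂ F x v) U := by
    intro v x hx
    obtain ⟨ρ, hρ, hball⟩ := Metric.isOpen_iff.1 hU x hx
    set R : ℝ := ρ / 4 / (‖v‖ + 1) with hR
    have hR0 : 0 < R := by positivity
    have hRv : R * ‖v‖ < ρ / 4 := by
      rw [hR, div_mul_eq_mul_div, div_lt_iff₀ (by positivity)]
      nlinarith [norm_nonneg v]
    have hin : ∀ y ∈ ball x (ρ / 4), ∀ τ : ℂ, ‖τ‖ ≤ 2 * R → y + τ • v ∈ U := by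
      intro y hy τ hτ
      refine hball ?_
      rw [mem_ball_iff_norm] at hy ⊢
      calc ‖y + τ • v - x‖ ≤ ‖y - x‖ + ‖τ • v‖ := by
            rw [add_sub_right_comm]; exact norm_add_le _ _
        _ ≤ ‖y - x‖ + 2 * R * ‖v‖ := by rw [norm_smul]; gcongr
        _ < ρ := by linarith
    have hform : ∀ y ∈ ball x (ρ / 4), fderiv ℂ F y v =
        (2 * Real.pi * Complex.I : ℂ)⁻¹ • ∫ θ in Icc (0 : ℝ) (2 * Real.pi),
          deriv (circleMap 0 R) θ • ((circleMap 0 R θ - 0) ^ 2)⁻¹ •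
            F (y + circleMap 0 R θ • v) := by
      intro y hy
      have hyU : y ∈ U := by simpa using hin y hy 0 (by simpa using hR0.le)
      have h1 : HasDerivAt (fun τ : ℂ => y + τ • v) v 0 := by
        simpa using ((hasDerivAt_id (0 : ℂ)).smul_const v).const_add y
      have h2 : HasFDerivAt F (fderiv ℂ F y) (y + (0 : ℂ) • v) := by
        simpa using (hF.differentiableAt (hU.mem_nhds hyU)).hasFDerivAt
      have hcauchy := Complex.two_pi_I_inv_smul_circleIntegral_sub_sq_inv_smul_of_differentiable
        (U := ball (0 : ℂ) (2 * R)) (c := 0) (w₀ := 0) (R := R) (f := fun τ => F (y + τ • v))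
        isOpen_ball (closedBall_subset_ball (by linarith)) (fun τ hτ =>
          ((hF.differentiableAt (hU.mem_nhds (hin y hy τ (mem_ball_zero_iff.1 hτ).le))).comp τ
            (by fun_prop)).differentiableWithinAt) (mem_ball_self hR0)
      have h3 : deriv (fun τ : ℂ => F (y + τ • v)) 0 = fderiv ℂ F y v :=
        (h2.comp_hasDerivAt 0 h1).deriv
      rw [← h3, ← hcauchy, circleIntegral, intervalIntegral.integral_of_le (by positivity),
        integral_Icc_eq_integral_Ioc]
    have hdiff : DifferentiableOn ℂ (fun y => (2 * Real.pi * Complex.I : ℂ)⁻¹ •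
        ∫ θ in Icc (0 : ℝ) (2 * Real.pi),
          deriv (circleMap 0 R) θ • ((circleMap 0 R θ - 0) ^ 2)⁻¹ •
            F (y + circleMap 0 R θ • v)) (ball x (ρ / 4)) := by
      refine DifferentiableOn.const_smul ?_ _
      have hmaps : ∀ y ∈ ball x (ρ / 4), ∀ θ : ℝ, y + circleMap 0 R θ • v ∈ U := fun y hy θ =>
        hin y hy _ (by simp [abs_of_pos hR0]; linarith)
      refine differentiableOn_integral_param isCompact_Icc measurableSet_Icc isOpen_ball ?_ ?_
      · have h0 : ∀ θ : ℝ, (circleMap 0 R θ - 0) ^ 2 ≠ 0 := fun θ => by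
          simp [hR0.ne', circleMap]
        have hcm : Continuous fun p : E × ℝ => circleMap 0 R p.2 :=
          (continuous_circleMap 0 R).comp continuous_snd
        refine ContinuousOn.smul ?_ (ContinuousOn.smul ?_ ?_)
        · simp only [deriv_circleMap]
          exact (hcm.mul continuous_const).continuousOn
        · exact (((hcm.sub continuous_const).pow 2).inv₀ fun p => h0 p.2).continuousOn
        · refine hF.continuousOn.comp (f := fun p : E × ℝ => p.1 + circleMap 0 R p.2 • v)
            (continuous_fst.add (hcm.smul continuous_const)).continuousOn
            fun p hp => hmaps p.1 hp.1 p.2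
      · intro θ _
        refine DifferentiableOn.const_smul (DifferentiableOn.const_smul ?_ _) _
        exact hF.comp (f := fun y => y + circleMap 0 R θ • v) (by fun_prop)
          fun y hy => hmaps y hy θ
    exact ((hdiff.congr hform).differentiableAt
      (ball_mem_nhds _ (by positivity))).differentiableWithinAt
  let b := Module.finBasis ℂ E
  have hsum : ∀ x, fderiv ℂ F x = ∑ i, ContinuousLinearMap.smulRightL ℂ E W
      (LinearMap.toContinuousLinearMap (b.coord i)) (fderiv ℂ F x (b i)) := by
    intro x
    ext v
    conv_lhs => rw [← b.sum_repr v, map_sum]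
    simp
  rw [show fderiv ℂ F = fun x => _ from funext hsum]
  refine DifferentiableOn.fun_sum fun i _ => ?_
  exact (ContinuousLinearMap.differentiable _).comp_differentiableOn (key (b i))

end Holomorphic

end Averaging

/-! ### Scales of domains, Lie series, and flows of slow vector fields. -/

namespace Averaging

/-- A decreasing family of open sets such that `dom a` contains the `(t - a)`-neighbourhood of
`dom t`. -/
structure DomainScale (E : Type*) [NormedAddCommGroup E] where
  dom : ℝ → Set E
  isOpen_dom : ∀ t, IsOpen (dom t)
  ball_subset : ∀ {a t x}, x ∈ dom t → ball x (t - a) ⊆ dom a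

section LieSeries

variable {E : Type*} [NormedAddCommGroup E]

lemma DomainScale.anti (S : DomainScale E) {a t : ℝ} (h : a ≤ t) : S.dom t ⊆ S.dom a := by
  rcases h.eq_or_lt with rfl | h
  · exact subset_rfl
  · exact fun x hx => S.ball_subset hx (mem_ball_self (sub_pos.2 h))

variable [NormedSpace ℂ E] {W : Type*} [NormedAddCommGroup W] [NormedSpace ℂ W]

lemma DomainScale.norm_fderiv_le (S : DomainScale E) {F : E → W} {a t C : ℝ} (hat : a < t)
    (hF : DifferentiableOn ℂ F (S.dom a)) (hC : ∀ x ∈ S.dom a, ‖F x‖ ≤ C) {x : E}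
    (hx : x ∈ S.dom t) : ‖fderiv ℂ F x‖ ≤ C / (t - a) :=
  Averaging.norm_fderiv_le (S.isOpen_dom a) hF (sub_pos.2 hat) (S.ball_subset hx)
    fun y hy => hC y (S.ball_subset hx hy)

/-- The Lie derivative along the vector field `X`. -/
noncomputable def lieD (X : E → E) (F : E → W) (x : E) : W := fderiv ℂ F x (X x)

lemma lieD_id (X : E → E) : lieD X (fun x => x) = X := by
  ext x; simp [lieD]

lemma pow_self_div_factorial_le (n : ℕ) : (n : ℝ) ^ n / n ! ≤ 3 ^ n := by
  refine (Real.pow_div_factorial_le_exp _ (Nat.cast_nonneg n) n).trans ?_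
  rw [← mul_one (n : ℝ), Real.exp_nat_mul]
  gcongr
  exact Real.exp_one_lt_d9.le.trans (by norm_num)

lemma lieD_congr {X : E → E} {F G : E → W} {U : Set E} (hU : IsOpen U) (h : EqOn F G U) :
    EqOn (lieD X F) (lieD X G) U := fun x hx => by
  rw [lieD, lieD, (h.eventuallyEq_of_mem (hU.mem_nhds hx)).fderiv_eq]

/-- The loss `t - a` is shared equally among the `n` derivatives. Each loses `(t - a) / n` in
Cauchy's estimate and contributes the factor `m` divided by that loss. -/
lemma DomainScale.norm_lieD_iterate_le (S : DomainScale E) {X : E → E} {F : E → W}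
    {a t m C : ℝ} (hat : a < t) (hF : ∀ n, DifferentiableOn ℂ ((lieD X)^[n] F) (S.dom a))
    (hXm : ∀ x ∈ S.dom a, ‖X x‖ ≤ m) (hC : ∀ x ∈ S.dom a, ‖F x‖ ≤ C) (n : ℕ) {x : E}
    (hx : x ∈ S.dom t) : ‖(lieD X)^[n] F x‖ ≤ C * (n * m / (t - a)) ^ n := by
  rcases Nat.eq_zero_or_pos n with rfl | hn
  · simpa using hC x (S.anti hat.le hx)
  have hn' : (0 : ℝ) < n := by exact_mod_cast hn
  have hta := sub_pos.2 hat
  have hC0 : 0 ≤ C := (norm_nonneg _).trans (hC x (S.anti hat.le hx))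
  have hm0 : 0 ≤ m := (norm_nonneg _).trans (hXm x (S.anti hat.le hx))
  set h : ℝ := (t - a) / n with hh
  have hh0 : 0 < h := by positivity
  have key : ∀ k : ℕ, ∀ y ∈ S.dom (a + k * h), ‖(lieD X)^[k] F y‖ ≤ C * (m / h) ^ k := by
    intro k
    induction k with
    | zero => intro y hy; simpa using hC y (by simpa using hy)
    | succ k ih =>
      intro y hy
      have hlt : a + k * h < a + (k + 1 : ℕ) * h := by push_cast; nlinarith
      have hsub : S.dom (a + k * h) ⊆ S.dom a := S.anti (by nlinarith [(Nat.cast_nonneg k : (0:ℝ) ≤ k)])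
      rw [Function.iterate_succ_apply', lieD]
      refine (ContinuousLinearMap.le_opNorm _ _).trans ?_
      have h1 := S.norm_fderiv_le hlt ((hF k).mono hsub) ih hy
      have h2 := hXm y (hsub (S.anti hlt.le hy))
      have e : a + ((k + 1 : ℕ) : ℝ) * h - (a + k * h) = h := by push_cast; ring
      rw [e] at h1
      calc _ ≤ C * (m / h) ^ k / h * m := by gcongr
        _ = C * (m / h) ^ (k + 1) := by rw [pow_succ]; ring
  have := key n x (by rw [hh]; convert! hx using 1; congr 1; field_simp; ring)
  convert! this using 3
  rw [hh]; field_simp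

/-- The Lie series of the vector field `X` at time `t`, without its zeroth term: applied to the Lie
derivative of `F` it is the increment of `F` along the flow. -/
noncomputable def lieSeries (t : ℝ) (X : E → E) (G : E → W) (x : E) : W :=
  ∑' n : ℕ, (t ^ (n + 1) / (n + 1)! : ℝ) • (lieD X)^[n] G x

lemma abs_coeff_le {t : ℝ} (ht : |t| ≤ 1) (n : ℕ) : |t ^ (n + 1) / (n + 1)!| ≤ 1 / n ! := by
  rw [abs_div, abs_pow, Nat.abs_cast]
  gcongr
  · exact pow_le_one₀ (abs_nonneg t) ht
  · exact Nat.le_succ n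

variable [FiniteDimensional ℂ E] [CompleteSpace W]

lemma differentiableOn_lieD {X : E → E} {F : E → W} {U : Set E} (hU : IsOpen U)
    (hX : DifferentiableOn ℂ X U) (hF : DifferentiableOn ℂ F U) :
    DifferentiableOn ℂ (lieD X F) U :=
  (differentiableOn_fderiv hU hF).clm_apply hX

lemma differentiableOn_lieD_iterate {X : E → E} {F : E → W} {U : Set E} (hU : IsOpen U)
    (hX : DifferentiableOn ℂ X U) (hF : DifferentiableOn ℂ F U) (n : ℕ) :
    DifferentiableOn ℂ ((lieD X)^[n] F) U := by
  induction n with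
  | zero => exact hF
  | succ n ih => rw [Function.iterate_succ']; exact differentiableOn_lieD hU hX ih

/-- Since `n ^ n / n! ≤ 3 ^ n`, the Lie series is dominated by a geometric series whose ratio is any
`q` with `3 m ≤ q (t - a)`. -/
lemma DomainScale.norm_lieD_iterate_div_factorial_le (S : DomainScale E) {X : E → E} {F : E → W}
    {a t m C q : ℝ} (hat : a < t) (hX : DifferentiableOn ℂ X (S.dom a))
    (hF : DifferentiableOn ℂ F (S.dom a))
    (hXm : ∀ x ∈ S.dom a, ‖X x‖ ≤ m) (hC : ∀ x ∈ S.dom a, ‖F x‖ ≤ C)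
    (hq : 3 * m ≤ q * (t - a)) (n : ℕ) {x : E}
    (hx : x ∈ S.dom t) : 1 / n ! * ‖(lieD X)^[n] F x‖ ≤ C * q ^ n := by
  have hC0 : 0 ≤ C := (norm_nonneg _).trans (hC x (S.anti hat.le hx))
  have hm0 : 0 ≤ m := (norm_nonneg _).trans (hXm x (S.anti hat.le hx))
  have hta := sub_pos.2 hat
  have h1 := S.norm_lieD_iterate_le hat
    (differentiableOn_lieD_iterate (S.isOpen_dom a) hX hF) hXm hC n hx
  calc 1 / n ! * ‖(lieD X)^[n] F x‖ ≤ 1 / n ! * (C * (n * m / (t - a)) ^ n) := by gcongr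
    _ = C * ((n : ℝ) ^ n / n ! * (m / (t - a)) ^ n) := by rw [mul_div_assoc, mul_pow]; ring
    _ ≤ C * (3 ^ n * (m / (t - a)) ^ n) := by gcongr; exact pow_self_div_factorial_le n
    _ = C * (3 * m / (t - a)) ^ n := by rw [← mul_pow, mul_div_assoc]
    _ ≤ C * q ^ n := by
      gcongr
      exact (div_le_iff₀ hta).2 hq

/-- The hypotheses under which a vector field `X` on `S.dom a` is integrated from `S.dom b`. -/
structure IsSlowField (S : DomainScale E) (X : E → E) (a b m : ℝ) : Prop where
  lt : a < b
  nonneg : 0 ≤ m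
  small : 16 * m ≤ b - a
  holo : DifferentiableOn ℂ X (S.dom a)
  bound : ∀ x ∈ S.dom a, ‖X x‖ ≤ m

/-- `Φ t` is the time `t` map of the vector field `X`, for `0 ≤ t ≤ 1`, on `S.dom b`. -/
def IsFlow (S : DomainScale E) (X : E → E) (b m : ℝ) (Φ : ℝ → E → E) : Prop :=
  ∀ x ∈ S.dom b, Φ 0 x = x ∧ ∀ s ∈ Icc (0 : ℝ) 1,
    HasDerivWithinAt (fun s => Φ s x) (X (Φ s x)) (Icc 0 1) s ∧ Φ s x ∈ closedBall x m

variable {S : DomainScale E} {X : E → E} {a b m : ℝ} {Φ : ℝ → E → E}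

omit [FiniteDimensional ℂ E] in
-- In unit time orbits move by at most `m ≤ (b - a) / 16`, so they spend less than an eighth of the
-- loss; seven eighths remain for Cauchy estimates along the orbit.
lemma IsSlowField.closedBall_subset (h : IsSlowField S X a b m) {x : E} (hx : x ∈ S.dom b) :
    closedBall x m ⊆ S.dom (a + (b - a) * (7 / 8)) := fun y hy => by
  have h1 := h.lt
  have h2 := h.small
  refine S.ball_subset hx (mem_ball.2 (lt_of_le_of_lt (mem_closedBall.1 hy) ?_))
  linarith

omit [FiniteDimensional ℂ E] in
-- Picard-Lindelöf on the ball of radius `m` about `x`: the field has size at most `m` there, so the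
-- solution exists up to time one. The Lipschitz constant comes from Cauchy's estimate.
lemma IsSlowField.exists_flow [CompleteSpace E] (h : IsSlowField S X a b m) :
    ∃ Φ : ℝ → E → E, IsFlow S X b m Φ := by
  have key : ∀ x ∈ S.dom b, ∃ γ : ℝ → E, γ 0 = x ∧ ∀ s ∈ Icc (0 : ℝ) 1,
      HasDerivWithinAt γ (X (γ s)) (Icc 0 1) s ∧ γ s ∈ closedBall x m := by
    intro x hx
    have hlt := h.lt
    have hsub := h.closedBall_subset hx
    have hsub' : S.dom (a + (b - a) * (7 / 8)) ⊆ S.dom a := S.anti (by linarith)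
    set m' : ℝ≥0 := ⟨m, h.nonneg⟩
    have hpl : IsPicardLindelof (fun _ : ℝ => X) (tmin := 0) (tmax := 1) ⟨0, by simp⟩ x m' 0 m'
        (Real.toNNReal (m / ((b - a) * (7 / 8)))) := by
      refine ⟨fun t _ => ?_, fun y _ => continuousOn_const, fun t _ y hy => ?_, ?_⟩
      · refine Convex.lipschitzOnWith_of_nnnorm_fderiv_le (𝕜 := ℂ) (fun y hy => ?_)
          (fun y hy => ?_) (convex_closedBall x m)
        · exact h.holo.differentiableAt ((S.isOpen_dom a).mem_nhds (hsub' (hsub hy)))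
        · rw [← NNReal.coe_le_coe, coe_nnnorm]
          refine le_trans ?_ (Real.le_coe_toNNReal _)
          have := S.norm_fderiv_le (by linarith) h.holo h.bound (hsub hy)
          rwa [add_sub_cancel_left] at this
      · exact h.bound y (hsub' (hsub hy))
      · simp [m']
    -- The fixed point of the Picard operator is kept as such, because its values are known to lie
    -- in the ball of radius `m`.
    obtain ⟨α, hα⟩ := ODE.FunSpace.exists_isFixedPt_next hpl (mem_closedBall_self le_rfl)
    refine ⟨α.compProj, ?_, fun s hs => ⟨?_, ?_⟩⟩
    · have := ODE.FunSpace.compProj_val (α := α) (t := ⟨0, by simp⟩)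
      rw [this, ← hα, ODE.FunSpace.next_apply₀]
    · apply ODE.hasDerivWithinAt_picard_Icc (⟨0, by simp⟩ : Icc (0:ℝ) 1).2 hpl.continuousOn_uncurry
        α.continuous_compProj.continuousOn (fun _ ht' ↦ α.compProj_mem_closedBall hpl.mul_max_le)
        x hs |>.congr_of_mem _ hs
      intro t' ht'
      nth_rw 1 [← hα]
      rw [ODE.FunSpace.compProj_of_mem ht', ODE.FunSpace.next_apply]
    · exact α.compProj_mem_closedBall hpl.mul_max_le
  choose! γ hγ using key
  exact ⟨fun s x => γ x s, hγ⟩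

/-- The Taylor polynomials of `F` along an integral curve. -/
lemma IsSlowField.tendsto_taylor (h : IsSlowField S X a b m) (hΦ : IsFlow S X b m Φ)
    {F : E → W} (hF : DifferentiableOn ℂ F (S.dom a)) {C : ℝ}
    (hC : ∀ x ∈ S.dom a, ‖lieD X F x‖ ≤ C) {x : E} (hx : x ∈ S.dom b) {s c : ℝ}
    (hs : s ∈ Icc (0 : ℝ) 1) (hc : c ∈ Icc (0 : ℝ) 1) :
    Tendsto (fun N : ℕ => ∑ n ∈ Finset.range (N + 1),
        ((c - s) ^ n / n ! : ℝ) • (lieD X)^[n] F (Φ s x) -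
      ∑ n ∈ Finset.range (N + 1), (c ^ n / n ! : ℝ) • (lieD X)^[n] F x) atTop (𝓝 0) := by
  obtain ⟨h0, hγ⟩ := hΦ x hx
  have hlt := h.lt
  have hsmall := h.small
  have hdom : ∀ s ∈ Icc (0 : ℝ) 1, Φ s x ∈ S.dom (a + (b - a) * (7 / 8)) := fun s hs =>
    h.closedBall_subset hx (hγ s hs).2
  have hsub' : S.dom (a + (b - a) * (7 / 8)) ⊆ S.dom a := S.anti (by linarith)
  have hda := S.isOpen_dom a
  have hdiff := differentiableOn_lieD_iterate hda h.holo hF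
  -- The Taylor polynomial based at `Φ s x` and read at time `c`. Its derivative in `s` telescopes
  -- to the single term of order `N`, which is small, so the polynomials based at `Φ s x` and at `x`
  -- nearly agree.
  set g : ℕ → ℝ → W := fun N s => ∑ n ∈ Finset.range (N + 1),
    ((c - s) ^ n / n ! : ℝ) • (lieD X)^[n] F (Φ s x) with hg
  have hterm : ∀ (n : ℕ), ∀ s ∈ Icc (0 : ℝ) 1, HasDerivWithinAt
      (fun s => (lieD X)^[n] F (Φ s x)) ((lieD X)^[n + 1] F (Φ s x)) (Icc 0 1) s := by
    intro n s hs
    rw [Function.iterate_succ_apply', lieD]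
    have h1 : HasFDerivAt ((lieD X)^[n] F) (fderiv ℂ ((lieD X)^[n] F) (Φ s x)) (Φ s x) :=
      ((hdiff n).differentiableAt (hda.mem_nhds (hsub' (hdom s hs)))).hasFDerivAt
    exact (h1.restrictScalars ℝ).comp_hasDerivWithinAt s (hγ s hs).1
  have hgd : ∀ N, ∀ s ∈ Icc (0 : ℝ) 1, HasDerivWithinAt (g N)
      (((c - s) ^ N / N ! : ℝ) • (lieD X)^[N + 1] F (Φ s x)) (Icc 0 1) s := by
    intro N s hs
    induction N with
    | zero => simpa [hg] using hterm 0 s hs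
    | succ N ih =>
      have e : g (N + 1) = fun s => g N s +
          ((c - s) ^ (N + 1) / (N + 1)! : ℝ) • (lieD X)^[N + 1] F (Φ s x) := by
        ext s; simp only [hg]; rw [Finset.sum_range_succ]
      rw [e]
      have hp : HasDerivWithinAt (fun s : ℝ => (c - s) ^ (N + 1) / ((N + 1)! : ℝ))
          (-((c - s) ^ N / N !)) (Icc 0 1) s := by
        have h2 : HasDerivAt (fun s : ℝ => (c - s) ^ (N + 1) / ((N + 1)! : ℝ))
            ((((N + 1 : ℕ) : ℝ) * (c - s) ^ N * (-1)) / ((N + 1)! : ℝ)) s := by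
          have := (((hasDerivAt_id s).const_sub c).pow (N + 1)).div_const ((N + 1)! : ℝ)
          simpa using this
        refine (h2.congr_deriv ?_).hasDerivWithinAt
        rw [Nat.factorial_succ]; push_cast
        field_simp
      have hs' := hp.smul (hterm (N + 1) s hs)
      refine (ih.add hs').congr_deriv ?_
      simp only [neg_smul]
      abel
  have hbound : ∀ N, ∀ s ∈ Icc (0 : ℝ) 1,
      ‖((c - s) ^ N / N ! : ℝ) • (lieD X)^[N + 1] F (Φ s x)‖ ≤ C * (1 / 4) ^ N := by
    intro N s hs
    rw [norm_smul, Real.norm_eq_abs, abs_div, Nat.abs_cast, abs_pow]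
    have h1 : |c - s| ^ N ≤ 1 := pow_le_one₀ (abs_nonneg _)
      (abs_le.2 ⟨by linarith [hs.2, hc.1], by linarith [hs.1, hc.2]⟩)
    -- Ratio `1/4`: `3 m ≤ (3/16) (b - a)`, which is less than a quarter of the remaining loss
    -- `(7/8) (b - a)`.
    refine le_trans ?_ (S.norm_lieD_iterate_div_factorial_le (F := lieD X F) (q := 1 / 4)
      (t := a + (b - a) * (7 / 8)) (by linarith) h.holo (hdiff 1) h.bound hC (by linarith) N
      (hdom s hs))
    rw [Function.iterate_succ_apply]
    gcongr
  have hz : Tendsto (fun N : ℕ => C * (1 / 4 : ℝ) ^ N) atTop (𝓝 0) := by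
    simpa using (tendsto_pow_atTop_nhds_zero_of_lt_one (by norm_num : (0 : ℝ) ≤ 1 / 4)
      (by norm_num)).const_mul C
  refine squeeze_zero_norm (fun N => ?_) hz
  have h1 := Convex.norm_image_sub_le_of_norm_hasDerivWithin_le (hgd N) (hbound N)
    (convex_Icc 0 1) (left_mem_Icc.2 zero_le_one) hs
  have h2 : ‖s - 0‖ ≤ 1 := by rw [sub_zero, Real.norm_eq_abs, abs_le]; exact ⟨by linarith [hs.1], hs.2⟩
  have hC0 : 0 ≤ C := (norm_nonneg _).trans (hC x (S.anti hlt.le hx))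
  have h3 : g N 0 = ∑ n ∈ Finset.range (N + 1), (c ^ n / n ! : ℝ) • (lieD X)^[n] F x := by
    simp [hg, h0]
  rw [h3] at h1
  exact h1.trans (mul_le_of_le_one_right (by positivity) h2)

lemma IsSlowField.norm_term_le (h : IsSlowField S X a b m) {G : E → W}
    (hG : DifferentiableOn ℂ G (S.dom a)) {C : ℝ} (hC : ∀ x ∈ S.dom a, ‖G x‖ ≤ C) {t : ℝ}
    (ht : |t| ≤ 1) (n : ℕ) {x : E} (hx : x ∈ S.dom b) :
    ‖(t ^ (n + 1) / (n + 1)! : ℝ) • (lieD X)^[n] G x‖ ≤ C * (1 / 4) ^ n := by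
  have hsmall := h.small
  have h0 := h.nonneg
  refine le_trans ?_ (S.norm_lieD_iterate_div_factorial_le h.lt h.holo hG h.bound hC
    (q := 1 / 4) (by linarith) n hx)
  rw [norm_smul, Real.norm_eq_abs]
  gcongr
  exact abs_coeff_le ht n

lemma summable_const_mul_quarter_pow (C : ℝ) : Summable fun n : ℕ => C * (1 / 4 : ℝ) ^ n :=
  (summable_geometric_of_lt_one (by norm_num) (by norm_num)).mul_left C

/-- The case `c = s = t` of `tendsto_taylor`: the polynomial based at the endpoint reduces to its
zeroth term, so the other one converges to `F (Φ t x)`. -/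
lemma IsSlowField.apply_flow (h : IsSlowField S X a b m) (hΦ : IsFlow S X b m Φ)
    {F : E → W} (hF : DifferentiableOn ℂ F (S.dom a)) {C : ℝ}
    (hC : ∀ x ∈ S.dom a, ‖lieD X F x‖ ≤ C) {x : E} (hx : x ∈ S.dom b) {t : ℝ}
    (ht : t ∈ Icc (0 : ℝ) 1) : F (Φ t x) = F x + lieSeries t X (lieD X F) x := by
  have hsum : HasSum (fun n : ℕ => (t ^ (n + 1) / (n + 1)! : ℝ) • (lieD X)^[n] (lieD X F) x)
      (lieSeries t X (lieD X F) x) :=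
    (Summable.of_norm_bounded (summable_const_mul_quarter_pow C) fun n =>
      h.norm_term_le (differentiableOn_lieD (S.isOpen_dom a) h.holo hF) hC
        (abs_le.2 ⟨by linarith [ht.1], ht.2⟩) n hx).hasSum
  have h1 := h.tendsto_taylor hΦ hF hC hx ht ht
  have h2 := (hsum.tendsto_sum_nat.const_add (F x))
  have e1 : ∀ N : ℕ, ∑ n ∈ Finset.range (N + 1),
      ((t - t) ^ n / n ! : ℝ) • (lieD X)^[n] F (Φ t x) = F (Φ t x) := by
    intro N
    rw [Finset.sum_range_succ']
    simp
  have e2 : ∀ N : ℕ, ∑ n ∈ Finset.range (N + 1), (t ^ n / n ! : ℝ) • (lieD X)^[n] F x =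
      F x + ∑ n ∈ Finset.range N,
        (t ^ (n + 1) / (n + 1)! : ℝ) • (lieD X)^[n] (lieD X F) x := by
    intro N
    rw [Finset.sum_range_succ']
    simp [Function.iterate_succ_apply, add_comm]
  simp only [e1, e2] at h1
  have h3 := h1.add h2
  simp only [sub_add_cancel, zero_add] at h3
  exact tendsto_nhds_unique tendsto_const_nhds h3

omit [FiniteDimensional ℂ E] in
lemma IsSlowField.mapsTo (h : IsSlowField S X a b m) (hΦ : IsFlow S X b m Φ) {t : ℝ}
    (ht : t ∈ Icc (0 : ℝ) 1) : MapsTo (Φ t) (S.dom b) (S.dom a) := fun x hx =>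
  S.anti (by linarith [h.lt]) (h.closedBall_subset hx ((hΦ x hx).2 t ht).2)

/-- The case `c = 0`, `s = 1` of `tendsto_taylor`, for the identity: the Lie series at time `-1`
based at the endpoint recovers the starting point. No backward flow has to be constructed. -/
lemma IsSlowField.flow_injOn (h : IsSlowField S X a b m) (hΦ : IsFlow S X b m Φ) :
    InjOn (Φ 1) (S.dom b) := by
  have : CompleteSpace E := FiniteDimensional.complete ℂ E
  have key : ∀ x ∈ S.dom b, Tendsto (fun N : ℕ => ∑ n ∈ Finset.range (N + 1),
      ((0 - 1) ^ n / n ! : ℝ) • (lieD X)^[n] (fun y => y) (Φ 1 x)) atTop (𝓝 x) := by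
    intro x hx
    have h1 := (h.tendsto_taylor hΦ (F := fun y : E => y) differentiableOn_id
      (by simpa only [lieD_id] using h.bound) hx (right_mem_Icc.2 zero_le_one)
      (left_mem_Icc.2 zero_le_one)).add_const x
    rw [zero_add] at h1
    refine h1.congr fun N => ?_
    rw [Finset.sum_range_succ' (fun n => ((0 : ℝ) ^ n / n ! : ℝ) • (lieD X)^[n] (fun y => y) x)]
    simp
  intro x hx y hy hxy
  have h1 := key x hx
  rw [hxy] at h1
  exact tendsto_nhds_unique h1 (key y hy)

lemma IsSlowField.hasFDerivAt_lieSeries (h : IsSlowField S X a b m) {G : E → W}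
    (hG : DifferentiableOn ℂ G (S.dom a)) {C : ℝ} (hC : ∀ x ∈ S.dom a, ‖G x‖ ≤ C) {t : ℝ}
    (ht : |t| ≤ 1) {x : E} (hx : x ∈ S.dom b) :
    HasFDerivAt (lieSeries t X G)
      (∑' n : ℕ, (t ^ (n + 1) / (n + 1)! : ℝ) • fderiv ℂ ((lieD X)^[n] G) x) x := by
  have hd : ∀ n, DifferentiableOn ℂ ((lieD X)^[n] G) (S.dom b) := fun n =>
    (differentiableOn_lieD_iterate (S.isOpen_dom a) h.holo hG n).mono (S.anti h.lt.le)
  have := hasFDerivAt_tsum_of_bound (S.isOpen_dom b)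
    (F := fun n x => (t ^ (n + 1) / (n + 1)! : ℝ) • (lieD X)^[n] G x)
    (fun n => (hd n).const_smul _) (summable_const_mul_quarter_pow C)
    (fun n x hx => h.norm_term_le hG hC ht n hx) hx
  refine this.congr_fderiv (tsum_congr fun n => ?_)
  exact fderiv_fun_const_smul ((hd n).differentiableAt ((S.isOpen_dom b).mem_nhds hx)) _

lemma IsSlowField.hasFDerivAt_flow (h : IsSlowField S X a b m) (hΦ : IsFlow S X b m Φ)
    {F : E → W} (hF : DifferentiableOn ℂ F (S.dom a)) {C : ℝ}
    (hC : ∀ x ∈ S.dom a, ‖lieD X F x‖ ≤ C) {x : E} (hx : x ∈ S.dom b) {t : ℝ}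
    (ht : t ∈ Icc (0 : ℝ) 1) : HasFDerivAt (fun y => F (Φ t y)) (fderiv ℂ F x +
      ∑' n : ℕ, (t ^ (n + 1) / (n + 1)! : ℝ) • fderiv ℂ ((lieD X)^[n] (lieD X F)) x) x := by
  have h1 := h.hasFDerivAt_lieSeries (differentiableOn_lieD (S.isOpen_dom a) h.holo hF) hC
    (abs_le.2 ⟨by linarith [ht.1], ht.2⟩) hx
  have h2 := (hF.differentiableAt ((S.isOpen_dom a).mem_nhds (S.anti h.lt.le hx))).hasFDerivAt
  refine (h2.add h1).congr_of_eventuallyEq ?_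
  filter_upwards [(S.isOpen_dom b).mem_nhds hx] with y hy
  exact h.apply_flow hΦ hF hC hy ht

lemma IsSlowField.differentiableOn_flow (h : IsSlowField S X a b m) (hΦ : IsFlow S X b m Φ)
    {t : ℝ} (ht : t ∈ Icc (0 : ℝ) 1) : DifferentiableOn ℂ (Φ t) (S.dom b) := fun x hx =>
  have : CompleteSpace E := FiniteDimensional.complete ℂ E
  (h.hasFDerivAt_flow hΦ (F := fun y : E => y) differentiableOn_id
    (by simpa only [lieD_id] using h.bound) hx ht).differentiableAt.differentiableWithinAt

/-- The variational equation. -/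
lemma IsSlowField.hasDerivWithinAt_fderiv_flow (h : IsSlowField S X a b m)
    (hΦ : IsFlow S X b m Φ) {c' : ℝ} (hac : a < c') (hc' : IsSlowField S X c' b m)
    {x : E} (hx : x ∈ S.dom b) {t : ℝ} (ht : t ∈ Icc (0 : ℝ) 1) :
    HasDerivWithinAt (fun t => fderiv ℂ (Φ t) x)
      ((fderiv ℂ X (Φ t x)).comp (fderiv ℂ (Φ t) x)) (Icc 0 1) t := by
  have : CompleteSpace E := FiniteDimensional.complete ℂ E
  have hlt := h.lt
  have hsmall := h.small
  have hm := h.nonneg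
  have hda := S.isOpen_dom a
  have hX' : ∀ x ∈ S.dom a, ‖lieD X (fun y : E => y) x‖ ≤ m := by
    simpa only [lieD_id] using h.bound
  have hform : ∀ t ∈ Icc (0 : ℝ) 1, fderiv ℂ (Φ t) x = ContinuousLinearMap.id ℂ E +
      ∑' n : ℕ, (t ^ (n + 1) / (n + 1)! : ℝ) • fderiv ℂ ((lieD X)^[n] X) x := by
    intro t ht
    have := (h.hasFDerivAt_flow hΦ (F := fun y : E => y) differentiableOn_id hX' hx ht).fderiv
    simpa only [lieD_id, fderiv_fun_id] using this
  -- Half of the loss pays for the iterated Lie derivatives, with ratio `3/8`, and the other half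
  -- for one more derivative in `x`.
  set c : ℝ := a + (b - a) / 2 with hc
  set K : ℝ := m / ((b - a) / 2) with hK
  have hA : ∀ n, 1 / n ! * ‖fderiv ℂ ((lieD X)^[n] X) x‖ ≤ K * (3 / 8) ^ n := by
    intro n
    have h1 : ∀ y ∈ S.dom c, ‖(lieD X)^[n] X y‖ ≤ m * (3 / 8) ^ n * n ! := by
      intro y hy
      have := S.norm_lieD_iterate_div_factorial_le (t := c) (by rw [hc]; linarith) h.holo h.holo
        h.bound h.bound (q := 3 / 8) (by rw [hc]; linarith) n hy
      rw [one_div_mul_eq_div, div_le_iff₀ (by positivity)] at this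
      exact this
    have h2 := S.norm_fderiv_le (a := c) (t := b) (by rw [hc]; linarith)
      ((differentiableOn_lieD_iterate hda h.holo h.holo n).mono (S.anti (by rw [hc]; linarith)))
      h1 hx
    have e : b - c = (b - a) / 2 := by rw [hc]; ring
    rw [e] at h2
    rw [one_div_mul_eq_div, div_le_iff₀ (by positivity), hK]
    refine h2.trans (le_of_eq ?_)
    ring
  -- Termwise differentiation in `t` needs an open interval around `[0, 1]`. On `(-2, 2)` the ratio
  -- `3/8` becomes `3/4`, which still converges.
  have hder : HasDerivAt (fun t : ℝ =>
      ∑' n : ℕ, (t ^ (n + 1) / (n + 1)! : ℝ) • fderiv ℂ ((lieD X)^[n] X) x)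
      (∑' n : ℕ, (t ^ n / n ! : ℝ) • fderiv ℂ ((lieD X)^[n] X) x) t := by
    have hsum : Summable fun n : ℕ => K * (3 / 4 : ℝ) ^ n :=
      (summable_geometric_of_lt_one (by norm_num) (by norm_num)).mul_left K
    refine hasDerivAt_tsum_of_isPreconnected (t := Ioo (-2 : ℝ) 2)
      (g := fun (n : ℕ) (t : ℝ) => (t ^ (n + 1) / (n + 1)! : ℝ) • fderiv ℂ ((lieD X)^[n] X) x)
      (g' := fun (n : ℕ) (t : ℝ) => (t ^ n / n ! : ℝ) • fderiv ℂ ((lieD X)^[n] X) x)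
      hsum isOpen_Ioo
      ((convex_Ioo (-2 : ℝ) 2).isPreconnected) (fun n s _ => ?_) (fun n s hs => ?_)
      (y₀ := (0 : ℝ)) (by simp) ?_ (show t ∈ Ioo (-2 : ℝ) 2 from
        ⟨by linarith [ht.1], by linarith [ht.2]⟩)
    · refine HasDerivAt.smul_const ?_ _
      have h2 : HasDerivAt (fun s : ℝ => s ^ (n + 1) / ((n + 1)! : ℝ))
            ((((n + 1 : ℕ) : ℝ) * s ^ n) / ((n + 1)! : ℝ)) s := by
        simpa using (hasDerivAt_pow (n + 1) s).div_const ((n + 1)! : ℝ)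
      refine h2.congr_deriv ?_
      rw [Nat.factorial_succ]; push_cast; field_simp
    · rw [norm_smul, Real.norm_eq_abs, abs_div, Nat.abs_cast, abs_pow]
      have hs2 : |s| ^ n ≤ 2 ^ n := pow_le_pow_left₀ (abs_nonneg _) (abs_le.2 ⟨hs.1.le, hs.2.le⟩) n
      calc |s| ^ n / n ! * ‖fderiv ℂ ((lieD X)^[n] X) x‖
          = |s| ^ n * (1 / n ! * ‖fderiv ℂ ((lieD X)^[n] X) x‖) := by ring
        _ ≤ 2 ^ n * (K * (3 / 8) ^ n) :=
          mul_le_mul hs2 (hA n) (by positivity) (by positivity)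
        _ = K * (3 / 4) ^ n := by
          rw [show (3 / 4 : ℝ) = 2 * (3 / 8) by norm_num, mul_pow]; ring
    · simp
  -- The field itself is transported along the flow. Bounding its Lie derivative costs a further
  -- derivative of `X`, hence the second, slightly smaller domain `c'`.
  have hXd := hc'.hasFDerivAt_flow hΦ (F := X) hc'.holo (C := m / (c' - a) * m) (fun y hy =>
    (ContinuousLinearMap.le_opNorm _ _).trans (mul_le_mul (S.norm_fderiv_le hac h.holo h.bound hy)
      (hc'.bound y hy) (norm_nonneg _) (div_nonneg hm (sub_pos.2 hac).le))) hx ht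
  have hval : (fderiv ℂ X (Φ t x)).comp (fderiv ℂ (Φ t) x) =
      ∑' n : ℕ, (t ^ n / n ! : ℝ) • fderiv ℂ ((lieD X)^[n] X) x := by
    have h1 : HasFDerivAt (fun y => X (Φ t y)) ((fderiv ℂ X (Φ t x)).comp (fderiv ℂ (Φ t) x)) x :=
      (h.holo.differentiableAt (hda.mem_nhds (h.mapsTo hΦ ht hx))).hasFDerivAt.comp x
        ((h.differentiableOn_flow hΦ ht).differentiableAt ((S.isOpen_dom b).mem_nhds hx)).hasFDerivAt
    rw [h1.unique hXd]
    have hs : Summable fun n : ℕ => (t ^ n / n ! : ℝ) • fderiv ℂ ((lieD X)^[n] X) x := by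
      refine Summable.of_norm_bounded (g := fun n => K * (3 / 8 : ℝ) ^ n)
        ((summable_geometric_of_lt_one (by norm_num) (by norm_num)).mul_left K) fun n => ?_
      refine le_trans ?_ (hA n)
      rw [norm_smul, Real.norm_eq_abs, abs_div, Nat.abs_cast, abs_pow]
      gcongr
      exact pow_le_one₀ (abs_nonneg _) (abs_le.2 ⟨by linarith [ht.1], ht.2⟩)
    rw [hs.tsum_eq_zero_add]
    simp [Function.iterate_succ_apply]
  have := (hder.const_add (ContinuousLinearMap.id ℂ E)).hasDerivWithinAt (s := Icc (0 : ℝ) 1)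
  rw [hval]
  exact this.congr_of_mem (fun s hs => hform s hs) ht

/-- The flow of a vector field with skew derivative preserves a bilinear form. -/
lemma IsSlowField.flow_preserves (h : IsSlowField S X a b m)
    (hΦ : IsFlow S X b m Φ) {c : ℝ} (hac : a < c) (hc : IsSlowField S X c b m)
    (Ω : E →L[ℂ] E →L[ℂ] ℂ)
    (hΩ : ∀ y ∈ S.dom a, ∀ u v, Ω (fderiv ℂ X y u) v + Ω u (fderiv ℂ X y v) = 0)
    {x : E} (hx : x ∈ S.dom b) (u v : E) :
    Ω (fderiv ℂ (Φ 1) x u) (fderiv ℂ (Φ 1) x v) = Ω u v := by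
  have hd : ∀ t ∈ Icc (0 : ℝ) 1, HasDerivWithinAt
      (fun t => Ω (fderiv ℂ (Φ t) x u) (fderiv ℂ (Φ t) x v)) 0 (Icc 0 1) t := by
    intro t ht
    have h0 := h.hasDerivWithinAt_fderiv_flow hΦ hac hc hx ht
    have happ : ∀ w, HasDerivWithinAt (fun t => fderiv ℂ (Φ t) x w)
        (fderiv ℂ X (Φ t x) (fderiv ℂ (Φ t) x w)) (Icc 0 1) t := fun w =>
      (((ContinuousLinearMap.apply ℂ E w).restrictScalars ℝ).hasFDerivAt.comp_hasDerivWithinAt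
        t h0)
    have hB : HasFDerivAt (fun p : E × E => Ω p.1 p.2) _ (fderiv ℂ (Φ t) x u, fderiv ℂ (Φ t) x v) :=
      Ω.hasFDerivAt_of_bilinear hasFDerivAt_fst hasFDerivAt_snd
    refine ((hB.restrictScalars ℝ).comp_hasDerivWithinAt t
      ((happ u).prodMk (happ v))).congr_deriv ?_
    have := hΩ (Φ t x) (h.mapsTo hΦ ht hx) (fderiv ℂ (Φ t) x u) (fderiv ℂ (Φ t) x v)
    rw [add_comm] at this
    simpa using this
  have h1 := Convex.norm_image_sub_le_of_norm_hasDerivWithin_le hd (C := 0) (by simp)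
    (convex_Icc 0 1) (left_mem_Icc.2 zero_le_one) (right_mem_Icc.2 zero_le_one)
  rw [zero_mul, norm_le_zero_iff, sub_eq_zero] at h1
  have h0 : fderiv ℂ (Φ 0) x = ContinuousLinearMap.id ℂ E := by
    rw [Filter.EventuallyEq.fderiv_eq (f₁ := Φ 0) (f := fun y => y), fderiv_fun_id]
    filter_upwards [(S.isOpen_dom b).mem_nhds hx] with y hy
    exact (hΦ y hy).1
  rw [h1, h0]
  rfl

omit [FiniteDimensional ℂ E] [CompleteSpace W] in
/-- The displacement of the flow, seen through a linear map. -/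
lemma IsSlowField.norm_flow_sub_le (h : IsSlowField S X a b m) (hΦ : IsFlow S X b m Φ)
    (Λ : E →L[ℂ] W) {C : ℝ} (hC : ∀ y ∈ S.dom a, ‖Λ (X y)‖ ≤ C) {x : E} (hx : x ∈ S.dom b) :
    ‖Λ (Φ 1 x - x)‖ ≤ C := by
  have hd : ∀ t ∈ Icc (0 : ℝ) 1, HasDerivWithinAt (fun t => Λ (Φ t x)) (Λ (X (Φ t x)))
      (Icc 0 1) t := fun t ht =>
    (Λ.restrictScalars ℝ).hasFDerivAt.comp_hasDerivWithinAt t ((hΦ x hx).2 t ht).1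
  have h1 := Convex.norm_image_sub_le_of_norm_hasDerivWithin_le hd
    (fun t ht => hC _ (h.mapsTo hΦ ht hx))
    (convex_Icc 0 1) (left_mem_Icc.2 zero_le_one) (right_mem_Icc.2 zero_le_one)
  rw [(hΦ x hx).1] at h1
  simpa using h1

/-- The form `(u, v) ↦ Ω (X' u) v` is the second derivative of `χ`, hence symmetric; antisymmetry of
`Ω` turns this into skewness of `X'`. -/
lemma skew_fderiv_of_hamiltonian {U : Set E} (hU : IsOpen U) {χ : E → ℂ}
    (hX : DifferentiableOn ℂ X U) (hχ : DifferentiableOn ℂ χ U) (Ω : E →L[ℂ] E →L[ℂ] ℂ)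
    (hanti : ∀ u v, Ω u v = -Ω v u) (hΩ : ∀ y ∈ U, ∀ v, Ω (X y) v = fderiv ℂ χ y v)
    {y : E} (hy : y ∈ U) (u v : E) :
    Ω (fderiv ℂ X y u) v + Ω u (fderiv ℂ X y v) = 0 := by
  have h2 := ((differentiableOn_fderiv hU hχ).differentiableAt (hU.mem_nhds hy)).hasFDerivAt
  have hXd := (hX.differentiableAt (hU.mem_nhds hy)).hasFDerivAt
  have h1 : HasFDerivAt (fun z => Ω (X z)) (Ω.comp (fderiv ℂ X y)) y :=
    Ω.hasFDerivAt.comp y hXd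
  have h3 : HasFDerivAt (fderiv ℂ χ) (Ω.comp (fderiv ℂ X y)) y := by
    refine h1.congr_of_eventuallyEq ?_
    filter_upwards [hU.mem_nhds hy] with z hz
    ext v
    exact (hΩ z hz v).symm
  have hsymm := second_derivative_symmetric_of_eventually (𝕜 := ℂ) (f := χ) (f' := fderiv ℂ χ)
    (by filter_upwards [hU.mem_nhds hy] with z hz
        exact (hχ.differentiableAt (hU.mem_nhds hz)).hasFDerivAt) h3 u v
  simp only [ContinuousLinearMap.comp_apply] at hsymm
  rw [hsymm, hanti u, add_neg_cancel]

end LieSeries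

end Averaging

/-! ### Mode systems: norms of families of modes and their Poisson brackets. -/

namespace Averaging

/-- The pull-back of a linear form by an antilinear map, made linear by conjugation. -/
noncomputable def conjDual {E : Type*} [NormedAddCommGroup E] [NormedSpace ℂ E]
    (c : E →L⋆[ℂ] E) (ℓ : E →L[ℂ] ℂ) : E →L[ℂ] ℂ :=
  ((starL ℂ : ℂ ≃L⋆[ℂ] ℂ) : ℂ →L⋆[ℂ] ℂ).comp (ℓ.comp c)

/-- A scale of domains in a symplectic vector space on which a group of affine symplectic maps and
an antilinear map act; `M` is the group of characters by which Fourier modes are indexed. -/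
structure ModeSystem (E M : Type*) [NormedAddCommGroup E] [NormedSpace ℂ E] [AddCommGroup M]
    extends DomainScale E where
  J : (E →L[ℂ] ℂ) →L[ℂ] E
  γ : ℝ
  γ_nonneg : 0 ≤ γ
  norm_J_le : ∀ ℓ, ‖J ℓ‖ ≤ γ * ‖ℓ‖
  Ω : E →L[ℂ] E →L[ℂ] ℂ
  Ω_anti : ∀ u v, Ω u v = -Ω v u
  Ω_J : ∀ ℓ v, Ω (J ℓ) v = ℓ v
  T : Type
  act : T → E → E
  lin : T → E →L[ℂ] E
  hasFDerivAt_act : ∀ g x, HasFDerivAt (act g) (lin g) x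
  act_mem : ∀ {g t x}, x ∈ dom t → act g x ∈ dom t
  lin_J : ∀ g ℓ, lin g (J (ℓ.comp (lin g))) = J ℓ
  char : T → M → ℂ
  char_add : ∀ g j k, char g (j + k) = char g j * char g k
  conj : E →L⋆[ℂ] E
  norm_conj_le : ∀ v, ‖conj v‖ ≤ ‖v‖
  conj_mem : ∀ {t x}, x ∈ dom t → conj x ∈ dom t
  conj_J : ∀ ℓ, conj (J (conjDual conj ℓ)) = J ℓ
  σ : M ≃+ M

section ModeSystem

variable {E M : Type*} [NormedAddCommGroup E] [NormedSpace ℂ E] [AddCommGroup M]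

/-- A holomorphic function composed with antilinear maps on both sides is holomorphic again. -/
lemma hasFDerivAt_conj {c : E →L⋆[ℂ] E} {F : E → ℂ} {ℓ : E →L[ℂ] ℂ} {x : E}
    (h : HasFDerivAt F ℓ (c x)) :
    HasFDerivAt (fun y => star (F (c y))) (conjDual c ℓ) x := by
  rw [hasFDerivAt_iff_isLittleO_nhds_zero] at h ⊢
  have hc : Tendsto (fun y : E => c y) (𝓝 0) (𝓝 0) := by
    simpa using c.continuous.tendsto 0
  have h0 : (fun y : E => c y) =O[𝓝 0] fun y => y := Asymptotics.IsBigO.of_bound ‖c‖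
    (Eventually.of_forall fun y => c.le_opNorm y)
  have h1 := (h.comp_tendsto hc).trans_isBigO h0
  refine (Asymptotics.isLittleO_norm_left.1 ?_)
  refine (Asymptotics.isLittleO_norm_left.2 h1).congr_left fun y => ?_
  simp only [Function.comp, map_add, conjDual, ContinuousLinearMap.comp_apply,
    ContinuousLinearEquiv.coe_coe, starL_apply, ← star_sub, norm_star]

variable (S : ModeSystem E M)

namespace ModeSystem

/-- The Poisson bracket. -/
noncomputable def pb (F G : E → ℂ) (x : E) : ℂ := fderiv ℂ F x (S.J (fderiv ℂ G x))

/-- The supremum of `|f|` over `dom t`. -/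
noncomputable def supN (t : ℝ) (f : E → ℂ) : ℝ≥0∞ := ⨆ x ∈ S.dom t, ‖f x‖ₑ

/-- The norm of a family of modes. -/
noncomputable def nrm (t : ℝ) (F : M → E → ℂ) : ℝ≥0∞ := ∑' k, S.supN t (F k)

/-- The Poisson bracket of two families of modes. -/
noncomputable def conv (F G : M → E → ℂ) (k : M) (x : E) : ℂ := ∑' j, S.pb (F j) (G (k - j)) x

/-- A family of holomorphic modes of a real function. -/
structure IsFam (t : ℝ) (F : M → E → ℂ) : Prop where
  holo : ∀ k, DifferentiableOn ℂ (F k) (S.dom t)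
  mode : ∀ k g, ∀ x ∈ S.dom t, F k (S.act g x) = S.char g k * F k x
  real : ∀ k, ∀ x ∈ S.dom t, star (F (S.σ k) (S.conj x)) = F k x

end ModeSystem

/-- The function with a given family of modes. -/
noncomputable def fsum (F : M → E → ℂ) (x : E) : ℂ := ∑' k, F k x

open ModeSystem

variable {S} {F G : M → E → ℂ} {a b t : ℝ}

namespace ModeSystem

lemma enorm_le_supN {f : E → ℂ} {x : E} (hx : x ∈ S.dom t) : ‖f x‖ₑ ≤ S.supN t f :=
  le_iSup₂ (f := fun x (_ : x ∈ S.dom t) => ‖f x‖ₑ) x hx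

lemma norm_le_toReal_supN {f : E → ℂ} (h : S.supN t f ≠ ⊤) {x : E} (hx : x ∈ S.dom t) :
    ‖f x‖ ≤ (S.supN t f).toReal := by
  rw [← toReal_enorm]
  exact ENNReal.toReal_mono h (enorm_le_supN hx)

lemma supN_le_ofReal {f : E → ℂ} {C : ℝ} (h : ∀ x ∈ S.dom t, ‖f x‖ ≤ C) :
    S.supN t f ≤ ENNReal.ofReal C :=
  iSup₂_le fun x hx => by
    rw [← ofReal_norm]
    exact ENNReal.ofReal_le_ofReal (h x hx)

lemma supN_anti (h : a ≤ t) (f : E → ℂ) : S.supN t f ≤ S.supN a f :=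
  iSup₂_le fun _ hx => enorm_le_supN (S.anti h hx)

lemma nrm_anti (h : a ≤ t) (F : M → E → ℂ) : S.nrm t F ≤ S.nrm a F :=
  ENNReal.tsum_le_tsum fun _ => supN_anti h _

lemma supN_le_nrm (F : M → E → ℂ) (k : M) : S.supN t (F k) ≤ S.nrm t F := ENNReal.le_tsum k

lemma supN_ne_top (h : S.nrm t F ≠ ⊤) (k : M) : S.supN t (F k) ≠ ⊤ :=
  ne_top_of_le_ne_top h (supN_le_nrm F k)

lemma summable_supN (h : S.nrm t F ≠ ⊤) : Summable fun k => (S.supN t (F k)).toReal :=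
  ENNReal.summable_toReal h

lemma tsum_supN (h : S.nrm t F ≠ ⊤) : ∑' k, (S.supN t (F k)).toReal = (S.nrm t F).toReal :=
  (ENNReal.tsum_toReal_eq fun k => supN_ne_top h k).symm

lemma summable_apply (h : S.nrm t F ≠ ⊤) {x : E} (hx : x ∈ S.dom t) : Summable fun k => F k x :=
  Summable.of_norm_bounded (summable_supN h) fun k => norm_le_toReal_supN (supN_ne_top h k) hx

lemma norm_fsum_le (h : S.nrm t F ≠ ⊤) {x : E} (hx : x ∈ S.dom t) :
    ‖fsum F x‖ ≤ (S.nrm t F).toReal := by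
  rw [← tsum_supN h]
  exact tsum_of_norm_bounded (summable_supN h).hasSum
    fun k => norm_le_toReal_supN (supN_ne_top h k) hx

lemma hasFDerivAt_fsum (hF : ∀ k, DifferentiableOn ℂ (F k) (S.dom t)) (h : S.nrm t F ≠ ⊤)
    {x : E} (hx : x ∈ S.dom t) : HasFDerivAt (fsum F) (∑' k, fderiv ℂ (F k) x) x :=
  hasFDerivAt_tsum_of_bound (S.isOpen_dom t) hF (summable_supN h)
    (fun k _ hx => norm_le_toReal_supN (supN_ne_top h k) hx) hx

lemma differentiableOn_fsum (hF : ∀ k, DifferentiableOn ℂ (F k) (S.dom t))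
    (h : S.nrm t F ≠ ⊤) : DifferentiableOn ℂ (fsum F) (S.dom t) :=
  fun _ hx => (hasFDerivAt_fsum hF h hx).differentiableAt.differentiableWithinAt

lemma norm_fderiv_le_supN (hat : a < t) {f : E → ℂ} (hf : DifferentiableOn ℂ f (S.dom a))
    (h : S.supN a f ≠ ⊤) {x : E} (hx : x ∈ S.dom t) :
    ‖fderiv ℂ f x‖ ≤ (S.supN a f).toReal / (t - a) :=
  S.norm_fderiv_le hat hf (fun _ hy => norm_le_toReal_supN h hy) hx

/-- Each factor keeps its own loss of domain. A function known on a much larger domain is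
differentiated at little cost, and the iterated steps depend on this. -/
lemma norm_pb_le (hat : a < t) (hbt : b < t) {f g : E → ℂ}
    (hf : DifferentiableOn ℂ f (S.dom a)) (hg : DifferentiableOn ℂ g (S.dom b))
    (hf' : S.supN a f ≠ ⊤) (hg' : S.supN b g ≠ ⊤) {x : E} (hx : x ∈ S.dom t) :
    ‖S.pb f g x‖ ≤ S.γ / ((t - a) * (t - b)) * (S.supN a f).toReal * (S.supN b g).toReal := by
  have h1 := norm_fderiv_le_supN hat hf hf' hx
  have h2 := norm_fderiv_le_supN hbt hg hg' hx
  have h0 := S.γ_nonneg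
  have hta := sub_pos.2 hat
  have htb := sub_pos.2 hbt
  calc ‖S.pb f g x‖ ≤ ‖fderiv ℂ f x‖ * ‖S.J (fderiv ℂ g x)‖ := ContinuousLinearMap.le_opNorm _ _
    _ ≤ ((S.supN a f).toReal / (t - a)) * (S.γ * ((S.supN b g).toReal / (t - b))) := by
      gcongr
      exact (S.norm_J_le _).trans (by gcongr)
    _ = _ := by field_simp

lemma supN_pb_le (hat : a < t) (hbt : b < t) {f g : E → ℂ}
    (hf : DifferentiableOn ℂ f (S.dom a)) (hg : DifferentiableOn ℂ g (S.dom b))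
    (hf' : S.supN a f ≠ ⊤) (hg' : S.supN b g ≠ ⊤) :
    S.supN t (S.pb f g) ≤ ENNReal.ofReal (S.γ / ((t - a) * (t - b))) * S.supN a f * S.supN b g := by
  refine (supN_le_ofReal fun x hx => norm_pb_le hat hbt hf hg hf' hg' hx).trans (le_of_eq ?_)
  have h0 := S.γ_nonneg
  have hta := sub_pos.2 hat
  have htb := sub_pos.2 hbt
  rw [ENNReal.ofReal_mul (by positivity), ENNReal.ofReal_mul (by positivity),
    ENNReal.ofReal_toReal hf', ENNReal.ofReal_toReal hg']

/-- Convolution over the group of modes multiplies `ℓ¹` norms, without any loss. -/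
lemma tsum_tsum_conv (A B : M → ℝ≥0∞) : ∑' k, ∑' j, A j * B (k - j) = (∑' j, A j) * ∑' j, B j := by
  rw [ENNReal.tsum_comm, ← ENNReal.tsum_mul_right]
  refine tsum_congr fun j => ?_
  rw [ENNReal.tsum_mul_left]
  congr 1
  exact (Equiv.subRight j).tsum_eq B

lemma tsum_supN_pb_le (hat : a < t) (hbt : b < t)
    (hF : ∀ k, DifferentiableOn ℂ (F k) (S.dom a)) (hG : ∀ k, DifferentiableOn ℂ (G k) (S.dom b))
    (hF' : S.nrm a F ≠ ⊤) (hG' : S.nrm b G ≠ ⊤) :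
    ∑' k, ∑' j, S.supN t (S.pb (F j) (G (k - j))) ≤
      ENNReal.ofReal (S.γ / ((t - a) * (t - b))) * S.nrm a F * S.nrm b G := by
  calc ∑' k, ∑' j, S.supN t (S.pb (F j) (G (k - j)))
      ≤ ∑' k, ∑' j, ENNReal.ofReal (S.γ / ((t - a) * (t - b))) * S.supN a (F j) *
          S.supN b (G (k - j)) := by
        refine ENNReal.tsum_le_tsum fun k => ENNReal.tsum_le_tsum fun j => ?_
        exact supN_pb_le hat hbt (hF j) (hG _) (supN_ne_top hF' j) (supN_ne_top hG' _)
    _ = _ := by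
        rw [tsum_tsum_conv (fun j => ENNReal.ofReal (S.γ / ((t - a) * (t - b))) * S.supN a (F j))
          (fun j => S.supN b (G j)), ENNReal.tsum_mul_left]
        rfl

lemma supN_tsum_le {ι : Type*} (f : ι → E → ℂ) :
    S.supN t (fun x => ∑' i, f i x) ≤ ∑' i, S.supN t (f i) :=
  iSup₂_le fun _ hx => enorm_tsum_le_tsum_enorm.trans
    (ENNReal.tsum_le_tsum fun _ => enorm_le_supN hx)

lemma nrm_conv_le (hat : a < t) (hbt : b < t)
    (hF : ∀ k, DifferentiableOn ℂ (F k) (S.dom a)) (hG : ∀ k, DifferentiableOn ℂ (G k) (S.dom b))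
    (hF' : S.nrm a F ≠ ⊤) (hG' : S.nrm b G ≠ ⊤) :
    S.nrm t (S.conv F G) ≤
      ENNReal.ofReal (S.γ / ((t - a) * (t - b))) * S.nrm a F * S.nrm b G :=
  (ENNReal.tsum_le_tsum fun _ => supN_tsum_le _).trans (tsum_supN_pb_le hat hbt hF hG hF' hG')

lemma nrm_conv_ne_top (hat : a < t) (hbt : b < t)
    (hF : ∀ k, DifferentiableOn ℂ (F k) (S.dom a)) (hG : ∀ k, DifferentiableOn ℂ (G k) (S.dom b))
    (hF' : S.nrm a F ≠ ⊤) (hG' : S.nrm b G ≠ ⊤) : S.nrm t (S.conv F G) ≠ ⊤ :=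
  ne_top_of_le_ne_top (ENNReal.mul_ne_top (ENNReal.mul_ne_top ENNReal.ofReal_ne_top hF') hG')
    (nrm_conv_le hat hbt hF hG hF' hG')

lemma hasFDerivAt_comp_act {f : E → ℂ} {g : S.T} {x : E}
    (hf : DifferentiableAt ℂ f (S.act g x)) :
    HasFDerivAt (fun y => f (S.act g y)) ((fderiv ℂ f (S.act g x)).comp (S.lin g)) x :=
  hf.hasFDerivAt.comp x (S.hasFDerivAt_act g x)

/-- The group acts by maps that preserve the Poisson tensor (`lin_J`), so the differentials of the
two eigenfunctions pull back to multiples of themselves and the multipliers come out of the bracket.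
-/
lemma pb_act {f h : E → ℂ} {c d : ℂ} {g : S.T}
    (hf : DifferentiableOn ℂ f (S.dom t)) (hh : DifferentiableOn ℂ h (S.dom t))
    (hfg : ∀ x ∈ S.dom t, f (S.act g x) = c * f x) (hhg : ∀ x ∈ S.dom t, h (S.act g x) = d * h x)
    {x : E} (hx : x ∈ S.dom t) : S.pb f h (S.act g x) = c * d * S.pb f h x := by
  have key : ∀ {f : E → ℂ} {c : ℂ}, DifferentiableOn ℂ f (S.dom t) →
      (∀ x ∈ S.dom t, f (S.act g x) = c * f x) →
      (fderiv ℂ f (S.act g x)).comp (S.lin g) = c • fderiv ℂ f x := by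
    intro f c hf hfg
    have hn := (S.isOpen_dom t).mem_nhds hx
    have h1 := hasFDerivAt_comp_act (hf.differentiableAt
      ((S.isOpen_dom t).mem_nhds (S.act_mem (g := g) hx)))
    have h2 : HasFDerivAt (fun y => f (S.act g y)) (c • fderiv ℂ f x) x := by
      refine ((hf.differentiableAt hn).hasFDerivAt.const_mul c).congr_of_eventuallyEq ?_
      filter_upwards [hn] with y hy using hfg y hy
    exact h1.unique h2
  have h1 := key hf hfg
  have h2 := key hh hhg
  have h3 := S.lin_J g (fderiv ℂ h (S.act g x))
  rw [pb, ← h3, ← ContinuousLinearMap.comp_apply, h1, h2, map_smul, map_smul, pb,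
    smul_eq_mul, _root_.smul_apply, smul_eq_mul]
  ring

lemma pb_conj {f h f' h' : E → ℂ}
    (hf : DifferentiableOn ℂ f (S.dom t)) (hh : DifferentiableOn ℂ h (S.dom t))
    (hfg : ∀ x ∈ S.dom t, star (f (S.conj x)) = f' x)
    (hhg : ∀ x ∈ S.dom t, star (h (S.conj x)) = h' x)
    {x : E} (hx : x ∈ S.dom t) : star (S.pb f h (S.conj x)) = S.pb f' h' x := by
  have key : ∀ {f f' : E → ℂ}, DifferentiableOn ℂ f (S.dom t) →
      (∀ x ∈ S.dom t, star (f (S.conj x)) = f' x) →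
      fderiv ℂ f' x = conjDual S.conj (fderiv ℂ f (S.conj x)) := by
    intro f f' hf hfg
    have hn := (S.isOpen_dom t).mem_nhds hx
    have h1 := hasFDerivAt_conj (hf.differentiableAt
      ((S.isOpen_dom t).mem_nhds (S.conj_mem hx))).hasFDerivAt
    refine (h1.congr_of_eventuallyEq ?_).fderiv
    filter_upwards [hn] with y hy using (hfg y hy).symm
  rw [pb, pb, key hf hfg, key hh hhg, ← S.conj_J (fderiv ℂ h (S.conj x))]
  rfl

variable [FiniteDimensional ℂ E]

lemma differentiableOn_J_fderiv {f : E → ℂ} (hf : DifferentiableOn ℂ f (S.dom t)) :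
    DifferentiableOn ℂ (fun x => S.J (fderiv ℂ f x)) (S.dom t) :=
  S.J.differentiable.comp_differentiableOn (differentiableOn_fderiv (S.isOpen_dom t) hf)

lemma differentiableOn_pb {f g : E → ℂ} (hf : DifferentiableOn ℂ f (S.dom t))
    (hg : DifferentiableOn ℂ g (S.dom t)) : DifferentiableOn ℂ (S.pb f g) (S.dom t) :=
  (differentiableOn_fderiv (S.isOpen_dom t) hf).clm_apply (differentiableOn_J_fderiv hg)

omit [FiniteDimensional ℂ E] in
lemma IsFam.anti (h : S.IsFam a F) (hat : a ≤ t) : S.IsFam t F :=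
  ⟨fun k => (h.holo k).mono (S.anti hat), fun k g x hx => h.mode k g x (S.anti hat hx),
    fun k x hx => h.real k x (S.anti hat hx)⟩

/-- Equivariance holds for each term because `j` and `k - j` add up to `k`; reality holds because
conjugation permutes the terms by `j ↦ σ j`. -/
lemma IsFam.conv (hat : a < t) (hbt : b < t) (hF : S.IsFam a F) (hG : S.IsFam b G)
    (hF' : S.nrm a F ≠ ⊤) (hG' : S.nrm b G ≠ ⊤) : S.IsFam t (S.conv F G) := by
  have hFt := hF.anti hat.le
  have hGt := hG.anti hbt.le
  refine ⟨fun k => ?_, fun k g x hx => ?_, fun k x hx => ?_⟩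
  · have hfin : ∑' j, S.supN t (S.pb (F j) (G (k - j))) ≠ ⊤ :=
      ne_top_of_le_ne_top (ENNReal.mul_ne_top (ENNReal.mul_ne_top ENNReal.ofReal_ne_top hF') hG')
        ((ENNReal.le_tsum k).trans (tsum_supN_pb_le hat hbt hF.holo hG.holo hF' hG'))
    exact differentiableOn_tsum_of_bound (S.isOpen_dom t)
      (fun j => differentiableOn_pb (hFt.holo j) (hGt.holo _)) (ENNReal.summable_toReal hfin)
      fun j x hx => norm_le_toReal_supN (ENNReal.ne_top_of_tsum_ne_top hfin j) hx
  · simp only [ModeSystem.conv]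
    rw [← tsum_mul_left]
    refine tsum_congr fun j => ?_
    rw [pb_act (hFt.holo j) (hGt.holo _) (hFt.mode j g) (hGt.mode _ g) hx, ← S.char_add,
      add_sub_cancel]
  · simp only [ModeSystem.conv]
    rw [← S.σ.toEquiv.tsum_eq, ← starL_apply (R := ℂ), ContinuousLinearEquiv.map_tsum]
    refine tsum_congr fun j => ?_
    rw [starL_apply]
    refine pb_conj (hFt.holo _) (hGt.holo _) (hFt.real j) ?_ hx
    intro y hy
    have := hGt.real (k - j) y hy
    rwa [map_sub] at this

omit [FiniteDimensional ℂ E] in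
-- Both series of differentials converge absolutely on the smaller domain, so the bracket expands
-- into a double series that may be rearranged by the total mode.
lemma pb_fsum (hat : a < t) (hbt : b < t)
    (hF : ∀ k, DifferentiableOn ℂ (F k) (S.dom a)) (hG : ∀ k, DifferentiableOn ℂ (G k) (S.dom b))
    (hF' : S.nrm a F ≠ ⊤) (hG' : S.nrm b G ≠ ⊤) {x : E} (hx : x ∈ S.dom t) :
    S.pb (fsum F) (fsum G) x = fsum (S.conv F G) x := by
  have hta := sub_pos.2 hat
  have htb := sub_pos.2 hbt
  have sF : Summable fun j => fderiv ℂ (F j) x :=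
    Summable.of_norm_bounded ((summable_supN hF').div_const (t - a)) fun k =>
      norm_fderiv_le_supN hat (hF k) (supN_ne_top hF' k) hx
  have sG : Summable fun j => fderiv ℂ (G j) x :=
    Summable.of_norm_bounded ((summable_supN hG').div_const (t - b)) fun k =>
      norm_fderiv_le_supN hbt (hG k) (supN_ne_top hG' k) hx
  have dF := (hasFDerivAt_fsum hF hF' (S.anti hat.le hx)).fderiv
  have dG := (hasFDerivAt_fsum hG hG' (S.anti hbt.le hx)).fderiv
  have h1 : S.pb (fsum F) (fsum G) x = ∑' j, ∑' i, S.pb (F j) (G i) x := by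
    have h2 := (ContinuousLinearMap.apply ℂ ℂ (∑' j, S.J (fderiv ℂ (G j) x))).map_tsum sF
    simp only [ContinuousLinearMap.apply_apply] at h2
    rw [pb, dF, dG, S.J.map_tsum sG, h2]
    refine tsum_congr fun j => ?_
    rw [ContinuousLinearMap.map_tsum _ (sG.mapL S.J)]
    rfl
  have hs : Summable fun p : M × M => S.pb (F p.2) (G (p.1 - p.2)) x := by
    have hfin : ∑' p : M × M, S.supN t (S.pb (F p.2) (G (p.1 - p.2))) ≠ ⊤ := by
      rw [ENNReal.tsum_prod (f := fun k j => S.supN t (S.pb (F j) (G (k - j))))]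
      exact ne_top_of_le_ne_top
        (ENNReal.mul_ne_top (ENNReal.mul_ne_top ENNReal.ofReal_ne_top hF') hG')
        (tsum_supN_pb_le hat hbt hF hG hF' hG')
    exact Summable.of_norm_bounded (ENNReal.summable_toReal hfin) fun p =>
      norm_le_toReal_supN (ENNReal.ne_top_of_tsum_ne_top hfin p) hx
  rw [h1, fsum]
  simp only [conv]
  have hs' : Summable (Function.uncurry fun k j => S.pb (F j) (G (k - j)) x) := hs
  rw [← hs'.tsum_comm (f := fun k j => S.pb (F j) (G (k - j)) x)]
  refine tsum_congr fun j => ?_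
  exact ((Equiv.subRight j).tsum_eq (fun i => S.pb (F j) (G i) x)).symm

end ModeSystem

end ModeSystem

end Averaging

/-! ### Symmetries of flows, canonical maps, and series of iterated brackets. -/

namespace Averaging

section FlowSymmetry

variable {E : Type*} [NormedAddCommGroup E] [NormedSpace ℂ E] [FiniteDimensional ℂ E]
  {S : DomainScale E} {X : E → E} {a b m : ℝ} {Φ : ℝ → E → E}

/-- The flow commutes with the affine symmetries of the vector field. -/
lemma IsSlowField.flow_comm (h : IsSlowField S X a b m) (hΦ : IsFlow S X b m Φ)
    {R : E → E} {R₀ : E →L[ℝ] E} (hR : ∀ x y, R y - R x = R₀ (y - x)) (hR₀ : ∀ v, ‖R₀ v‖ ≤ ‖v‖)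
    (hX : ∀ y ∈ S.dom a, X (R y) = R₀ (X y)) {x : E} (hx : x ∈ S.dom b) (hRx : R x ∈ S.dom b) :
    Φ 1 (R x) = R (Φ 1 x) := by
  classical
  have : CompleteSpace E := FiniteDimensional.complete ℂ E
  have hRe : ∀ y, R y = R x + R₀ (y - x) := fun y => by rw [← hR x y]; abel
  have hΨ : IsFlow S X b m (fun s y => if y = R x then R (Φ s x) else Φ s y) := by
    intro y hy
    rcases eq_or_ne y (R x) with rfl | hne
    · simp only [if_true]
      refine ⟨by rw [(hΦ x hx).1], fun s hs => ⟨?_, ?_⟩⟩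
      · rw [hX _ (h.mapsTo hΦ hs hx)]
        have h1 := R₀.hasFDerivAt.comp_hasDerivWithinAt s (((hΦ x hx).2 s hs).1.sub_const x)
        refine (h1.const_add (R x)).congr_of_mem (fun s _ => ?_) hs
        simp only [Function.comp]
        exact hRe _
      · rw [mem_closedBall_iff_norm, hR]
        exact (hR₀ _).trans (mem_closedBall_iff_norm.1 ((hΦ x hx).2 s hs).2)
    · simp only [if_neg hne]
      exact hΦ y hy
  have hid : ∀ y ∈ S.dom a, ‖lieD X (fun y : E => y) y‖ ≤ m := by
    simpa only [lieD_id] using h.bound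
  have h1 := h.apply_flow hΦ (F := fun y : E => y) differentiableOn_id hid hRx
    (right_mem_Icc.2 zero_le_one)
  have h2 := h.apply_flow hΨ (F := fun y : E => y) differentiableOn_id hid hRx
    (right_mem_Icc.2 zero_le_one)
  simp only [if_true] at h2
  rw [h1, h2]

end FlowSymmetry

namespace ModeSystem

variable {E M : Type*} [NormedAddCommGroup E] [NormedSpace ℂ E] [AddCommGroup M]

/-- A canonical transformation of `dom s` into `dom t` which respects the symmetries of `S`. -/
structure IsCanonical (S : ModeSystem E M) (s t : ℝ) (Φ : E → E) : Prop where
  mapsTo : MapsTo Φ (S.dom s) (S.dom t)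
  holo : DifferentiableOn ℂ Φ (S.dom s)
  injOn : InjOn Φ (S.dom s)
  sympl : ∀ x ∈ S.dom s, ∀ u v, S.Ω (fderiv ℂ Φ x u) (fderiv ℂ Φ x v) = S.Ω u v
  conj : ∀ x ∈ S.dom s, Φ (S.conj x) = S.conj (Φ x)
  periodic : ∀ g v, (∀ x, S.act g x = x + v) → (∀ k, S.char g k = 1) →
    ∀ x ∈ S.dom s, Φ (x + v) = Φ x + v

variable {S : ModeSystem E M} {F G K χ : M → E → ℂ} {a b t : ℝ}

lemma IsCanonical.comp {s t u : ℝ} {Φ Ψ : E → E} (hΨ : S.IsCanonical t u Ψ)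
    (hΦ : S.IsCanonical s t Φ) : S.IsCanonical s u (Ψ ∘ Φ) where
  mapsTo := hΨ.mapsTo.comp hΦ.mapsTo
  holo := hΨ.holo.comp hΦ.holo hΦ.mapsTo
  injOn := hΨ.injOn.comp hΦ.injOn hΦ.mapsTo
  sympl x hx u v := by
    have h1 := hΨ.holo.differentiableAt ((S.isOpen_dom t).mem_nhds (hΦ.mapsTo hx))
    have h2 := hΦ.holo.differentiableAt ((S.isOpen_dom s).mem_nhds hx)
    rw [fderiv_comp x h1 h2, ContinuousLinearMap.comp_apply, ContinuousLinearMap.comp_apply,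
      hΨ.sympl _ (hΦ.mapsTo hx), hΦ.sympl x hx]
  conj x hx := by
    simp only [Function.comp]
    rw [hΦ.conj x hx, hΨ.conj _ (hΦ.mapsTo hx)]
  periodic g v hg hk x hx := by
    simp only [Function.comp]
    rw [hΦ.periodic g v hg hk x hx, hΨ.periodic g v hg hk _ (hΦ.mapsTo hx)]

lemma IsCanonical.anti {s s' t t' : ℝ} {Φ : E → E} (h : S.IsCanonical s t Φ) (hs : s ≤ s')
    (ht : t' ≤ t) : S.IsCanonical s' t' Φ where
  mapsTo _ hx := S.anti ht (h.mapsTo (S.anti hs hx))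
  holo := h.holo.mono (S.anti hs)
  injOn := h.injOn.mono (S.anti hs)
  sympl x hx := h.sympl x (S.anti hs hx)
  conj x hx := h.conj x (S.anti hs hx)
  periodic g v hg hk x hx := h.periodic g v hg hk x (S.anti hs hx)

lemma pb_anti (f g : E → ℂ) (x : E) : S.pb f g x = -S.pb g f x := by
  rw [pb, pb, ← S.Ω_J, S.Ω_anti, S.Ω_J]

lemma nrm_conv_le_ofReal {A B C : ℝ} (hat : a < t) (hbt : b < t) (hF : S.IsFam a F)
    (hG : S.IsFam b G) (hF' : S.nrm a F ≤ ENNReal.ofReal A)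
    (hG' : S.nrm b G ≤ ENNReal.ofReal B) (hA : 0 ≤ A)
    (hC : S.γ / ((t - a) * (t - b)) * A * B ≤ C) :
    S.nrm t (S.conv F G) ≤ ENNReal.ofReal C := by
  have h0 := S.γ_nonneg
  have hta := sub_pos.2 hat
  have htb := sub_pos.2 hbt
  calc S.nrm t (S.conv F G)
      ≤ ENNReal.ofReal (S.γ / ((t - a) * (t - b))) * S.nrm a F * S.nrm b G :=
        nrm_conv_le hat hbt hF.holo hG.holo (ne_top_of_le_ne_top ENNReal.ofReal_ne_top hF')
          (ne_top_of_le_ne_top ENNReal.ofReal_ne_top hG')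
    _ ≤ ENNReal.ofReal (S.γ / ((t - a) * (t - b))) * ENNReal.ofReal A * ENNReal.ofReal B := by
        gcongr
    _ = ENNReal.ofReal (S.γ / ((t - a) * (t - b)) * A * B) := by
        rw [ENNReal.ofReal_mul (by positivity), ENNReal.ofReal_mul (by positivity)]
    _ ≤ ENNReal.ofReal C := ENNReal.ofReal_le_ofReal hC

lemma nrm_add_le (F G : M → E → ℂ) : S.nrm t (F + G) ≤ S.nrm t F + S.nrm t G := by
  rw [nrm, nrm, nrm, ← ENNReal.tsum_add]
  refine ENNReal.tsum_le_tsum fun k => iSup₂_le fun x hx => ?_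
  exact (enorm_add_le _ _).trans (add_le_add (enorm_le_supN hx) (enorm_le_supN hx))

lemma nrm_neg (F : M → E → ℂ) : S.nrm t (-F) = S.nrm t F := by
  simp [nrm, supN]

lemma IsFam.add (hF : S.IsFam t F) (hG : S.IsFam t G) : S.IsFam t (F + G) where
  holo k := (hF.holo k).add (hG.holo k)
  mode k g x hx := by
    simp only [Pi.add_apply]; rw [hF.mode k g x hx, hG.mode k g x hx]; ring
  real k x hx := by
    simp only [Pi.add_apply]; rw [star_add, hF.real k x hx, hG.real k x hx]

lemma IsFam.neg (hF : S.IsFam t F) : S.IsFam t (-F) where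
  holo k := (hF.holo k).neg
  mode k g x hx := by simp only [Pi.neg_apply]; rw [hF.mode k g x hx]; ring
  real k x hx := by simp only [Pi.neg_apply]; rw [star_neg, hF.real k x hx]

lemma IsFam.indicator (hF : S.IsFam t F) {N : Set M} (hN : ∀ k, S.σ k ∈ N ↔ k ∈ N) :
    S.IsFam t (N.indicator F) := by
  have key : ∀ k, (∀ x, N.indicator F k x = F k x) ∧ k ∈ N ∨ (∀ x, N.indicator F k x = 0) ∧ k ∉ N :=
    fun k => by
      by_cases hk : k ∈ N
      · exact Or.inl ⟨fun x => by rw [indicator_of_mem hk], hk⟩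
      · exact Or.inr ⟨fun x => by rw [indicator_of_notMem hk]; rfl, hk⟩
  refine ⟨fun k => ?_, fun k g x hx => ?_, fun k x hx => ?_⟩
  · rcases key k with ⟨h, -⟩ | ⟨h, -⟩
    · exact (hF.holo k).congr fun x _ => h x
    · exact (differentiableOn_const 0).congr fun x _ => h x
  · rcases key k with ⟨h, -⟩ | ⟨h, -⟩
    · rw [h, h, hF.mode k g x hx]
    · rw [h, h, mul_zero]
  · rcases key k with ⟨h, hk⟩ | ⟨h, hk⟩
    · rw [h, indicator_of_mem ((hN k).2 hk), hF.real k x hx]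
    · rw [h, indicator_of_notMem (fun h' => hk ((hN k).1 h'))]; simp

lemma fsum_add (hF : S.nrm t F ≠ ⊤) (hG : S.nrm t G ≠ ⊤) {x : E} (hx : x ∈ S.dom t) :
    fsum (F + G) x = fsum F x + fsum G x :=
  (summable_apply hF hx).tsum_add (summable_apply hG hx)

omit [NormedAddCommGroup E] [NormedSpace ℂ E] [AddCommGroup M] in
lemma fsum_neg (F : M → E → ℂ) (x : E) : fsum (-F) x = -fsum F x := tsum_neg

lemma nrm_indicator_add (N : Set M) (F : M → E → ℂ) :
    S.nrm t (N.indicator F) + S.nrm t (Nᶜ.indicator F) = S.nrm t F := by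
  rw [nrm, nrm, nrm, ← ENNReal.tsum_add]
  refine tsum_congr fun k => ?_
  by_cases hk : k ∈ N <;> simp [hk, supN]

lemma nrm_indicator_le (N : Set M) (F : M → E → ℂ) : S.nrm t (N.indicator F) ≤ S.nrm t F := by
  rw [← nrm_indicator_add N F]
  exact le_self_add

lemma fsum_indicator_add (hF : S.nrm t F ≠ ⊤) (N : Set M) {x : E} (hx : x ∈ S.dom t) :
    fsum (N.indicator F) x + fsum (Nᶜ.indicator F) x = fsum F x := by
  rw [← fsum_add (ne_top_of_le_ne_top hF (nrm_indicator_le N F))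
    (ne_top_of_le_ne_top hF (nrm_indicator_le _ F)) hx, indicator_self_add_compl]

lemma star_fsum (hF : S.IsFam t F) {x : E} (hx : x ∈ S.dom t) :
    star (fsum F (S.conj x)) = fsum F x := by
  rw [fsum, fsum, ← S.σ.toEquiv.tsum_eq, ← starL_apply (R := ℂ), ContinuousLinearEquiv.map_tsum]
  exact tsum_congr fun k => by rw [starL_apply]; exact hF.real k x hx

/-- The Hamiltonian vector field of `f`. -/
noncomputable def ham (S : ModeSystem E M) (f : E → ℂ) (x : E) : E := S.J (fderiv ℂ f x)

lemma lieD_ham (f g : E → ℂ) : lieD (S.ham g) f = S.pb f g := rfl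

/-- Iterated brackets with `χ`. -/
noncomputable def adIter (S : ModeSystem E M) (χ K : M → E → ℂ) (n : ℕ) : M → E → ℂ :=
  (fun K => S.conv K χ)^[n] K

/-- Series of iterated brackets with coefficients `w`. -/
noncomputable def adSeries (S : ModeSystem E M) (w : ℕ → ℝ) (χ K : M → E → ℂ) (k : M) (x : E) : ℂ :=
  ∑' n, w n • S.adIter χ K n k x

variable [FiniteDimensional ℂ E]

/-- The qualitative part: each bracket may use an arbitrarily small loss, so every level `t > b` is
reached for each `n`. The bound is left to `nrm_adIter_le`. -/
lemma adIter_spec (hab : a < b) (hK : S.IsFam b K) (hχ : S.IsFam a χ) (hK' : S.nrm b K ≠ ⊤)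
    (hχ' : S.nrm a χ ≠ ⊤) (n : ℕ) : ∀ t, b < t → S.IsFam t (S.adIter χ K n) ∧
      S.nrm t (S.adIter χ K n) ≠ ⊤ ∧
      ∀ x ∈ S.dom t, (lieD (S.ham (fsum χ)))^[n] (fsum K) x = fsum (S.adIter χ K n) x := by
  induction n with
  | zero =>
    exact fun t ht => ⟨hK.anti ht.le, ne_top_of_le_ne_top hK' (nrm_anti ht.le K), fun _ _ => rfl⟩
  | succ n ih =>
    intro t ht
    obtain ⟨h1, h2, h3⟩ := ih ((b + t) / 2) (by linarith)
    have e : S.adIter χ K (n + 1) = S.conv (S.adIter χ K n) χ := by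
      rw [adIter, Function.iterate_succ_apply']; rfl
    have hbt : (b + t) / 2 < t := by linarith
    have hat : a < t := by linarith
    rw [e]
    refine ⟨h1.conv hbt hat hχ h2 hχ', nrm_conv_ne_top hbt hat h1.holo hχ.holo h2 hχ',
      fun x hx => ?_⟩
    rw [Function.iterate_succ_apply', lieD_congr (S.isOpen_dom _) h3 (S.anti hbt.le hx),
      lieD_ham, pb_fsum hbt hat h1.holo hχ.holo h2 hχ' hx]

/-- The loss `t - b` is again shared equally among the brackets, but only on the side of the
iterate. The generator `χ` is known at level `a` and always has a loss of at least `l`, so `γ m₀ /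
l` plays the role of the speed of the field. -/
lemma nrm_adIter_le {C m₀ l q : ℝ} (hbt : b < t) (hl : 0 < l) (hab : a + l ≤ b)
    (hK : S.IsFam b K) (hχ : S.IsFam a χ)
    (hC : 0 ≤ C) (hm₀ : 0 ≤ m₀) (hK' : S.nrm b K ≤ ENNReal.ofReal C)
    (hχ' : S.nrm a χ ≤ ENNReal.ofReal m₀) (hq : 3 * (S.γ * m₀ / l) ≤ q * (t - b)) (n : ℕ) :
    S.nrm t (S.adIter χ K n) ≤ ENNReal.ofReal (n ! * (C * q ^ n)) := by
  have hfin := ne_top_of_le_ne_top ENNReal.ofReal_ne_top hK'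
  have hfin' := ne_top_of_le_ne_top ENNReal.ofReal_ne_top hχ'
  have hγ := S.γ_nonneg
  have htb := sub_pos.2 hbt
  rcases Nat.eq_zero_or_pos n with rfl | hn
  · simpa [adIter] using (nrm_anti hbt.le K).trans hK'
  have hn' : (0 : ℝ) < n := by exact_mod_cast hn
  set m := S.γ * m₀ / l with hm
  have hm0 : 0 ≤ m := by positivity
  set h : ℝ := (t - b) / n with hh
  have hh0 : 0 < h := by positivity
  have key : ∀ k : ℕ, S.nrm (b + k * h) (S.adIter χ K k) ≤ ENNReal.ofReal (C * (m / h) ^ k) ∧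
      S.IsFam (b + k * h) (S.adIter χ K k) := by
    intro k
    induction k with
    | zero => simpa [adIter] using ⟨hK', hK⟩
    | succ k ih =>
      have hkh : 0 ≤ k * h := by positivity
      have e1 : b + ((k + 1 : ℕ) : ℝ) * h - (b + k * h) = h := by push_cast; ring
      have hlt : b + k * h < b + (k + 1 : ℕ) * h := by linarith
      have hlt' : a < b + (k + 1 : ℕ) * h := by linarith
      have e : S.adIter χ K (k + 1) = S.conv (S.adIter χ K k) χ := by
        rw [adIter, Function.iterate_succ_apply']; rfl
      rw [e]
      refine ⟨?_, ih.2.conv hlt hlt' hχ (ne_top_of_le_ne_top ENNReal.ofReal_ne_top ih.1) hfin'⟩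
      refine nrm_conv_le_ofReal hlt hlt' ih.2 hχ ih.1 hχ' (by positivity) ?_
      rw [e1]
      have hl' : l ≤ b + ((k + 1 : ℕ) : ℝ) * h - a := by linarith
      calc S.γ / (h * (b + ((k + 1 : ℕ) : ℝ) * h - a)) * (C * (m / h) ^ k) * m₀
          ≤ S.γ / (h * l) * (C * (m / h) ^ k) * m₀ := by gcongr
        _ = C * (m / h) ^ (k + 1) := by rw [pow_succ, hm]; field_simp
  have h1 := (key n).1
  have e : b + n * h = t := by rw [hh]; field_simp; ring
  rw [e] at h1
  refine h1.trans (ENNReal.ofReal_le_ofReal ?_)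
  have h2 : m / h = n * (m / (t - b)) := by rw [hh]; field_simp
  rw [h2, mul_pow]
  have h3 := pow_self_div_factorial_le n
  rw [div_le_iff₀ (by positivity)] at h3
  calc C * ((n : ℝ) ^ n * (m / (t - b)) ^ n) ≤ C * (3 ^ n * n ! * (m / (t - b)) ^ n) := by gcongr
    _ = n ! * (C * (3 * m / (t - b)) ^ n) := by rw [mul_div_assoc, mul_pow]; ring
    _ ≤ n ! * (C * q ^ n) := by
      gcongr
      exact (div_le_iff₀ htb).2 hq

omit [FiniteDimensional ℂ E] in
lemma nrm_smul (c : ℝ) (F : M → E → ℂ) :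
    S.nrm t (fun k x => c • F k x) = ENNReal.ofReal |c| * S.nrm t F := by
  rw [nrm, nrm, ← ENNReal.tsum_mul_left]
  refine tsum_congr fun k => ?_
  simp only [supN, enorm_smul, Real.enorm_eq_ofReal_abs, ENNReal.mul_iSup]

/-- The double series over the number of brackets and over the modes converges absolutely. Summing
it mode by mode gives the family and its norm; summing it by the number of brackets gives the Lie
series of the function. -/
lemma adSeries_spec {w : ℕ → ℝ} {c₀ C m₀ l q : ℝ} (hbt : b < t) (hl : 0 < l) (hab : a + l ≤ b)
    (hK : S.IsFam b K) (hχ : S.IsFam a χ)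
    (hC : 0 ≤ C) (hm₀ : 0 ≤ m₀) (hK' : S.nrm b K ≤ ENNReal.ofReal C)
    (hχ' : S.nrm a χ ≤ ENNReal.ofReal m₀) (hq : 3 * (S.γ * m₀ / l) ≤ q * (t - b))
    (hq0 : 0 ≤ q) (hq1 : q < 1) (hc₀ : 0 ≤ c₀) (hw : ∀ n, |w n| ≤ c₀ / n !) :
    S.IsFam t (S.adSeries w χ K) ∧
    S.nrm t (S.adSeries w χ K) ≤ ENNReal.ofReal (c₀ * C / (1 - q)) ∧
    ∀ x ∈ S.dom t, fsum (S.adSeries w χ K) x =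
      ∑' n, w n • (lieD (S.ham (fsum χ)))^[n] (fsum K) x := by
  have hfin := ne_top_of_le_ne_top ENNReal.ofReal_ne_top hK'
  have hfin' := ne_top_of_le_ne_top ENNReal.ofReal_ne_top hχ'
  have hspec := fun n => adIter_spec (by linarith) hK hχ hfin hfin' n t hbt
  have hsum : Summable fun n : ℕ => c₀ * C * q ^ n :=
    (summable_geometric_of_lt_one hq0 hq1).mul_left _
  have hterm : ∀ n, S.nrm t (fun k x => w n • S.adIter χ K n k x) ≤
      ENNReal.ofReal (c₀ * C * q ^ n) := by
    intro n
    rw [nrm_smul]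
    have h1 := nrm_adIter_le hbt hl hab hK hχ hC hm₀ hK' hχ' hq n
    calc ENNReal.ofReal |w n| * S.nrm t (S.adIter χ K n)
        ≤ ENNReal.ofReal (c₀ / n !) * ENNReal.ofReal (n ! * (C * q ^ n)) := by
          gcongr; exact hw n
      _ = ENNReal.ofReal (c₀ * C * q ^ n) := by
          rw [← ENNReal.ofReal_mul (by positivity)]
          congr 1; field_simp
  have htot : ∑' n, S.nrm t (fun k x => w n • S.adIter χ K n k x) ≤
      ENNReal.ofReal (c₀ * C / (1 - q)) := by
    refine (ENNReal.tsum_le_tsum hterm).trans (le_of_eq ?_)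
    rw [← ENNReal.ofReal_tsum_of_nonneg (fun n => by positivity) hsum, tsum_mul_left,
      tsum_geometric_of_lt_one hq0 hq1, div_eq_mul_inv]
  have hbd : ∀ k n, ∀ x ∈ S.dom t, ‖w n • S.adIter χ K n k x‖ ≤ c₀ * C * q ^ n := by
    intro k n x hx
    have h1 : ‖w n • S.adIter χ K n k x‖ₑ ≤ _ :=
      (enorm_le_supN (f := fun x => w n • S.adIter χ K n k x) hx).trans
      ((supN_le_nrm (fun k x => w n • S.adIter χ K n k x) k).trans (hterm n))
    rw [← ofReal_norm] at h1
    exact (ENNReal.ofReal_le_ofReal_iff (by positivity)).1 h1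
  refine ⟨⟨fun k => ?_, fun k g x hx => ?_, fun k x hx => ?_⟩, ?_, fun x hx => ?_⟩
  · exact differentiableOn_tsum_of_bound (S.isOpen_dom t)
      (fun n => show DifferentiableOn ℂ (w n • S.adIter χ K n k) _ from
        ((hspec n).1.holo k).const_smul _) hsum (hbd k)
  · rw [adSeries, adSeries, ← tsum_mul_left]
    refine tsum_congr fun n => ?_
    rw [(hspec n).1.mode k g x hx, mul_smul_comm]
  · rw [adSeries, adSeries, ← starL_apply (R := ℂ), ContinuousLinearEquiv.map_tsum]
    refine tsum_congr fun n => ?_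
    rw [starL_apply, star_smul, (hspec n).1.real k x hx, star_trivial]
  · refine le_trans ?_ htot
    rw [show ∑' n, S.nrm t (fun k x => w n • S.adIter χ K n k x) =
      ∑' n, ∑' k, S.supN t (fun x => w n • S.adIter χ K n k x) from rfl, ENNReal.tsum_comm]
    exact ENNReal.tsum_le_tsum fun k => supN_tsum_le _
  · have hs : Summable (Function.uncurry fun (n : ℕ) (k : M) => w n • S.adIter χ K n k x) := by
      have hfin2 : ∑' p : ℕ × M, ‖w p.1 • S.adIter χ K p.1 p.2 x‖ₑ ≠ ⊤ := by
        rw [ENNReal.tsum_prod (f := fun n k => ‖w n • S.adIter χ K n k x‖ₑ)]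
        refine ne_top_of_le_ne_top ENNReal.ofReal_ne_top (le_trans ?_ htot)
        exact ENNReal.tsum_le_tsum fun n => ENNReal.tsum_le_tsum fun k =>
          enorm_le_supN (f := fun x => w n • S.adIter χ K n k x) hx
      refine Summable.of_norm ?_
      exact (ENNReal.summable_toReal hfin2).congr fun p => toReal_enorm _
    simp only [fsum, adSeries]
    rw [hs.tsum_comm (f := fun (n : ℕ) (k : M) => w n • S.adIter χ K n k x)]
    refine tsum_congr fun n => ?_
    rw [(hspec n).2.2 x hx, fsum, ← tsum_const_smul'']

end ModeSystem

end Averaging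

/-! ### The homological equation and one averaging step. -/

namespace Averaging

namespace ModeSystem

variable {E M : Type*} [NormedAddCommGroup E] [NormedSpace ℂ E] [AddCommGroup M]
variable {S : ModeSystem E M} {F G K χ : M → E → ℂ} {a b t : ℝ}

/-- An integrable Hamiltonian `h` with divisors `d`: `{f, h} = d k * f` for every mode `f` of
index `k`. -/
structure Unperturbed (S : ModeSystem E M) (h : E → ℂ) (d : M → E → ℂ) : Prop where
  holo : DifferentiableOn ℂ h (S.dom 0)
  holo_div : ∀ k, DifferentiableOn ℂ (d k) (S.dom 0)
  div_act : ∀ k g, ∀ x ∈ S.dom 0, d k (S.act g x) = d k x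
  div_real : ∀ k, ∀ x ∈ S.dom 0, star (d (S.σ k) (S.conj x)) = d k x
  pb_eq : ∀ t, 0 ≤ t → ∀ k f, DifferentiableOn ℂ f (S.dom t) →
    (∀ g, ∀ x ∈ S.dom t, f (S.act g x) = S.char g k * f x) →
    ∀ x ∈ S.dom t, S.pb f h x = d k x * f x

/-- The solution `χ` of the homological equation `{h, χ} = -R` on the modes in `N`. -/
noncomputable def chi (N : Set M) (d R : M → E → ℂ) : M → E → ℂ :=
  fun k x => N.indicator R k x / d k x

variable {h : E → ℂ} {d R : M → E → ℂ} {N : Set M} {β τ : ℝ}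

omit [NormedAddCommGroup E] [NormedSpace ℂ E] [AddCommGroup M] in
lemma chi_of_mem {k : M} (hk : k ∈ N) (x : E) : chi N d R k x = R k x / d k x := by
  rw [chi, indicator_of_mem hk]

omit [NormedAddCommGroup E] [NormedSpace ℂ E] [AddCommGroup M] in
lemma chi_of_notMem {k : M} (hk : k ∉ N) (x : E) : chi N d R k x = 0 := by
  rw [chi, indicator_of_notMem hk]; simp

/-- The divisors are invariant under the group and compatible with conjugation, so division by them
preserves equivariance and reality; reality also needs `N` to be stable under `σ`. -/
lemma isFam_chi (hU : S.Unperturbed h d) (hN : ∀ k, S.σ k ∈ N ↔ k ∈ N) (hβ : 0 < β)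
    (hd : ∀ k ∈ N, ∀ x ∈ S.dom 0, β ≤ ‖d k x‖) (ha : 0 ≤ a) (hR : S.IsFam a R) :
    S.IsFam a (chi N d R) := by
  have hsub := S.anti ha
  refine ⟨fun k => ?_, fun k g x hx => ?_, fun k x hx => ?_⟩ <;> by_cases hk : k ∈ N
  · have hne : ∀ x ∈ S.dom a, d k x ≠ 0 := fun x hx =>
      norm_pos_iff.1 (hβ.trans_le (hd k hk x (hsub hx)))
    have hq : DifferentiableOn ℂ (fun x => R k x / d k x) (S.dom a) := fun x hx =>
      (hR.holo k x hx).mul (((hU.holo_div k).mono hsub x hx).inv (hne x hx))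
    exact hq.congr fun x _ => chi_of_mem hk x
  · exact (differentiableOn_const 0).congr fun x _ => chi_of_notMem hk x
  · rw [chi_of_mem hk, chi_of_mem hk, hR.mode k g x hx, hU.div_act k g x (hsub hx), mul_div_assoc]
  · rw [chi_of_notMem hk, chi_of_notMem hk, mul_zero]
  · rw [chi_of_mem hk, chi_of_mem ((hN k).2 hk), star_div₀, hR.real k x hx,
      hU.div_real k x (hsub hx)]
  · rw [chi_of_notMem hk, chi_of_notMem (fun h' => hk ((hN k).1 h')), star_zero]

lemma supN_chi_le (hβ : 0 < β) (ha : 0 ≤ a) {k : M} (hd : ∀ x ∈ S.dom 0, β ≤ ‖d k x‖) :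
    S.supN a (chi N d R k) ≤ ENNReal.ofReal β⁻¹ * S.supN a (N.indicator R k) := by
  refine iSup₂_le fun x hx => ?_
  rw [chi, div_eq_inv_mul, enorm_mul]
  gcongr
  · rw [← ofReal_norm, norm_inv]
    exact ENNReal.ofReal_le_ofReal (inv_anti₀ hβ (hd x (S.anti ha hx)))
  · exact enorm_le_supN hx

lemma nrm_chi_le (hβ : 0 < β) (hd : ∀ k ∈ N, ∀ x ∈ S.dom 0, β ≤ ‖d k x‖) (ha : 0 ≤ a)
    (hτ : S.nrm a (N.indicator R) ≤ ENNReal.ofReal τ) :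
    S.nrm a (chi N d R) ≤ ENNReal.ofReal (τ / β) := by
  calc S.nrm a (chi N d R) ≤ ∑' k, ENNReal.ofReal β⁻¹ * S.supN a (N.indicator R k) := by
        refine ENNReal.tsum_le_tsum fun k => ?_
        by_cases hk : k ∈ N
        · exact supN_chi_le hβ ha (hd k hk)
        · refine iSup₂_le fun x _ => ?_
          rw [chi_of_notMem hk, enorm_zero]; exact zero_le
    _ = ENNReal.ofReal β⁻¹ * S.nrm a (N.indicator R) := ENNReal.tsum_mul_left
    _ ≤ ENNReal.ofReal β⁻¹ * ENNReal.ofReal τ := by gcongr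
    _ = ENNReal.ofReal (τ / β) := by
        rw [← ENNReal.ofReal_mul (by positivity), div_eq_inv_mul]

/-- Mode by mode, `{h, χ_k} = -d_k χ_k`, which is `-R_k` for `k` in `N` and zero otherwise. -/
lemma pb_fsum_chi (hU : S.Unperturbed h d) (hN : ∀ k, S.σ k ∈ N ↔ k ∈ N) (hβ : 0 < β)
    (hd : ∀ k ∈ N, ∀ x ∈ S.dom 0, β ≤ ‖d k x‖) (ha : 0 ≤ a) (hR : S.IsFam a R)
    (hτ : S.nrm a (N.indicator R) ≤ ENNReal.ofReal τ) (hat : a < t) {x : E} (hx : x ∈ S.dom t) :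
    S.pb h (fsum (chi N d R)) x = fsum (-N.indicator R) x := by
  have hχ := isFam_chi hU hN hβ hd ha hR
  have hχ' := ne_top_of_le_ne_top ENNReal.ofReal_ne_top (nrm_chi_le hβ hd ha hτ)
  have hxa := S.anti hat.le hx
  have s : Summable fun k => fderiv ℂ (chi N d R k) x :=
    Summable.of_norm_bounded ((summable_supN hχ').div_const (t - a)) fun k =>
      norm_fderiv_le_supN hat (hχ.holo k) (supN_ne_top hχ' k) hx
  have h2 := (ContinuousLinearMap.apply ℂ ℂ (S.J (fderiv ℂ h x))).map_tsum s
  simp only [ContinuousLinearMap.apply_apply] at h2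
  rw [pb_anti, pb, (hasFDerivAt_fsum hχ.holo hχ' hxa).fderiv, h2, fsum_neg, fsum]
  congr 1
  refine tsum_congr fun k => ?_
  have h3 := hU.pb_eq a ha k _ (hχ.holo k) (hχ.mode k) x hxa
  rw [pb] at h3
  rw [h3, chi]
  by_cases hk : k ∈ N
  · rw [mul_div_cancel₀]
    exact norm_pos_iff.1 (hβ.trans_le (hd k hk x (S.anti ha hxa)))
  · rw [indicator_of_notMem hk]; simp

/-- Antilinear maps are real-linear. -/
noncomputable def conjReal (c : E →L⋆[ℂ] E) : E →L[ℝ] E where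
  toFun := c
  map_add' := map_add c
  map_smul' r x := by
    rw [← Complex.coe_smul, map_smulₛₗ]
    simp
  cont := c.continuous

variable [FiniteDimensional ℂ E]

omit [FiniteDimensional ℂ E] in
lemma ham_conj {f : E → ℂ} (hf : DifferentiableOn ℂ f (S.dom t))
    (hreal : ∀ x ∈ S.dom t, star (f (S.conj x)) = f x) {x : E} (hx : x ∈ S.dom t) :
    S.ham f (S.conj x) = S.conj (S.ham f x) := by
  have h1 := hasFDerivAt_conj (hf.differentiableAt
    ((S.isOpen_dom t).mem_nhds (S.conj_mem hx))).hasFDerivAt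
  have h2 : fderiv ℂ f x = conjDual S.conj (fderiv ℂ f (S.conj x)) := by
    refine (h1.congr_of_eventuallyEq ?_).fderiv
    filter_upwards [(S.isOpen_dom t).mem_nhds hx] with y hy using (hreal y hy).symm
  rw [ham, ham, h2, S.conj_J]

omit [FiniteDimensional ℂ E] in
lemma ham_add {f : E → ℂ} {v : E} (hf : ∀ x ∈ S.dom t, f (x + v) = f x) {x : E}
    (hx : x ∈ S.dom t) : S.ham f (x + v) = S.ham f x := by
  rw [ham, ham, ← fderiv_comp_add_right]
  congr 1
  refine Filter.EventuallyEq.fderiv_eq ?_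
  filter_upwards [(S.isOpen_dom t).mem_nhds hx] with y hy using hf y hy

lemma isSlowField_ham {f : E → ℂ} {m₀ l : ℝ} (hf : DifferentiableOn ℂ f (S.dom a))
    (hm₀ : ∀ x ∈ S.dom a, ‖f x‖ ≤ m₀) (h0 : 0 ≤ m₀) (hl : 0 < l) (hab : a + l ≤ b) (hbt : b < t)
    (hsmall : 16 * (S.γ * m₀ / l) ≤ t - b) :
    IsSlowField S.toDomainScale (S.ham f) b t (S.γ * m₀ / l) where
  lt := hbt
  nonneg := by have := S.γ_nonneg; positivity
  small := hsmall
  holo := (differentiableOn_J_fderiv hf).mono (S.anti (by linarith))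
  bound x hx := by
    have h1 := S.norm_fderiv_le (t := a + l) (by linarith) hf hm₀ (S.anti hab hx)
    rw [add_sub_cancel_left] at h1
    have := S.γ_nonneg
    calc ‖S.ham f x‖ ≤ S.γ * ‖fderiv ℂ f x‖ := S.norm_J_le _
      _ ≤ S.γ * (m₀ / l) := by gcongr
      _ = _ := by ring

/-- The time one map of a slow Hamiltonian field is canonical. -/
lemma isCanonical_flow {f : E → ℂ} {m : ℝ} {Φ : ℝ → E → E} {c : ℝ}
    (hf : DifferentiableOn ℂ f (S.dom a))
    (hreal : ∀ x ∈ S.dom a, star (f (S.conj x)) = f x)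
    (hper : ∀ g v, (∀ x, S.act g x = x + v) → (∀ k, S.char g k = 1) →
      ∀ x ∈ S.dom a, f (x + v) = f x)
    (hab : a ≤ b) (h : IsSlowField S.toDomainScale (S.ham f) b t m) (hbc : b < c)
    (hc : IsSlowField S.toDomainScale (S.ham f) c t m)
    (hΦ : IsFlow S.toDomainScale (S.ham f) t m Φ) : S.IsCanonical t b (Φ 1) where
  mapsTo := h.mapsTo hΦ (right_mem_Icc.2 zero_le_one)
  holo := h.differentiableOn_flow hΦ (right_mem_Icc.2 zero_le_one)
  injOn := h.flow_injOn hΦ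
  sympl x hx u v := by
    refine h.flow_preserves hΦ hbc hc S.Ω (fun y hy u v => ?_) hx u v
    refine skew_fderiv_of_hamiltonian (S.isOpen_dom b) h.holo (hf.mono (S.anti hab)) S.Ω S.Ω_anti
      (fun y _ v => S.Ω_J _ v) hy u v
  conj x hx := h.flow_comm hΦ (R := S.conj) (R₀ := conjReal S.conj)
    (fun x y => (map_sub S.conj y x).symm) S.norm_conj_le
    (fun y hy => ham_conj hf hreal (S.anti hab hy)) hx (S.conj_mem hx)
  periodic g v hg hk x hx := h.flow_comm hΦ (R := fun y => y + v) (R₀ := .id ℝ E)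
    (fun x y => by simp) (fun v => le_rfl)
    (fun y hy => ham_add (hper g v hg hk) (S.anti hab hy)) hx (by
      have := S.act_mem (g := g) hx
      rwa [hg] at this)

omit [FiniteDimensional ℂ E] in
lemma fsum_periodic (hF : S.IsFam t F) {g : S.T} {v : E} (hg : ∀ x, S.act g x = x + v)
    (hk : ∀ k, S.char g k = 1) {x : E} (hx : x ∈ S.dom t) : fsum F (x + v) = fsum F x :=
  tsum_congr fun k => by rw [← hg, hF.mode k g x hx, hk, one_mul]

/-- Transport of a function along the flow of `χ` by iterated brackets of modes. -/
lemma apply_flow_eq {f : E → ℂ} {C m₀ l : ℝ} {Φ : ℝ → E → E} (hbt : b < t)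
    (hf : DifferentiableOn ℂ f (S.dom b)) (hK' : S.nrm b K ≤ ENNReal.ofReal C)
    (hLf : EqOn (S.pb f (fsum χ)) (fsum K) (S.dom b))
    (hs : IsSlowField S.toDomainScale (S.ham (fsum χ)) b t (S.γ * m₀ / l))
    (hΦ : IsFlow S.toDomainScale (S.ham (fsum χ)) t (S.γ * m₀ / l) Φ) {x : E}
    (hx : x ∈ S.dom t) :
    f (Φ 1 x) = f x + ∑' n : ℕ, ((n + 1)! : ℝ)⁻¹ • (lieD (S.ham (fsum χ)))^[n] (fsum K) x := by
  have hfin := ne_top_of_le_ne_top ENNReal.ofReal_ne_top hK'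
  have hbd : ∀ y ∈ S.dom b, ‖lieD (S.ham (fsum χ)) f y‖ ≤ (S.nrm b K).toReal := by
    intro y hy
    rw [lieD_ham, hLf hy]
    exact norm_fsum_le hfin hy
  rw [hs.apply_flow hΦ hf hbd hx (right_mem_Icc.2 zero_le_one), lieSeries]
  congr 1
  refine tsum_congr fun n => ?_
  rw [one_pow, one_div]
  congr 1
  have key : EqOn ((lieD (S.ham (fsum χ)))^[n] (lieD (S.ham (fsum χ)) f))
      ((lieD (S.ham (fsum χ)))^[n] (fsum K)) (S.dom b) := by
    induction n with
    | zero => exact hLf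
    | succ n ih =>
      rw [Function.iterate_succ', Function.comp, Function.comp]
      exact lieD_congr (S.isOpen_dom b) ih
  exact key (S.anti hbt.le hx)

lemma abs_inv_factorial_succ_le (n : ℕ) : |((n + 1)! : ℝ)⁻¹| ≤ 1 / n ! := by
  rw [abs_inv, Nat.abs_cast, ← one_div]
  gcongr
  exact Nat.le_succ n

lemma abs_inv_factorial_add_two_le (n : ℕ) : |((n + 2)! : ℝ)⁻¹| ≤ (1 / 2) / n ! := by
  rw [abs_inv, Nat.abs_cast, ← one_div, div_div]
  gcongr
  rw [Nat.factorial_succ, Nat.factorial_succ]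
  push_cast
  have h1 : (0 : ℝ) < n ! := by positivity
  have h2 : (0 : ℝ) ≤ n := Nat.cast_nonneg n
  nlinarith [mul_nonneg h1.le h2, mul_nonneg (mul_nonneg h1.le h2) h2]

/-- One step of the averaging procedure. -/
theorem exists_averaging_step (hU : S.Unperturbed h d) (hN : ∀ k, S.σ k ∈ N ↔ k ∈ N)
    (hβ : 0 < β) (hd : ∀ k ∈ N, ∀ x ∈ S.dom 0, β ≤ ‖d k x‖) {l η ρ q : ℝ} (ha : 0 ≤ a)
    (hl : 0 < l) (hη : 0 ≤ η) (hρ : 0 ≤ ρ) (hτ : 0 ≤ τ)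
    (hG : S.IsFam 0 G) (hG' : S.nrm 0 G ≤ ENNReal.ofReal η)
    (hR : S.IsFam a R) (hR' : S.nrm a R ≤ ENNReal.ofReal ρ)
    (hP : S.nrm a (N.indicator R) ≤ ENNReal.ofReal τ)
    (hsmall : 32 * (S.γ * (τ / β) / l) ≤ l) (hq : 3 * (S.γ * (τ / β) / l) ≤ q * l)
    (hq0 : 0 ≤ q) (hq1 : q < 1) :
    ∃ (Φ : E → E) (Q : M → E → ℂ), S.IsCanonical (a + 2 * l) (a + l) Φ ∧ S.IsFam (a + 2 * l) Q ∧
      S.nrm (a + 2 * l) Q ≤ ENNReal.ofReal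
        ((S.γ / ((a + l) * l) * η * (τ / β) + S.γ / (l * l) * ρ * (τ / β) +
          1 / 2 * (S.γ / (l * l) * τ * (τ / β))) / (1 - q)) ∧
      (∀ x ∈ S.dom (a + 2 * l), h (Φ x) + fsum G (Φ x) + fsum R (Φ x) =
        h x + fsum G x + fsum (Nᶜ.indicator R + Q) x) ∧
      ∀ (W : Type) [NormedAddCommGroup W] [NormedSpace ℂ W] (Λ : E →L[ℂ] W) (cΛ β' : ℝ), 0 < β' →
        0 ≤ cΛ → (∀ ℓ, ‖Λ (S.J ℓ)‖ ≤ cΛ * ‖ℓ‖) →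
        (∀ k ∈ N, (∀ x ∈ S.dom 0, β' ≤ ‖d k x‖) ∨ ∀ t, 0 ≤ t → ∀ f : E → ℂ,
          DifferentiableOn ℂ f (S.dom t) →
          (∀ g, ∀ x ∈ S.dom t, f (S.act g x) = S.char g k * f x) →
          ∀ x ∈ S.dom t, Λ (S.J (fderiv ℂ f x)) = 0) →
        ∀ x ∈ S.dom (a + 2 * l), ‖Λ (Φ x - x)‖ ≤ cΛ * (τ / (β' * l)) := by
  have hγ := S.γ_nonneg
  have hm₀ : 0 ≤ τ / β := by positivity
  set χ := chi N d R with hχdef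
  have hχ : S.IsFam a χ := isFam_chi hU hN hβ hd ha hR
  have hχ' : S.nrm a χ ≤ ENNReal.ofReal (τ / β) := nrm_chi_le hβ hd ha hP
  have hχfin := ne_top_of_le_ne_top ENNReal.ofReal_ne_top hχ'
  have hGfin := ne_top_of_le_ne_top ENNReal.ofReal_ne_top hG'
  have hRfin := ne_top_of_le_ne_top ENNReal.ofReal_ne_top hR'
  have hPfin := ne_top_of_le_ne_top ENNReal.ofReal_ne_top hP
  have hPfam := (hR.indicator hN).neg
  have hP' : S.nrm a (-N.indicator R) ≤ ENNReal.ofReal τ := by rwa [nrm_neg]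
  have hχholo := differentiableOn_fsum hχ.holo hχfin
  have hχbd : ∀ x ∈ S.dom a, ‖fsum χ x‖ ≤ τ / β := fun x hx =>
    (norm_fsum_le hχfin hx).trans (ENNReal.toReal_le_of_le_ofReal hm₀ hχ')
  set m := S.γ * (τ / β) / l with hm
  have hm0 : 0 ≤ m := by positivity
  have hs : IsSlowField S.toDomainScale (S.ham (fsum χ)) (a + l) (a + 2 * l) m :=
    isSlowField_ham hχholo hχbd hm₀ hl le_rfl (by linarith) (by linarith)
  -- A second level, needed for the variational equation behind symplecticity. It halves the loss,
  -- which accounts for the constant `32` in place of `16`.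
  have hs' : IsSlowField S.toDomainScale (S.ham (fsum χ)) (a + l + l / 2) (a + 2 * l) m :=
    isSlowField_ham hχholo hχbd hm₀ hl (by linarith) (by linarith) (by linarith)
  have : CompleteSpace E := FiniteDimensional.complete ℂ E
  obtain ⟨Φ, hΦ⟩ := hs.exists_flow
  have hal : a < a + l := by linarith
  have h0l : 0 < a + l := by linarith
  have hlt : a + l < a + 2 * l := by linarith
  have e1 : a + l - a = l := by ring
  have e2 : a + 2 * l - (a + l) = l := by ring
  have hKG : S.IsFam (a + l) (S.conv G χ) := hG.conv h0l hal hχ hGfin hχfin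
  -- `G` is known at level `0`, so differentiating it costs `1 / (a + l)` and only `χ` contributes
  -- `1 / l`.
  have hKG' : S.nrm (a + l) (S.conv G χ) ≤ ENNReal.ofReal (S.γ / ((a + l) * l) * η * (τ / β)) :=
    nrm_conv_le_ofReal h0l hal hG hχ hG' hχ' hη (by rw [e1, sub_zero])
  have hKR : S.IsFam (a + l) (S.conv R χ) := hR.conv hal hal hχ hRfin hχfin
  have hKR' : S.nrm (a + l) (S.conv R χ) ≤ ENNReal.ofReal (S.γ / (l * l) * ρ * (τ / β)) :=
    nrm_conv_le_ofReal hal hal hR hχ hR' hχ' hρ (by rw [e1])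
  have hPfin' := ne_top_of_le_ne_top ENNReal.ofReal_ne_top hP'
  have hKP : S.IsFam (a + l) (S.conv (-N.indicator R) χ) := hPfam.conv hal hal hχ hPfin' hχfin
  have hKP' : S.nrm (a + l) (S.conv (-N.indicator R) χ) ≤
      ENNReal.ofReal (S.γ / (l * l) * τ * (τ / β)) :=
    nrm_conv_le_ofReal hal hal hPfam hχ hP' hχ' hτ (by rw [e1])
  have hqe : 3 * (S.γ * (τ / β) / l) ≤ q * (a + 2 * l - (a + l)) := by rw [e2]; exact hq
  have hw1 : ∀ n : ℕ, |((n + 1)! : ℝ)⁻¹| ≤ 1 / n ! := abs_inv_factorial_succ_le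
  have hw2 : ∀ n : ℕ, |((n + 2)! : ℝ)⁻¹| ≤ (1 / 2) / n ! := abs_inv_factorial_add_two_le
  obtain ⟨fG, nG, sG⟩ := adSeries_spec (w := fun n => ((n + 1)! : ℝ)⁻¹) hlt hl le_rfl hKG hχ
    (by positivity) hm₀ hKG' hχ' hqe hq0 hq1 zero_le_one hw1
  obtain ⟨fR, nR, sR⟩ := adSeries_spec (w := fun n => ((n + 1)! : ℝ)⁻¹) hlt hl le_rfl hKR hχ
    (by positivity) hm₀ hKR' hχ' hqe hq0 hq1 zero_le_one hw1
  obtain ⟨fP, nP, sP⟩ := adSeries_spec (w := fun n => ((n + 2)! : ℝ)⁻¹) hlt hl le_rfl hKP hχ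
    (by positivity) hm₀ hKP' hχ' hqe hq0 hq1 (by norm_num) hw2
  have nGfin := ne_top_of_le_ne_top ENNReal.ofReal_ne_top nG
  have nRfin := ne_top_of_le_ne_top ENNReal.ofReal_ne_top nR
  have nPfin := ne_top_of_le_ne_top ENNReal.ofReal_ne_top nP
  have hq1' : 0 < 1 - q := by linarith
  have nGR := (nrm_add_le (S := S) (t := a + 2 * l) _ _).trans (add_le_add nG nR)
  rw [← ENNReal.ofReal_add (by positivity) (by positivity)] at nGR
  have nGRP := (nrm_add_le (S := S) (t := a + 2 * l) _ _).trans (add_le_add nGR nP)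
  rw [← ENNReal.ofReal_add (by positivity) (by positivity)] at nGRP
  refine ⟨Φ 1, _, ?_, (fG.add fR).add fP, ?_, ?_, ?_⟩
  · exact isCanonical_flow hχholo (fun x hx => star_fsum hχ hx)
      (fun g v hg hk x hx => fsum_periodic hχ hg hk hx) hal.le hs (by linarith) hs' hΦ
  · refine nGRP.trans (ENNReal.ofReal_le_ofReal (le_of_eq ?_))
    field_simp
  · intro x hx
    have hxa := S.anti hal.le (S.anti hlt.le hx)
    have hQR : S.nrm (a + 2 * l) (Nᶜ.indicator R) ≠ ⊤ := ne_top_of_le_ne_top hRfin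
      ((nrm_anti (by linarith) _).trans (nrm_indicator_le _ R))
    rw [fsum_add hQR (ne_top_of_le_ne_top ENNReal.ofReal_ne_top nGRP) hx,
      fsum_add (ne_top_of_le_ne_top ENNReal.ofReal_ne_top nGR) nPfin hx,
      fsum_add nGfin nRfin hx, sG x hx, sR x hx, sP x hx]
    have tG := apply_flow_eq hlt ((differentiableOn_fsum hG.holo hGfin).mono
      (S.anti h0l.le)) hKG'
      (fun y hy => pb_fsum h0l hal hG.holo hχ.holo hGfin hχfin hy) hs hΦ hx
    have tR := apply_flow_eq hlt ((differentiableOn_fsum hR.holo hRfin).mono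
      (S.anti hal.le)) hKR'
      (fun y hy => pb_fsum hal hal hR.holo hχ.holo hRfin hχfin hy) hs hΦ hx
    have th := apply_flow_eq hlt (hU.holo.mono (S.anti h0l.le)) ((nrm_anti hal.le _).trans hP')
      (fun y hy => pb_fsum_chi hU hN hβ hd ha hR hP hal hy) hs hΦ hx
    have hbd : ∀ y ∈ S.dom (a + l), ‖fsum (-N.indicator R) y‖ ≤ τ := fun y hy =>
      (norm_fsum_le hPfin' (S.anti hal.le hy)).trans (ENNReal.toReal_le_of_le_ofReal hτ hP')
    have hPh : DifferentiableOn ℂ (fsum (-N.indicator R)) (S.dom (a + l)) :=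
      (differentiableOn_fsum hPfam.holo hPfin').mono (S.anti hal.le)
    have hsumm : Summable fun n : ℕ => ((n + 1)! : ℝ)⁻¹ •
        (lieD (S.ham (fsum χ)))^[n] (fsum (-N.indicator R)) x := by
      refine Summable.of_norm_bounded (summable_const_mul_quarter_pow τ) fun n => ?_
      simpa using! hs.norm_term_le hPh hbd (t := 1) (by simp) n hx
    -- The term of first order in `h ∘ Φ` is minus the `N`-part of `R` and cancels it. The rest has
    -- coefficients `1 / (n + 2)!`, which explains the factor `1/2` in the estimate.
    rw [hsumm.tsum_eq_zero_add] at th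
    have hshift : ∀ n : ℕ, (lieD (S.ham (fsum χ)))^[n + 1] (fsum (-N.indicator R)) x =
        (lieD (S.ham (fsum χ)))^[n] (fsum (S.conv (-N.indicator R) χ)) x := by
      have key : ∀ n : ℕ, EqOn ((lieD (S.ham (fsum χ)))^[n + 1] (fsum (-N.indicator R)))
          ((lieD (S.ham (fsum χ)))^[n] (fsum (S.conv (-N.indicator R) χ))) (S.dom (a + l)) := by
        intro n
        induction n with
        | zero =>
          exact fun y hy => pb_fsum hal hal hPfam.holo hχ.holo hPfin' hχfin hy
        | succ n ih =>
          intro y hy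
          rw [Function.iterate_succ_apply',
            Function.iterate_succ_apply' _ n (fsum (S.conv (-N.indicator R) χ))]
          exact lieD_congr (S.isOpen_dom _) ih hy
      exact fun n => key n (S.anti hlt.le hx)
    simp only [hshift] at th
    have hsplit := fsum_indicator_add hRfin N hxa
    rw [tG, tR, th]
    simp only [zero_add, Nat.factorial_one, Nat.cast_one, inv_one, one_smul,
      Function.iterate_zero, id_eq, fsum_neg] at *
    rw [← hsplit]
    ring
  · intro W _ _ Λ cΛ β' hβ' hcΛ hΛ hdich x hx
    refine hs.norm_flow_sub_le hΦ Λ (fun y hy => ?_) hx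
    have hya := S.anti hal.le hy
    have s : Summable fun k => fderiv ℂ (χ k) y :=
      Summable.of_norm_bounded ((summable_supN hχfin).div_const (a + l - a)) fun k =>
        norm_fderiv_le_supN hal (hχ.holo k) (supN_ne_top hχfin k) hy
    rw [ham, (hasFDerivAt_fsum hχ.holo hχfin hya).fderiv, S.J.map_tsum s,
      Λ.map_tsum (s.mapL S.J)]
    -- Modes of `χ` with a divisor not bounded below by `β'` are annihilated by the functional, so
    -- `β'` may replace `β` here.
    have hterm : ∀ k, ‖Λ (S.J (fderiv ℂ (χ k) y))‖ ≤
        cΛ / (β' * l) * (S.supN a (N.indicator R k)).toReal := by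
      intro k
      by_cases hk : k ∈ N
      · rcases hdich k hk with h1 | h1
        · have h2 := supN_chi_le (S := S) (N := N) (R := R) hβ' ha h1
          have h3 := ENNReal.toReal_mono
            (ENNReal.mul_ne_top ENNReal.ofReal_ne_top (supN_ne_top hPfin k)) h2
          rw [ENNReal.toReal_mul, ENNReal.toReal_ofReal (by positivity)] at h3
          have h4 := norm_fderiv_le_supN hal (hχ.holo k) (supN_ne_top hχfin k) hy
          rw [e1] at h4
          calc ‖Λ (S.J (fderiv ℂ (χ k) y))‖ ≤ cΛ * ‖fderiv ℂ (χ k) y‖ := hΛ _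
            _ ≤ cΛ * ((β'⁻¹ * (S.supN a (N.indicator R k)).toReal) / l) := by
              gcongr
              exact h4.trans (by gcongr)
            _ = _ := by field_simp
        · rw [h1 a ha _ (hχ.holo k) (hχ.mode k) y hya, norm_zero]
          positivity
      · have : χ k = fun _ => 0 := funext fun z => chi_of_notMem hk z
        rw [this]
        simp only [fderiv_fun_const, Pi.zero_apply, map_zero, norm_zero]
        positivity
    have h5 := tsum_of_norm_bounded ((summable_supN hPfin).hasSum.mul_left _) hterm
    refine h5.trans ?_
    rw [tsum_supN hPfin]
    have h6 := ENNReal.toReal_le_of_le_ofReal hτ hP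
    calc cΛ / (β' * l) * (S.nrm a (N.indicator R)).toReal ≤ cΛ / (β' * l) * τ := by gcongr
      _ = _ := by ring

end ModeSystem

end Averaging

/-! ### Iteration of the averaging step. -/

namespace Averaging

namespace ModeSystem

variable {E M : Type*} [NormedAddCommGroup E] [NormedSpace ℂ E] [AddCommGroup M]
variable {S : ModeSystem E M} {F G : M → E → ℂ} {a b t : ℝ}
variable {h : E → ℂ} {d R : M → E → ℂ} {N : Set M} {β τ : ℝ}

/-- The linear functionals of the displacement of `Φ` are bounded by `C`, divided by a lower bound
of those divisors that contribute to the functional. -/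
def DisplacedBy (S : ModeSystem E M) (d : M → E → ℂ) (N : Set M) (s : ℝ) (Φ : E → E) (C : ℝ) :
    Prop :=
  ∀ (W : Type) [NormedAddCommGroup W] [NormedSpace ℂ W] (Λ : E →L[ℂ] W) (cΛ β' : ℝ), 0 < β' →
    0 ≤ cΛ → (∀ ℓ, ‖Λ (S.J ℓ)‖ ≤ cΛ * ‖ℓ‖) →
    (∀ k ∈ N, (∀ x ∈ S.dom 0, β' ≤ ‖d k x‖) ∨ ∀ t, 0 ≤ t → ∀ f : E → ℂ,
      DifferentiableOn ℂ f (S.dom t) →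
      (∀ g, ∀ x ∈ S.dom t, f (S.act g x) = S.char g k * f x) →
      ∀ x ∈ S.dom t, Λ (S.J (fderiv ℂ f x)) = 0) →
    ∀ x ∈ S.dom s, ‖Λ (Φ x - x)‖ ≤ cΛ * (C / β')

lemma DisplacedBy.comp {s t u C C' : ℝ} {Φ Ψ : E → E} (hΨ : S.DisplacedBy d N t Ψ C)
    (hΦ : S.DisplacedBy d N s Φ C') (hΦm : S.IsCanonical s u Φ) (htu : t ≤ u) :
    S.DisplacedBy d N s (Ψ ∘ Φ) (C + C') := by
  intro W _ _ Λ cΛ β' hβ' hcΛ hΛ hd x hx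
  have h1 := hΨ W Λ cΛ β' hβ' hcΛ hΛ hd (Φ x) (S.anti htu (hΦm.mapsTo hx))
  have h2 := hΦ W Λ cΛ β' hβ' hcΛ hΛ hd x hx
  have e : Λ ((Ψ ∘ Φ) x - x) = Λ (Ψ (Φ x) - Φ x) + Λ (Φ x - x) := by
    rw [← map_add, sub_add_sub_cancel]; rfl
  rw [e]
  refine (norm_add_le _ _).trans ((add_le_add h1 h2).trans (le_of_eq ?_))
  ring

lemma DisplacedBy.mono {s C C' : ℝ} {Φ : E → E} (hΦ : S.DisplacedBy d N s Φ C) (h : C ≤ C') :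
    S.DisplacedBy d N s Φ C' := by
  intro W _ _ Λ cΛ β' hβ' hcΛ hΛ hd x hx
  refine (hΦ W Λ cΛ β' hβ' hcΛ hΛ hd x hx).trans ?_
  gcongr

omit [NormedAddCommGroup E] [NormedSpace ℂ E] [AddCommGroup M] in
lemma indicator_indicator_compl (F : M → E → ℂ) : Nᶜ.indicator (N.indicator F) = 0 := by
  rw [indicator_indicator, compl_inter_self, indicator_empty]; rfl

omit [NormedAddCommGroup E] [NormedSpace ℂ E] [AddCommGroup M] in
lemma indicator_compl_indicator (F : M → E → ℂ) : N.indicator (Nᶜ.indicator F) = 0 := by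
  rw [indicator_indicator, inter_compl_self, indicator_empty]; rfl

variable [FiniteDimensional ℂ E]

/-- The first step of the averaging procedure, with a large loss of domain. -/
theorem exists_first_step (hU : S.Unperturbed h d) (hN : ∀ k, S.σ k ∈ N ↔ k ∈ N)
    (hβ : 0 < β) (hd : ∀ k ∈ N, ∀ x ∈ S.dom 0, β ≤ ‖d k x‖) {η μ : ℝ} (hη : 0 ≤ η)
    (hμ : S.γ * η ≤ μ * β) (hμ1 : μ ≤ 10 / 221) (hμ0 : 0 ≤ μ)
    (hF : S.IsFam 0 F) (hF' : S.nrm 0 F ≤ ENNReal.ofReal η) :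
    ∃ (Φ : E → E) (Q : M → E → ℂ), S.IsCanonical (5 / 2) 0 Φ ∧ S.IsFam (5 / 2) Q ∧
      S.nrm (5 / 2) Q ≤ ENNReal.ofReal (53 / 50 * μ * η) ∧
      (∀ x ∈ S.dom (5 / 2), h (Φ x) + fsum F (Φ x) =
        h x + fsum (Nᶜ.indicator F) x + fsum Q x) ∧
      S.DisplacedBy d N (5 / 2) Φ (4 / 5 * η) := by
  have hγ := S.γ_nonneg
  have hfin := ne_top_of_le_ne_top ENNReal.ofReal_ne_top hF'
  have hadd := nrm_indicator_add (S := S) (t := 0) N F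
  have hNfin : S.nrm 0 (N.indicator F) ≠ ⊤ := ne_top_of_le_ne_top hfin (nrm_indicator_le _ _)
  have hCfin : S.nrm 0 (Nᶜ.indicator F) ≠ ⊤ := ne_top_of_le_ne_top hfin (nrm_indicator_le _ _)
  set ρ := (S.nrm 0 (N.indicator F)).toReal with hρ
  set g := (S.nrm 0 (Nᶜ.indicator F)).toReal with hg
  have hρ0 : 0 ≤ ρ := ENNReal.toReal_nonneg
  have hg0 : 0 ≤ g := ENNReal.toReal_nonneg
  -- The norm splits exactly over complementary sets of modes; bounding both parts by `η` separately
  -- would be too weak for the constant `53/50`.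
  have hsum : g + ρ ≤ η := by
    rw [hρ, hg, add_comm, ← ENNReal.toReal_add hNfin hCfin, hadd]
    exact ENNReal.toReal_le_of_le_ofReal hη hF'
  have hρη : S.γ * (ρ / β) ≤ μ := by
    rw [← mul_div_assoc, div_le_iff₀ hβ]
    exact (mul_le_mul_of_nonneg_left (by linarith) hγ).trans hμ
  -- The whole of `R` is to be removed, so `ρ = τ`. The ratio solves `3 y / l = q l` for `l = 5/4`
  -- and `y = μ`, the bound for `γ ρ / β`.
  obtain ⟨Φ, Q, h1, h2, h3, h4, h5⟩ := exists_averaging_step (G := Nᶜ.indicator F)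
    (R := N.indicator F) (N := N) (a := 0) (l := 5 / 4) (η := g) (ρ := ρ) (τ := ρ)
    (q := 48 / 25 * μ) hU hN hβ hd le_rfl (by norm_num) hg0 hρ0 hρ0
    (hF.indicator (N := Nᶜ) fun k => not_congr (hN k)) (by rw [ENNReal.ofReal_toReal hCfin])
    (hF.indicator hN) (by rw [ENNReal.ofReal_toReal hNfin])
    (by rw [indicator_indicator, inter_self, ENNReal.ofReal_toReal hNfin])
    (by linarith) (by linarith) (by positivity) (by linarith)
  have e : (0 : ℝ) + 2 * (5 / 4) = 5 / 2 := by norm_num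
  rw [e] at h1 h2 h3 h4 h5
  refine ⟨Φ, Q, h1.anti le_rfl (by norm_num), h2, h3.trans (ENNReal.ofReal_le_ofReal ?_), ?_, ?_⟩
  · rw [div_le_iff₀ (by linarith)]
    set y := S.γ * (ρ / β) with hy
    have hy0 : 0 ≤ y := by positivity
    have e2 : S.γ / ((0 + 5 / 4) * (5 / 4)) * g * (ρ / β) + S.γ / (5 / 4 * (5 / 4)) * ρ * (ρ / β) +
        1 / 2 * (S.γ / (5 / 4 * (5 / 4)) * ρ * (ρ / β)) = 16 / 25 * (g + 3 / 2 * ρ) * y := by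
      rw [hy]; ring
    rw [e2]
    have h6 : g + 3 / 2 * ρ ≤ 3 / 2 * η := by linarith
    calc 16 / 25 * (g + 3 / 2 * ρ) * y ≤ 16 / 25 * (3 / 2 * η) * μ := by gcongr
      _ = μ * η * (24 / 25) := by ring
      _ ≤ μ * η * (53 / 50 * (1 - 48 / 25 * μ)) := by gcongr; linarith
      _ = _ := by ring
  · intro x hx
    have h6 := h4 x hx
    rw [indicator_indicator_compl, zero_add] at h6
    rw [← h6, ← fsum_indicator_add hfin N (h1.mapsTo.mono_right (S.anti (by norm_num)) hx)]
    ring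
  · intro W _ _ Λ cΛ β' hβ' hcΛ hΛ hdich x hx
    refine (h5 W Λ cΛ β' hβ' hcΛ hΛ hdich x hx).trans ?_
    rw [mul_comm β', ← div_div]
    gcongr
    linarith

/-- The remaining steps of the averaging procedure, with equal small losses of domain. -/
theorem exists_iterated_steps (hU : S.Unperturbed h d) (hN : ∀ k, S.σ k ∈ N ↔ k ∈ N)
    (hβ : 0 < β) (hd : ∀ k ∈ N, ∀ x ∈ S.dom 0, β ≤ ‖d k x‖) {η μ : ℝ} {n : ℕ} (hη : 0 ≤ η)
    (hμ : S.γ * η ≤ μ * β) (hn : 0 < n) (hμ1 : n * μ ≤ 1 / 13) (hμ0 : 0 ≤ μ)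
    (hG : S.IsFam 0 G) (hG' : S.nrm 0 G ≤ ENNReal.ofReal η)
    (hR : S.IsFam (5 / 2) R) (hR' : S.nrm (5 / 2) R ≤ ENNReal.ofReal (53 / 50 * μ * η)) (i : ℕ) :
    ∃ (Φ : E → E) (Q : M → E → ℂ), S.IsCanonical (5 / 2 + i / n) (5 / 2) Φ ∧
      S.IsFam (5 / 2 + i / n) Q ∧
      S.nrm (5 / 2 + i / n) Q ≤ ENNReal.ofReal (53 / 50 * μ * η * ((8 - (1 / 8) ^ i) / 7)) ∧
      S.nrm (5 / 2 + i / n) (N.indicator Q) ≤ ENNReal.ofReal (53 / 50 * μ * η * (1 / 8) ^ i) ∧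
      (∀ x ∈ S.dom (5 / 2 + i / n), h (Φ x) + fsum G (Φ x) + fsum R (Φ x) =
        h x + fsum G x + fsum Q x) ∧
      S.DisplacedBy d N (5 / 2 + i / n) Φ (53 / 25 * (1 / 13) * η * (8 / 7 * (1 - (1 / 8) ^ i))) := by
  have hγ := S.γ_nonneg
  have hn' : (0 : ℝ) < n := by exact_mod_cast hn
  induction i with
  | zero =>
    have e : (5 / 2 + ((0 : ℕ) : ℝ) / n) = 5 / 2 := by simp
    rw [e]
    refine ⟨id, R, ⟨mapsTo_id _, differentiableOn_id, injOn_id _, fun x _ u v => ?_,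
      fun x _ => rfl, fun _ _ _ _ _ _ => rfl⟩, hR, ?_, ?_, fun x _ => rfl, ?_⟩
    · rw [fderiv_id]; rfl
    · norm_num; convert! hR' using 2
    · refine (nrm_indicator_le _ _).trans ?_
      simpa using hR'
    · intro W _ _ Λ cΛ β' _ _ _ _ x _
      simp
  | succ i ih =>
    obtain ⟨Φ, Q, h1, h2, h3, h4, h5, h6⟩ := ih
    have hp0 : (0 : ℝ) < (1 / 8) ^ i := by positivity
    have hp1 : ((1 : ℝ) / 8) ^ i ≤ 1 := pow_le_one₀ (by norm_num) (by norm_num)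
    set p := ((1 : ℝ) / 8) ^ i with hp
    set a := (5 / 2 + (i : ℝ) / n) with ha
    have ha0 : 5 / 2 ≤ a := by rw [ha]; have : 0 ≤ (i : ℝ) / n := by positivity
                               linarith
    -- One step costs `2 l`, so that `n` steps cost one level.
    set l := 1 / (2 * (n : ℝ)) with hl
    have hl0 : 0 < l := by positivity
    have hln : l * n = 1 / 2 := by rw [hl]; field_simp
    have hμl : μ ≤ 2 / 13 * l := by
      have : n * μ ≤ n * (2 / 13 * l) := by nlinarith
      exact le_of_mul_le_mul_left this hn'
    have eη : S.γ * (η / β) ≤ μ := by rw [← mul_div_assoc, div_le_iff₀ hβ]; exact hμ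
    have hx0 : 0 ≤ S.γ * (η / β) := by positivity
    set τ := 53 / 50 * μ * η * p with hτ
    set ρ := 53 / 50 * μ * η * ((8 - p) / 7) with hρ
    have hτ0 : 0 ≤ τ := by positivity
    have hρ0 : 0 ≤ ρ := by have : 0 ≤ 8 - p := by linarith
                           positivity
    have eτ : S.γ * (τ / β) ≤ 53 / 50 * μ * μ := by
      have : S.γ * (τ / β) = 53 / 50 * μ * p * (S.γ * (η / β)) := by rw [hτ]; ring
      rw [this]
      calc 53 / 50 * μ * p * (S.γ * (η / β)) ≤ 53 / 50 * μ * 1 * μ := by gcongr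
        _ = _ := by ring
    have hμμ : μ * μ ≤ 4 / 169 * (l * l) := by nlinarith
    have hq : S.γ * (τ / β) ≤ 53 / 50 * (4 / 169 * (l * l)) := by linarith
    obtain ⟨Ψ, Q', k1, k2, k3, k4, k5⟩ := exists_averaging_step (G := G)
      (R := Q) (N := N) (a := a) (l := l) (η := η) (ρ := ρ) (τ := τ) (q := 1 / 13)
      hU hN hβ hd (by linarith) hl0 hη hρ0 hτ0 hG hG' h2 h3 h4
      (by
        rw [← mul_div_assoc, div_le_iff₀ hl0]
        linarith [mul_pos hl0 hl0])
      (by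
        rw [← mul_div_assoc, div_le_iff₀ hl0]
        linarith [mul_pos hl0 hl0])
      (by norm_num) (by norm_num)
    have e : a + 2 * l = 5 / 2 + ((i + 1 : ℕ) : ℝ) / n := by
      rw [ha, hl]; push_cast; field_simp; ring
    -- The contraction by eight. The bracket with `G` is of relative size `μ / ((a + l) l)`,
    -- harmless because `a ≥ 5/2` and `μ ≤ (2/13) l`. In the other two the dangerous `1 / l ^ 2` is
    -- met by two factors `μ`, as the remainder is already of size `μ η`. With `1 - q = 12/13` the
    -- sum stays below `1/8`.
    have hQ : (S.γ / ((a + l) * l) * η * (τ / β) + S.γ / (l * l) * ρ * (τ / β) +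
        1 / 2 * (S.γ / (l * l) * τ * (τ / β))) / (1 - 1 / 13) ≤ 1 / 8 * τ := by
      have z1 : S.γ / ((a + l) * l) * η * (τ / β) ≤ 4 / 65 * τ := by
        have : S.γ / ((a + l) * l) * η * (τ / β) = S.γ * (η / β) / ((a + l) * l) * τ := by ring
        rw [this]
        refine mul_le_mul_of_nonneg_right ?_ hτ0
        rw [div_le_iff₀ (by positivity)]
        nlinarith
      have z2 : S.γ / (l * l) * ρ * (τ / β) ≤ 53 / 50 * (4 / 169) * (8 / 7) * τ := by
        have : S.γ / (l * l) * ρ * (τ / β) =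
          53 / 50 * (μ * (S.γ * (η / β)) / (l * l)) * ((8 - p) / 7) * τ := by rw [hρ]; ring
        rw [this]
        have : (8 - p) / 7 ≤ 8 / 7 := by linarith
        have h0 : 0 ≤ (8 - p) / 7 := by linarith
        have h7 : μ * (S.γ * (η / β)) / (l * l) ≤ 4 / 169 := by
          rw [div_le_iff₀ (by positivity)]
          exact (mul_le_mul_of_nonneg_left eη hμ0).trans hμμ
        gcongr
      have z3 : S.γ / (l * l) * τ * (τ / β) ≤ 53 / 50 * (4 / 169) * τ := by
        have : S.γ / (l * l) * τ * (τ / β) = S.γ * (τ / β) / (l * l) * τ := by ring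
        rw [this]
        refine mul_le_mul_of_nonneg_right ?_ hτ0
        rw [div_le_iff₀ (by positivity)]
        linarith
      rw [div_le_iff₀ (by norm_num)]
      linarith
    rw [e] at k1 k2 k3 k4 k5
    have hle : a ≤ 5 / 2 + ((i + 1 : ℕ) : ℝ) / n := by rw [← e]; linarith
    have k3' := k3.trans (ENNReal.ofReal_le_ofReal hQ)
    -- Modes outside `N` are kept and accumulate to a geometric sum, the factor `(8 - (1/8) ^ i) /
    -- 7`, while the new `N`-part comes from `Q'` alone.
    refine ⟨Φ ∘ Ψ, Nᶜ.indicator Q + Q', h1.comp (k1.anti le_rfl (by linarith)),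
      ((h2.indicator (N := Nᶜ) fun k => not_congr (hN k)).anti hle).add k2, ?_, ?_, ?_, ?_⟩
    · have hb := (nrm_add_le (S := S) (t := 5 / 2 + ((i + 1 : ℕ) : ℝ) / n) (Nᶜ.indicator Q) Q').trans
        (add_le_add (((nrm_indicator_le _ _).trans (nrm_anti hle Q)).trans h3) k3')
      rw [← ENNReal.ofReal_add hρ0 (by positivity)] at hb
      refine hb.trans (ENNReal.ofReal_le_ofReal (le_of_eq ?_))
      rw [hρ, hτ, pow_succ, ← hp]; ring
    · rw [indicator_add', indicator_compl_indicator, zero_add]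
      refine (nrm_indicator_le _ _).trans (k3'.trans (ENNReal.ofReal_le_ofReal (le_of_eq ?_)))
      rw [hτ, pow_succ, ← hp]; ring
    · intro x hx
      rw [← k4 x hx, Function.comp]
      exact h5 (Ψ x) (S.anti (by linarith) (k1.mapsTo hx))
    · have hΨ : S.DisplacedBy d N (5 / 2 + ((i + 1 : ℕ) : ℝ) / n) Ψ
          (53 / 25 * (1 / 13) * η * p) := by
        intro W _ _ Λ cΛ β' hβ' hcΛ hΛ hdich x hx
        refine (k5 W Λ cΛ β' hβ' hcΛ hΛ hdich x hx).trans ?_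
        rw [mul_comm β', ← div_div]
        gcongr
        rw [div_le_iff₀ hl0, hτ]
        have : 53 / 50 * η * p * μ ≤ 53 / 50 * η * p * (2 / 13 * l) := by gcongr
        linarith
      refine (h6.comp hΨ k1 (by linarith)).mono (le_of_eq ?_)
      rw [pow_succ, ← hp]; ring

/-- `e ^ 2 < 8`, so `n ≥ X / 8` steps of ratio `1/8` give at most `e^{-2 n} ≤ e^{-X/4}`. -/
lemma eighth_pow_le {n : ℕ} {X : ℝ} (h : X / 8 ≤ n) : ((1 : ℝ) / 8) ^ n ≤ Real.exp (-(X / 4)) := by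
  have h1 : (1 : ℝ) / 8 ≤ Real.exp (-2) := by
    rw [Real.exp_neg, one_div]
    refine inv_anti₀ (Real.exp_pos _) ?_
    have h2 := Real.exp_one_lt_d9
    have h3 : Real.exp 2 = Real.exp 1 ^ 2 := by rw [← Real.exp_nat_mul]; norm_num
    rw [h3]
    nlinarith [Real.exp_pos 1]
  calc ((1 : ℝ) / 8) ^ n ≤ Real.exp (-2) ^ n := by gcongr
    _ = Real.exp (-(2 * n)) := by rw [← Real.exp_nat_mul]; ring_nf
    _ ≤ _ := Real.exp_le_exp.2 (by linarith)

/-- Averaging to exponentially small order of the modes in `N`. -/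
theorem exists_averaging (hU : S.Unperturbed h d) (hN : ∀ k, S.σ k ∈ N ↔ k ∈ N)
    (hβ : 0 < β) (hd : ∀ k ∈ N, ∀ x ∈ S.dom 0, β ≤ ‖d k x‖) {η μ X : ℝ} (hη : 0 ≤ η)
    (hμ : S.γ * η ≤ μ * β) (hμ0 : 0 ≤ μ) (hX : 5.545 ≤ X) (hμX : 4 * X * μ ≤ 1)
    (hF : S.IsFam 0 F) (hF' : S.nrm 0 F ≤ ENNReal.ofReal η) :
    ∃ (Φ : E → E) (R : M → E → ℂ), S.IsCanonical (7 / 2) 0 Φ ∧ S.IsFam (7 / 2) R ∧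
      S.nrm (7 / 2) R ≤ ENNReal.ofReal (5 / 4 * μ * η) ∧
      S.nrm (7 / 2) (N.indicator R) ≤ ENNReal.ofReal (1 / 20 * Real.exp (-(X / 4)) * η) ∧
      (∀ x ∈ S.dom (7 / 2), h (Φ x) + fsum F (Φ x) =
        h x + fsum (Nᶜ.indicator F) x + fsum R x) ∧
      S.DisplacedBy d N (7 / 2) Φ η := by
  -- `4 · 5.545 = 22.18 ≥ 22.1`. The number `5.545` is just below `8 log 2`.
  have hμ1 : μ ≤ 10 / 221 := by
    norm_num at hX
    nlinarith
  set n := ⌈X / 8⌉₊ with hndef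
  have hX0 : 0 < X := by norm_num at hX; linarith
  have hn : 0 < n := Nat.ceil_pos.2 (by linarith)
  have hn1 : X / 8 ≤ n := Nat.le_ceil _
  have hn2 : (n : ℝ) ≤ X / 8 + 1 := (Nat.ceil_lt_add_one (by linarith)).le
  -- `n μ ≤ X μ / 8 + μ ≤ 1/32 + 10/221`, just below `1/13`.
  have hnμ : n * μ ≤ 1 / 13 := by nlinarith
  have hn' : (0 : ℝ) < n := by exact_mod_cast hn
  obtain ⟨Φ, Q, h1, h2, h3, h4, h5⟩ := exists_first_step hU hN hβ hd hη hμ hμ1 hμ0 hF hF'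
  obtain ⟨Ψ, R, k1, k2, k3, k4, k5, k6⟩ := exists_iterated_steps hU hN hβ hd hη hμ hn hnμ hμ0
    (hF.indicator (N := Nᶜ) fun k => not_congr (hN k)) ((nrm_indicator_le _ _).trans hF') h2 h3 n
  have e : (5 / 2 + (n : ℝ) / n) = 7 / 2 := by rw [div_self hn'.ne']; norm_num
  rw [e] at k1 k2 k3 k4 k5 k6
  have hp0 : (0 : ℝ) < (1 / 8) ^ n := by positivity
  have hμη : 0 ≤ μ * η := by positivity
  refine ⟨Φ ∘ Ψ, R, h1.comp k1, k2, k3.trans (ENNReal.ofReal_le_ofReal ?_),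
    k4.trans (ENNReal.ofReal_le_ofReal ?_), fun x hx => ?_, ?_⟩
  · nlinarith [mul_nonneg hμη hp0.le]
  · have h6 := eighth_pow_le hn1
    calc 53 / 50 * μ * η * (1 / 8) ^ n ≤ 53 / 50 * (10 / 221) * η * Real.exp (-(X / 4)) := by gcongr
      _ ≤ _ := by nlinarith [mul_nonneg hη (Real.exp_pos (-(X / 4))).le]
  · rw [← k5 x hx]
    exact h4 (Ψ x) (k1.mapsTo hx)
  -- The first step contributes `4/5` and the others together at most `(53/325) (8/7) < 1/5`.
  · refine (h5.comp k6 k1 le_rfl).mono ?_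
    nlinarith [mul_nonneg hη hp0.le]

end ModeSystem

end Averaging

/-! ### Normal coordinates, the rescaled chart, and the scale of domains. -/

namespace Averaging

section Coordinates

lemma sqrt_two_sq : (Real.sqrt 2 : ℂ) ^ 2 = 2 := by
  rw [← Complex.ofReal_pow, Real.sq_sqrt (by norm_num)]; norm_num

lemma sqrt_two_ne_zero : (Real.sqrt 2 : ℂ) ≠ 0 := fun h => by
  have := sqrt_two_sq
  rw [h] at this
  norm_num at this

lemma zCoord_p_q (kd : Kind) (z w : ℂ) : zCoord kd (pCoord kd z w) (qCoord kd z w) = z := by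
  cases kd
  · rfl
  · simp only [pCoord, zCoord, qCoord]
    field_simp [sqrt_two_ne_zero]
    rw [sqrt_two_sq]
    linear_combination (-z) * Complex.I_sq

lemma wCoord_p_q (kd : Kind) (z w : ℂ) : wCoord kd (pCoord kd z w) (qCoord kd z w) = w := by
  cases kd
  · rfl
  · simp only [pCoord, wCoord, qCoord]
    field_simp [sqrt_two_ne_zero, Complex.I_ne_zero]
    rw [sqrt_two_sq]
    linear_combination z * Complex.I_sq

lemma pCoord_add (kd : Kind) (z w z' w' : ℂ) :
    pCoord kd (z + z') (w + w') = pCoord kd z w + pCoord kd z' w' := by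
  cases kd
  · rfl
  · simp only [pCoord]; ring

lemma qCoord_add (kd : Kind) (z w z' w' : ℂ) :
    qCoord kd (z + z') (w + w') = qCoord kd z w + qCoord kd z' w' := by
  cases kd
  · rfl
  · simp only [qCoord]; ring

lemma pCoord_mul (kd : Kind) (c z w : ℂ) : pCoord kd (c * z) (c * w) = c * pCoord kd z w := by
  cases kd
  · rfl
  · simp only [pCoord]; ring

lemma qCoord_mul (kd : Kind) (c z w : ℂ) : qCoord kd (c * z) (c * w) = c * qCoord kd z w := by
  cases kd
  · rfl
  · simp only [qCoord]; ring

/-- `dp ∧ dq = dz ∧ dw`. -/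
lemma symplectic_p_q (kd : Kind) (z w z' w' : ℂ) :
    pCoord kd z w * qCoord kd z' w' - qCoord kd z w * pCoord kd z' w' = z * w' - w * z' := by
  cases kd
  · rfl
  · simp only [pCoord, qCoord]
    field_simp [sqrt_two_ne_zero]
    rw [sqrt_two_sq]
    linear_combination (w * z' - z * w') * Complex.I_sq

/-- The factor `c` in `J = c z w`. -/
noncomputable def actionFactor : Kind → ℂ
  | .hyperbolic => 1
  | .elliptic => Complex.I

lemma action_p_q (kd : Kind) (z w : ℂ) :
    action kd (pCoord kd z w) (qCoord kd z w) = actionFactor kd * (z * w) := by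
  cases kd
  · simp [action, pCoord, qCoord, actionFactor]
  · simp only [action, pCoord, qCoord, actionFactor]
    field_simp [sqrt_two_ne_zero]
    rw [sqrt_two_sq]
    linear_combination (z ^ 2 + w ^ 2) * Complex.I_sq

lemma norm_actionFactor (kd : Kind) : ‖actionFactor kd‖ = 1 := by
  cases kd <;> simp [actionFactor]

/-- Complex conjugation of `(p, q)`, in the coordinates `(z, w)`. -/
noncomputable def conjZ : Kind → ℂ → ℂ → ℂ
  | .hyperbolic, z, _ => star z
  | .elliptic, _, w => -Complex.I * star w

/-- Complex conjugation of `(p, q)`, in the coordinates `(z, w)`. -/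
noncomputable def conjW : Kind → ℂ → ℂ → ℂ
  | .hyperbolic, _, w => star w
  | .elliptic, z, _ => -Complex.I * star z

lemma pCoord_conj (kd : Kind) (z w : ℂ) :
    pCoord kd (conjZ kd z w) (conjW kd z w) = star (pCoord kd z w) := by
  cases kd
  · rfl
  · simp only [pCoord, conjZ, conjW, star_div₀, star_add, star_mul', Complex.star_def,
      Complex.conj_I, Complex.conj_ofReal]
    congr 1
    linear_combination (-(starRingEnd ℂ) z) * Complex.I_sq

lemma qCoord_conj (kd : Kind) (z w : ℂ) :
    qCoord kd (conjZ kd z w) (conjW kd z w) = star (qCoord kd z w) := by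
  cases kd
  · rfl
  · simp only [qCoord, conjZ, conjW, star_div₀, star_add, star_mul', Complex.star_def,
      Complex.conj_I, Complex.conj_ofReal]
    congr 1
    linear_combination (-(starRingEnd ℂ) w) * Complex.I_sq

end Coordinates

/-- Phase space in the coordinates `(I, φ, z, w)`, with the `1`-norm on the actions. -/
abbrev Esp (ι : Type) (m : ℕ) : Type :=
  PiLp 1 (fun _ : ι => ℂ) × (ι → ℂ) × (Fin m → ℂ) × (Fin m → ℂ)

/-- Domains and losses of domain. -/
structure Scales (ι : Type) where
  kd : Kind
  A : Set (ι → ℝ)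
  r : ℝ
  s : ℝ
  ε : ℝ
  r' : ℝ
  s' : ℝ
  ε' : ℝ
  hr : 0 < r'
  hs : 0 < s'
  hε : 0 < ε'

namespace Scales

variable {ι : Type} [Fintype ι] {m : ℕ} (P : Scales ι)

lemma r_ne : (P.r' : ℂ) ≠ 0 := Complex.ofReal_ne_zero.2 P.hr.ne'
lemma s_ne : (P.s' : ℂ) ≠ 0 := Complex.ofReal_ne_zero.2 P.hs.ne'
lemma ε_ne : (P.ε' : ℂ) ≠ 0 := Complex.ofReal_ne_zero.2 P.hε.ne'

/-- `δ = min(r' s', ε'²)`. -/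
def δ : ℝ := min (P.r' * P.s') (P.ε' ^ 2)

lemma δ_pos : 0 < P.δ := lt_min (mul_pos P.hr P.hs) (pow_pos P.hε 2)

/-- The rescaled coordinates, as a linear map. -/
noncomputable def chartLinear : Esp ι m ≃ₗ[ℂ] Phase ι m where
  toFun x := (fun i => P.r' * x.1 i, fun i => P.s' * x.2.1 i,
    fun j => pCoord P.kd (P.ε' * x.2.2.1 j) (P.ε' * x.2.2.2 j),
    fun j => qCoord P.kd (P.ε' * x.2.2.1 j) (P.ε' * x.2.2.2 j))
  map_add' x y := by
    refine Prod.ext ?_ (Prod.ext ?_ (Prod.ext ?_ ?_)) <;> funext i <;>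
      simp [mul_add, pCoord_add, qCoord_add]
  map_smul' c x := by
    refine Prod.ext ?_ (Prod.ext ?_ (Prod.ext ?_ ?_)) <;> funext i <;>
      simp [mul_left_comm _ c, pCoord_mul, qCoord_mul]
  invFun y := (WithLp.toLp 1 fun i => (P.r' : ℂ)⁻¹ * y.1 i, fun i => (P.s' : ℂ)⁻¹ * y.2.1 i,
    fun j => (P.ε' : ℂ)⁻¹ * zCoord P.kd (y.2.2.1 j) (y.2.2.2 j),
    fun j => (P.ε' : ℂ)⁻¹ * wCoord P.kd (y.2.2.1 j) (y.2.2.2 j))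
  left_inv x := by
    refine Prod.ext ?_ (Prod.ext ?_ (Prod.ext ?_ ?_)) <;> [ext i; funext i; funext i; funext i] <;>
      simp [zCoord_p_q, wCoord_p_q, P.r_ne, P.s_ne, P.ε_ne]
  right_inv y := by
    refine Prod.ext ?_ (Prod.ext ?_ (Prod.ext ?_ ?_)) <;> funext i <;>
      simp [pCoord_z_w, qCoord_z_w, P.r_ne, P.s_ne, mul_inv_cancel_left₀ P.ε_ne]

/-- The rescaled coordinates. -/
noncomputable def chart : Esp ι m ≃L[ℂ] Phase ι m := P.chartLinear.toContinuousLinearEquiv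

lemma chart_apply (x : Esp ι m) : P.chart x = (fun i => P.r' * x.1 i, fun i => P.s' * x.2.1 i,
    fun j => pCoord P.kd (P.ε' * x.2.2.1 j) (P.ε' * x.2.2.2 j),
    fun j => qCoord P.kd (P.ε' * x.2.2.1 j) (P.ε' * x.2.2.2 j)) := rfl

lemma chart_symm_apply (y : Phase ι m) : P.chart.symm y =
    (WithLp.toLp 1 fun i => (P.r' : ℂ)⁻¹ * y.1 i, fun i => (P.s' : ℂ)⁻¹ * y.2.1 i,
    fun j => (P.ε' : ℂ)⁻¹ * zCoord P.kd (y.2.2.1 j) (y.2.2.2 j),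
    fun j => (P.ε' : ℂ)⁻¹ * wCoord P.kd (y.2.2.1 j) (y.2.2.2 j)) := rfl

/-- The domain `W_{r - t r', s - t s', ε - t ε'}`. -/
def phaseDom (m : ℕ) (t : ℝ) : Set (Phase ι m) :=
  domain P.kd P.A (P.r - t * P.r') (P.s - t * P.s') (P.ε - t * P.ε')

/-- The domain `W_{r - t r', s - t s', ε - t ε'}` in rescaled coordinates. -/
def dom (m : ℕ) (t : ℝ) : Set (Esp ι m) := {x | P.chart x ∈ P.phaseDom m t}

lemma mem_dom_iff {t : ℝ} {x : Esp ι m} : x ∈ P.dom m t ↔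
    (∃ a ∈ P.A, ∑ i, ‖P.r' * x.1 i - (a i : ℂ)‖ < P.r - t * P.r') ∧
    (∀ i, |(P.s' * x.2.1 i).im| < P.s - t * P.s') ∧
    ∀ j, ‖P.ε' * x.2.2.1 j‖ < P.ε - t * P.ε' ∧ ‖P.ε' * x.2.2.2 j‖ < P.ε - t * P.ε' := by
  simp only [dom, phaseDom, domain, nbhd, polyball, Set.mem_ofPred_eq, chart_apply, zCoord_p_q,
    wCoord_p_q]

lemma isOpen_dom (t : ℝ) : IsOpen (P.dom m t) := by
  have h : P.dom m t = (⋃ a ∈ P.A, {x : Esp ι m | ∑ i, ‖P.r' * x.1 i - (a i : ℂ)‖ < P.r - t * P.r'}) ∩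
      ((⋂ i, {x : Esp ι m | |(P.s' * x.2.1 i).im| < P.s - t * P.s'}) ∩
      ⋂ j, {x : Esp ι m | ‖P.ε' * x.2.2.1 j‖ < P.ε - t * P.ε'} ∩
        {x : Esp ι m | ‖P.ε' * x.2.2.2 j‖ < P.ε - t * P.ε'})
      := by
    ext x
    simp only [mem_dom_iff, mem_inter_iff, mem_iUnion, mem_iInter, Set.mem_ofPred_eq, exists_prop]
  rw [h]
  refine (isOpen_biUnion fun a _ => isOpen_lt (by fun_prop) continuous_const).inter
    ((isOpen_iInter_of_finite fun i => isOpen_lt ?_ continuous_const).inter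
    (isOpen_iInter_of_finite fun j => (isOpen_lt (by fun_prop) continuous_const).inter
      (isOpen_lt (by fun_prop) continuous_const)))
  exact (Complex.continuous_im.comp (by fun_prop)).abs

lemma isOpen_phaseDom (t : ℝ) : IsOpen (P.phaseDom m t) := by
  have h : P.phaseDom m t = P.chart.symm ⁻¹' P.dom m t := by
    ext y; simp [dom]
  rw [h]
  exact (P.isOpen_dom t).preimage P.chart.symm.continuous

/-- The purpose of the rescaling: one unit of distance is one unit of each of the losses `r'`, `s'`,
`ε'`, and the `1`-norm of the actions matches the definition of `A_r`. -/
lemma ball_subset_dom {a t : ℝ} {x : Esp ι m} (hx : x ∈ P.dom m t) :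
    ball x (t - a) ⊆ P.dom m a := by
  intro y hy
  have hr := P.hr
  have hs := P.hs
  have hε := P.hε
  rw [mem_ball, dist_eq_norm] at hy
  rw [mem_dom_iff] at hx ⊢
  obtain ⟨⟨c, hc, hxI⟩, hxφ, hxz⟩ := hx
  have h1 : ∑ i, ‖y.1 i - x.1 i‖ < t - a := by
    refine lt_of_le_of_lt ?_ ((norm_fst_le (y - x)).trans_lt hy)
    rw [PiLp.norm_eq_of_L1]
    exact le_of_eq rfl
  have h2 : ∀ i, ‖y.2.1 i - x.2.1 i‖ < t - a := fun i =>
    ((norm_le_pi_norm (y.2.1 - x.2.1) i).trans ((norm_fst_le (y.2 - x.2)).trans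
      (norm_snd_le (y - x)))).trans_lt hy
  have h3 : ∀ i, ‖y.2.2.1 i - x.2.2.1 i‖ < t - a := fun i =>
    ((norm_le_pi_norm (y.2.2.1 - x.2.2.1) i).trans ((norm_fst_le (y.2.2 - x.2.2)).trans
      ((norm_snd_le (y.2 - x.2)).trans (norm_snd_le (y - x))))).trans_lt hy
  have h4 : ∀ i, ‖y.2.2.2 i - x.2.2.2 i‖ < t - a := fun i =>
    ((norm_le_pi_norm (y.2.2.2 - x.2.2.2) i).trans ((norm_snd_le (y.2.2 - x.2.2)).trans
      ((norm_snd_le (y.2 - x.2)).trans (norm_snd_le (y - x))))).trans_lt hy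
  have key : ∀ (ρ e : ℝ) (u v : ℂ), 0 < ρ → ‖v - u‖ < t - a → ‖ρ * u‖ < e - t * ρ →
      ‖ρ * v‖ < e - a * ρ := by
    intro ρ e u v hρ h5 h6
    have e1 : (ρ : ℂ) * v = ρ * u + ρ * (v - u) := by ring
    have e2 : ‖(ρ : ℂ) * (v - u)‖ = ρ * ‖v - u‖ := by
      rw [norm_mul, Complex.norm_real, Real.norm_of_nonneg hρ.le]
    have := mul_lt_mul_of_pos_left h5 hρ
    rw [e1]
    refine (norm_add_le _ _).trans_lt ?_
    rw [e2]
    linarith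
  refine ⟨⟨c, hc, ?_⟩, fun i => ?_, fun j => ⟨key _ _ _ _ hε (h3 j) (hxz j).1,
    key _ _ _ _ hε (h4 j) (hxz j).2⟩⟩
  · calc ∑ i, ‖P.r' * y.1 i - (c i : ℂ)‖
        ≤ ∑ i, (‖P.r' * x.1 i - (c i : ℂ)‖ + P.r' * ‖y.1 i - x.1 i‖) := by
          refine Finset.sum_le_sum fun i _ => ?_
          have e1 : (P.r' : ℂ) * y.1 i - c i = (P.r' * x.1 i - c i) + P.r' * (y.1 i - x.1 i) := by
            ring
          rw [e1]
          refine (norm_add_le _ _).trans ?_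
          rw [norm_mul, Complex.norm_real, Real.norm_of_nonneg hr.le]
      _ < P.r - a * P.r' := by
          rw [Finset.sum_add_distrib, ← Finset.mul_sum]
          have := mul_lt_mul_of_pos_left h1 hr
          linarith
  · have e1 : (P.s' * y.2.1 i).im = (P.s' * x.2.1 i).im + P.s' * (y.2.1 i - x.2.1 i).im := by
      simp; ring
    have e2 := (Complex.abs_im_le_norm (y.2.1 i - x.2.1 i)).trans_lt (h2 i)
    have e3 := mul_lt_mul_of_pos_left e2 hs
    rw [e1]
    refine (abs_add_le _ _).trans_lt ?_
    rw [abs_mul, abs_of_pos hs]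
    linarith [hxφ i]

end Scales

end Averaging

/-! ### Poisson tensor, torus action and conjugation in rescaled coordinates. -/

namespace Averaging

/-- The dual of the sup norm is the `ℓ¹` norm: test on a vector of coefficients of modulus at most
one that align the values. -/
lemma sum_norm_apply_single_le {ι : Type*} [Fintype ι] [DecidableEq ι] (ℓ : (ι → ℂ) →L[ℂ] ℂ) :
    ∑ i, ‖ℓ (Pi.single i 1)‖ ≤ ‖ℓ‖ := by
  have hc : ∀ a : ℂ, ∃ c : ℂ, ‖c‖ ≤ 1 ∧ c * a = ‖a‖ := by
    intro a
    by_cases h : a = 0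
    · exact ⟨0, by simp, by simp [h]⟩
    · have h' : (‖a‖ : ℂ) ≠ 0 := by simpa using h
      refine ⟨star a / ‖a‖, ?_, ?_⟩
      · rw [norm_div, norm_star, Complex.norm_real, norm_norm, div_self (norm_ne_zero_iff.2 h)]
      · rw [div_mul_eq_mul_div, Complex.star_def, Complex.conj_mul', div_eq_iff h', sq]
  choose c hc1 hc2 using fun i => hc (ℓ (Pi.single i 1))
  have h1 : ℓ c = ((∑ i, ‖ℓ (Pi.single i 1)‖ : ℝ) : ℂ) := by
    conv_lhs => rw [← Finset.univ_sum_single c]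
    rw [map_sum, Complex.ofReal_sum]
    refine Finset.sum_congr rfl fun i _ => ?_
    rw [← hc2 i, ← smul_eq_mul (c i), ← map_smul, ← Pi.single_smul, smul_eq_mul, mul_one]
  have h2 := ℓ.le_opNorm_of_le ((pi_norm_le_iff_of_nonneg zero_le_one).2 hc1)
  rw [h1, Complex.norm_real, mul_one] at h2
  exact (le_abs_self _).trans h2

namespace Scales

variable {ι : Type} [Fintype ι] [DecidableEq ι] {m : ℕ} (P : Scales ι)

/-- Unit vector in the direction of `I_i`. -/
def eI (m : ℕ) (i : ι) : Esp ι m := (WithLp.toLp 1 (Pi.single i 1), 0, 0, 0)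
/-- Unit vector in the direction of `φ_i`. -/
def eφ (m : ℕ) (i : ι) : Esp ι m := (0, Pi.single i 1, 0, 0)
/-- Unit vector in the direction of `z_j`. -/
def ez (ι : Type) {m : ℕ} (j : Fin m) : Esp ι m := (0, 0, Pi.single j 1, 0)
/-- Unit vector in the direction of `w_j`. -/
def ew (ι : Type) {m : ℕ} (j : Fin m) : Esp ι m := (0, 0, 0, Pi.single j 1)

lemma eq_sum_basis (v : Esp ι m) : v = ∑ i, v.1 i • eI m i + ∑ i, v.2.1 i • eφ m i +
    (∑ j, v.2.2.1 j • ez ι j + ∑ j, v.2.2.2 j • ew ι j) := by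
  refine Prod.ext ?_ (Prod.ext ?_ (Prod.ext ?_ ?_)) <;> [ext i; funext i; funext i; funext i] <;>
    simp [Prod.fst_sum, Prod.snd_sum, eI, eφ, ez, ew, Finset.sum_apply, Pi.single_apply,
      WithLp.ofLp_sum]

lemma apply_eq_sum (ℓ : Esp ι m →L[ℂ] ℂ) (v : Esp ι m) :
    ℓ v = ∑ i, v.1 i * ℓ (eI m i) + ∑ i, v.2.1 i * ℓ (eφ m i) +
      (∑ j, v.2.2.1 j * ℓ (ez ι j) + ∑ j, v.2.2.2 j * ℓ (ew ι j)) := by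
  conv_lhs => rw [eq_sum_basis v]
  simp only [map_add, map_sum, map_smul, smul_eq_mul]

/-- The Poisson tensor in rescaled coordinates. -/
noncomputable def Jmap : (Esp ι m →L[ℂ] ℂ) →L[ℂ] Esp ι m :=
  LinearMap.toContinuousLinearMap
    { toFun := fun ℓ => (WithLp.toLp 1 fun i => (P.r' * P.s' : ℂ)⁻¹ * ℓ (eφ m i),
        fun i => -((P.r' * P.s' : ℂ)⁻¹ * ℓ (eI m i)),
        fun j => (P.ε' ^ 2 : ℂ)⁻¹ * ℓ (ew ι j), fun j => -((P.ε' ^ 2 : ℂ)⁻¹ * ℓ (ez ι j)))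
      map_add' := fun ℓ ℓ' => by
        refine Prod.ext ?_ (Prod.ext ?_ (Prod.ext ?_ ?_)) <;>
          [ext i; funext i; funext i; funext i] <;> simp <;> ring
      map_smul' := fun c ℓ => by
        refine Prod.ext ?_ (Prod.ext ?_ (Prod.ext ?_ ?_)) <;>
          [ext i; funext i; funext i; funext i] <;> simp <;> ring }

lemma Jmap_apply (ℓ : Esp ι m →L[ℂ] ℂ) : P.Jmap ℓ =
    (WithLp.toLp 1 fun i => (P.r' * P.s' : ℂ)⁻¹ * ℓ (eφ m i),
      fun i => -((P.r' * P.s' : ℂ)⁻¹ * ℓ (eI m i)),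
      fun j => (P.ε' ^ 2 : ℂ)⁻¹ * ℓ (ew ι j), fun j => -((P.ε' ^ 2 : ℂ)⁻¹ * ℓ (ez ι j))) := rfl

lemma norm_eI (i : ι) : ‖eI m i‖ ≤ 1 := by
  simp [eI, Prod.norm_def]

lemma norm_ez (j : Fin m) : ‖ez ι j‖ ≤ 1 := by
  simp [ez, Prod.norm_def, Pi.norm_single]

lemma norm_ew (j : Fin m) : ‖ew ι j‖ ≤ 1 := by
  simp [ew, Prod.norm_def, Pi.norm_single]

lemma sum_norm_apply_eφ_le (ℓ : Esp ι m →L[ℂ] ℂ) : ∑ i, ‖ℓ (eφ m i)‖ ≤ ‖ℓ‖ := by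
  set j : (ι → ℂ) →L[ℂ] Esp ι m := (ContinuousLinearMap.inr ℂ _ _).comp
    (ContinuousLinearMap.inl ℂ _ _)
  have hj : ‖j‖ ≤ 1 := by
    refine ContinuousLinearMap.opNorm_le_bound _ zero_le_one fun x => ?_
    simp [j, Prod.norm_def]
  refine (sum_norm_apply_single_le (ℓ.comp j)).trans ((ℓ.opNorm_comp_le j).trans ?_)
  exact mul_le_of_le_one_right (norm_nonneg _) hj

lemma norm_rs : ‖(P.r' * P.s' : ℂ)⁻¹‖ = (P.r' * P.s')⁻¹ := by
  rw [norm_inv, norm_mul, Complex.norm_real, Complex.norm_real, Real.norm_of_nonneg P.hr.le,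
    Real.norm_of_nonneg P.hs.le]

lemma norm_εε : ‖(P.ε' ^ 2 : ℂ)⁻¹‖ = (P.ε' ^ 2)⁻¹ := by
  rw [norm_inv, norm_pow, Complex.norm_real, Real.norm_of_nonneg P.hε.le]

lemma rs_inv_le : (P.r' * P.s')⁻¹ ≤ P.δ⁻¹ := inv_anti₀ P.δ_pos (min_le_left _ _)

lemma εε_inv_le : (P.ε' ^ 2)⁻¹ ≤ P.δ⁻¹ := inv_anti₀ P.δ_pos (min_le_right _ _)

/-- The actions carry the `1`-norm and receive the angle derivatives, which are summable in the dual
of the sup norm; hence no factor depends on the number of degrees of freedom. -/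
lemma norm_Jmap_le (ℓ : Esp ι m →L[ℂ] ℂ) : ‖P.Jmap ℓ‖ ≤ P.δ⁻¹ * ‖ℓ‖ := by
  have hδ := inv_nonneg.2 P.δ_pos.le
  have hr := P.hr
  have hs := P.hs
  have h0 : 0 ≤ P.δ⁻¹ * ‖ℓ‖ := by positivity
  have h1 := P.rs_inv_le
  have h2 := P.εε_inv_le
  have key : ∀ v : Esp ι m, ‖v‖ ≤ 1 → ‖ℓ v‖ ≤ ‖ℓ‖ := fun v hv => by
    simpa using ℓ.le_opNorm_of_le hv
  rw [Jmap_apply, Prod.norm_def, Prod.norm_def, Prod.norm_def]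
  refine max_le ?_ (max_le ?_ (max_le ?_ ?_))
  · rw [PiLp.norm_eq_of_L1]
    simp only [norm_mul, P.norm_rs, ← Finset.mul_sum]
    have := sum_norm_apply_eφ_le ℓ
    gcongr
  · refine (pi_norm_le_iff_of_nonneg h0).2 fun i => ?_
    rw [norm_neg, norm_mul, P.norm_rs]
    have := key _ (norm_eI i)
    gcongr
  · refine (pi_norm_le_iff_of_nonneg h0).2 fun i => ?_
    rw [norm_mul, P.norm_εε]
    have := key _ (norm_ew i)
    gcongr
  · refine (pi_norm_le_iff_of_nonneg h0).2 fun i => ?_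
    rw [norm_neg, norm_mul, P.norm_εε]
    have := key _ (norm_ez i)
    gcongr

/-- The symplectic form in rescaled coordinates. -/
noncomputable def form : Esp ι m →L[ℂ] Esp ι m →L[ℂ] ℂ :=
  LinearMap.toContinuousLinearMap
    ((LinearMap.toContinuousLinearMap : (Esp ι m →ₗ[ℂ] ℂ) ≃ₗ[ℂ] (Esp ι m →L[ℂ] ℂ)).toLinearMap ∘ₗ
      LinearMap.mk₂ ℂ (fun u v : Esp ι m => (P.r' * P.s' : ℂ) *
        ∑ i, (u.1 i * v.2.1 i - u.2.1 i * v.1 i) + (P.ε' ^ 2 : ℂ) *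
        ∑ j, (u.2.2.1 j * v.2.2.2 j - u.2.2.2 j * v.2.2.1 j))
      (fun u u' v => by
        simp only [Finset.mul_sum]
        rw [add_add_add_comm, ← Finset.sum_add_distrib, ← Finset.sum_add_distrib]
        congr 1 <;> refine Finset.sum_congr rfl fun i _ => ?_ <;> simp <;> ring)
      (fun c u v => by
        simp only [Finset.mul_sum, smul_eq_mul, mul_add]
        congr 1 <;> refine Finset.sum_congr rfl fun i _ => ?_ <;> simp <;> ring)
      (fun u v v' => by
        simp only [Finset.mul_sum]
        rw [add_add_add_comm, ← Finset.sum_add_distrib, ← Finset.sum_add_distrib]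
        congr 1 <;> refine Finset.sum_congr rfl fun i _ => ?_ <;> simp <;> ring)
      (fun c u v => by
        simp only [Finset.mul_sum, smul_eq_mul, mul_add]
        congr 1 <;> refine Finset.sum_congr rfl fun i _ => ?_ <;> simp <;> ring))

lemma form_apply (u v : Esp ι m) : P.form u v = (P.r' * P.s' : ℂ) *
    ∑ i, (u.1 i * v.2.1 i - u.2.1 i * v.1 i) + (P.ε' ^ 2 : ℂ) *
    ∑ j, (u.2.2.1 j * v.2.2.2 j - u.2.2.2 j * v.2.2.1 j) := rfl

lemma form_eq (u v : Esp ι m) : P.form u v = symplForm (P.chart u) (P.chart v) := by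
  rw [form_apply, symplForm, Finset.mul_sum, Finset.mul_sum, chart_apply, chart_apply]
  congr 1 <;> refine Finset.sum_congr rfl fun i _ => ?_
  · ring
  · rw [symplectic_p_q]; ring

lemma form_anti (u v : Esp ι m) : P.form u v = -P.form v u := by
  rw [form_apply, form_apply, neg_add, ← mul_neg, ← mul_neg, ← Finset.sum_neg_distrib,
    ← Finset.sum_neg_distrib]
  congr 2 <;> refine Finset.sum_congr rfl fun i _ => ?_ <;> ring

lemma form_Jmap (ℓ : Esp ι m →L[ℂ] ℂ) (v : Esp ι m) : P.form (P.Jmap ℓ) v = ℓ v := by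
  have h1 := P.r_ne
  have h2 := P.s_ne
  have h3 := P.ε_ne
  rw [apply_eq_sum ℓ v, form_apply, Jmap_apply, Finset.mul_sum, Finset.mul_sum,
    ← Finset.sum_add_distrib, ← Finset.sum_add_distrib]
  congr 1 <;> refine Finset.sum_congr rfl fun i _ => ?_
  · field_simp; ring
  · field_simp; ring

/-- The complexified torus action: translation of the angles by `θ` and rotation of the pairs
`(z_j, w_j)` by `ψ_j`. -/
noncomputable def rotLin (ψ : Fin m → ℂ) : Esp ι m →L[ℂ] Esp ι m :=
  LinearMap.toContinuousLinearMap
    { toFun := fun x => (x.1, x.2.1, fun j => Complex.exp (-(Complex.I * ψ j)) * x.2.2.1 j,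
        fun j => Complex.exp (Complex.I * ψ j) * x.2.2.2 j)
      map_add' := fun x y => by
        refine Prod.ext ?_ (Prod.ext ?_ (Prod.ext ?_ ?_)) <;>
          [ext i; funext i; funext i; funext i] <;> simp <;> ring
      map_smul' := fun c x => by
        refine Prod.ext ?_ (Prod.ext ?_ (Prod.ext ?_ ?_)) <;>
          [ext i; funext i; funext i; funext i] <;> simp <;> ring }

lemma rotLin_apply (ψ : Fin m → ℂ) (x : Esp ι m) : rotLin ψ x =
    (x.1, x.2.1, fun j => Complex.exp (-(Complex.I * ψ j)) * x.2.2.1 j,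
        fun j => Complex.exp (Complex.I * ψ j) * x.2.2.2 j) := rfl

/-- The complexified torus action: translation of the angles by `θ` and rotation of the pairs
`(z_j, w_j)` by `ψ_j`. -/
noncomputable def actC (g : (ι → ℂ) × (Fin m → ℂ)) (x : Esp ι m) : Esp ι m :=
  (x.1, fun i => x.2.1 i + (P.s' : ℂ)⁻¹ * g.1 i,
    fun j => Complex.exp (-(Complex.I * g.2 j)) * x.2.2.1 j,
    fun j => Complex.exp (Complex.I * g.2 j) * x.2.2.2 j)

lemma actC_eq (g : (ι → ℂ) × (Fin m → ℂ)) (x : Esp ι m) :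
    P.actC g x = rotLin g.2 x + (0, fun i => (P.s' : ℂ)⁻¹ * g.1 i, 0, 0) := by
  rw [rotLin_apply, actC]
  refine Prod.ext ?_ (Prod.ext ?_ (Prod.ext ?_ ?_)) <;> [ext i; funext i; funext i; funext i] <;>
    simp

lemma hasFDerivAt_actC (g : (ι → ℂ) × (Fin m → ℂ)) (x : Esp ι m) :
    HasFDerivAt (P.actC g) (rotLin g.2) x := by
  have h := ((rotLin (ι := ι) g.2).hasFDerivAt (x := x)).add_const
    ((0, fun i => (P.s' : ℂ)⁻¹ * g.1 i, 0, 0) : Esp ι m)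
  exact h.congr_of_eventuallyEq (Eventually.of_forall fun y => P.actC_eq g y)

/-- The inclusion of the real torus group in its complexification. -/
def castC (g : (ι → ℝ) × (Fin m → ℝ)) : (ι → ℂ) × (Fin m → ℂ) :=
  (fun i => (g.1 i : ℂ), fun j => (g.2 j : ℂ))

/-- The pairing of modes and of the Lie algebra of the torus. -/
noncomputable def phase (g : (ι → ℂ) × (Fin m → ℂ)) (κ : Mode ι m) : ℂ :=
  ∑ i, (κ.1 i : ℂ) * g.1 i + ∑ j, (κ.2 j : ℂ) * g.2 j

lemma phase_add (g : (ι → ℂ) × (Fin m → ℂ)) (κ κ' : Mode ι m) :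
    phase g (κ + κ') = phase g κ + phase g κ' := by
  simp only [phase, Prod.fst_add, Prod.snd_add, Pi.add_apply, Int.cast_add, add_mul,
    Finset.sum_add_distrib]
  ring

lemma actC_mem {t : ℝ} {x : Esp ι m} (g : (ι → ℝ) × (Fin m → ℝ)) (hx : x ∈ P.dom m t) :
    P.actC (castC g) x ∈ P.dom m t := by
  have h1 : ∀ ψ : ℝ, ‖Complex.exp (-(Complex.I * ψ))‖ = 1 := fun ψ => by
    rw [Complex.norm_exp]; simp
  have h2 : ∀ ψ : ℝ, ‖Complex.exp (Complex.I * ψ)‖ = 1 := fun ψ => by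
    rw [Complex.norm_exp]; simp
  rw [mem_dom_iff] at hx ⊢
  refine ⟨hx.1, fun i => ?_, fun j => ?_⟩
  · have e : ((P.s' : ℂ) * (P.actC (castC g) x).2.1 i).im = (P.s' * x.2.1 i).im := by
      simp only [actC, castC, mul_add, mul_inv_cancel_left₀ P.s_ne]
      simp
    rw [e]; exact hx.2.1 i
  · simpa only [actC, castC, norm_mul, h1, h2, one_mul] using hx.2.2 j

/-- `z_j` and `w_j` are multiplied by inverse factors, so `dz_j ∧ dw_j` is preserved. -/
lemma rotLin_Jmap (ψ : Fin m → ℂ) (ℓ : Esp ι m →L[ℂ] ℂ) :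
    rotLin ψ (P.Jmap (ℓ.comp (rotLin ψ))) = P.Jmap ℓ := by
  have hI : ∀ i : ι, rotLin ψ (eI m i) = eI m i := fun i => by
    simp [rotLin_apply, eI]; rfl
  have hφ : ∀ i : ι, rotLin ψ (eφ m i) = eφ m i := fun i => by
    simp [rotLin_apply, eφ]; rfl
  have hz : ∀ j, rotLin ψ (ez ι j) = Complex.exp (-(Complex.I * ψ j)) • ez ι j := fun j => by
    refine Prod.ext ?_ (Prod.ext ?_ (Prod.ext ?_ ?_)) <;>
      [ext i; funext i; funext i; funext i] <;> simp [rotLin_apply, ez, Pi.single_apply]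
    all_goals split_ifs with h <;> [simp only [h]; rfl]
  have hw : ∀ j, rotLin ψ (ew ι j) = Complex.exp (Complex.I * ψ j) • ew ι j := fun j => by
    refine Prod.ext ?_ (Prod.ext ?_ (Prod.ext ?_ ?_)) <;>
      [ext i; funext i; funext i; funext i] <;> simp [rotLin_apply, ew, Pi.single_apply]
    all_goals split_ifs with h <;> [simp only [h]; rfl]
  have h0 : ∀ j, Complex.exp (-(Complex.I * ψ j)) * Complex.exp (Complex.I * ψ j) = 1 := fun j => by
    rw [← Complex.exp_add]; simp
  simp only [Jmap_apply, ContinuousLinearMap.comp_apply, hI, hφ, hz, hw, rotLin_apply, map_smul,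
    smul_eq_mul]
  refine Prod.ext rfl (Prod.ext rfl (Prod.ext ?_ ?_)) <;> funext j
  · linear_combination ((P.ε' ^ 2 : ℂ)⁻¹ * ℓ (ew ι j)) * h0 j
  · linear_combination (-(P.ε' ^ 2 : ℂ)⁻¹ * ℓ (ez ι j)) * h0 j

/-- Complex conjugation in rescaled coordinates. -/
noncomputable def conjL : Esp ι m →L⋆[ℂ] Esp ι m :=
  (P.chart (m := m)).symm.toContinuousLinearMap.comp
    ((starL ℂ : Phase ι m ≃L⋆[ℂ] Phase ι m).toContinuousLinearMap.comp
      (P.chart (m := m)).toContinuousLinearMap)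

lemma chart_conjL (x : Esp ι m) : P.chart (P.conjL x) = star (P.chart x) := by
  simp [conjL]

lemma conjL_apply (x : Esp ι m) : P.conjL x = (WithLp.toLp 1 fun i => star (x.1 i),
    fun i => star (x.2.1 i), fun j => conjZ P.kd (x.2.2.1 j) (x.2.2.2 j),
    fun j => conjW P.kd (x.2.2.1 j) (x.2.2.2 j)) := by
  have hz : ∀ z w, (P.ε' : ℂ) * conjZ P.kd z w = conjZ P.kd (P.ε' * z) (P.ε' * w) := by
    intro z w
    cases P.kd <;> simp [conjZ, mul_left_comm]
  have hw : ∀ z w, (P.ε' : ℂ) * conjW P.kd z w = conjW P.kd (P.ε' * z) (P.ε' * w) := by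
    intro z w
    cases P.kd <;> simp [conjW, mul_left_comm]
  apply P.chart.injective
  rw [chart_conjL, chart_apply, chart_apply]
  simp only [hz, hw, pCoord_conj, qCoord_conj]
  refine Prod.ext ?_ (Prod.ext ?_ (Prod.ext ?_ ?_)) <;> funext i <;> simp

lemma norm_conjZ_le {z w : ℂ} {C : ℝ} (kd : Kind) (hz : ‖z‖ ≤ C) (hw : ‖w‖ ≤ C) :
    ‖conjZ kd z w‖ ≤ C := by cases kd <;> simpa [conjZ]

lemma norm_conjW_le {z w : ℂ} {C : ℝ} (kd : Kind) (hz : ‖z‖ ≤ C) (hw : ‖w‖ ≤ C) :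
    ‖conjW kd z w‖ ≤ C := by cases kd <;> simpa [conjW]

lemma norm_conjL_le (x : Esp ι m) : ‖P.conjL x‖ ≤ ‖x‖ := by
  have h1 : ‖x.1‖ ≤ ‖x‖ := norm_fst_le x
  have h2 : ‖x.2.1‖ ≤ ‖x‖ := (norm_fst_le x.2).trans (norm_snd_le x)
  have h3 : ‖x.2.2.1‖ ≤ ‖x‖ := (norm_fst_le x.2.2).trans ((norm_snd_le x.2).trans (norm_snd_le x))
  have h4 : ‖x.2.2.2‖ ≤ ‖x‖ := (norm_snd_le x.2.2).trans ((norm_snd_le x.2).trans (norm_snd_le x))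
  rw [conjL_apply, Prod.norm_def, Prod.norm_def, Prod.norm_def]
  refine max_le ?_ (max_le ?_ (max_le ?_ ?_))
  · rw [PiLp.norm_eq_of_L1] at h1 ⊢
    simpa using h1
  · refine (pi_norm_le_iff_of_nonneg (norm_nonneg _)).2 fun i => ?_
    rw [norm_star]
    exact (norm_le_pi_norm _ i).trans h2
  · exact (pi_norm_le_iff_of_nonneg (norm_nonneg _)).2 fun i =>
      norm_conjZ_le _ ((norm_le_pi_norm _ i).trans h3) ((norm_le_pi_norm _ i).trans h4)
  · exact (pi_norm_le_iff_of_nonneg (norm_nonneg _)).2 fun i =>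
      norm_conjW_le _ ((norm_le_pi_norm _ i).trans h3) ((norm_le_pi_norm _ i).trans h4)

lemma conjL_mem {t : ℝ} {x : Esp ι m} (hx : x ∈ P.dom m t) : P.conjL x ∈ P.dom m t := by
  rw [mem_dom_iff] at hx ⊢
  obtain ⟨⟨a, ha, h1⟩, h2, h3⟩ := hx
  rw [conjL_apply]
  refine ⟨⟨a, ha, ?_⟩, fun i => ?_, fun j => ?_⟩
  · refine lt_of_eq_of_lt (Finset.sum_congr rfl fun i _ => ?_) h1
    rw [← norm_star]
    simp
  · have := h2 i
    simpa using this
  · obtain ⟨h4, h5⟩ := h3 j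
    simp only [norm_mul] at h4 h5 ⊢
    cases P.kd
    · simpa only [conjZ, conjW, norm_star] using ⟨h4, h5⟩
    · simpa only [conjZ, conjW, norm_star, norm_mul, norm_neg, Complex.norm_I, one_mul] using
        ⟨h5, h4⟩

/-- The Poisson tensor has real coefficients in `(I, φ, p, q)`. In elliptic coordinates this takes a
computation, because conjugation exchanges `z` and `w` up to the factor `-i`. -/
lemma conjL_Jmap (ℓ : Esp ι m →L[ℂ] ℂ) : P.conjL (P.Jmap (conjDual P.conjL ℓ)) = P.Jmap ℓ := by
  have hJ : ∀ v, conjDual P.conjL ℓ v = star (ℓ (P.conjL v)) := fun v => rfl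
  have hI : ∀ i : ι, P.conjL (eI m i) = eI m i := fun i => by
    rw [conjL_apply]
    refine Prod.ext ?_ (Prod.ext ?_ (Prod.ext ?_ ?_)) <;>
      [ext j; funext i; funext i; funext i] <;> simp [eI, apply_ite] <;>
      cases P.kd <;> simp [conjZ, conjW]
  have hφ : ∀ i : ι, P.conjL (eφ m i) = eφ m i := fun i => by
    rw [conjL_apply]
    refine Prod.ext ?_ (Prod.ext ?_ (Prod.ext ?_ ?_)) <;>
      [ext j; funext i; funext i; funext i] <;> simp [eφ, Pi.single_apply, apply_ite] <;>
      cases P.kd <;> simp [conjZ, conjW]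
  have hrs : star ((P.r' * P.s' : ℂ)⁻¹) = (P.r' * P.s' : ℂ)⁻¹ := by simp
  have hεε : star ((P.ε' ^ 2 : ℂ)⁻¹) = (P.ε' ^ 2 : ℂ)⁻¹ := by simp
  rw [conjL_apply, Jmap_apply, Jmap_apply]
  simp only [hJ, hI, hφ]
  refine Prod.ext ?_ (Prod.ext ?_ ?_)
  · ext i
    simp only [star_mul', hrs, star_star]
  · funext i
    simp only [star_mul', star_neg, hrs, star_star]
  · cases hk : P.kd
    · have hz : ∀ j : Fin m, P.conjL (ez ι j) = ez ι j := fun j => by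
        rw [conjL_apply, hk]
        refine Prod.ext ?_ (Prod.ext ?_ (Prod.ext ?_ ?_)) <;>
          [ext i; funext i; funext i; funext i] <;>
          simp [ez, Pi.single_apply, apply_ite, conjZ, conjW]
      have hw : ∀ j : Fin m, P.conjL (ew ι j) = ew ι j := fun j => by
        rw [conjL_apply, hk]
        refine Prod.ext ?_ (Prod.ext ?_ (Prod.ext ?_ ?_)) <;>
          [ext i; funext i; funext i; funext i] <;>
          simp [ew, Pi.single_apply, apply_ite, conjZ, conjW]
      simp only [conjZ, conjW, hz, hw]
      refine Prod.ext ?_ ?_ <;> funext j <;>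
        simp only [star_mul', star_neg, hεε, star_star]
    · have hz : ∀ j : Fin m, P.conjL (ez ι j) = (-Complex.I) • ew ι j := fun j => by
        rw [conjL_apply, hk]
        refine Prod.ext ?_ (Prod.ext ?_ (Prod.ext ?_ ?_)) <;>
          [ext i; funext i; funext i; funext i] <;>
          simp [ez, ew, Pi.single_apply, apply_ite, conjZ, conjW]
      have hw : ∀ j : Fin m, P.conjL (ew ι j) = (-Complex.I) • ez ι j := fun j => by
        rw [conjL_apply, hk]
        refine Prod.ext ?_ (Prod.ext ?_ (Prod.ext ?_ ?_)) <;>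
          [ext i; funext i; funext i; funext i] <;>
          simp [ez, ew, Pi.single_apply, apply_ite, conjZ, conjW]
      simp only [conjZ, conjW, hz, hw]
      refine Prod.ext ?_ ?_ <;> funext j <;>
        simp only [star_mul', star_neg, hεε, star_star, map_smul, smul_eq_mul]
      · linear_combination (-(P.ε' ^ 2 : ℂ)⁻¹ * ℓ (ew ι j)) * Complex.I_sq
      · linear_combination ((P.ε' ^ 2 : ℂ)⁻¹ * ℓ (ez ι j)) * Complex.I_sq

/-- The involution of the modes induced by complex conjugation. -/
def conjMode (kd : Kind) (ι : Type) (m : ℕ) : Mode ι m ≃+ Mode ι m :=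
  match kd with
  | .hyperbolic => (AddEquiv.neg (ι → ℤ)).prodCongr (AddEquiv.refl (Fin m → ℤ))
  | .elliptic => AddEquiv.neg (Mode ι m)

/-- The mode system of the averaging theorem. -/
noncomputable def system (m : ℕ) : ModeSystem (Esp ι m) (Mode ι m) where
  dom := P.dom m
  isOpen_dom := P.isOpen_dom
  ball_subset := P.ball_subset_dom
  J := P.Jmap
  γ := P.δ⁻¹
  γ_nonneg := inv_nonneg.2 P.δ_pos.le
  norm_J_le := P.norm_Jmap_le
  Ω := P.form
  Ω_anti := P.form_anti
  Ω_J := P.form_Jmap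
  T := (ι → ℝ) × (Fin m → ℝ)
  act g := P.actC (castC g)
  lin g := rotLin (castC g).2
  hasFDerivAt_act g x := P.hasFDerivAt_actC (castC g) x
  act_mem := P.actC_mem _
  lin_J g ℓ := P.rotLin_Jmap _ ℓ
  char g κ := Complex.exp (Complex.I * phase (castC g) κ)
  char_add g j k := by rw [phase_add, mul_add, Complex.exp_add]
  conj := P.conjL
  norm_conj_le := P.norm_conjL_le
  conj_mem := P.conjL_mem
  conj_J := P.conjL_Jmap
  σ := conjMode P.kd ι m

end Scales

end Averaging

/-! ### Schwarz reflection on the domains. -/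

namespace Averaging

/-- Schwarz reflection along the segment that joins a point to its conjugate. -/
lemma star_apply_of_real {V : Type*} [NormedAddCommGroup V] [NormedSpace ℂ V] {c : V →L⋆[ℂ] V}
    (hc : ∀ x, c (c x) = x) {W : Set V} (hW : IsOpen W) {f : V → ℂ} (hf : DifferentiableOn ℂ f W)
    (hcW : ∀ x ∈ W, c x ∈ W) (hreal : ∀ x ∈ W, c x = x → (f x).im = 0) {x : V}
    (hseg : ∀ v ∈ Icc (-1 : ℝ) 1, (((1 + v) / 2 : ℝ) : ℂ) • x + (((1 - v) / 2 : ℝ) : ℂ) • c x ∈ W) :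
    star (f (c x)) = f x := by
  have h2 : (starRingEnd ℂ) 2⁻¹ = 2⁻¹ := by
    rw [map_inv₀]
    congr 1
    exact Complex.conj_ofNat 2
  -- Real and imaginary parts: `a` and `b` are fixed by `c`, `x = a + i b`, and real `τ` give real
  -- points `a + τ b`.
  set a : V := (2⁻¹ : ℂ) • (x + c x) with ha
  set b : V := (-(2⁻¹ : ℂ) * Complex.I) • (x - c x) with hb
  have hca : c a = a := by
    rw [ha, map_smulₛₗ, map_add, hc, add_comm (c x), h2]
  have hcb : c b = b := by
    rw [hb, map_smulₛₗ, map_sub, hc, ← neg_sub x, smul_neg, ← neg_smul, map_mul, map_neg, h2, Complex.conj_I]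
    congr 1
    ring
  have hcab : ∀ τ : ℂ, c (a + τ • b) = a + star τ • b := fun τ => by
    rw [map_add, hca, map_smulₛₗ, hcb]; rfl
  have hline : ∀ v : ℝ, a + ((v : ℂ) * Complex.I) • b =
      (((1 + v) / 2 : ℝ) : ℂ) • x + (((1 - v) / 2 : ℝ) : ℂ) • c x := by
    intro v
    have e : (v : ℂ) * Complex.I * (-(2⁻¹ : ℂ) * Complex.I) = v / 2 := by
      linear_combination (-(v : ℂ) / 2) * Complex.I_sq
    rw [ha, hb, smul_smul, e]
    push_cast
    module
  have hx : a + Complex.I • b = x := by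
    have := hline 1
    norm_num at this
    exact this
  have hcx : a + star Complex.I • b = c x := by
    rw [← hcab, hx]
  set O : Set ℂ := {τ | a + τ • b ∈ W} with hO
  have hOo : IsOpen O := hW.preimage (by fun_prop)
  have hOs : ∀ τ ∈ O, star τ ∈ O := fun τ hτ => by
    have := hcW _ hτ
    rwa [hcab] at this
  set G : ℂ → ℂ := fun τ => f (a + τ • b) with hG
  have hGd : DifferentiableOn ℂ G O := fun τ hτ =>
    ((hf.differentiableAt (hW.mem_nhds hτ)).comp τ (by fun_prop)).differentiableWithinAt
  have hGs : DifferentiableOn ℂ (fun τ => star (G (star τ))) O := fun τ hτ => by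
    have h1 := (hGd.differentiableAt (hOo.mem_nhds (hOs τ hτ))).hasFDerivAt
    exact (hasFDerivAt_conj (c := ((starL ℂ : ℂ ≃L⋆[ℂ] ℂ) : ℂ →L⋆[ℂ] ℂ))
      h1).differentiableAt.differentiableWithinAt
  -- The imaginary segment from `-i` to `i` parametrizes the segment from `c x` to `x`. It is
  -- connected and contains `0`, near which the two functions agree on the real axis; the identity
  -- theorem carries this to `i`.
  set Z : Set ℂ := (fun v : ℝ => (v : ℂ) * Complex.I) '' Icc (-1) 1 with hZ
  have hZO : Z ⊆ O := by
    rintro _ ⟨v, hv, rfl⟩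
    change a + ((v : ℂ) * Complex.I) • b ∈ W
    rw [hline]
    exact hseg v hv
  have hZc : IsPreconnected Z := isPreconnected_Icc.image _ (by fun_prop)
  have h0 : (0 : ℂ) ∈ Z := ⟨0, by norm_num, by simp⟩
  have hfreq : ∃ᶠ z in 𝓝[≠] (0 : ℂ), G z = star (G (star z)) := by
    have ht : Tendsto (fun t : ℝ => (t : ℂ)) (𝓝[≠] 0) (𝓝[≠] 0) := by
      refine tendsto_nhdsWithin_iff.2 ⟨?_, ?_⟩
      · exact (Complex.continuous_ofReal.tendsto' 0 0 rfl).mono_left nhdsWithin_le_nhds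
      · filter_upwards [self_mem_nhdsWithin] with t ht using Complex.ofReal_ne_zero.2 ht
    refine ht.frequently (Eventually.frequently ?_)
    have h1 : ∀ᶠ z in 𝓝[≠] (0 : ℂ), z ∈ O := nhdsWithin_le_nhds (hOo.mem_nhds (hZO h0))
    filter_upwards [ht.eventually h1] with t htO
    have hst : star (t : ℂ) = t := Complex.conj_ofReal t
    rw [hst]
    refine (Complex.conj_eq_iff_im.2 (hreal _ htO ?_)).symm
    rw [hcab, hst]
  have key := AnalyticOnNhd.eqOn_of_preconnected_of_frequently_eq
    ((hGd.analyticOnNhd hOo).mono hZO) ((hGs.analyticOnNhd hOo).mono hZO) hZc h0 hfreq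
  have h1 := key (show Complex.I ∈ Z from ⟨1, by norm_num, by simp⟩)
  simp only [hG, hx, hcx] at h1
  exact h1.symm

namespace Scales

variable {ι : Type} [Fintype ι] [DecidableEq ι] {m : ℕ} (P : Scales ι)

lemma conjL_conjL (x : Esp ι m) : P.conjL (P.conjL x) = x := by
  apply P.chart.injective
  rw [chart_conjL, chart_conjL, star_star]

lemma norm_convex_lt {a b C : ℝ} {u v w : ℂ} (ha : 0 ≤ a) (hb : 0 ≤ b) (hab : a + b = 1)
    (hu : ‖u - w‖ < C) (hv : ‖v - w‖ < C) : ‖(a : ℂ) * u + (b : ℂ) * v - w‖ < C := by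
  have h := (convex_ball w C) (mem_ball_iff_norm.2 hu) (mem_ball_iff_norm.2 hv) ha hb hab
  rw [mem_ball_iff_norm] at h
  simpa using h

lemma sum_norm_convex_lt {a b C : ℝ} {u v w : ι → ℂ} (ha : 0 ≤ a) (hb : 0 ≤ b) (hab : a + b = 1)
    (hu : ∑ i, ‖u i - w i‖ < C) (hv : ∑ i, ‖v i - w i‖ < C) :
    ∑ i, ‖(a : ℂ) * u i + (b : ℂ) * v i - w i‖ < C := by
  have h1 : ∑ i, ‖(a : ℂ) * u i + (b : ℂ) * v i - w i‖ ≤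
      a * ∑ i, ‖u i - w i‖ + b * ∑ i, ‖v i - w i‖ := by
    rw [Finset.mul_sum, Finset.mul_sum, ← Finset.sum_add_distrib]
    refine Finset.sum_le_sum fun i _ => ?_
    have e : (a : ℂ) * u i + (b : ℂ) * v i - w i = a * (u i - w i) + b * (v i - w i) := by
      have : (a : ℂ) + b = 1 := by exact_mod_cast hab
      linear_combination (w i) * this
    rw [e]
    refine (norm_add_le _ _).trans (le_of_eq ?_)
    rw [norm_mul, norm_mul, Complex.norm_real, Complex.norm_real, Real.norm_of_nonneg ha,
      Real.norm_of_nonneg hb]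
  refine h1.trans_lt ?_
  rcases ha.eq_or_lt with rfl | ha
  · have : b = 1 := by linarith
    subst this; linarith
  · have h2 := mul_lt_mul_of_pos_left hu ha
    have h3 := mul_le_mul_of_nonneg_left hv.le hb
    have h4 : a * C + b * C = C := by rw [← add_mul, hab, one_mul]
    linarith

/-- The centre of a ball in `A_r` is real, so a point and its conjugate lie in the same convex piece
of the domain and reflection applies along the segment between them. -/
lemma star_comp_chart {f : Phase ι m → ℂ} {t : ℝ} (hf : DifferentiableOn ℂ f (P.phaseDom m t))
    (hreal : ∀ x ∈ P.phaseDom m t, IsRealPoint x → (f x).im = 0) {x : Esp ι m}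
    (hx : x ∈ P.dom m t) : star (f (P.chart (P.conjL x))) = f (P.chart x) := by
  refine star_apply_of_real (f := fun x => f (P.chart x)) P.conjL_conjL (P.isOpen_dom t)
    (hf.comp P.chart.differentiable.differentiableOn fun y hy => hy) (fun y hy => P.conjL_mem hy)
    (fun y hy hc => ?_) fun v hv => ?_
  · refine hreal _ hy ?_
    have h := P.chart_conjL y
    rw [hc] at h
    have hre : ∀ a : ℂ, a = star a → a.im = 0 := fun a ha => Complex.conj_eq_iff_im.1 ha.symm
    refine ⟨fun i => hre _ ?_, fun i => hre _ ?_, fun i => hre _ ?_, fun i => hre _ ?_⟩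
    · exact congrArg (fun y : Phase ι m => y.1 i) h
    · exact congrArg (fun y : Phase ι m => y.2.1 i) h
    · exact congrArg (fun y : Phase ι m => y.2.2.1 i) h
    · exact congrArg (fun y : Phase ι m => y.2.2.2 i) h
  · have hα : 0 ≤ (1 + v) / 2 := by linarith [hv.1]
    have hβ : 0 ≤ (1 - v) / 2 := by linarith [hv.2]
    have hαβ : (1 + v) / 2 + (1 - v) / 2 = 1 := by ring
    set α := (1 + v) / 2
    set β := (1 - v) / 2
    have hy := P.conjL_mem hx
    obtain ⟨⟨a, ha, h1⟩, h2, h3⟩ := P.mem_dom_iff.1 hx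
    obtain ⟨-, h5, h6⟩ := P.mem_dom_iff.1 hy
    have h4 : ∑ i, ‖P.r' * (P.conjL x).1 i - (a i : ℂ)‖ < P.r - t * P.r' := by
      refine lt_of_eq_of_lt (Finset.sum_congr rfl fun i _ => ?_) h1
      rw [conjL_apply, ← norm_star]
      simp
    set y := P.conjL x
    refine P.mem_dom_iff.2 ⟨⟨a, ha, ?_⟩, fun i => ?_, fun j => ⟨?_, ?_⟩⟩
    · have := sum_norm_convex_lt hα hβ hαβ h1 h4
      refine lt_of_eq_of_lt (Finset.sum_congr rfl fun i _ => ?_) this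
      congr 2
      simp
      ring
    · have e : (P.s' * ((α : ℂ) • x + (β : ℂ) • y).2.1 i).im =
          α * (P.s' * x.2.1 i).im + β * (P.s' * y.2.1 i).im := by
        simp; ring
      have h7 := (convex_Ioo (-(P.s - t * P.s')) (P.s - t * P.s')) (abs_lt.1 (h2 i))
        (abs_lt.1 (h5 i)) hα hβ hαβ
      rw [e]
      exact abs_lt.2 h7
    · have := norm_convex_lt (w := 0) hα hβ hαβ
        (by rw [sub_zero]; exact (h3 j).1) (by rw [sub_zero]; exact (h6 j).1)
      refine lt_of_eq_of_lt ?_ this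
      congr 1
      simp
      ring
    · have := norm_convex_lt (w := 0) hα hβ hαβ
        (by rw [sub_zero]; exact (h3 j).2) (by rw [sub_zero]; exact (h6 j).2)
      refine lt_of_eq_of_lt ?_ this
      congr 1
      simp
      ring

lemma isOpen_nbhd (A : Set (ι → ℝ)) (r : ℝ) : IsOpen (nbhd A r) := by
  have h : nbhd A r = ⋃ a ∈ A, {I : ι → ℂ | ∑ i, ‖I i - (a i : ℂ)‖ < r} := by
    ext; simp [nbhd]
  rw [h]
  exact isOpen_biUnion fun a _ => isOpen_lt (by fun_prop) continuous_const

lemma isOpen_actionDomain (A : Set (ι → ℝ)) (r ε : ℝ) : IsOpen (actionDomain A m r ε) := by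
  have h : actionDomain A m r ε =
      Prod.fst ⁻¹' nbhd A r ∩ ⋂ j, {y : (ι → ℂ) × (Fin m → ℂ) | ‖y.2 j‖ < ε ^ 2} := by
    ext; simp [actionDomain]
  rw [h]
  exact ((isOpen_nbhd A r).preimage continuous_fst).inter
    (isOpen_iInter_of_finite fun j => isOpen_lt (by fun_prop) continuous_const)

lemma star_mem_actionDomain {A : Set (ι → ℝ)} {r ε : ℝ} {y : (ι → ℂ) × (Fin m → ℂ)}
    (hy : y ∈ actionDomain A m r ε) : star y ∈ actionDomain A m r ε := by
  obtain ⟨⟨a, ha, h1⟩, h2⟩ := hy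
  refine ⟨⟨a, ha, lt_of_eq_of_lt (Finset.sum_congr rfl fun i _ => ?_) h1⟩, fun j => ?_⟩
  · rw [← norm_star]
    simp
  · simpa using h2 j

lemma star_integrable {A : Set (ι → ℝ)} {r ε : ℝ} {h : (ι → ℂ) × (Fin m → ℂ) → ℂ}
    (hh : RealAnalyticIntegrable h (actionDomain A m r ε)) {y : (ι → ℂ) × (Fin m → ℂ)}
    (hy : y ∈ actionDomain A m r ε) : star (h (star y)) = h y := by
  refine star_apply_of_real
    (c := (starL ℂ : ((ι → ℂ) × (Fin m → ℂ)) ≃L⋆[ℂ] ((ι → ℂ) × (Fin m → ℂ))).toContinuousLinearMap)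
    (fun x => star_star x) (isOpen_actionDomain A r ε) hh.holo
    (fun y hy => star_mem_actionDomain hy) (fun y hy hc => ?_) fun v hv => ?_
  · have hre : ∀ a : ℂ, star a = a → a.im = 0 := fun a ha => Complex.conj_eq_iff_im.1 ha
    refine hh.real y hy (fun i => hre _ ?_) (fun i => hre _ ?_)
    · exact congrArg (fun y : (ι → ℂ) × (Fin m → ℂ) => y.1 i) hc
    · exact congrArg (fun y : (ι → ℂ) × (Fin m → ℂ) => y.2 i) hc
  · have hα : 0 ≤ (1 + v) / 2 := by linarith [hv.1]
    have hβ : 0 ≤ (1 - v) / 2 := by linarith [hv.2]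
    have hαβ : (1 + v) / 2 + (1 - v) / 2 = 1 := by ring
    set α := (1 + v) / 2
    set β := (1 - v) / 2
    obtain ⟨⟨a, ha, h1⟩, h2⟩ := hy
    refine ⟨⟨a, ha, ?_⟩, fun j => ?_⟩
    · refine sum_norm_convex_lt (u := y.1) (v := star y.1) hα hβ hαβ h1 ?_
      refine lt_of_eq_of_lt (Finset.sum_congr rfl fun i _ => ?_) h1
      rw [← norm_star]
      simp
    · have := norm_convex_lt (w := 0) (v := star (y.2 j)) hα hβ hαβ (by simpa using h2 j)
        (by simpa using h2 j)
      simpa using this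

end Scales

end Averaging

/-! ### Generators of the torus action and the bracket with the integrable part. -/

namespace Averaging

lemma symplForm_dirφ {ι : Type} [Fintype ι] [DecidableEq ι] {m : ℕ} (u : Phase ι m) (i : ι) :
    symplForm u (dirφ m i) = u.1 i := by
  simp [symplForm, dirφ, Pi.single_apply]

lemma symplForm_dirI {ι : Type} [Fintype ι] [DecidableEq ι] {m : ℕ} (u : Phase ι m) (i : ι) :
    symplForm u (dirI m i) = -u.2.1 i := by
  simp [symplForm, dirI, Pi.single_apply]

lemma symplForm_dirq {ι : Type} [Fintype ι] {m : ℕ} (u : Phase ι m) (j : Fin m) :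
    symplForm u (dirq ι j) = u.2.2.1 j := by
  simp [symplForm, dirq, Pi.single_apply]

lemma symplForm_dirp {ι : Type} [Fintype ι] {m : ℕ} (u : Phase ι m) (j : Fin m) :
    symplForm u (dirp ι j) = -u.2.2.2 j := by
  simp [symplForm, dirp, Pi.single_apply]

lemma phase_eq_sum {ι : Type} [Fintype ι] [DecidableEq ι] {m : ℕ} (v : Phase ι m) :
    v = ∑ i, v.1 i • dirI m i + ∑ i, v.2.1 i • dirφ m i +
    (∑ j, v.2.2.1 j • dirp ι j + ∑ j, v.2.2.2 j • dirq ι j) := by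
  refine Prod.ext ?_ (Prod.ext ?_ (Prod.ext ?_ ?_)) <;> funext i <;>
    simp [Prod.fst_sum, Prod.snd_sum, dirI, dirφ, dirp, dirq, Finset.sum_apply, Pi.single_apply]

namespace Scales

variable {ι : Type} [Fintype ι] [DecidableEq ι] {m : ℕ} (P : Scales ι)

/-- The components are read off by pairing with the coordinate vectors of the original phase space,
so both kinds of normal coordinates are treated at once. -/
lemma chart_Jmap (ℓ : Esp ι m →L[ℂ] ℂ) : P.chart (P.Jmap ℓ) =
    (fun i => ℓ (P.chart.symm (dirφ m i)), fun i => -ℓ (P.chart.symm (dirI m i)),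
      fun j => ℓ (P.chart.symm (dirq ι j)), fun j => -ℓ (P.chart.symm (dirp ι j))) := by
  have h : ∀ v, symplForm (P.chart (P.Jmap ℓ)) v = ℓ (P.chart.symm v) := fun v => by
    rw [← P.form_Jmap ℓ, form_eq, ContinuousLinearEquiv.apply_symm_apply]
  refine Prod.ext ?_ (Prod.ext ?_ (Prod.ext ?_ ?_)) <;> funext i <;> simp only [← h]
  · rw [symplForm_dirφ]
  · rw [symplForm_dirI, neg_neg]
  · rw [symplForm_dirq]
  · rw [symplForm_dirp, neg_neg]

lemma fderiv_comp_chart {f : Phase ι m → ℂ} {x : Esp ι m} (hf : DifferentiableAt ℂ f (P.chart x)) :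
    fderiv ℂ (fun y => f (P.chart y)) x = (fderiv ℂ f (P.chart x)).comp
      P.chart.toContinuousLinearMap :=
  (hf.hasFDerivAt.comp x P.chart.hasFDerivAt).fderiv

lemma poisson_chart {f g : Phase ι m → ℂ} {x : Esp ι m} (hf : DifferentiableAt ℂ f (P.chart x))
    (hg : DifferentiableAt ℂ g (P.chart x)) : poisson f g (P.chart x) =
      (P.system m).pb (fun y => f (P.chart y)) (fun y => g (P.chart y)) x := by
  have h : (P.system m).J = P.Jmap := rfl
  rw [ModeSystem.pb, h, fderiv_comp_chart P hf, fderiv_comp_chart P hg,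
    ContinuousLinearMap.comp_apply]
  set D := fderiv ℂ f (P.chart x)
  have e : P.chart.toContinuousLinearMap (P.Jmap ((fderiv ℂ g (P.chart x)).comp
      P.chart.toContinuousLinearMap)) = P.chart (P.Jmap ((fderiv ℂ g (P.chart x)).comp
      P.chart.toContinuousLinearMap)) := rfl
  rw [e, chart_Jmap]
  conv_rhs => rw [phase_eq_sum (_, _)]
  simp only [map_add, map_sum, map_smul, smul_eq_mul, ContinuousLinearMap.comp_apply,
    ContinuousLinearEquiv.coe_coe, ContinuousLinearEquiv.apply_symm_apply, poisson]
  rw [← Finset.sum_add_distrib, ← Finset.sum_add_distrib]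
  congr 1 <;> refine Finset.sum_congr rfl fun i _ => ?_ <;> ring

/-- The generator of the complexified torus action. -/
noncomputable def gen (g : (ι → ℂ) × (Fin m → ℂ)) (x : Esp ι m) : Esp ι m :=
  (0, fun i => (P.s' : ℂ)⁻¹ * g.1 i, fun j => -(Complex.I * g.2 j) * x.2.2.1 j,
    fun j => Complex.I * g.2 j * x.2.2.2 j)

lemma hasDerivAt_actC (g : (ι → ℂ) × (Fin m → ℂ)) (x : Esp ι m) (τ : ℂ) :
    HasDerivAt (fun τ : ℂ => P.actC (τ • g) x) (P.gen g (P.actC (τ • g) x)) τ := by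
  refine HasDerivAt.prodMk (hasDerivAt_const _ _) (HasDerivAt.prodMk (hasDerivAt_pi.2 fun i => ?_)
    (HasDerivAt.prodMk (hasDerivAt_pi.2 fun j => ?_) (hasDerivAt_pi.2 fun j => ?_)))
  · have h := (((hasDerivAt_id τ).mul_const (g.1 i)).const_mul (P.s' : ℂ)⁻¹).const_add (x.2.1 i)
    simpa [actC] using h
  · have h := (((((hasDerivAt_id τ).mul_const (g.2 j)).const_mul Complex.I).neg).cexp).mul_const
      (x.2.2.1 j)
    convert! h using 1
    simp [actC]; ring
  · have h := ((((hasDerivAt_id τ).mul_const (g.2 j)).const_mul Complex.I).cexp).mul_const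
      (x.2.2.2 j)
    convert! h using 1
    simp [actC]; ring

lemma actC_zero (x : Esp ι m) : P.actC 0 x = x := by
  refine Prod.ext ?_ (Prod.ext ?_ (Prod.ext ?_ ?_)) <;> [rfl; funext i; funext i; funext i] <;>
    simp [actC]

lemma gen_add_smul (g g' : (ι → ℂ) × (Fin m → ℂ)) (c : ℂ) (x : Esp ι m) :
    P.gen (g + c • g') x = P.gen g x + c • P.gen g' x := by
  refine Prod.ext ?_ (Prod.ext ?_ (Prod.ext ?_ ?_)) <;> [ext i; funext i; funext i; funext i] <;>
    simp [gen] <;> ring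

lemma phase_add_smul (g g' : (ι → ℂ) × (Fin m → ℂ)) (c : ℂ) (κ : Mode ι m) :
    phase (g + c • g') κ = phase g κ + c * phase g' κ := by
  simp only [phase, Prod.fst_add, Prod.snd_add, Pi.add_apply, Prod.smul_fst, Prod.smul_snd,
    Pi.smul_apply, smul_eq_mul, mul_add, Finset.mul_sum, Finset.sum_add_distrib]
  rw [add_add_add_comm]
  congr 2 <;> refine Finset.sum_congr rfl fun i _ => by ring

lemma phase_smul (g : (ι → ℂ) × (Fin m → ℂ)) (c : ℂ) (κ : Mode ι m) :
    phase (c • g) κ = c * phase g κ := by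
  have := phase_add_smul 0 g c κ
  simpa [phase] using this

/-- A holomorphic function of a single mode `κ` on `P.dom m t`. -/
structure ModeFun (t : ℝ) (κ : Mode ι m) (F : Esp ι m → ℂ) : Prop where
  holo : DifferentiableOn ℂ F (P.dom m t)
  mode : ∀ g, ∀ x ∈ P.dom m t, F (P.actC (castC g) x) =
    Complex.exp (Complex.I * phase (castC g) κ) * F x

variable {P} {t : ℝ} {κ : Mode ι m} {F : Esp ι m → ℂ}

/-- For real `g`, differentiate the equivariance along a one-parameter subgroup. Both sides are
complex linear in `g`, which gives the general case. -/
lemma ModeFun.fderiv_gen (hF : P.ModeFun t κ F) (g : (ι → ℂ) × (Fin m → ℂ)) {x : Esp ι m}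
    (hx : x ∈ P.dom m t) : fderiv ℂ F x (P.gen g x) = Complex.I * phase g κ * F x := by
  have hreal : ∀ g : (ι → ℝ) × (Fin m → ℝ), fderiv ℂ F x (P.gen (castC g) x) =
      Complex.I * phase (castC g) κ * F x := by
    intro g
    have h1 : HasDerivAt (fun τ : ℂ => F (P.actC (τ • castC g) x))
        (fderiv ℂ F x (P.gen (castC g) x)) 0 := by
      have h2 := P.hasDerivAt_actC (castC g) x 0
      have h3 : P.actC ((0 : ℂ) • castC g) x = x := by rw [zero_smul, actC_zero]
      have h4 := (hF.holo.differentiableAt ((P.isOpen_dom t).mem_nhds hx)).hasFDerivAt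
      rw [h3] at h2
      rw [← h3] at h4
      have := h4.comp_hasDerivAt (0 : ℂ) h2
      rwa [h3] at this
    have h2 : HasDerivAt (fun τ : ℂ => Complex.exp (Complex.I * (τ * phase (castC g) κ)) * F x)
        (Complex.I * phase (castC g) κ * F x) 0 := by
      have := ((((hasDerivAt_id (0 : ℂ)).mul_const (phase (castC g) κ)).const_mul
        Complex.I).cexp).mul_const (F x)
      simpa using this
    refine h1.comp_ofReal.unique (h2.comp_ofReal.congr_of_eventuallyEq (Eventually.of_forall ?_))
    intro τ
    have e : (τ : ℂ) • castC g = castC (τ • g) := by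
      refine Prod.ext ?_ ?_ <;> funext i <;> simp [castC]
    change F (P.actC ((τ : ℂ) • castC g) x) = _
    rw [e, hF.mode _ x hx, ← e, phase_smul]
  have hdec : g = castC (fun i => (g.1 i).re, fun j => (g.2 j).re) +
      Complex.I • castC (fun i => (g.1 i).im, fun j => (g.2 j).im) := by
    refine Prod.ext ?_ ?_ <;> funext i <;> simp [castC, mul_comm Complex.I]
  rw [hdec, gen_add_smul, map_add, map_smul, hreal, hreal, phase_add_smul, smul_eq_mul]
  ring

/-- Equivariance under the complexified torus action, as long as one does not leave the domain. -/
lemma ModeFun.apply_actC (hF : P.ModeFun t κ F) (g : (ι → ℂ) × (Fin m → ℂ)) {x : Esp ι m}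
    (hx : ∀ τ ∈ Icc (0 : ℝ) 1, P.actC ((τ : ℂ) • g) x ∈ P.dom m t) :
    F (P.actC g x) = Complex.exp (Complex.I * phase g κ) * F x := by
  -- By `fderiv_gen` the value along the orbit, divided by its expected growth, has zero derivative.
  set u : ℝ → ℂ := fun τ =>
    Complex.exp (-(Complex.I * (τ * phase g κ))) * F (P.actC ((τ : ℂ) • g) x) with hu
  have hder : ∀ τ ∈ Icc (0 : ℝ) 1, HasDerivAt u 0 τ := by
    intro τ hτ
    have h1 : HasDerivAt (fun τ : ℂ => F (P.actC (τ • g) x))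
        (fderiv ℂ F (P.actC ((τ : ℂ) • g) x) (P.gen g (P.actC ((τ : ℂ) • g) x))) τ :=
      (hF.holo.differentiableAt ((P.isOpen_dom t).mem_nhds (hx τ hτ))).hasFDerivAt.comp_hasDerivAt
        (τ : ℂ) (P.hasDerivAt_actC g x τ)
    rw [hF.fderiv_gen g (hx τ hτ)] at h1
    have h2 := (((((hasDerivAt_id (τ : ℂ)).mul_const (phase g κ)).const_mul
      Complex.I).neg).cexp).mul h1
    have h3 := h2.comp_ofReal
    convert! h3 using 1
    simp
    ring
  have h := constant_of_has_deriv_right_zero (f := u) (a := 0) (b := 1)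
    (fun τ hτ => (hder τ hτ).continuousAt.continuousWithinAt)
    (fun τ hτ => (hder τ (Ico_subset_Icc_self hτ)).hasDerivWithinAt) 1 (by norm_num)
  simp only [hu, Complex.ofReal_one, one_mul, one_smul, Complex.ofReal_zero, zero_mul, mul_zero,
    neg_zero, Complex.exp_zero, zero_smul, actC_zero] at h
  rw [← h, ← mul_assoc, ← Complex.exp_add, add_neg_cancel, Complex.exp_zero, one_mul]

variable (P)

/-- The map `(I, φ, z, w) ↦ (I, J)`. -/
noncomputable def actionMap (x : Esp ι m) : (ι → ℂ) × (Fin m → ℂ) :=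
  (fun i => P.r' * x.1 i, fun j => actionFactor P.kd * P.ε' ^ 2 * (x.2.2.1 j * x.2.2.2 j))

lemma actionMap_eq (x : Esp ι m) :
    P.actionMap x = ((P.chart x).1, actions P.kd (P.chart x).2.2) := by
  refine Prod.ext rfl ?_
  funext j
  simp only [actionMap, actions, chart_apply, action_p_q]
  ring

/-- The derivative of `actionMap`. -/
noncomputable def actionDeriv (x : Esp ι m) : Esp ι m →L[ℂ] (ι → ℂ) × (Fin m → ℂ) :=
  LinearMap.toContinuousLinearMap
    { toFun := fun v => (fun i => P.r' * v.1 i, fun j => actionFactor P.kd * P.ε' ^ 2 *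
        (x.2.2.1 j * v.2.2.2 j + x.2.2.2 j * v.2.2.1 j))
      map_add' := fun u v => by
        refine Prod.ext ?_ ?_ <;> funext i <;> simp <;> ring
      map_smul' := fun c u => by
        refine Prod.ext ?_ ?_ <;> funext i <;> simp <;> ring }

lemma actionDeriv_apply (x v : Esp ι m) : P.actionDeriv x v =
    (fun i => P.r' * v.1 i, fun j => actionFactor P.kd * P.ε' ^ 2 *
        (x.2.2.1 j * v.2.2.2 j + x.2.2.2 j * v.2.2.1 j)) := rfl

lemma hasFDerivAt_actionMap (x : Esp ι m) : HasFDerivAt P.actionMap (P.actionDeriv x) x := by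
  set zc : Fin m → (Esp ι m →L[ℂ] ℂ) := fun j => LinearMap.toContinuousLinearMap
    { toFun := fun v => v.2.2.1 j, map_add' := fun _ _ => rfl, map_smul' := fun _ _ => rfl }
  set wc : Fin m → (Esp ι m →L[ℂ] ℂ) := fun j => LinearMap.toContinuousLinearMap
    { toFun := fun v => v.2.2.2 j, map_add' := fun _ _ => rfl, map_smul' := fun _ _ => rfl }
  set Ic : ι → (Esp ι m →L[ℂ] ℂ) := fun i => LinearMap.toContinuousLinearMap
    { toFun := fun v => v.1 i, map_add' := fun _ _ => rfl, map_smul' := fun _ _ => rfl }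
  have h1 : ∀ i, HasFDerivAt (fun x : Esp ι m => (P.r' : ℂ) * x.1 i) ((P.r' : ℂ) • Ic i) x :=
    fun i => ((Ic i).hasFDerivAt (x := x)).const_mul (P.r' : ℂ)
  have h2 : ∀ j, HasFDerivAt (fun x : Esp ι m => actionFactor P.kd * (P.ε' : ℂ) ^ 2 *
      (x.2.2.1 j * x.2.2.2 j))
      ((actionFactor P.kd * (P.ε' : ℂ) ^ 2) • (x.2.2.1 j • wc j + x.2.2.2 j • zc j)) x :=
    fun j => (((zc j).hasFDerivAt (x := x)).mul ((wc j).hasFDerivAt (x := x))).const_mul _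
  exact (hasFDerivAt_pi.2 h1).prodMk (hasFDerivAt_pi.2 h2)

lemma actionMap_mem {x : Esp ι m} (hx : x ∈ P.dom m 0) :
    P.actionMap x ∈ actionDomain P.A m P.r P.ε := by
  obtain ⟨⟨a, ha, h1⟩, -, h3⟩ := P.mem_dom_iff.1 hx
  refine ⟨⟨a, ha, by simpa [actionMap] using h1⟩, fun j => ?_⟩
  obtain ⟨h4, h5⟩ := h3 j
  rw [zero_mul, sub_zero] at h4 h5
  have e : (P.actionMap x).2 j = actionFactor P.kd * ((P.ε' * x.2.2.1 j) * (P.ε' * x.2.2.2 j)) := by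
    simp only [actionMap]; ring
  rw [e, norm_mul, norm_actionFactor, one_mul, norm_mul, sq]
  exact mul_lt_mul'' h4 h5 (norm_nonneg _) (norm_nonneg _)

variable {h : (ι → ℂ) × (Fin m → ℂ) → ℂ}

/-- The integrable part in rescaled coordinates. -/
noncomputable def hamC (h : (ι → ℂ) × (Fin m → ℂ) → ℂ) (x : Esp ι m) : ℂ := h (P.actionMap x)

/-- The divisors in rescaled coordinates. -/
noncomputable def divC (h : (ι → ℂ) × (Fin m → ℂ) → ℂ) (κ : Mode ι m) (x : Esp ι m) : ℂ :=
  -Complex.I * divisor P.kd h κ ((P.chart x).1, (P.chart x).2.2)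

/-- The frequencies, as an element of the complexified Lie algebra of the torus. -/
noncomputable def freq (h : (ι → ℂ) × (Fin m → ℂ) → ℂ) (y : (ι → ℂ) × (Fin m → ℂ)) :
    (ι → ℂ) × (Fin m → ℂ) :=
  (fun i => -fderiv ℂ h y (Pi.single i 1, 0),
    fun j => Complex.I * actionFactor P.kd * fderiv ℂ h y (0, Pi.single j 1))

lemma divC_eq (κ : Mode ι m) (x : Esp ι m) :
    P.divC h κ x = Complex.I * phase (P.freq h (P.actionMap x)) κ := by
  rw [divC, phase, freq, actionMap_eq]
  cases hk : P.kd
  · simp only [divisor, actionFactor]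
    rw [Finset.mul_sum]
    simp only [mul_add, Finset.mul_sum, sub_eq_add_neg, ← Finset.sum_neg_distrib]
    congr 1 <;> refine Finset.sum_congr rfl fun i _ => ?_ <;> ring
  · simp only [divisor, actionFactor, mul_add, Finset.mul_sum]
    congr 1 <;> refine Finset.sum_congr rfl fun i _ => ?_
    · ring
    · linear_combination (-Complex.I * κ.2 i * (fderiv ℂ h ((P.chart x).1,
        actions Kind.elliptic (P.chart x).2.2)) (0, Pi.single i 1)) * Complex.I_sq

/-- The integrable part depends only on `I` and the products `z_j w_j`, which the torus leaves
fixed. Its field is therefore a generator of the complex torus action whose parameter, the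
frequency, depends on the point only through these invariants. -/
lemma ham_hamC (hh : RealAnalyticIntegrable h (actionDomain P.A m P.r P.ε)) {x : Esp ι m}
    (hx : x ∈ P.dom m 0) :
    P.Jmap (fderiv ℂ (P.hamC h) x) = P.gen (P.freq h (P.actionMap x)) x := by
  have hy := P.actionMap_mem hx
  have h1 := (hh.holo.differentiableAt ((isOpen_actionDomain _ _ _).mem_nhds hy)).hasFDerivAt
  have h2 : fderiv ℂ (P.hamC h) x = (fderiv ℂ h (P.actionMap x)).comp (P.actionDeriv x) :=
    (h1.comp x (P.hasFDerivAt_actionMap x)).fderiv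
  set D := fderiv ℂ h (P.actionMap x) with hD
  have hI : ∀ i, P.actionDeriv x (eI m i) = (P.r' : ℂ) • (Pi.single i 1, 0) := fun i => by
    rw [actionDeriv_apply]
    refine Prod.ext ?_ ?_ <;> funext j <;> simp [eI, Pi.single_apply]
  have hφ : ∀ i, P.actionDeriv x (eφ m i) = 0 := fun i => by
    rw [actionDeriv_apply]
    refine Prod.ext ?_ ?_ <;> funext j <;> simp [eφ]
  have hz : ∀ j, P.actionDeriv x (ez ι j) =
      (actionFactor P.kd * P.ε' ^ 2 * x.2.2.2 j) • (0, Pi.single j 1) := fun j => by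
    rw [actionDeriv_apply]
    refine Prod.ext ?_ ?_ <;> funext i <;> simp [ez, Pi.single_apply]
    split_ifs with h <;> simp [h]
  have hw : ∀ j, P.actionDeriv x (ew ι j) =
      (actionFactor P.kd * P.ε' ^ 2 * x.2.2.1 j) • (0, Pi.single j 1) := fun j => by
    rw [actionDeriv_apply]
    refine Prod.ext ?_ ?_ <;> funext i <;> simp [ew, Pi.single_apply]
    split_ifs with h <;> simp [h]
  have n1 := P.r_ne
  have n2 := P.s_ne
  have n3 := P.ε_ne
  rw [h2, Jmap_apply, gen, freq]
  simp only [ContinuousLinearMap.comp_apply, hI, hφ, hz, hw, map_smul, map_zero, smul_eq_mul,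
    mul_zero, ← hD]
  refine Prod.ext rfl (Prod.ext ?_ (Prod.ext ?_ ?_)) <;> funext i
  · simp only; field_simp
  · simp only; field_simp
    linear_combination (actionFactor P.kd * x.2.2.1 i * D (0, Pi.single i 1)) * Complex.I_sq
  · simp only; field_simp
    linear_combination (-actionFactor P.kd * x.2.2.2 i * D (0, Pi.single i 1)) * Complex.I_sq

lemma actionMap_actC (g : (ι → ℂ) × (Fin m → ℂ)) (x : Esp ι m) :
    P.actionMap (P.actC g x) = P.actionMap x := by
  refine Prod.ext rfl ?_
  funext j
  have h0 : Complex.exp (-(Complex.I * g.2 j)) * Complex.exp (Complex.I * g.2 j) = 1 := by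
    rw [← Complex.exp_add]; simp
  simp only [actionMap, actC]
  linear_combination (actionFactor P.kd * P.ε' ^ 2 * x.2.2.1 j * x.2.2.2 j) * h0

lemma actionMap_conjL (x : Esp ι m) : P.actionMap (P.conjL x) = star (P.actionMap x) := by
  refine Prod.ext ?_ ?_ <;> funext j
  · simp [actionMap, conjL_apply]
  · simp only [actionMap, conjL_apply, Prod.snd_star, Pi.star_apply]
    cases P.kd
    · simp [actionFactor, conjZ, conjW]
    · simp only [actionFactor, conjZ, conjW, star_mul', Complex.star_def, Complex.conj_I, map_pow,
        Complex.conj_ofReal]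
      linear_combination (Complex.I * P.ε' ^ 2 * (starRingEnd ℂ) (x.2.2.1 j) *
        (starRingEnd ℂ) (x.2.2.2 j)) * Complex.I_sq

lemma fderiv_star (hh : RealAnalyticIntegrable h (actionDomain P.A m P.r P.ε))
    {y : (ι → ℂ) × (Fin m → ℂ)} (hy : y ∈ actionDomain P.A m P.r P.ε)
    (v : (ι → ℂ) × (Fin m → ℂ)) :
    fderiv ℂ h (star y) (star v) = star (fderiv ℂ h y v) := by
  have h1 := (hh.holo.differentiableAt ((isOpen_actionDomain _ _ _).mem_nhds
    (star_mem_actionDomain hy))).hasFDerivAt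
  have h2 := hasFDerivAt_conj (x := y) (c := (starL ℂ : ((ι → ℂ) × (Fin m → ℂ)) ≃L⋆[ℂ]
    ((ι → ℂ) × (Fin m → ℂ))).toContinuousLinearMap) h1
  have h3 : fderiv ℂ h y = conjDual (starL ℂ : ((ι → ℂ) × (Fin m → ℂ)) ≃L⋆[ℂ]
      ((ι → ℂ) × (Fin m → ℂ))).toContinuousLinearMap (fderiv ℂ h (star y)) := by
    refine (h2.congr_of_eventuallyEq ?_).fderiv
    filter_upwards [(isOpen_actionDomain _ _ _).mem_nhds hy] with z hz
    exact (star_integrable hh hz).symm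
  rw [h3]
  exact (star_star _).symm

lemma conjMode_hyperbolic_fst (κ : Mode ι m) : (conjMode .hyperbolic ι m κ).1 = -κ.1 := rfl

lemma conjMode_hyperbolic_snd (κ : Mode ι m) : (conjMode .hyperbolic ι m κ).2 = κ.2 := rfl

/-- The integrable part satisfies the hypotheses of the abstract averaging theorem. -/
theorem unperturbed (hh : RealAnalyticIntegrable h (actionDomain P.A m P.r P.ε)) :
    (P.system m).Unperturbed (P.hamC h) (P.divC h) where
  holo := hh.holo.comp (fun x _ => (P.hasFDerivAt_actionMap x).differentiableAt.differentiableWithinAt)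
    fun x hx => P.actionMap_mem hx
  holo_div κ := by
    have h1 : DifferentiableOn ℂ (fun x => fderiv ℂ h (P.actionMap x)) (P.dom m 0) :=
      (differentiableOn_fderiv (isOpen_actionDomain _ _ _) hh.holo).comp
      (fun x _ => (P.hasFDerivAt_actionMap x).differentiableAt.differentiableWithinAt)
      fun x hx => P.actionMap_mem hx
    have h2 : ∀ v, DifferentiableOn ℂ (fun x => fderiv ℂ h (P.actionMap x) v) (P.dom m 0) :=
      fun v => h1.clm_apply (differentiableOn_const v)
    have h3 : DifferentiableOn ℂ (fun x => Complex.I * phase (P.freq h (P.actionMap x)) κ)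
        (P.dom m 0) := by
      simp only [phase, freq]
      refine DifferentiableOn.const_mul (DifferentiableOn.add ?_ ?_) _
      · exact DifferentiableOn.fun_sum fun i _ => ((h2 _).fun_neg).const_mul _
      · exact DifferentiableOn.fun_sum fun i _ => ((h2 _).const_mul _).const_mul _
    exact h3.congr fun x _ => P.divC_eq κ x
  div_act κ g x _ := by
    change P.divC h κ (P.actC (castC g) x) = _
    rw [divC_eq, divC_eq, actionMap_actC]
  div_real κ x hx := by
    change star (P.divC h (conjMode P.kd ι m κ) (P.conjL x)) = _
    have hy := P.actionMap_mem hx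
    rw [divC_eq, divC_eq, actionMap_conjL]
    have hs1 : ∀ i : ι, star ((Pi.single i 1, 0) : (ι → ℂ) × (Fin m → ℂ)) = (Pi.single i 1, 0) :=
      fun i => by
        refine Prod.ext ?_ ?_ <;> funext j <;> simp [Pi.single_apply, apply_ite]
    have hs2 : ∀ i, star ((0, Pi.single i 1) : (ι → ℂ) × (Fin m → ℂ)) = (0, Pi.single i 1) :=
      fun i => by
        refine Prod.ext ?_ ?_ <;> funext j <;> simp [Pi.single_apply, apply_ite]
    have e1 : ∀ i : ι, fderiv ℂ h (star (P.actionMap x)) (Pi.single i 1, 0) =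
        star (fderiv ℂ h (P.actionMap x) (Pi.single i 1, 0)) := fun i => by
      rw [← P.fderiv_star hh hy, hs1]
    have e2 : ∀ i, fderiv ℂ h (star (P.actionMap x)) (0, Pi.single i 1) =
        star (fderiv ℂ h (P.actionMap x) (0, Pi.single i 1)) := fun i => by
      rw [← P.fderiv_star hh hy, hs2]
    simp only [phase, freq, e1, e2, star_mul', star_add, star_sum, star_neg, star_star]
    cases hk : P.kd
    · simp only [conjMode_hyperbolic_fst, conjMode_hyperbolic_snd, actionFactor]
      simp
      ring
    · simp [conjMode, actionFactor]
      ring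
  pb_eq t ht κ F hF hm x hx := by
    have hM : P.ModeFun t κ F := ⟨hF, hm⟩
    have hx0 : x ∈ P.dom m 0 := (P.system m).anti ht hx
    change fderiv ℂ F x (P.Jmap (fderiv ℂ (P.hamC h) x)) = _
    rw [P.ham_hamC hh hx0, hM.fderiv_gen _ hx, divC_eq]

end Scales

end Averaging

/-! ### Fourier coefficients of periodic functions on the unit box. -/

namespace Averaging

section Box

variable {d : Type} [Fintype d] {G : (d → ℝ) → ℂ}

/-- The Fourier coefficients of a function on `ℝ^d` of period one in all variables. -/
noncomputable def boxCoeff (G : (d → ℝ) → ℂ) (n : d → ℤ) : ℂ :=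
  ∫ x in Icc (0 : d → ℝ) 1, Complex.exp (-(2 * Real.pi * Complex.I * ∑ i, (n i : ℂ) * x i)) * G x

lemma isOpenQuotientMap_torus :
    IsOpenQuotientMap (Pi.map fun (_ : d) (t : ℝ) => (t : UnitAddCircle)) :=
  IsOpenQuotientMap.piMap fun _ => QuotientAddGroup.isOpenQuotientMap_mk

lemma exists_torus_lift (hG : Continuous G) (hper : ∀ (k : d → ℤ) x, G (fun i => x i + k i) = G x) :
    ∃ T : C(UnitAddTorus d, ℂ), ∀ x : d → ℝ, T (fun i => (x i : UnitAddCircle)) = G x := by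
  set q : C(d → ℝ, UnitAddTorus d) :=
    ⟨Pi.map fun (_ : d) (t : ℝ) => (t : UnitAddCircle), isOpenQuotientMap_torus.continuous⟩
  have hq : IsQuotientMap q := isOpenQuotientMap_torus.isQuotientMap
  have hf : Function.FactorsThrough (⟨G, hG⟩ : C(d → ℝ, ℂ)) q := by
    intro x y hxy
    have h1 : ∀ i, ∃ k : ℤ, y i + k = x i := fun i => by
      have h2 : (x i : UnitAddCircle) = y i := congrFun hxy i
      have h3 : ((x i - y i : ℝ) : UnitAddCircle) = 0 := by
        rw [AddCircle.coe_sub, h2, sub_self]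
      obtain ⟨k, hk⟩ := (AddCircle.coe_eq_zero_iff (1 : ℝ)).1 h3
      refine ⟨k, ?_⟩
      rw [zsmul_eq_mul, mul_one] at hk
      linarith
    choose k hk using h1
    change G x = G y
    rw [← hper k y]
    congr 1
    funext i
    exact (hk i).symm
  refine ⟨hq.lift _ hf, fun x => ?_⟩
  exact DFunLike.congr_fun (hq.lift_comp _ hf) x

lemma mFourier_neg_coe (n : d → ℤ) (x : d → ℝ) :
    UnitAddTorus.mFourier (-n) (fun i => (x i : UnitAddCircle)) =
      Complex.exp (-(2 * Real.pi * Complex.I * ∑ i, (n i : ℂ) * x i)) := by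
  simp only [UnitAddTorus.mFourier, ContinuousMap.coe_mk, fourier_coe_apply, Pi.neg_apply]
  rw [← Complex.exp_sum, Finset.mul_sum, ← Finset.sum_neg_distrib]
  congr 1
  refine Finset.sum_congr rfl fun i _ => ?_
  push_cast
  ring

lemma mFourierCoeff_eq_box {T : C(UnitAddTorus d, ℂ)}
    (hT : ∀ x : d → ℝ, T (fun i => (x i : UnitAddCircle)) = G x) (n : d → ℤ) (a : d → ℝ) :
    UnitAddTorus.mFourierCoeff T n = ∫ x in {x : d → ℝ | ∀ i, x i ∈ Ioc (a i) (a i + 1)},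
      Complex.exp (-(2 * Real.pi * Complex.I * ∑ i, (n i : ℂ) * x i)) * G x := by
  rw [UnitAddTorus.mFourierCoeff_eq_integral _ _ a]
  simp only [hT, mFourier_neg_coe, smul_eq_mul]

lemma boxCoeff_eq_Ioc (n : d → ℤ) :
    boxCoeff G n = ∫ x in {x : d → ℝ | ∀ i, x i ∈ Ioc (0 : ℝ) (0 + 1)},
      Complex.exp (-(2 * Real.pi * Complex.I * ∑ i, (n i : ℂ) * x i)) * G x := by
  refine setIntegral_congr_set (EventuallyEq.symm ?_)
  have h := Measure.univ_pi_Ioc_ae_eq_Icc (μ := fun _ : d => (volume : Measure ℝ))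
    (f := (0 : d → ℝ)) (g := 1)
  rw [← volume_pi] at h
  have e : {x : d → ℝ | ∀ i, x i ∈ Ioc (0 : ℝ) (0 + 1)} =
      univ.pi fun i => Ioc ((0 : d → ℝ) i) ((1 : d → ℝ) i) := by
    ext x
    simp
  rw [e]
  exact h

lemma mFourierCoeff_eq_boxCoeff {T : C(UnitAddTorus d, ℂ)}
    (hT : ∀ x : d → ℝ, T (fun i => (x i : UnitAddCircle)) = G x) (n : d → ℤ) :
    UnitAddTorus.mFourierCoeff T n = boxCoeff G n := by
  rw [boxCoeff_eq_Ioc, mFourierCoeff_eq_box hT n 0]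
  rfl

lemma hasSum_boxCoeff (hG : Continuous G) (hper : ∀ (k : d → ℤ) x, G (fun i => x i + k i) = G x)
    (hs : Summable (boxCoeff G)) : HasSum (boxCoeff G) (G 0) := by
  obtain ⟨T, hT⟩ := exists_torus_lift hG hper
  have e : UnitAddTorus.mFourierCoeff T = boxCoeff G :=
    funext fun n => mFourierCoeff_eq_boxCoeff hT n
  have h := UnitAddTorus.hasSum_mFourier_series_apply_of_summable (f := T) (by rwa [e])
    (fun i => ((0 : ℝ) : UnitAddCircle))
  have h0 : ∀ n : d → ℤ, UnitAddTorus.mFourier n (fun _ : d => ((0 : ℝ) : UnitAddCircle)) = 1 :=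
    fun n => by simp [UnitAddTorus.mFourier]
  have h2 := hT 0
  simp only [Pi.zero_apply] at h2
  rw [h2, e] at h
  simpa only [h0, smul_eq_mul, mul_one] using h

/-- A coefficient on the torus may be computed over any translate of the unit box; translating that
box back produces the character. -/
lemma boxCoeff_translate (hG : Continuous G)
    (hper : ∀ (k : d → ℤ) x, G (fun i => x i + k i) = G x) (n : d → ℤ) (a : d → ℝ) :
    boxCoeff (fun x => G (x + a)) n =
      Complex.exp (2 * Real.pi * Complex.I * ∑ i, (n i : ℂ) * a i) * boxCoeff G n := by
  obtain ⟨T, hT⟩ := exists_torus_lift hG hper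
  have hm : ∀ a : d → ℝ, MeasurableSet {x : d → ℝ | ∀ i, x i ∈ Ioc (a i) (a i + 1)} := fun a => by
    have : {x : d → ℝ | ∀ i, x i ∈ Ioc (a i) (a i + 1)} =
        univ.pi fun i => Ioc (a i) (a i + 1) := by
      ext; simp
    rw [this]
    exact MeasurableSet.univ_pi fun i => measurableSet_Ioc
  have hm0 : MeasurableSet {x : d → ℝ | ∀ i, x i ∈ Ioc (0 : ℝ) (0 + 1)} := hm 0
  rw [← mFourierCoeff_eq_boxCoeff hT, mFourierCoeff_eq_box hT n a, boxCoeff_eq_Ioc,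
    ← integral_const_mul, ← integral_indicator (hm a), ← integral_indicator hm0]
  refine Eq.trans ?_ (integral_add_right_eq_self _ a)
  congr 1
  funext x
  by_cases hx : ∀ i, x i ∈ Ioc (0 : ℝ) (0 + 1)
  · have hx' : ∀ i, (x + a) i ∈ Ioc (a i) (a i + 1) := fun i => by
      have := hx i
      simp only [Pi.add_apply, mem_Ioc] at this ⊢
      constructor <;> linarith [this.1, this.2]
    rw [indicator_of_mem (show x ∈ {x : d → ℝ | ∀ i, x i ∈ Ioc (0 : ℝ) (0 + 1)} from hx),
      indicator_of_mem (show x + a ∈ {x : d → ℝ | ∀ i, x i ∈ Ioc (a i) (a i + 1)} from hx'),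
      ← mul_assoc, ← Complex.exp_add]
    congr 2
    simp only [Pi.add_apply, Complex.ofReal_add, mul_add, Finset.sum_add_distrib]
    ring
  · have hx' : ¬ ∀ i, (x + a) i ∈ Ioc (a i) (a i + 1) := fun h => hx fun i => by
      have := h i
      simp only [Pi.add_apply, mem_Ioc] at this ⊢
      constructor <;> linarith [this.1, this.2]
    rw [indicator_of_notMem (show x ∉ {x : d → ℝ | ∀ i, x i ∈ Ioc (0 : ℝ) (0 + 1)} from hx),
      indicator_of_notMem (show x + a ∉ {x : d → ℝ | ∀ i, x i ∈ Ioc (a i) (a i + 1)} from hx')]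

lemma boxCoeff_const_mul (c : ℂ) (n : d → ℤ) : boxCoeff (fun x => c * G x) n = c * boxCoeff G n := by
  rw [boxCoeff, boxCoeff, ← integral_const_mul]
  congr 1
  funext x
  ring

lemma volume_unit_box : volume.real (Icc (0 : d → ℝ) 1) = 1 := by
  rw [Measure.real, Real.volume_Icc_pi]
  simp

lemma boxCoeff_self (c : ℂ) (n : d → ℤ) :
    boxCoeff (fun x => Complex.exp (2 * Real.pi * Complex.I * ∑ i, (n i : ℂ) * x i) * c) n = c := by
  have h : ∀ x : d → ℝ, Complex.exp (-(2 * Real.pi * Complex.I * ∑ i, (n i : ℂ) * x i)) *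
      (Complex.exp (2 * Real.pi * Complex.I * ∑ i, (n i : ℂ) * x i) * c) = c := fun x => by
    rw [← mul_assoc, ← Complex.exp_add, neg_add_cancel, Complex.exp_zero, one_mul]
  rw [boxCoeff]
  simp only [h]
  rw [setIntegral_const, volume_unit_box, one_smul]

/-- Orthogonality of characters. -/
lemma boxCoeff_character (c : ℂ) {n k : d → ℤ} (hk : k ≠ n) :
    boxCoeff (fun x => Complex.exp (2 * Real.pi * Complex.I * ∑ i, (k i : ℂ) * x i) * c) n = 0 := by
  set G : (d → ℝ) → ℂ := fun x =>
    Complex.exp (2 * Real.pi * Complex.I * ∑ i, (k i : ℂ) * x i) * c with hGdef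
  have hG : Continuous G := by fun_prop
  have hadd : ∀ x a : d → ℝ, G (x + a) =
      Complex.exp (2 * Real.pi * Complex.I * ∑ i, (k i : ℂ) * a i) * G x := fun x a => by
    rw [hGdef]
    simp only
    rw [← mul_assoc, ← Complex.exp_add]
    congr 2
    simp only [Pi.add_apply, Complex.ofReal_add, mul_add, Finset.sum_add_distrib]
    ring
  have hper : ∀ (l : d → ℤ) x, G (fun i => x i + l i) = G x := fun l x => by
    have h1 := hadd x (fun i => (l i : ℝ))
    have h2 : Complex.exp (2 * Real.pi * Complex.I * ∑ i, (k i : ℂ) * ((l i : ℝ) : ℂ)) = 1 := by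
      rw [Complex.exp_eq_one_iff]
      refine ⟨∑ i, k i * l i, ?_⟩
      push_cast
      ring
    rw [h2, one_mul] at h1
    exact h1
  classical
  obtain ⟨j, hj⟩ := Function.ne_iff.1 hk
  have hj' : ((k j : ℂ) - n j) ≠ 0 := sub_ne_zero.2 (by exact_mod_cast hj)
  -- Translation by half a period of the character `k - n`: the two ways of computing the translated
  -- coefficient differ by a sign.
  set a : d → ℝ := Pi.single j (1 / (2 * ((k j : ℝ) - n j))) with ha
  have hsum : ∀ l : d → ℤ, ∑ i, (l i : ℂ) * (a i : ℂ) = l j / (2 * ((k j : ℂ) - n j)) := by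
    intro l
    rw [Finset.sum_eq_single j]
    · rw [ha, Pi.single_eq_same]; push_cast; ring
    · intro i _ hi
      rw [ha, Pi.single_eq_of_ne hi]; simp
    · simp
  have h1 := boxCoeff_translate hG hper n a
  simp only [hadd] at h1
  rw [boxCoeff_const_mul, hsum, hsum] at h1
  have h3 : Complex.exp (2 * Real.pi * Complex.I * (k j / (2 * ((k j : ℂ) - n j)))) =
      -Complex.exp (2 * Real.pi * Complex.I * (n j / (2 * ((k j : ℂ) - n j)))) := by
    have e : 2 * Real.pi * Complex.I * (k j / (2 * ((k j : ℂ) - n j))) =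
        Real.pi * Complex.I + 2 * Real.pi * Complex.I * (n j / (2 * ((k j : ℂ) - n j))) := by
      field_simp
      ring
    rw [e, Complex.exp_add, Complex.exp_pi_mul_I]
    ring
  rw [h3] at h1
  have h4 : Complex.exp (2 * Real.pi * Complex.I * (n j / (2 * ((k j : ℂ) - n j)))) *
      boxCoeff G n = 0 := by linear_combination (-1 / 2 : ℂ) * h1
  exact (mul_eq_zero.1 h4).resolve_left (Complex.exp_ne_zero _)

end Box

end Averaging

/-! ### Modes of functions on phase space. -/

namespace Averaging

namespace Scales

variable {ι : Type} [Fintype ι] [DecidableEq ι] {m : ℕ} (P : Scales ι)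

/-- A point of the unit torus as an element of the group that acts. -/
noncomputable def turn (x : ι ⊕ Fin m → ℝ) : (ι → ℝ) × (Fin m → ℝ) :=
  (fun i => 2 * Real.pi * x (.inl i), fun j => 2 * Real.pi * x (.inr j))

/-- Modes as functions on the set of all angles. -/
def modeEquiv (ι : Type) (m : ℕ) : Mode ι m ≃ (ι ⊕ Fin m → ℤ) :=
  (Equiv.sumArrowEquivProdArrow ι (Fin m) ℤ).symm

lemma sum_modeEquiv (κ : Mode ι m) (x : ι ⊕ Fin m → ℝ) :
    2 * Real.pi * Complex.I * ∑ i, (modeEquiv ι m κ i : ℂ) * x i =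
      Complex.I * phase (castC (turn x)) κ := by
  have hl : ∀ i, modeEquiv ι m κ (.inl i) = κ.1 i := fun _ => rfl
  have hr : ∀ i, modeEquiv ι m κ (.inr i) = κ.2 i := fun _ => rfl
  simp only [Fintype.sum_sum_type, hl, hr, phase, castC, turn, mul_add, Finset.mul_sum,
    Complex.ofReal_mul, Complex.ofReal_ofNat]
  congr 1 <;> refine Finset.sum_congr rfl fun i _ => by ring

/-- The orbit of a point under the torus, as a function on the universal cover. -/
noncomputable def orbit (f : Esp ι m → ℂ) (y : Esp ι m) (x : ι ⊕ Fin m → ℝ) : ℂ :=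
  f (P.actC (castC (turn x)) y)

/-- The mode of index `κ` of a function. -/
noncomputable def modeCoeff (f : Esp ι m → ℂ) (κ : Mode ι m) (y : Esp ι m) : ℂ :=
  boxCoeff (P.orbit f y) (modeEquiv ι m κ)

lemma actC_add (g g' : (ι → ℂ) × (Fin m → ℂ)) (x : Esp ι m) :
    P.actC (g + g') x = P.actC g (P.actC g' x) := by
  refine Prod.ext ?_ (Prod.ext ?_ (Prod.ext ?_ ?_)) <;> [rfl; funext i; funext i; funext i]
  · simp [actC]; ring
  · simp only [actC, Prod.snd_add, Pi.add_apply]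
    rw [← mul_assoc, ← Complex.exp_add]
    congr 2; ring
  · simp only [actC, Prod.snd_add, Pi.add_apply]
    rw [← mul_assoc, ← Complex.exp_add]
    congr 2; ring

lemma castC_add (g g' : (ι → ℝ) × (Fin m → ℝ)) : castC (g + g') = castC g + castC g' := by
  refine Prod.ext ?_ ?_ <;> funext i <;> simp [castC]

lemma continuous_actC : Continuous fun p : ((ι → ℂ) × (Fin m → ℂ)) × Esp ι m =>
    P.actC p.1 p.2 := by
  unfold actC
  fun_prop

lemma continuous_castC_turn : Continuous fun x : ι ⊕ Fin m → ℝ => castC (turn x) := by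
  unfold castC turn
  fun_prop

/-- Holomorphic functions on the torus, lifted to rescaled coordinates. -/
structure PeriodicFun (t : ℝ) (f : Esp ι m → ℂ) : Prop where
  holo : DifferentiableOn ℂ f (P.dom m t)
  periodic : ∀ k : ι → ℤ, ∀ x ∈ P.dom m t, f (P.actC (fun i => 2 * Real.pi * (k i : ℂ), 0) x) = f x

variable {P} {t : ℝ} {f : Esp ι m → ℂ}

lemma continuous_orbit (hf : ContinuousOn f (P.dom m t)) {y : Esp ι m} (hy : y ∈ P.dom m t) :
    Continuous (P.orbit f y) :=
  hf.comp_continuous ((P.continuous_actC).comp (continuous_castC_turn.prodMk continuous_const))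
    fun x => P.actC_mem (turn x) hy

lemma PeriodicFun.orbit_add (hf : P.PeriodicFun t f) {y : Esp ι m} (hy : y ∈ P.dom m t)
    (k : ι ⊕ Fin m → ℤ) (x : ι ⊕ Fin m → ℝ) :
    P.orbit f y (fun i => x i + k i) = P.orbit f y x := by
  have e : P.actC (castC (turn fun i => x i + k i)) y =
      P.actC (fun i => 2 * Real.pi * (k (.inl i) : ℂ), 0) (P.actC (castC (turn x)) y) := by
    refine Prod.ext ?_ (Prod.ext ?_ (Prod.ext ?_ ?_)) <;> [rfl; funext i; funext i; funext i]
    · simp [actC, castC, turn]; ring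
    · have h : Complex.exp (-(Complex.I * (2 * Real.pi * (x (.inr i) + k (.inr i))))) =
          Complex.exp (-(Complex.I * (2 * Real.pi * x (.inr i)))) := by
        rw [Complex.exp_eq_exp_iff_exists_int]
        exact ⟨-k (.inr i), by push_cast; ring⟩
      simp [actC, castC, turn, h]
    · have h : Complex.exp (Complex.I * (2 * Real.pi * (x (.inr i) + k (.inr i)))) =
          Complex.exp (Complex.I * (2 * Real.pi * x (.inr i))) := by
        rw [Complex.exp_eq_exp_iff_exists_int]
        exact ⟨k (.inr i), by ring⟩
      simp [actC, castC, turn, h]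
  rw [orbit, e, hf.periodic _ _ (P.actC_mem _ hy)]
  rfl

/-- Averaging over the orbit against a character projects on a single mode: holomorphy is that of a
parameter integral, and equivariance is translation of the orbit. -/
lemma PeriodicFun.modeFun (hf : P.PeriodicFun t f) (κ : Mode ι m) :
    P.ModeFun t κ (P.modeCoeff f κ) where
  holo := by
    refine differentiableOn_integral_param isCompact_Icc measurableSet_Icc (P.isOpen_dom t)
      (F := fun y x => Complex.exp (-(2 * Real.pi * Complex.I *
        ∑ i, (modeEquiv ι m κ i : ℂ) * x i)) * P.orbit f y x) ?_ fun x _ => ?_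
    · refine ContinuousOn.mul (Continuous.continuousOn (by fun_prop)) ?_
      refine hf.holo.continuousOn.comp (t := P.dom m t) (Continuous.continuousOn ?_) ?_
      · exact P.continuous_actC.comp ((continuous_castC_turn.comp continuous_snd).prodMk
          continuous_fst)
      · exact fun p hp => P.actC_mem _ hp.1
    · refine DifferentiableOn.const_mul ?_ _
      exact hf.holo.comp (fun y _ =>
        (P.hasFDerivAt_actC _ y).differentiableAt.differentiableWithinAt)
        fun y hy => P.actC_mem _ hy
  mode g y hy := by
    set a : ι ⊕ Fin m → ℝ := Sum.elim (fun i => g.1 i / (2 * Real.pi))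
      (fun j => g.2 j / (2 * Real.pi)) with ha
    have hpi : (2 : ℝ) * Real.pi ≠ 0 := by positivity
    have hta : turn a = g := by
      refine Prod.ext ?_ ?_ <;> funext i <;> simp only [turn, ha, Sum.elim_inl, Sum.elim_inr] <;>
        field_simp
    have hadd : ∀ x, turn (x + a) = turn x + g := fun x => by
      rw [← hta]
      refine Prod.ext ?_ ?_ <;> funext i <;> simp [turn, mul_add]
    have e : P.orbit f (P.actC (castC g) y) = fun x => P.orbit f y (x + a) := by
      funext x
      rw [orbit, orbit, hadd, castC_add, actC_add]
    rw [modeCoeff, e, boxCoeff_translate (continuous_orbit hf.holo.continuousOn hy)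
      (hf.orbit_add hy), sum_modeEquiv, hta, modeCoeff]

lemma PeriodicFun.hasSum_modeCoeff (hf : P.PeriodicFun t f) {y : Esp ι m} (hy : y ∈ P.dom m t)
    (hs : Summable fun κ => P.modeCoeff f κ y) : HasSum (fun κ => P.modeCoeff f κ y) (f y) := by
  have h0 : P.orbit f y 0 = f y := by
    have : castC (turn (0 : ι ⊕ Fin m → ℝ)) = 0 := by
      refine Prod.ext ?_ ?_ <;> funext i <;> simp [castC, turn]
    rw [orbit, this, actC_zero]
  rw [← h0]
  refine (modeEquiv ι m).hasSum_iff.2 (hasSum_boxCoeff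
    (continuous_orbit hf.holo.continuousOn hy) (hf.orbit_add hy) ?_)
  exact (modeEquiv ι m).summable_iff.1 hs

/-- Uniqueness of the modes. -/
lemma modeCoeff_fsum {F : Mode ι m → Esp ι m → ℂ} (hF : ∀ κ, P.ModeFun t κ (F κ)) {y : Esp ι m}
    (hy : y ∈ P.dom m t) (hf : EqOn f (fsum F) (P.dom m t)) (hs : Summable fun κ => ‖F κ y‖)
    (κ : Mode ι m) : P.modeCoeff f κ y = F κ y := by
  have h1 : ∀ x, P.orbit f y x = ∑' κ' : Mode ι m, Complex.exp (2 * Real.pi * Complex.I *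
      ∑ i, (modeEquiv ι m κ' i : ℂ) * x i) * F κ' y := by
    intro x
    rw [orbit, hf (P.actC_mem _ hy), fsum]
    refine tsum_congr fun κ' => ?_
    rw [(hF κ').mode _ y hy, sum_modeEquiv]
  have hnorm : ∀ (n : ι ⊕ Fin m → ℤ) (x : ι ⊕ Fin m → ℝ),
      ‖Complex.exp (2 * Real.pi * Complex.I * ∑ i, (n i : ℂ) * x i)‖ = 1 := by
    intro n x
    have e : 2 * Real.pi * Complex.I * ∑ i, (n i : ℂ) * x i =
        ((2 * Real.pi * ∑ i, (n i : ℝ) * x i : ℝ) : ℂ) * Complex.I := by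
      push_cast; ring
    rw [e, Complex.norm_exp_ofReal_mul_I]
  have hnorm' : ∀ (n : ι ⊕ Fin m → ℤ) (x : ι ⊕ Fin m → ℝ),
      ‖Complex.exp (-(2 * Real.pi * Complex.I * ∑ i, (n i : ℂ) * x i))‖ = 1 := by
    intro n x
    rw [Complex.exp_neg, norm_inv, hnorm, inv_one]
  set H : Mode ι m → (ι ⊕ Fin m → ℝ) → ℂ := fun κ' x =>
    Complex.exp (-(2 * Real.pi * Complex.I * ∑ i, (modeEquiv ι m κ i : ℂ) * x i)) *
      (Complex.exp (2 * Real.pi * Complex.I * ∑ i, (modeEquiv ι m κ' i : ℂ) * x i) * F κ' y)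
    with hH
  have hHc : ∀ κ', Continuous (H κ') := fun κ' => by fun_prop
  have hHn : ∀ κ' x, ‖H κ' x‖ = ‖F κ' y‖ := fun κ' x => by
    rw [hH]; simp only [norm_mul, hnorm, hnorm', one_mul]
  -- The absolutely convergent series is integrated term by term; by orthogonality only the term of
  -- index `κ` survives.
  have h2 := hasSum_integral_of_summable_integral_norm
    (μ := volume.restrict (Icc (0 : ι ⊕ Fin m → ℝ) 1)) (F := H)
    (fun κ' => (hHc κ').continuousOn.integrableOn_compact isCompact_Icc) (by
      simp only [hHn]
      simpa [setIntegral_const, volume_unit_box] using hs)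
  have h3 : ∫ x in Icc (0 : ι ⊕ Fin m → ℝ) 1, ∑' κ', H κ' x = P.modeCoeff f κ y := by
    rw [modeCoeff, boxCoeff]
    congr 1
    funext x
    rw [h1, tsum_mul_left]
  have h4 : ∀ κ', ∫ x in Icc (0 : ι ⊕ Fin m → ℝ) 1, H κ' x = if κ' = κ then F κ y else 0 := by
    intro κ'
    split_ifs with h
    · subst h
      exact boxCoeff_self _ _
    · exact boxCoeff_character _ fun h' => h ((modeEquiv ι m).injective h')
  rw [← h3, ← h2.tsum_eq]
  simp only [h4, tsum_ite_eq]

open scoped Pointwise in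
lemma integral_scaled_box {α : Type} [Fintype α] (g : (α → ℝ) → ℂ) :
    ∫ x in Icc (0 : α → ℝ) (fun _ => 2 * Real.pi), g x =
      ((2 * Real.pi : ℝ) : ℂ) ^ Fintype.card α * ∫ x in Icc (0 : α → ℝ) 1,
        g ((2 * Real.pi) • x) := by
  have hpi : (0 : ℝ) < 2 * Real.pi := by positivity
  have h := Measure.setIntegral_comp_smul (volume : Measure (α → ℝ)) g (Icc (0 : α → ℝ) 1) hpi.ne'
  have e : (2 * Real.pi) • Icc (0 : α → ℝ) 1 = Icc (0 : α → ℝ) (fun _ => 2 * Real.pi) := by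
    ext x
    rw [mem_smul_set_iff_inv_smul_mem₀ hpi.ne']
    simp only [mem_Icc, Pi.le_def, Pi.smul_apply, smul_eq_mul, Pi.zero_apply, Pi.one_apply]
    refine and_congr (forall_congr' fun i => ?_) (forall_congr' fun i => ?_)
    · exact mul_nonneg_iff_of_pos_left (inv_pos.2 hpi)
    · rw [inv_mul_le_iff₀ hpi, mul_one]
  rw [e, Module.finrank_fintype_fun_eq_card, abs_of_pos (by positivity)] at h
  rw [h, Complex.real_smul, ← mul_assoc]
  push_cast
  rw [mul_inv_cancel₀ (pow_ne_zero _ (mul_ne_zero two_ne_zero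
    (Complex.ofReal_ne_zero.2 Real.pi_ne_zero))), one_mul]

lemma chart_actC (g : (ι → ℝ) × (Fin m → ℝ)) (u : Base ι m) :
    P.chart (P.actC (castC g) (P.chart.symm (u.1, 0, u.2))) =
      (u.1, fun i => (g.1 i : ℂ), rot P.kd g.2 u.2) := by
  have hz : ∀ a b : ℂ, (P.ε' : ℂ) * (a * ((P.ε' : ℂ)⁻¹ * b)) = a * b := fun a b => by
    have := P.ε_ne
    field_simp
  rw [chart_apply, chart_symm_apply]
  simp only [actC, castC, rot, hz]
  refine Prod.ext ?_ (Prod.ext ?_ rfl)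
  · funext i
    simp [mul_inv_cancel_left₀ P.r_ne]
  · funext i
    simp [mul_inv_cancel_left₀ P.s_ne]

/-- Fubini and the change of variables by `2π` turn the iterated integral into one over the unit
box. The orbit is taken of the point with vanishing angles, since the real angles of the integrand
are then those of the group element. -/
lemma fourierPart_eq {f : Phase ι m → ℂ} (hf : ContinuousOn f (P.phaseDom m t)) {u : Base ι m}
    (hu : P.chart.symm (u.1, 0, u.2) ∈ P.dom m t) (κ : Mode ι m) :
    fourierPart P.kd f κ u =
      P.modeCoeff (fun x => f (P.chart x)) κ (P.chart.symm (u.1, 0, u.2)) := by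
  set y := P.chart.symm (u.1, 0, u.2) with hy
  have hpi : ((2 * Real.pi : ℝ) : ℂ) ≠ 0 := by
    exact_mod_cast (by positivity : (2 : ℝ) * Real.pi ≠ 0)
  have hfc : ContinuousOn (fun x => f (P.chart x)) (P.dom m t) :=
    hf.comp P.chart.continuous.continuousOn fun x hx => hx
  set H : (ι → ℝ) × (Fin m → ℝ) → ℂ := fun g =>
    f (u.1, fun i => (g.1 i : ℂ), rot P.kd g.2 u.2) * Complex.exp (-(Complex.I *
      (∑ i, (κ.1 i : ℂ) * (g.1 i : ℂ) + ∑ j, (κ.2 j : ℂ) * (g.2 j : ℂ)))) with hH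
  have hHeq : ∀ g, H g = Complex.exp (-(Complex.I * phase (castC g) κ)) *
      f (P.chart (P.actC (castC g) y)) := fun g => by
    rw [hy, chart_actC, hH, mul_comm]; rfl
  have hHc : Continuous H := by
    rw [funext hHeq]
    refine Continuous.mul ?_ ?_
    · unfold phase castC; fun_prop
    · refine hfc.comp_continuous (P.continuous_actC.comp (Continuous.prodMk ?_ continuous_const))
        fun g => P.actC_mem g hu
      fun_prop
  have h1 : fourierPart P.kd f κ u = ∫ θ in Icc (0 : ι → ℝ) 1, ∫ ψ in Icc (0 : Fin m → ℝ) 1,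
      H ((2 * Real.pi) • θ, (2 * Real.pi) • ψ) := by
    change _ * ∫ θ in Icc (0 : ι → ℝ) (fun _ => 2 * Real.pi),
      ∫ ψ in Icc (0 : Fin m → ℝ) (fun _ => 2 * Real.pi), H (θ, ψ) = _
    rw [integral_scaled_box]
    simp only [integral_scaled_box]
    rw [integral_const_mul, Fintype.card_fin, ← mul_assoc, ← mul_assoc, pow_add, mul_assoc,
      mul_assoc, mul_assoc]
    rw [mul_left_comm (((2 * Real.pi : ℝ) : ℂ)⁻¹ ^ m), ← mul_assoc, ← mul_assoc _ _
      (∫ θ in Icc (0 : ι → ℝ) 1, _), ← mul_pow, ← mul_pow, inv_mul_cancel₀ hpi]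
    simp
  have hcont : Continuous fun g : (ι → ℝ) × (Fin m → ℝ) =>
      H ((2 * Real.pi) • g.1, (2 * Real.pi) • g.2) := hHc.comp (by fun_prop)
  rw [h1, ← setIntegral_prod (fun g : (ι → ℝ) × (Fin m → ℝ) =>
    H ((2 * Real.pi) • g.1, (2 * Real.pi) • g.2))
    (hcont.continuousOn.integrableOn_compact (isCompact_Icc.prod isCompact_Icc)), modeCoeff,
    boxCoeff]
  have hmp := volume_measurePreserving_sumPiEquivProdPi (fun _ : ι ⊕ Fin m => ℝ)
  have h2 := hmp.setIntegral_preimage_emb (MeasurableEquiv.measurableEmbedding _)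
    (fun g : (ι → ℝ) × (Fin m → ℝ) => H ((2 * Real.pi) • g.1, (2 * Real.pi) • g.2))
    (Icc (0 : ι → ℝ) 1 ×ˢ Icc (0 : Fin m → ℝ) 1)
  rw [Measure.volume_eq_prod] at h2
  rw [← h2]
  have e : (MeasurableEquiv.sumPiEquivProdPi fun _ : ι ⊕ Fin m => ℝ) ⁻¹'
      Icc (0 : ι → ℝ) 1 ×ˢ Icc (0 : Fin m → ℝ) 1 = Icc 0 1 := by
    ext x
    simp only [mem_preimage, mem_prod, mem_Icc, Pi.le_def, MeasurableEquiv.coe_sumPiEquivProdPi,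
      Equiv.sumPiEquivProdPi_apply, Sum.forall]
    exact ⟨fun h => ⟨⟨h.1.1, h.2.1⟩, ⟨h.1.2, h.2.2⟩⟩, fun h => ⟨⟨h.1.1, h.2.1⟩, ⟨h.1.2, h.2.2⟩⟩⟩
  rw [e]
  congr 1
  funext x
  rw [hHeq, sum_modeEquiv]
  rfl

end Scales

end Averaging

/-! ### Complexified torus orbits and the supremum of a mode. -/

namespace Averaging

namespace Scales

variable {ι : Type} [Fintype ι] [DecidableEq ι] {m : ℕ} {P : Scales ι}
variable {t : ℝ} {κ : Mode ι m} {F : Esp ι m → ℂ}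

lemma norm_exp_I_mul (c : ℂ) : ‖Complex.exp (Complex.I * c)‖ = Real.exp (-c.im) := by
  rw [Complex.norm_exp]; simp

lemma norm_exp_neg_I_mul (c : ℂ) : ‖Complex.exp (-(Complex.I * c))‖ = Real.exp c.im := by
  rw [Complex.norm_exp]; simp

/-- The domains are convex along orbits of one-parameter groups. -/
lemma actC_segment_mem {g : (ι → ℂ) × (Fin m → ℂ)} {x : Esp ι m} (hx : x ∈ P.dom m t)
    (hg : P.actC g x ∈ P.dom m t) {τ : ℝ} (hτ : τ ∈ Icc (0 : ℝ) 1) :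
    P.actC ((τ : ℂ) • g) x ∈ P.dom m t := by
  rw [mem_dom_iff] at hx hg ⊢
  obtain ⟨h1, h2, h3⟩ := hx
  obtain ⟨-, k2, k3⟩ := hg
  have h0 : 0 ≤ 1 - τ := by linarith [hτ.2]
  have key : ∀ (c : ℝ) (z : ℂ) (E : ℝ), ‖z‖ < E → Real.exp c * ‖z‖ < E →
      Real.exp (τ * c) * ‖z‖ < E := by
    intro c z E h4 h5
    rcases le_total c 0 with hc | hc
    · refine lt_of_le_of_lt ?_ h4
      have : Real.exp (τ * c) ≤ 1 := Real.exp_le_one_iff.2 (mul_nonpos_of_nonneg_of_nonpos hτ.1 hc)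
      nlinarith [norm_nonneg z]
    · refine lt_of_le_of_lt ?_ h5
      have : Real.exp (τ * c) ≤ Real.exp c := Real.exp_le_exp.2 (by nlinarith [hτ.2])
      gcongr
  refine ⟨h1, fun i => ?_, fun j => ⟨?_, ?_⟩⟩
  · have e : (P.s' * (P.actC ((τ : ℂ) • g) x).2.1 i).im =
        (1 - τ) * (P.s' * x.2.1 i).im + τ * (P.s' * (P.actC g x).2.1 i).im := by
      simp [actC]; ring
    have h7 := (convex_Ioo (-(P.s - t * P.s')) (P.s - t * P.s')) (abs_lt.1 (h2 i))
      (abs_lt.1 (k2 i)) h0 hτ.1 (by ring)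
    rw [e]
    exact abs_lt.2 h7
  · have h4 := (h3 j).1
    have h5 := (k3 j).1
    simp only [actC, mul_left_comm (P.ε' : ℂ), norm_mul, norm_exp_neg_I_mul] at h5 ⊢
    rw [← norm_mul] at h5 ⊢
    have := key _ _ _ h4 h5
    simpa using this
  · have h4 := (h3 j).2
    have h5 := (k3 j).2
    simp only [actC, mul_left_comm (P.ε' : ℂ), norm_mul, norm_exp_I_mul] at h5 ⊢
    rw [← norm_mul] at h5 ⊢
    have := key _ _ _ h4 h5
    simpa using this

lemma ModeFun.apply_actC_of_mem (hF : P.ModeFun t κ F) {g : (ι → ℂ) × (Fin m → ℂ)} {x : Esp ι m}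
    (hx : x ∈ P.dom m t) (hg : P.actC g x ∈ P.dom m t) :
    F (P.actC g x) = Complex.exp (Complex.I * phase g κ) * F x :=
  hF.apply_actC g fun _ hτ => actC_segment_mem hx hg hτ

variable (P) in
/-- The point with vanishing angles over a point of the base. -/
noncomputable def basePoint (u : Base ι m) : Esp ι m := P.chart.symm (u.1, 0, u.2)

lemma basePoint_mem (hs : 0 < P.s - t * P.s') {u : Base ι m} :
    P.basePoint u ∈ P.dom m t ↔
      u ∈ baseDomain P.kd P.A (P.r - t * P.r') (P.ε - t * P.ε') := by
  rw [dom, Set.mem_ofPred_eq, basePoint, ContinuousLinearEquiv.apply_symm_apply]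
  simp [phaseDom, domain, baseDomain, hs]

lemma chart_mem_baseDomain {x : Esp ι m} (hx : x ∈ P.dom m t) :
    ((P.chart x).1, (P.chart x).2.2) ∈
      baseDomain P.kd P.A (P.r - t * P.r') (P.ε - t * P.ε') := ⟨hx.1, hx.2.2⟩

lemma actC_basePoint (x : Esp ι m) :
    P.actC ((P.chart x).2.1, 0) (P.basePoint ((P.chart x).1, (P.chart x).2.2)) = x := by
  refine Prod.ext ?_ (Prod.ext ?_ (Prod.ext ?_ ?_)) <;> [ext i; funext i; funext i; funext i] <;>
    simp [actC, basePoint, chart_symm_apply, chart_apply, zCoord_p_q, wCoord_p_q, P.r_ne, P.s_ne,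
      P.ε_ne]

lemma pos_s {x : Esp ι m} (hs : 0 < P.s - t * P.s') (hx : x ∈ P.dom m t) :
    P.basePoint ((P.chart x).1, (P.chart x).2.2) ∈ P.dom m t :=
  (basePoint_mem hs).2 (chart_mem_baseDomain hx)

lemma ModeFun.eq_basePoint (hF : P.ModeFun t κ F) (hs : 0 < P.s - t * P.s') {x : Esp ι m}
    (hx : x ∈ P.dom m t) : F x = Complex.exp (Complex.I * ∑ i, (κ.1 i : ℂ) * (P.chart x).2.1 i) *
      F (P.basePoint ((P.chart x).1, (P.chart x).2.2)) := by
  have h := hF.apply_actC_of_mem (pos_s hs hx) (by rwa [actC_basePoint])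
  rw [actC_basePoint] at h
  rw [h]
  simp [phase]

lemma coords_basePoint (u : Base ι m) (j : Fin m) :
    P.ε' * (P.basePoint u).2.2.1 j = zCoord P.kd (u.2.1 j) (u.2.2 j) ∧
    P.ε' * (P.basePoint u).2.2.2 j = wCoord P.kd (u.2.1 j) (u.2.2 j) := by
  simp [basePoint, chart_symm_apply, mul_inv_cancel_left₀ P.ε_ne]

/-- A mode vanishes where its monomial vanishes. -/
lemma ModeFun.eq_zero (hF : P.ModeFun t κ F) {x : Esp ι m} (hx : x ∈ P.dom m t) {j : Fin m}
    (hj : κ.2 j < 0 ∧ x.2.2.1 j = 0 ∨ 0 < κ.2 j ∧ x.2.2.2 j = 0) : F x = 0 := by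
  classical
  -- The sign of an imaginary rotation of the `j`-th pair that contracts the coordinate which need
  -- not vanish. Along it the point stays in the domain and converges, while the mode is multiplied
  -- by `e^{|l_j| y}`; letting `y` tend to infinity forces `F x = 0`.
  set ς : ℝ := if κ.2 j < 0 then 1 else -1 with hς
  set g : ℝ → (ι → ℂ) × (Fin m → ℂ) := fun y => (0, Pi.single j (Complex.I * (ς * y))) with hg
  have h1 : ∀ y i, i ≠ j → (P.actC (g y) x).2.2.1 i = x.2.2.1 i ∧
      (P.actC (g y) x).2.2.2 i = x.2.2.2 i := by
    intro y i hi
    simp [actC, hg, Pi.single_eq_of_ne hi]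
  have h2 : ∀ y, (P.actC (g y) x).2.2.1 j = Complex.exp ((ς * y : ℝ) : ℂ) * x.2.2.1 j ∧
      (P.actC (g y) x).2.2.2 j = Complex.exp ((-(ς * y) : ℝ) : ℂ) * x.2.2.2 j := by
    intro y
    have e1 : -(Complex.I * (Complex.I * (ς * y))) = ((ς * y : ℝ) : ℂ) := by
      push_cast; linear_combination (-(ς * y : ℂ)) * Complex.I_sq
    have e2 : Complex.I * (Complex.I * (ς * y)) = ((-(ς * y) : ℝ) : ℂ) := by
      push_cast; linear_combination (ς * y : ℂ) * Complex.I_sq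
    refine ⟨?_, ?_⟩
    · simp only [actC, hg, Pi.single_eq_same, e1]
    · simp only [actC, hg, Pi.single_eq_same, e2]
  set x' : Esp ι m := (x.1, x.2.1, fun i => if i = j then 0 else x.2.2.1 i,
    fun i => if i = j then 0 else x.2.2.2 i) with hx'
  have hmem : ∀ y : ℝ, 0 ≤ y → P.actC (g y) x ∈ P.dom m t := by
    intro y hy
    rw [mem_dom_iff] at hx ⊢
    obtain ⟨k1, k2, k3⟩ := hx
    refine ⟨k1, fun i => ?_, fun i => ?_⟩
    · simpa [actC, hg] using k2 i
    · by_cases hi : i = j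
      · subst hi
        rw [(h2 y).1, (h2 y).2]
        have hE : 0 < P.ε - t * P.ε' := (norm_nonneg _).trans_lt (k3 i).1
        have hle : ∀ z : ℂ, ‖(P.ε' : ℂ) * (Complex.exp ((-y : ℝ) : ℂ) * z)‖ ≤ ‖(P.ε' : ℂ) * z‖ := by
          intro z
          rw [mul_left_comm, norm_mul, ← Complex.ofReal_exp, Complex.norm_real,
            Real.norm_of_nonneg (Real.exp_pos _).le]
          have := Real.exp_le_one_iff.2 (neg_nonpos.2 hy)
          nlinarith [norm_nonneg ((P.ε' : ℂ) * z)]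
        rcases hj with ⟨h3, h4⟩ | ⟨h3, h4⟩
        · rw [h4, hς, if_pos h3, one_mul, mul_zero, mul_zero, norm_zero]
          exact ⟨hE, (hle _).trans_lt (k3 i).2⟩
        · rw [h4, hς, if_neg (by lia), neg_one_mul, mul_zero, mul_zero, norm_zero]
          exact ⟨(hle _).trans_lt (k3 i).1, hE⟩
      · rw [(h1 y i hi).1, (h1 y i hi).2]
        exact k3 i
  have hx'mem : x' ∈ P.dom m t := by
    rw [mem_dom_iff] at hx ⊢
    obtain ⟨k1, k2, k3⟩ := hx
    refine ⟨k1, k2, fun i => ?_⟩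
    have hE : 0 < P.ε - t * P.ε' := (norm_nonneg _).trans_lt (k3 i).1
    by_cases hi : i = j
    · simpa [hx', hi] using hE
    · simpa only [hx', if_neg hi] using k3 i
  have hexp : Tendsto (fun y : ℝ => Complex.exp ((-y : ℝ) : ℂ)) atTop (𝓝 0) := by
    have := (Complex.continuous_ofReal.tendsto 0).comp
      (Real.tendsto_exp_atBot.comp tendsto_neg_atTop_atBot)
    simpa [Function.comp_def] using this
  have hlim : Tendsto (fun y => P.actC (g y) x) atTop (𝓝 x') := by
    refine Tendsto.prodMk_nhds tendsto_const_nhds (Tendsto.prodMk_nhds ?_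
      (Tendsto.prodMk_nhds (tendsto_pi_nhds.2 fun i => ?_) (tendsto_pi_nhds.2 fun i => ?_)))
    · simp [hg]
    · change Tendsto (fun y => (P.actC (g y) x).2.2.1 i) atTop _
      by_cases hi : i = j
      · subst hi
        simp only [h2, if_true]
        rcases hj with ⟨h3, h4⟩ | ⟨h3, h4⟩
        · simp [h4]
        · simp only [hς, if_neg (show ¬ κ.2 i < 0 by lia), neg_one_mul]
          simpa using hexp.mul_const (x.2.2.1 i)
      · simp only [h1 _ i hi, if_neg hi]
        exact tendsto_const_nhds
    · change Tendsto (fun y => (P.actC (g y) x).2.2.2 i) atTop _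
      by_cases hi : i = j
      · subst hi
        simp only [h2, if_true]
        rcases hj with ⟨h3, h4⟩ | ⟨h3, h4⟩
        · simp only [hς, if_pos h3, one_mul]
          simpa using hexp.mul_const (x.2.2.2 i)
        · simp [h4]
      · simp only [h1 _ i hi, if_neg hi]
        exact tendsto_const_nhds
  have hFlim := ((hF.holo.continuousOn.continuousAt
    ((P.isOpen_dom t).mem_nhds hx'mem)).tendsto).comp hlim
  have hk : (1 : ℝ) ≤ |(κ.2 j : ℝ)| := by
    have : (1 : ℤ) ≤ |κ.2 j| := Int.one_le_abs (by rcases hj with h | h <;> lia)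
    exact_mod_cast this
  have hς2 : (κ.2 j : ℝ) * ς = -|(κ.2 j : ℝ)| := by
    rcases hj with ⟨h3, h4⟩ | ⟨h3, h4⟩
    · have : (κ.2 j : ℝ) < 0 := by exact_mod_cast h3
      rw [hς, if_pos h3, abs_of_neg this]; ring
    · have : (0 : ℝ) < κ.2 j := by exact_mod_cast h3
      rw [hς, if_neg (by lia), abs_of_pos this]; ring
  have hval : ∀ y : ℝ, 0 ≤ y → F x = Complex.exp ((-(|(κ.2 j : ℝ)| * y) : ℝ) : ℂ) *
      F (P.actC (g y) x) := by
    intro y hy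
    rw [hF.apply_actC_of_mem hx (hmem y hy), ← mul_assoc, ← Complex.exp_add]
    have e : phase (g y) κ = (κ.2 j : ℂ) * (Complex.I * (ς * y)) := by
      simp only [phase, hg, Pi.zero_apply, mul_zero, Finset.sum_const_zero, zero_add]
      rw [Finset.sum_eq_single j]
      · rw [Pi.single_eq_same]
      · intro i _ hi
        rw [Pi.single_eq_of_ne hi, mul_zero]
      · simp
    have e2 : ((-(|(κ.2 j : ℝ)| * y) : ℝ) : ℂ) + Complex.I * phase (g y) κ = 0 := by
      rw [e, ← neg_mul, ← hς2]
      push_cast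
      linear_combination ((κ.2 j : ℂ) * ς * y) * Complex.I_sq
    rw [e2, Complex.exp_zero, one_mul]
  have hexp2 : Tendsto (fun y : ℝ => Complex.exp ((-(|(κ.2 j : ℝ)| * y) : ℝ) : ℂ)) atTop (𝓝 0) :=
    hexp.comp (tendsto_id.const_mul_atTop (by linarith))
  have h5 := hexp2.mul hFlim
  rw [zero_mul] at h5
  refine tendsto_nhds_unique (tendsto_const_nhds (x := F x) (f := atTop)) (h5.congr' ?_)
  filter_upwards [eventually_ge_atTop 0] with y hy
  exact (hval y hy).symm

/-- `|k|₁`. -/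
noncomputable def angleNorm (κ : Mode ι m) : ℝ := ∑ i, |(κ.1 i : ℝ)|

/-- The direction of the complexified torus in which a mode grows. -/
noncomputable def growth (κ : Mode ι m) (θ : ℝ) (y : Fin m → ℝ) : (ι → ℂ) × (Fin m → ℂ) :=
  (fun i => -(Complex.I * ((SignType.sign (κ.1 i) : ℤ) * θ : ℝ)),
    fun j => Complex.I * (y j : ℝ))

lemma norm_exp_growth (κ : Mode ι m) (θ : ℝ) (y : Fin m → ℝ) :
    ‖Complex.exp (Complex.I * phase (growth κ θ y) κ)‖ =
      Real.exp (angleNorm κ * θ) * ∏ j, Real.exp (-(κ.2 j * y j)) := by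
  rw [norm_exp_I_mul, ← Real.exp_sum, ← Real.exp_add]
  congr 1
  have h : ∀ i, (((κ.1 i : ℤ) : ℂ) * -(Complex.I * (((SignType.sign (κ.1 i) : ℤ) * θ : ℝ) : ℂ))).im =
      -(|(κ.1 i : ℝ)| * θ) := by
    intro i
    have h2 : |(κ.1 i : ℝ)| = κ.1 i * (SignType.sign (κ.1 i) : ℤ) := by
      have := self_mul_sign (κ.1 i)
      rw [← Int.cast_abs, ← this]
      push_cast; rfl
    rw [h2]
    simp
    ring
  have h' : ∀ j, (((κ.2 j : ℤ) : ℂ) * (Complex.I * ((y j : ℝ) : ℂ))).im = κ.2 j * y j := by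
    intro j; simp
  simp only [phase, growth, Complex.add_im, Complex.im_sum, h, h', Finset.sum_neg_distrib,
    angleNorm, Finset.sum_mul]
  ring

lemma norm_coords_growth (κ : Mode ι m) (θ : ℝ) (y : Fin m → ℝ) (x : Esp ι m) (j : Fin m) :
    ‖P.ε' * (P.actC (growth κ θ y) x).2.2.1 j‖ = Real.exp (y j) * ‖P.ε' * x.2.2.1 j‖ ∧
    ‖P.ε' * (P.actC (growth κ θ y) x).2.2.2 j‖ = Real.exp (-y j) * ‖P.ε' * x.2.2.2 j‖ := by
  simp only [actC, mul_left_comm (P.ε' : ℂ), norm_mul, norm_exp_I_mul, norm_exp_neg_I_mul]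
  simp [growth]

lemma im_growth (κ : Mode ι m) {θ : ℝ} (hθ : 0 ≤ θ) (y : Fin m → ℝ) (x : Esp ι m) (i : ι) :
    |(P.s' * (P.actC (growth κ θ y) x).2.1 i).im| ≤ |(P.s' * x.2.1 i).im| + θ := by
  have e : (P.s' : ℂ) * (P.actC (growth κ θ y) x).2.1 i = P.s' * x.2.1 i +
      -(Complex.I * ((SignType.sign (κ.1 i) : ℤ) * θ : ℝ)) := by
    simp only [actC, growth, mul_add, mul_inv_cancel_left₀ P.s_ne]
  rw [e, Complex.add_im]
  refine (abs_add_le _ _).trans (add_le_add le_rfl ?_)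
  have h : |((SignType.sign (κ.1 i) : ℤ) : ℝ)| ≤ 1 := by
    rcases SignType.trichotomy (SignType.sign (κ.1 i)) with h | h | h <;> rw [h] <;> simp
  have : |(-(Complex.I * (((SignType.sign (κ.1 i) : ℤ) * θ : ℝ) : ℂ))).im| =
      |((SignType.sign (κ.1 i) : ℤ) : ℝ)| * θ := by
    rw [Complex.neg_im, abs_neg, Complex.I_mul_im, Complex.ofReal_re, abs_mul, abs_of_nonneg hθ]
  rw [this]
  exact mul_le_of_le_one_left hθ h

lemma norm_monomial (kd : Kind) (l : Fin m → ℤ) (y : (Fin m → ℂ) × (Fin m → ℂ)) :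
    ‖monomial kd l y‖ = ∏ j, ‖zCoord kd (y.1 j) (y.2 j)‖ ^ (-l j).toNat *
      ‖wCoord kd (y.1 j) (y.2 j)‖ ^ (l j).toNat := by
  simp [monomial, norm_prod]

/-- The supremum of a mode in terms of the supremum of its coefficient. -/
lemma ModeFun.sup_eq (hF : P.ModeFun t κ F) (hs : 0 < P.s - t * P.s')
    (hε : 0 < P.ε - t * P.ε') :
    (⨆ u ∈ baseDomain P.kd P.A (P.r - t * P.r') (P.ε - t * P.ε'),
      ‖F (P.basePoint u) / monomial P.kd κ.2 u.2‖ₑ) *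
      ENNReal.ofReal (Real.exp ((∑ i, |(κ.1 i : ℝ)|) * (P.s - t * P.s'))) *
      ENNReal.ofReal ((P.ε - t * P.ε') ^ (∑ j, (κ.2 j).natAbs)) = (P.system m).supN t F := by
  set s := P.s - t * P.s' with hsdef
  set ε := P.ε - t * P.ε' with hεdef
  apply le_antisymm
  · rw [mul_assoc, ENNReal.iSup_mul]
    refine iSup_le fun u => ?_
    rw [ENNReal.iSup_mul]
    refine iSup_le fun hu => ?_
    have hx := (basePoint_mem (m := m) hs).2 hu
    set x := P.basePoint u with hxdef
    by_cases hmono : monomial P.kd κ.2 u.2 = 0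
    · simp [hmono]
    by_cases htop : (P.system m).supN t F = ⊤
    · rw [htop]; exact le_top
    have hzw : ∀ j, ‖zCoord P.kd (u.2.1 j) (u.2.2 j)‖ < ε ∧ ‖wCoord P.kd (u.2.1 j) (u.2.2 j)‖ < ε :=
      hu.2
    have hne : ∀ j, (κ.2 j < 0 → zCoord P.kd (u.2.1 j) (u.2.2 j) ≠ 0) ∧
        (0 < κ.2 j → wCoord P.kd (u.2.1 j) (u.2.2 j) ≠ 0) := by
      intro j
      have h1 := Finset.prod_ne_zero_iff.1 hmono j (Finset.mem_univ j)
      refine ⟨fun h2 h3 => h1 ?_, fun h2 h3 => h1 ?_⟩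
      · rw [h3, zero_pow (by lia), zero_mul]
      · rw [h3, zero_pow (n := (κ.2 j).toNat) (by lia), mul_zero]
    -- For `τ < 1`, the base point is moved along the complex torus until the angles with nonzero
    -- frequency have imaginary part of modulus `τ s` and the coordinates in the monomial have
    -- modulus `τ ε`. The mode grows there to its coefficient times the weights with `τ s` and `τ
    -- ε`.
    have hev : ∀ᶠ τ : ℝ in 𝓝[<] 1, ‖F x / monomial P.kd κ.2 u.2‖ *
        (Real.exp (angleNorm κ * (τ * s)) * (τ * ε) ^ (∑ j, (κ.2 j).natAbs)) ≤
        ((P.system m).supN t F).toReal := by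
      have hev1 : ∀ᶠ τ : ℝ in 𝓝[<] 1, ∀ j, ‖zCoord P.kd (u.2.1 j) (u.2.2 j)‖ < τ * ε ∧
          ‖wCoord P.kd (u.2.1 j) (u.2.2 j)‖ < τ * ε := by
        rw [eventually_all]
        intro j
        have hc : Tendsto (fun τ : ℝ => τ * ε) (𝓝[<] 1) (𝓝 ε) := by
          have : ContinuousAt (fun τ : ℝ => τ * ε) 1 := by fun_prop
          simpa using this.tendsto.mono_left nhdsWithin_le_nhds
        exact (hc.eventually_const_lt (hzw j).1).and (hc.eventually_const_lt (hzw j).2)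
      have hev2 : ∀ᶠ τ : ℝ in 𝓝[<] 1, τ ∈ Ioo (0 : ℝ) 1 := Ioo_mem_nhdsLT (by norm_num)
      filter_upwards [hev1, hev2] with τ hτ1 hτ2
      set ρ := τ * ε with hρ
      have hρ0 : 0 < ρ := mul_pos hτ2.1 hε
      have hρε : ρ < ε := by rw [hρ]; nlinarith [hτ2.2]
      -- Of each pair, only one coordinate occurs in the monomial. It is enlarged to modulus `ρ`,
      -- and the other one shrinks by the same factor, so the point stays in the domain.
      set y : Fin m → ℝ := fun j => if κ.2 j < 0 then
        Real.log (ρ / ‖zCoord P.kd (u.2.1 j) (u.2.2 j)‖) else if 0 < κ.2 j then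
        -Real.log (ρ / ‖wCoord P.kd (u.2.1 j) (u.2.2 j)‖) else 0 with hy
      have hmem : P.actC (growth κ (τ * s) y) x ∈ P.dom m t := by
        obtain ⟨k1, k2, k3⟩ := P.mem_dom_iff.1 hx
        refine P.mem_dom_iff.2 ⟨k1, fun i => ?_, fun j => ?_⟩
        · refine (im_growth κ (mul_nonneg hτ2.1.le hs.le) y x i).trans_lt ?_
          have e : (P.s' * x.2.1 i).im = 0 := by simp [hxdef, basePoint, chart_symm_apply]
          rw [e, abs_zero, zero_add]
          nlinarith [hτ2.2]
        · rw [(norm_coords_growth κ _ y x j).1, (norm_coords_growth κ _ y x j).2, hxdef,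
            (coords_basePoint u j).1, (coords_basePoint u j).2]
          rcases lt_trichotomy (κ.2 j) 0 with h | h | h
          · have hz := norm_pos_iff.2 ((hne j).1 h)
            have hy1 : y j = Real.log (ρ / ‖zCoord P.kd (u.2.1 j) (u.2.2 j)‖) := by
              rw [hy]; simp only [if_pos h]
            have hy0 : 0 ≤ y j := by
              rw [hy1]
              exact Real.log_nonneg ((one_le_div hz).2 (hτ1 j).1.le)
            refine ⟨?_, ?_⟩
            · rw [hy1, Real.exp_log (div_pos hρ0 hz), div_mul_cancel₀ _ hz.ne']
              exact hρε
            · have := Real.exp_le_one_iff.2 (neg_nonpos.2 hy0)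
              exact (mul_le_of_le_one_left (norm_nonneg _) this).trans_lt (hzw j).2
          · have hy1 : y j = 0 := by simp [hy, h]
            simpa [hy1] using hzw j
          · have hz := norm_pos_iff.2 ((hne j).2 h)
            have hy1 : y j = -Real.log (ρ / ‖wCoord P.kd (u.2.1 j) (u.2.2 j)‖) := by
              rw [hy]; simp only [if_neg (not_lt.2 h.le), if_pos h]
            have hy0 : y j ≤ 0 := by
              rw [hy1]
              exact neg_nonpos.2 (Real.log_nonneg ((one_le_div hz).2 (hτ1 j).2.le))
            refine ⟨?_, ?_⟩
            · have := Real.exp_le_one_iff.2 hy0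
              exact (mul_le_of_le_one_left (norm_nonneg _) this).trans_lt (hzw j).1
            · rw [hy1, neg_neg, Real.exp_log (div_pos hρ0 hz), div_mul_cancel₀ _ hz.ne']
              exact hρε
      have hval := hF.apply_actC_of_mem hx hmem
      have hbd := ModeSystem.norm_le_toReal_supN (S := P.system m) htop hmem
      rw [hval, norm_mul, norm_exp_growth] at hbd
      have hmono' : (∏ j, Real.exp (-(κ.2 j * y j))) * ‖monomial P.kd κ.2 u.2‖ =
          ρ ^ (∑ j, (κ.2 j).natAbs) := by
        rw [norm_monomial, ← Finset.prod_mul_distrib, ← Finset.prod_pow_eq_pow_sum]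
        refine Finset.prod_congr rfl fun j _ => ?_
        rcases lt_trichotomy (κ.2 j) 0 with h | h | h
        · have hz := norm_pos_iff.2 ((hne j).1 h)
          have e1 : (-κ.2 j).toNat = (κ.2 j).natAbs := by lia
          have e2 : (κ.2 j).toNat = 0 := by lia
          have e3 : -((κ.2 j : ℝ) * y j) = ((κ.2 j).natAbs : ℕ) *
              Real.log (ρ / ‖zCoord P.kd (u.2.1 j) (u.2.2 j)‖) := by
            have : (((κ.2 j).natAbs : ℕ) : ℝ) = -(κ.2 j : ℝ) := by
              rw [Nat.cast_natAbs, abs_of_neg h, Int.cast_neg]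
            rw [this, hy]; simp only [if_pos h]; ring
          rw [e1, e2, e3, Real.exp_nat_mul, Real.exp_log (div_pos hρ0 hz), pow_zero, mul_one,
            ← mul_pow, div_mul_cancel₀ _ hz.ne']
        · simp [h]
        · have hz := norm_pos_iff.2 ((hne j).2 h)
          have e1 : (κ.2 j).toNat = (κ.2 j).natAbs := by lia
          have e2 : (-κ.2 j).toNat = 0 := by lia
          have e3 : -((κ.2 j : ℝ) * y j) = ((κ.2 j).natAbs : ℕ) *
              Real.log (ρ / ‖wCoord P.kd (u.2.1 j) (u.2.2 j)‖) := by
            have : (((κ.2 j).natAbs : ℕ) : ℝ) = (κ.2 j : ℝ) := by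
              rw [Nat.cast_natAbs, abs_of_pos h]
            rw [this, hy]; simp only [if_neg (not_lt.2 h.le), if_pos h]; ring
          rw [e1, e2, e3, Real.exp_nat_mul, Real.exp_log (div_pos hρ0 hz), pow_zero, one_mul,
            ← mul_pow, div_mul_cancel₀ _ hz.ne']
      refine le_trans (le_of_eq ?_) hbd
      rw [← hmono', norm_div]
      have := norm_ne_zero_iff.2 hmono
      field_simp
    have hlim : Tendsto (fun τ : ℝ => ‖F x / monomial P.kd κ.2 u.2‖ *
        (Real.exp (angleNorm κ * (τ * s)) * (τ * ε) ^ (∑ j, (κ.2 j).natAbs))) (𝓝[<] 1)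
        (𝓝 (‖F x / monomial P.kd κ.2 u.2‖ *
        (Real.exp (angleNorm κ * (1 * s)) * (1 * ε) ^ (∑ j, (κ.2 j).natAbs)))) := by
      refine Tendsto.mono_left (ContinuousAt.tendsto ?_) nhdsWithin_le_nhds
      fun_prop
    have hle := le_of_tendsto hlim hev
    rw [one_mul, one_mul] at hle
    rw [← ofReal_norm, ← ENNReal.ofReal_mul (Real.exp_pos _).le, ← ENNReal.ofReal_mul (norm_nonneg _),
      ← ENNReal.ofReal_toReal htop]
    exact ENNReal.ofReal_le_ofReal hle
  · refine iSup₂_le fun x hx => ?_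
    set u : Base ι m := ((P.chart x).1, (P.chart x).2.2) with hu
    have hub : u ∈ baseDomain P.kd P.A (P.r - t * P.r') ε := chart_mem_baseDomain hx
    have hu0 : P.basePoint u ∈ P.dom m t := pos_s hs hx
    refine le_trans ?_ (mul_le_mul_left (mul_le_mul_left (le_iSup₂ (f := fun u (_ : u ∈
      baseDomain P.kd P.A (P.r - t * P.r') ε) => ‖F (P.basePoint u) / monomial P.kd κ.2 u.2‖ₑ)
      u hub) _) _)
    rw [← ofReal_norm, ← ofReal_norm, ← ENNReal.ofReal_mul (norm_nonneg _),
      ← ENNReal.ofReal_mul (by positivity)]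
    apply ENNReal.ofReal_le_ofReal
    rw [hF.eq_basePoint hs hx, norm_mul, norm_exp_I_mul]
    have h1 : Real.exp (-(∑ i, (κ.1 i : ℂ) * (P.chart x).2.1 i).im) ≤
        Real.exp ((∑ i, |(κ.1 i : ℝ)|) * s) := by
      apply Real.exp_le_exp.2
      rw [Complex.im_sum, ← Finset.sum_neg_distrib, Finset.sum_mul]
      refine Finset.sum_le_sum fun i _ => ?_
      have h2 : |((P.chart x).2.1 i).im| < s := hx.2.1 i
      have h3 : ((κ.1 i : ℂ) * (P.chart x).2.1 i).im = κ.1 i * ((P.chart x).2.1 i).im := by simp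
      rw [h3]
      refine (neg_le_abs _).trans ?_
      rw [abs_mul]
      gcongr
    -- Where the monomial vanishes the quotient is zero by convention, and nothing is lost because
    -- the mode vanishes too.
    by_cases hmono : monomial P.kd κ.2 u.2 = 0
    · obtain ⟨j, -, hj⟩ := Finset.prod_eq_zero_iff.1 hmono
      have hzero : F (P.basePoint u) = 0 := by
        refine hF.eq_zero hu0 (j := j) ?_
        have hε0 := P.ε_ne
        have hc := coords_basePoint (P := P) u j
        rcases mul_eq_zero.1 hj with h | h
        · left
          have h2 := eq_zero_of_pow_eq_zero h
          refine ⟨?_, ?_⟩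
          · by_contra h3
            rw [Int.toNat_of_nonpos (by lia), pow_zero] at h
            exact one_ne_zero h
          · rw [← hc.1] at h2
            exact (mul_eq_zero.1 h2).resolve_left hε0
        · right
          have h2 := eq_zero_of_pow_eq_zero h
          refine ⟨?_, ?_⟩
          · by_contra h3
            rw [Int.toNat_of_nonpos (by lia), pow_zero] at h
            exact one_ne_zero h
          · rw [← hc.2] at h2
            exact (mul_eq_zero.1 h2).resolve_left hε0
      rw [hzero, norm_zero, mul_zero]
      positivity
    · have h4 : ‖monomial P.kd κ.2 u.2‖ ≤ ε ^ (∑ j, (κ.2 j).natAbs) := by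
        rw [norm_monomial, ← Finset.prod_pow_eq_pow_sum]
        refine Finset.prod_le_prod (fun j _ => by positivity) fun j _ => ?_
        have h5 := hub.2 j
        have e : (κ.2 j).natAbs = (-κ.2 j).toNat + (κ.2 j).toNat := by lia
        rw [e, pow_add]
        have := h5.1.le
        have := h5.2.le
        gcongr
      have h5 : ‖F (P.basePoint u)‖ = ‖F (P.basePoint u) / monomial P.kd κ.2 u.2‖ *
          ‖monomial P.kd κ.2 u.2‖ := by
        rw [← norm_mul, div_mul_cancel₀ _ hmono]
      rw [h5]
      calc _ ≤ Real.exp ((∑ i, |(κ.1 i : ℝ)|) * s) *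
            (‖F (P.basePoint u) / monomial P.kd κ.2 u.2‖ * ε ^ (∑ j, (κ.2 j).natAbs)) := by gcongr
        _ = _ := by ring

end Scales

end Averaging

/-! ### Norms and projections of functions in terms of families of modes. -/

namespace Averaging

open ModeSystem

namespace Scales

variable {ι : Type} [Fintype ι] [DecidableEq ι] {m : ℕ} {P : Scales ι}
variable {t : ℝ} {κ : Mode ι m} {F : Mode ι m → Esp ι m → ℂ} {f : Phase ι m → ℂ}

lemma IsFam.modeFun (hF : (P.system m).IsFam t F) (κ : Mode ι m) : P.ModeFun t κ (F κ) :=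
  ⟨hF.holo κ, hF.mode κ⟩

lemma symm_mem_dom {y : Phase ι m} (hy : y ∈ P.phaseDom m t) : P.chart.symm y ∈ P.dom m t := by
  rwa [dom, Set.mem_ofPred_eq, ContinuousLinearEquiv.apply_symm_apply]

lemma chart_actC_shift (k : ι → ℤ) (x : Esp ι m) :
    P.chart (P.actC (fun i => 2 * Real.pi * (k i : ℂ), 0) x) = shift k (P.chart x) := by
  rw [chart_apply, chart_apply, shift]
  refine Prod.ext ?_ (Prod.ext ?_ ?_)
  · simp [actC]
  · funext i
    simp [actC, mul_add, mul_inv_cancel_left₀ P.s_ne]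
  · simp [actC]

lemma _root_.Averaging.RealAnalyticFun.periodicFun (hf : RealAnalyticFun f (P.phaseDom m t)) :
    P.PeriodicFun t (fun x => f (P.chart x)) where
  holo := hf.holo.comp P.chart.differentiable.differentiableOn fun x hx => hx
  periodic k x hx := by
    rw [chart_actC_shift]
    exact hf.periodic k _ hx

lemma castC_turn_int (k : ι → ℤ) : (castC (fun i => 2 * Real.pi * (k i : ℝ), 0) :
    (ι → ℂ) × (Fin m → ℂ)) = (fun i => 2 * Real.pi * (k i : ℂ), 0) := by
  refine Prod.ext ?_ ?_ <;> funext i <;> simp [castC]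

lemma exp_phase_int (k : ι → ℤ) (κ : Mode ι m) :
    Complex.exp (Complex.I * phase (castC (fun i => 2 * Real.pi * (k i : ℝ), 0)) κ) = 1 := by
  rw [castC_turn_int, Complex.exp_eq_one_iff]
  refine ⟨∑ i, κ.1 i * k i, ?_⟩
  simp only [phase, Pi.zero_apply, mul_zero, Finset.sum_const_zero, add_zero, Finset.mul_sum,
    Int.cast_sum, Finset.sum_mul, Int.cast_mul]
  exact Finset.sum_congr rfl fun i _ => by ring

lemma PeriodicFun.of_fsum (hF : (P.system m).IsFam t F) (hn : (P.system m).nrm t F ≠ ⊤)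
    {G : Esp ι m → ℂ} (hG : EqOn G (fsum F) (P.dom m t)) : P.PeriodicFun t G where
  holo := (differentiableOn_fsum hF.holo hn).congr hG
  periodic k x hx := by
    have h1 := P.actC_mem (fun i => 2 * Real.pi * (k i : ℝ), 0) hx
    have h2 : ∀ κ, F κ (P.actC (castC (fun i => 2 * Real.pi * (k i : ℝ), 0)) x) = F κ x :=
      fun κ => by rw [(IsFam.modeFun hF κ).mode _ x hx, exp_phase_int, one_mul]
    rw [castC_turn_int] at h1 h2
    rw [hG h1, hG hx]
    exact tsum_congr h2

/-- The norm of a function is the norm of the family of its modes. -/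
lemma tfNorm_eq_nrm_modeCoeff (hs : 0 < P.s - t * P.s') (hε : 0 < P.ε - t * P.ε')
    (hf : P.PeriodicFun t (fun x => f (P.chart x))) :
    tfNorm P.kd P.A (P.r - t * P.r') (P.s - t * P.s') (P.ε - t * P.ε') f =
      (P.system m).nrm t (P.modeCoeff fun x => f (P.chart x)) := by
  have hc : ContinuousOn f (P.phaseDom m t) := by
    have := hf.holo.continuousOn.comp (f := P.chart.symm) (s := P.phaseDom m t)
      P.chart.symm.continuous.continuousOn fun y hy => symm_mem_dom hy
    refine this.congr fun y _ => ?_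
    simp
  refine tsum_congr fun κ => ?_
  rw [← (hf.modeFun κ).sup_eq hs hε]
  congr 2
  refine iSup_congr fun u => iSup_congr fun hu => ?_
  rw [coeff, fourierPart_eq hc ((basePoint_mem hs).2 hu)]
  rfl

/-- By uniqueness of the modes, any summable family with sum `f` computes the norm; the functions
built in the abstract part need no Fourier integrals. -/
lemma tfNorm_eq_nrm (hs : 0 < P.s - t * P.s') (hε : 0 < P.ε - t * P.ε')
    (hF : (P.system m).IsFam t F) (hn : (P.system m).nrm t F ≠ ⊤)
    (hf : EqOn (fun x => f (P.chart x)) (fsum F) (P.dom m t)) :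
    tfNorm P.kd P.A (P.r - t * P.r') (P.s - t * P.s') (P.ε - t * P.ε') f =
      (P.system m).nrm t F := by
  rw [tfNorm_eq_nrm_modeCoeff hs hε (PeriodicFun.of_fsum hF hn hf)]
  refine tsum_congr fun κ => iSup_congr fun x => iSup_congr fun hx => ?_
  rw [modeCoeff_fsum (IsFam.modeFun hF) hx hf (summable_apply hn hx).norm]

/-- The projection on a set of modes. -/
lemma harmonicProj_chart (hs : 0 < P.s - t * P.s') (hF : (P.system m).IsFam t F)
    (hn : (P.system m).nrm t F ≠ ⊤) (hf : EqOn (fun x => f (P.chart x)) (fsum F) (P.dom m t))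
    (S : Set (Mode ι m)) {x : Esp ι m} (hx : x ∈ P.dom m t) :
    harmonicProj P.kd S f (P.chart x) = fsum (S.indicator F) x := by
  have hc : ContinuousOn f (P.phaseDom m t) := by
    have := (PeriodicFun.of_fsum hF hn hf).holo.continuousOn.comp (f := P.chart.symm)
      (s := P.phaseDom m t) P.chart.symm.continuous.continuousOn fun y hy => symm_mem_dom hy
    refine this.congr fun y _ => ?_
    simp
  refine tsum_congr fun κ => ?_
  have hy := pos_s hs hx
  by_cases h : κ ∈ S
  · rw [if_pos h, Set.indicator_of_mem h, fourierPart_eq hc hy, (IsFam.modeFun hF κ).eq_basePoint hs hx,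
      mul_comm]
    congr 1
    exact modeCoeff_fsum (IsFam.modeFun hF) hy hf (summable_apply hn hy).norm κ
  · rw [if_neg h, Set.indicator_of_notMem h]
    rfl

lemma IsFam.realAnalyticFun (hF : (P.system m).IsFam t F) (hn : (P.system m).nrm t F ≠ ⊤)
    (hf : EqOn (fun x => f (P.chart x)) (fsum F) (P.dom m t)) :
    RealAnalyticFun f (P.phaseDom m t) := by
  have hp := PeriodicFun.of_fsum hF hn hf
  have hmem : ∀ y ∈ P.phaseDom m t, P.chart.symm y ∈ P.dom m t := fun y hy => symm_mem_dom hy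
  refine ⟨?_, fun k y hy => ?_, fun y hy hre => ?_⟩
  · have := hp.holo.comp (f := P.chart.symm) (s := P.phaseDom m t)
      P.chart.symm.differentiable.differentiableOn hmem
    refine this.congr fun y _ => ?_
    simp
  · have := hp.periodic k _ (hmem y hy)
    rwa [chart_actC_shift, ContinuousLinearEquiv.apply_symm_apply] at this
  · have h1 : P.conjL (P.chart.symm y) = P.chart.symm y := by
      apply P.chart.injective
      rw [chart_conjL, ContinuousLinearEquiv.apply_symm_apply]
      refine Prod.ext ?_ (Prod.ext ?_ (Prod.ext ?_ ?_)) <;> funext i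
      · exact Complex.conj_eq_iff_im.2 (hre.1 i)
      · exact Complex.conj_eq_iff_im.2 (hre.2.1 i)
      · exact Complex.conj_eq_iff_im.2 (hre.2.2.1 i)
      · exact Complex.conj_eq_iff_im.2 (hre.2.2.2 i)
    have h2 := star_fsum hF (hmem y hy)
    have h3 : (P.system m).conj (P.chart.symm y) = P.chart.symm y := h1
    rw [h3] at h2
    have h4 := hf (hmem y hy)
    simp only [ContinuousLinearEquiv.apply_symm_apply] at h4
    rw [h4]
    exact Complex.conj_eq_iff_im.1 h2

/-- The real form of the torus action. -/
def conjTurn (kd : Kind) (g : (ι → ℝ) × (Fin m → ℝ)) : (ι → ℝ) × (Fin m → ℝ) :=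
  match kd with
  | .hyperbolic => (g.1, -g.2)
  | .elliptic => g

/-- Conjugation inverts the unimodular factors `e^{∓iψ}`. In hyperbolic coordinates this reverses
the rotation; in elliptic ones conjugation also exchanges `z` and `w`, which undoes the reversal. -/
lemma conjL_actC (g : (ι → ℝ) × (Fin m → ℝ)) (x : Esp ι m) :
    P.conjL (P.actC (castC g) x) = P.actC (castC (conjTurn P.kd g)) (P.conjL x) := by
  rw [conjL_apply, conjL_apply]
  have e1 : ∀ ψ : ℝ, (starRingEnd ℂ) (Complex.exp (-(Complex.I * ψ))) =
      Complex.exp (Complex.I * ψ) := fun ψ => by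
    rw [← Complex.exp_conj]; simp
  have e2 : ∀ ψ : ℝ, (starRingEnd ℂ) (Complex.exp (Complex.I * ψ)) =
      Complex.exp (-(Complex.I * ψ)) := fun ψ => by
    rw [← Complex.exp_conj]; simp
  refine Prod.ext ?_ (Prod.ext ?_ ?_)
  · rfl
  · funext i
    cases P.kd <;> simp [actC, castC, conjTurn]
  · cases P.kd
    · refine Prod.ext ?_ ?_ <;> funext j <;> simp [actC, castC, conjTurn, conjZ, conjW, e1, e2]
    · refine Prod.ext ?_ ?_ <;> funext j <;>
        simp [actC, castC, conjTurn, conjZ, conjW, e1, e2, mul_left_comm]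

lemma star_exp_phase (kd : Kind) (g : (ι → ℝ) × (Fin m → ℝ)) (κ : Mode ι m) :
    star (Complex.exp (Complex.I * phase (castC (conjTurn kd g)) (conjMode kd ι m κ))) =
      Complex.exp (Complex.I * phase (castC g) κ) := by
  rw [Complex.star_def, ← Complex.exp_conj]
  congr 1
  have e1 : conjMode .hyperbolic ι m κ = (-κ.1, κ.2) := rfl
  have e2 : conjMode .elliptic ι m κ = -κ := rfl
  cases kd <;> simp [phase, castC, conjTurn, e1, e2] <;> ring

lemma ModeFun.star_conj {G : Esp ι m → ℂ} (hG : P.ModeFun t (conjMode P.kd ι m κ) G) :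
    P.ModeFun t κ (fun x => star (G (P.conjL x))) where
  holo x hx := (hasFDerivAt_conj (c := P.conjL) (hG.holo.differentiableAt
    ((P.isOpen_dom t).mem_nhds (P.conjL_mem hx))).hasFDerivAt).differentiableAt.differentiableWithinAt
  mode g x hx := by
    rw [conjL_actC, hG.mode _ _ (P.conjL_mem hx), star_mul', star_exp_phase]

/-- The modes of a real-analytic function of finite norm form a family. -/
lemma _root_.Averaging.RealAnalyticFun.isFam (hf : RealAnalyticFun f (P.phaseDom m t))
    (hn : (P.system m).nrm t (P.modeCoeff fun x => f (P.chart x)) ≠ ⊤) :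
    (P.system m).IsFam t (P.modeCoeff fun x => f (P.chart x)) ∧
      EqOn (fun x => f (P.chart x)) (fsum (P.modeCoeff fun x => f (P.chart x))) (P.dom m t) := by
  have hp := hf.periodicFun
  have heq : EqOn (fun x => f (P.chart x)) (fsum (P.modeCoeff fun x => f (P.chart x)))
      (P.dom m t) := fun x hx => (hp.hasSum_modeCoeff hx (summable_apply hn hx)).tsum_eq.symm
  refine ⟨⟨fun κ => (hp.modeFun κ).holo, fun κ => (hp.modeFun κ).mode, fun κ x hx => ?_⟩, heq⟩
  set F := P.modeCoeff fun x => f (P.chart x) with hF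
  -- By reflection, the conjugated modes, reindexed, also sum to `f`; uniqueness identifies them
  -- with the modes of `f`.
  refine (modeCoeff_fsum (f := fun x => f (P.chart x))
    (F := fun κ x => star (F (conjMode P.kd ι m κ) (P.conjL x)))
    (fun κ => (hp.modeFun _).star_conj) hx (fun y hy => ?_) ?_ κ).symm
  · have h1 := star_comp_chart P hf.holo hf.real hy
    have h2 := heq (P.conjL_mem hy)
    simp only at h2 ⊢
    rw [← h1, h2, fsum, fsum, tsum_star]
    exact ((conjMode P.kd ι m).toEquiv.tsum_eq fun κ => star (F κ (P.conjL y))).symm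
  · simp only [norm_star]
    exact (conjMode P.kd ι m).toEquiv.summable_iff.2 (summable_apply hn (P.conjL_mem hx)).norm

/-- Modes of high order are small on smaller domains. -/
lemma ModeFun.supN_four_le {G : Esp ι m → ℂ} (hG : P.ModeFun (7 / 2) κ G)
    (hε : 4 * P.ε' < P.ε) {K σ : ℝ} (hK : K ≤ modeNorm κ) (hσ0 : 0 ≤ σ) (hσs : σ ≤ P.s')
    (hσε : σ ≤ P.ε' / P.ε) :
    (P.system m).supN 4 G ≤
      ENNReal.ofReal (Real.exp (-(K * σ / 2))) * (P.system m).supN (7 / 2) G := by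
  refine iSup₂_le fun x hx => ?_
  set u := P.ε' / P.ε with hu
  have hε0 : 0 < P.ε := by linarith [P.hε]
  have hu0 : 0 < u := div_pos P.hε hε0
  have hu4 : u < 1 / 4 := by rw [hu, div_lt_iff₀ hε0]; linarith
  -- In each pair with `l_j ≠ 0`, the coordinate in the monomial is enlarged by `e^{u/2}`; for `l_j
  -- = 0` nothing is moved.
  set y : Fin m → ℝ := fun j => -((SignType.sign (κ.2 j) : ℤ) * (u / 2) : ℝ) with hy
  have hyabs : ∀ j, |y j| ≤ u / 2 := fun j => by
    have h : |((SignType.sign (κ.2 j) : ℤ) : ℝ)| ≤ 1 := by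
      rcases SignType.trichotomy (SignType.sign (κ.2 j)) with h | h | h <;> rw [h] <;> simp
    rw [hy]
    simp only [abs_neg, abs_mul]
    rw [abs_of_pos (by linarith : 0 < u / 2)]
    exact mul_le_of_le_one_left (by linarith) h
  -- In units of `ε` the claim is `e^{u/2} (1 - 4u) ≤ 1 - 7u/2`. It follows from `e^{u/2} ≤ (1 -
  -- u/2)⁻¹` and `(1 - u/2) (1 - 7u/2) ≥ 1 - 4u`.
  have hexp : ∀ c : ℝ, |c| ≤ u / 2 → ∀ E : ℝ, E < P.ε - 4 * P.ε' → 0 ≤ E →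
      Real.exp c * E < P.ε - 7 / 2 * P.ε' := by
    intro c hc E hE hE0
    have h1 : Real.exp c ≤ (1 - u / 2)⁻¹ := by
      refine (Real.exp_le_exp.2 ((le_abs_self c).trans hc)).trans ?_
      rw [← neg_neg (u / 2), Real.exp_neg]
      refine inv_anti₀ (by linarith) ?_
      have := Real.add_one_le_exp (-(u / 2))
      linarith
    have h2 : P.ε' = u * P.ε := by rw [hu, div_mul_cancel₀ _ hε0.ne']
    have h3 : P.ε - 4 * P.ε' ≤ (1 - u / 2) * (P.ε - 7 / 2 * P.ε') := by
      rw [h2]; nlinarith [mul_pos hu0 hu0, mul_pos (mul_pos hu0 hu0) hε0]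
    calc Real.exp c * E ≤ (1 - u / 2)⁻¹ * E := by gcongr
      _ < (1 - u / 2)⁻¹ * ((1 - u / 2) * (P.ε - 7 / 2 * P.ε')) := by
        refine mul_lt_mul_of_pos_left (hE.trans_le h3) (inv_pos.2 (by linarith))
      _ = _ := by rw [inv_mul_cancel_left₀ (by linarith)]
  have hx2 : x ∈ P.dom m (7 / 2) := (P.system m).anti (by norm_num) hx
  have hmem : P.actC (growth κ (P.s' / 2) y) x ∈ P.dom m (7 / 2) := by
    obtain ⟨k1, k2, k3⟩ := P.mem_dom_iff.1 hx2
    obtain ⟨-, l2, l3⟩ := P.mem_dom_iff.1 hx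
    refine P.mem_dom_iff.2 ⟨k1, fun i => ?_, fun j => ⟨?_, ?_⟩⟩
    · have := l2 i
      refine (im_growth κ (half_pos P.hs).le y x i).trans_lt ?_
      linarith
    · rw [(norm_coords_growth κ _ y x j).1]
      exact hexp _ (hyabs j) _ (l3 j).1 (norm_nonneg _)
    · rw [(norm_coords_growth κ _ y x j).2]
      exact hexp _ (by rw [abs_neg]; exact hyabs j) _ (l3 j).2 (norm_nonneg _)
  have hval := hG.apply_actC_of_mem hx2 hmem
  have hle := enorm_le_supN (S := P.system m) (f := G) hmem
  rw [hval, enorm_mul, ← ofReal_norm (Complex.exp _), norm_exp_growth] at hle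
  -- The exponent gained is `|k|₁ s'/2 + |l|₁ u/2`, and both `s'` and `u` are at least `σ`.
  have hgrow : Real.exp (K * σ / 2) ≤
      Real.exp (angleNorm κ * (P.s' / 2)) * ∏ j, Real.exp (-(κ.2 j * y j)) := by
    rw [← Real.exp_sum, ← Real.exp_add]
    apply Real.exp_le_exp.2
    have e : ∀ j, -((κ.2 j : ℝ) * y j) = |(κ.2 j : ℝ)| * (u / 2) := fun j => by
      have h2 : |(κ.2 j : ℝ)| = κ.2 j * (SignType.sign (κ.2 j) : ℤ) := by
        have := self_mul_sign (κ.2 j)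
        rw [← Int.cast_abs, ← this]
        push_cast; rfl
      rw [h2, hy]; ring
    simp only [e, ← Finset.sum_mul]
    have h1 : 0 ≤ angleNorm κ := Finset.sum_nonneg fun i _ => abs_nonneg _
    have h2 : 0 ≤ ∑ j, |(κ.2 j : ℝ)| := Finset.sum_nonneg fun i _ => abs_nonneg _
    have h3 : modeNorm κ = angleNorm κ + ∑ j, |(κ.2 j : ℝ)| := rfl
    calc K * σ / 2 ≤ modeNorm κ * σ / 2 := by gcongr
      _ = angleNorm κ * (σ / 2) + (∑ j, |(κ.2 j : ℝ)|) * (σ / 2) := by rw [h3]; ring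
      _ ≤ _ := by gcongr
  calc ‖G x‖ₑ = ENNReal.ofReal (Real.exp (-(K * σ / 2))) *
        (ENNReal.ofReal (Real.exp (K * σ / 2)) * ‖G x‖ₑ) := by
        rw [← mul_assoc, ← ENNReal.ofReal_mul (Real.exp_pos _).le, ← Real.exp_add, neg_add_cancel,
          Real.exp_zero, ENNReal.ofReal_one, one_mul]
    _ ≤ _ := by
        gcongr
        exact le_trans (by gcongr) hle

end Scales

end Averaging

/-! ### Upper and lower bounds for the constant of the bracket estimate. -/

namespace Averaging

open ModeSystem

section

variable {E M : Type*} [NormedAddCommGroup E] [NormedSpace ℂ E] [AddCommGroup M] [DecidableEq M]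

lemma nrm_single (S : ModeSystem E M) (t : ℝ) (k : M) (G : E → ℂ) :
    S.nrm t (Pi.single k G) = S.supN t G := by
  rw [nrm, tsum_eq_single k, Pi.single_eq_same]
  intro j hj
  rw [Pi.single_eq_of_ne hj]
  simp [supN]

omit [NormedAddCommGroup E] [NormedSpace ℂ E] [AddCommGroup M] in
lemma fsum_single (k : M) (G : E → ℂ) (x : E) : fsum (Pi.single k G) x = G x := by
  rw [fsum, tsum_eq_single k, Pi.single_eq_same]
  intro j hj
  rw [Pi.single_eq_of_ne hj]
  rfl

end

namespace Scales

variable {ι : Type} [Fintype ι] [DecidableEq ι] {m : ℕ} {P : Scales ι}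
variable {t : ℝ} {κ : Mode ι m} {F : Mode ι m → Esp ι m → ℂ} {f g : Phase ι m → ℂ}

lemma isFam_zero : (P.system m).IsFam t 0 :=
  ⟨fun _ => differentiableOn_const 0, fun _ _ _ _ => by simp, fun _ _ _ => by simp⟩

lemma nrm_zero : (P.system m).nrm t 0 = 0 := by simp [nrm, supN]

lemma tfNorm_eq_zero (hs : 0 < P.s - t * P.s') (hε : 0 < P.ε - t * P.ε')
    (hf : ∀ x ∈ P.dom m t, f (P.chart x) = 0) :
    tfNorm P.kd P.A (P.r - t * P.r') (P.s - t * P.s') (P.ε - t * P.ε') f = 0 := by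
  rw [tfNorm_eq_nrm hs hε (F := 0) isFam_zero (by rw [nrm_zero]; simp), nrm_zero]
  intro x hx
  simpa [fsum] using hf x hx

lemma eq_zero_of_tfNorm (hs : 0 < P.s - t * P.s') (hε : 0 < P.ε - t * P.ε')
    (hf : RealAnalyticFun f (P.phaseDom m t))
    (h : tfNorm P.kd P.A (P.r - t * P.r') (P.s - t * P.s') (P.ε - t * P.ε') f = 0) {x : Esp ι m}
    (hx : x ∈ P.dom m t) : f (P.chart x) = 0 := by
  rw [tfNorm_eq_nrm_modeCoeff hs hε hf.periodicFun] at h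
  have h1 := (hf.isFam (by rw [h]; simp)).2 hx
  simp only at h1
  rw [h1]
  have h2 := norm_fsum_le (S := P.system m) (F := P.modeCoeff fun x => f (P.chart x))
    (by rw [h]; simp) hx
  rw [h] at h2
  simpa using h2

/-- The estimate of Poisson brackets. -/
lemma tfNorm_poisson_le (hs : P.s' < P.s) (hε : P.ε' < P.ε)
    (hf : RealAnalyticFun f (domain P.kd P.A P.r P.s P.ε))
    (hg : RealAnalyticFun g (domain P.kd P.A P.r P.s P.ε)) :
    tfNorm P.kd P.A (P.r - P.r') (P.s - P.s') (P.ε - P.ε') (poisson f g) ≤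
      ENNReal.ofReal P.δ⁻¹ * tfNorm P.kd P.A P.r P.s P.ε f * tfNorm P.kd P.A P.r P.s P.ε g := by
  have hs0 : 0 < P.s - 0 * P.s' := by linarith [P.hs]
  have hε0 : 0 < P.ε - 0 * P.ε' := by linarith [P.hε]
  have hs1 : 0 < P.s - 1 * P.s' := by linarith
  have hε1 : 0 < P.ε - 1 * P.ε' := by linarith
  have hr0 : P.r = P.r - 0 * P.r' := by ring
  have hs0' : P.s = P.s - 0 * P.s' := by ring
  have hε0' : P.ε = P.ε - 0 * P.ε' := by ring
  have e0 : domain P.kd P.A P.r P.s P.ε = P.phaseDom m 0 := by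
    rw [phaseDom, ← hr0, ← hs0', ← hε0']
  have t0 : ∀ u : Phase ι m → ℂ, tfNorm P.kd P.A P.r P.s P.ε u =
      tfNorm P.kd P.A (P.r - 0 * P.r') (P.s - 0 * P.s') (P.ε - 0 * P.ε') u := fun u => by
    rw [← hr0, ← hs0', ← hε0']
  have t1 : tfNorm P.kd P.A (P.r - P.r') (P.s - P.s') (P.ε - P.ε') (poisson f g) =
      tfNorm P.kd P.A (P.r - 1 * P.r') (P.s - 1 * P.s') (P.ε - 1 * P.ε') (poisson f g) := by
    rw [one_mul, one_mul, one_mul]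
  rw [e0] at hf hg
  have hsub : ∀ x ∈ P.dom m 1, x ∈ P.dom m 0 := fun x hx =>
    (P.system m).anti (by norm_num) hx
  have hpb : ∀ x ∈ P.dom m 0, poisson f g (P.chart x) =
      (P.system m).pb (fun y => f (P.chart y)) (fun y => g (P.chart y)) x := fun x hx =>
    poisson_chart P (hf.holo.differentiableAt ((P.isOpen_phaseDom 0).mem_nhds hx))
      (hg.holo.differentiableAt ((P.isOpen_phaseDom 0).mem_nhds hx))
  have hzero : ∀ u : Esp ι m → ℂ, (∀ x ∈ P.dom m 0, u x = 0) → ∀ x ∈ P.dom m 0,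
      fderiv ℂ u x = 0 := fun u hu x hx => by
    have : u =ᶠ[𝓝 x] fun _ => 0 := by
      filter_upwards [(P.isOpen_dom 0).mem_nhds hx] with y hy using hu y hy
    rw [this.fderiv_eq, fderiv_fun_const]
    rfl
  have hδ : ENNReal.ofReal P.δ⁻¹ ≠ 0 := by
    simpa using P.δ_pos
  by_cases hf0 : tfNorm P.kd P.A P.r P.s P.ε f = 0
  · rw [t1, tfNorm_eq_zero hs1 hε1]
    · exact bot_le
    · intro x hx
      rw [t0] at hf0
      rw [hpb x (hsub x hx), pb, hzero _ (fun y hy => eq_zero_of_tfNorm hs0 hε0 hf hf0 hy) x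
        (hsub x hx)]
      rfl
  by_cases hg0 : tfNorm P.kd P.A P.r P.s P.ε g = 0
  · rw [t1, tfNorm_eq_zero hs1 hε1]
    · exact bot_le
    · intro x hx
      rw [t0] at hg0
      rw [hpb x (hsub x hx), pb, hzero _ (fun y hy => eq_zero_of_tfNorm hs0 hε0 hg hg0 hy) x
        (hsub x hx), map_zero, map_zero]
  by_cases hft : tfNorm P.kd P.A P.r P.s P.ε f = ⊤
  · rw [hft, ENNReal.mul_top hδ, ENNReal.top_mul hg0]
    exact le_top
  by_cases hgt : tfNorm P.kd P.A P.r P.s P.ε g = ⊤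
  · rw [hgt, ENNReal.mul_top (mul_ne_zero hδ hf0)]
    exact le_top
  rw [t0, tfNorm_eq_nrm_modeCoeff hs0 hε0 hf.periodicFun] at hft ⊢
  rw [t0 g, tfNorm_eq_nrm_modeCoeff hs0 hε0 hg.periodicFun] at hgt ⊢
  obtain ⟨hF, hFf⟩ := hf.isFam hft
  obtain ⟨hG, hGg⟩ := hg.isFam hgt
  have h01 : (0 : ℝ) < 1 := one_pos
  have hγ : (P.system m).γ = P.δ⁻¹ := rfl
  rw [t1, tfNorm_eq_nrm hs1 hε1 (hF.conv h01 h01 hG hft hgt)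
    (nrm_conv_ne_top h01 h01 hF.holo hG.holo hft hgt)]
  · refine (nrm_conv_le h01 h01 hF.holo hG.holo hft hgt).trans (le_of_eq ?_)
    rw [hγ, sub_zero, one_mul, div_one]
  · intro x hx
    have hx0 := hsub x hx
    have hcongr : ∀ (u v : Esp ι m → ℂ), EqOn u v (P.dom m 0) →
        fderiv ℂ u x = fderiv ℂ v x := fun u v huv =>
      (huv.eventuallyEq_of_mem ((P.isOpen_dom 0).mem_nhds hx0)).fderiv_eq
    rw [← pb_fsum h01 h01 hF.holo hG.holo hft hgt hx]
    simp only
    rw [hpb x hx0, pb, pb, hcongr _ _ hFf, hcongr _ _ hGg]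

/-- The norm of a linear function of one pair of coordinates. -/
lemma tfNorm_linear_le (hs : 0 < P.s) (hε : 0 < P.ε) {a b : ℂ} {j : Fin m}
    (hf : ∀ x : Esp ι m, f (P.chart x) = a * (P.ε' * x.2.2.1 j) + b * (P.ε' * x.2.2.2 j)) :
    tfNorm P.kd P.A P.r P.s P.ε f ≤ ENNReal.ofReal ((‖a‖ + ‖b‖) * P.ε) := by
  have hs0 : 0 < P.s - 0 * P.s' := by linarith
  have hε0 : 0 < P.ε - 0 * P.ε' := by linarith
  have t0 : tfNorm P.kd P.A P.r P.s P.ε f =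
      tfNorm P.kd P.A (P.r - 0 * P.r') (P.s - 0 * P.s') (P.ε - 0 * P.ε') f := by
    rw [zero_mul, zero_mul, zero_mul, sub_zero, sub_zero, sub_zero]
  have hfc : (fun x => f (P.chart x)) = fun x : Esp ι m => a * (P.ε' * x.2.2.1 j) +
      b * (P.ε' * x.2.2.2 j) := funext hf
  set κz : Mode ι m := (0, Pi.single j (-1)) with hκz
  set κw : Mode ι m := (0, Pi.single j 1) with hκw
  set Z : Esp ι m → ℂ := fun x => a * (P.ε' * x.2.2.1 j) with hZ
  set W : Esp ι m → ℂ := fun x => b * (P.ε' * x.2.2.2 j) with hW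
  have hp : P.PeriodicFun 0 (fun x => f (P.chart x)) := by
    rw [hfc]
    exact ⟨by fun_prop, fun k x _ => by simp [actC]⟩
  have hZm : P.ModeFun 0 κz Z := by
    refine ⟨by fun_prop, fun g x _ => ?_⟩
    simp only [hZ, hκz, actC, castC, phase]
    simp [Pi.single_apply]
    ring
  have hWm : P.ModeFun 0 κw W := by
    refine ⟨by fun_prop, fun g x _ => ?_⟩
    simp only [hW, hκw, actC, castC, phase]
    simp [Pi.single_apply]
    ring
  have hZn : (P.system m).supN 0 Z ≤ ENNReal.ofReal (‖a‖ * P.ε) := by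
    refine supN_le_ofReal fun x hx => ?_
    have h := ((P.mem_dom_iff.1 hx).2.2 j).1
    rw [zero_mul, sub_zero] at h
    rw [hZ]; simp only [norm_mul a]
    gcongr
  have hWn : (P.system m).supN 0 W ≤ ENNReal.ofReal (‖b‖ * P.ε) := by
    refine supN_le_ofReal fun x hx => ?_
    have h := ((P.mem_dom_iff.1 hx).2.2 j).2
    rw [zero_mul, sub_zero] at h
    rw [hW]; simp only [norm_mul b]
    gcongr
  set F : Mode ι m → Esp ι m → ℂ := Pi.single κz Z + Pi.single κw W with hF
  have hzero : ∀ κ : Mode ι m, P.ModeFun 0 κ 0 := fun κ =>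
    ⟨differentiableOn_const 0, fun _ _ _ => by simp⟩
  have hadd : ∀ (κ : Mode ι m) (U V : Esp ι m → ℂ), P.ModeFun 0 κ U → P.ModeFun 0 κ V →
      P.ModeFun 0 κ (U + V) := fun κ U V hU hV =>
    ⟨hU.holo.add hV.holo, fun g x hx => by
      rw [Pi.add_apply, hU.mode g x hx, hV.mode g x hx, Pi.add_apply, mul_add]⟩
  have hsingle : ∀ (κ κ' : Mode ι m) (U : Esp ι m → ℂ), P.ModeFun 0 κ U →
      P.ModeFun 0 κ' ((Pi.single κ U : Mode ι m → Esp ι m → ℂ) κ') := by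
    intro κ κ' U hU
    by_cases h : κ' = κ
    · subst h; rwa [Pi.single_eq_same]
    · rw [Pi.single_eq_of_ne h]; exact hzero _
  have hn1 : (P.system m).nrm 0 (Pi.single κz Z) ≤ ENNReal.ofReal (‖a‖ * P.ε) := by
    rwa [nrm_single]
  have hn2 : (P.system m).nrm 0 (Pi.single κw W) ≤ ENNReal.ofReal (‖b‖ * P.ε) := by
    rwa [nrm_single]
  have hn : (P.system m).nrm 0 F ≤ ENNReal.ofReal ((‖a‖ + ‖b‖) * P.ε) := by
    rw [add_mul, ENNReal.ofReal_add (by positivity) (by positivity)]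
    exact (nrm_add_le _ _).trans (add_le_add hn1 hn2)
  have heq : EqOn (fun x => f (P.chart x)) (fsum F) (P.dom m 0) := by
    intro x hx
    rw [hfc, hF, fsum_add (S := P.system m) (ne_top_of_le_ne_top ENNReal.ofReal_ne_top hn1)
      (ne_top_of_le_ne_top ENNReal.ofReal_ne_top hn2) hx, fsum_single, fsum_single]
  rw [t0, tfNorm_eq_nrm_modeCoeff hs0 hε0 hp]
  refine le_trans (le_of_eq ?_) hn
  refine tsum_congr fun κ => iSup_congr fun x => iSup_congr fun hx => ?_
  rw [modeCoeff_fsum (F := F) (fun κ => hadd κ _ _ (hsingle _ _ _ hZm) (hsingle _ _ _ hWm)) hx heq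
    (summable_apply (ne_top_of_le_ne_top ENNReal.ofReal_ne_top hn) hx).norm]

/-- The constant is its own mode of index zero; a point of the domain is needed, since the norm over
an empty domain is zero. -/
lemma one_le_tfNorm_one (hs : 0 < P.s - t * P.s') (hε : 0 < P.ε - t * P.ε') {x : Esp ι m}
    (hx : x ∈ P.dom m t) :
    1 ≤ tfNorm (m := m) P.kd P.A (P.r - t * P.r') (P.s - t * P.s') (P.ε - t * P.ε')
      (fun _ => 1) := by
  have hp : P.PeriodicFun (m := m) t fun _ => 1 := ⟨differentiableOn_const 1, fun _ _ _ => rfl⟩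
  have hm : ∀ κ, P.ModeFun t κ ((Pi.single 0 (fun _ => 1) : Mode ι m → Esp ι m → ℂ) κ) := by
    intro κ
    by_cases h : κ = 0
    · subst h
      rw [Pi.single_eq_same]
      exact ⟨differentiableOn_const 1, fun g x _ => by simp [phase]⟩
    · rw [Pi.single_eq_of_ne h]
      exact ⟨differentiableOn_const 0, fun _ _ _ => by simp⟩
  rw [tfNorm_eq_nrm_modeCoeff (f := fun _ => 1) hs hε hp]
  refine le_trans ?_ (supN_le_nrm (S := P.system m) _ (0 : Mode ι m))
  refine le_trans (le_of_eq ?_) (enorm_le_supN (S := P.system m) hx)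
  rw [modeCoeff_fsum hm hx (fun y _ => (fsum_single _ _ _).symm) ?_ 0, Pi.single_eq_same]
  · simp
  · refine summable_of_ne_finset_zero (s := {0}) fun κ hκ => ?_
    rw [Pi.single_eq_of_ne (by simpa using hκ)]
    simp

end Scales

section Coordinates

variable {ι : Type} [Fintype ι] [DecidableEq ι] {m : ℕ}

lemma poisson_p_q (j : Fin m) :
    poisson (fun x : Phase ι m => x.2.2.1 j) (fun x => x.2.2.2 j) = fun _ => 1 := by
  funext x
  have hp : HasFDerivAt (fun x : Phase ι m => x.2.2.1 j) ((ContinuousLinearMap.proj j).comp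
      ((ContinuousLinearMap.fst ℂ _ _).comp ((ContinuousLinearMap.snd ℂ _ _).comp
        (ContinuousLinearMap.snd ℂ _ _)))) x :=
    (ContinuousLinearMap.hasFDerivAt (E := Phase ι m) ((ContinuousLinearMap.proj j).comp
      ((ContinuousLinearMap.fst ℂ _ _).comp ((ContinuousLinearMap.snd ℂ _ _).comp
        (ContinuousLinearMap.snd ℂ _ _)))) : _)
  have hq : HasFDerivAt (fun x : Phase ι m => x.2.2.2 j) ((ContinuousLinearMap.proj j).comp
      ((ContinuousLinearMap.snd ℂ _ _).comp ((ContinuousLinearMap.snd ℂ _ _).comp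
        (ContinuousLinearMap.snd ℂ _ _)))) x :=
    (ContinuousLinearMap.hasFDerivAt (E := Phase ι m) ((ContinuousLinearMap.proj j).comp
      ((ContinuousLinearMap.snd ℂ _ _).comp ((ContinuousLinearMap.snd ℂ _ _).comp
        (ContinuousLinearMap.snd ℂ _ _)))) : _)
  rw [poisson, hp.fderiv, hq.fderiv]
  simp [dirI, dirφ, dirp, dirq, Pi.single_apply]

lemma realAnalyticFun_p (j : Fin m) (U : Set (Phase ι m)) :
    RealAnalyticFun (fun x : Phase ι m => x.2.2.1 j) U :=
  ⟨by fun_prop, fun _ _ _ => rfl, fun _ _ h => h.2.2.1 j⟩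

lemma realAnalyticFun_q (j : Fin m) (U : Set (Phase ι m)) :
    RealAnalyticFun (fun x : Phase ι m => x.2.2.2 j) U :=
  ⟨by fun_prop, fun _ _ _ => rfl, fun _ _ h => h.2.2.2 j⟩

lemma pCoord_eq (kd : Kind) (z w : ℂ) :
    pCoord kd z w = pCoord kd 1 0 * z + pCoord kd 0 1 * w := by
  cases kd
  · simp [pCoord]
  · simp only [pCoord]; ring

lemma qCoord_eq (kd : Kind) (z w : ℂ) :
    qCoord kd z w = qCoord kd 1 0 * z + qCoord kd 0 1 * w := by
  cases kd
  · simp [qCoord]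
  · simp only [qCoord]; ring

/-- With `tfNorm_linear_le` this bounds the norm of `p_j` by `√2 ε`; the value `√2` comes from the
elliptic formula `p = (z + i w) / √2`. -/
lemma norm_pCoord_add_le (kd : Kind) : ‖pCoord kd 1 0‖ + ‖pCoord kd 0 1‖ ≤ √2 := by
  cases kd
  · simp [pCoord]
  · have h : √2 * √2 = 2 := Real.mul_self_sqrt (by norm_num)
    have h0 : 0 < √2 := by positivity
    simp only [pCoord, mul_zero, mul_one, add_zero, zero_add, norm_div, norm_one, Complex.norm_I,
      Complex.norm_real, Real.norm_of_nonneg h0.le]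
    rw [← add_div, div_le_iff₀ h0]
    linarith

lemma norm_qCoord_add_le (kd : Kind) : ‖qCoord kd 1 0‖ + ‖qCoord kd 0 1‖ ≤ √2 := by
  cases kd
  · simp [qCoord]
  · have h : √2 * √2 = 2 := Real.mul_self_sqrt (by norm_num)
    have h0 : 0 < √2 := by positivity
    simp only [qCoord, mul_zero, mul_one, add_zero, zero_add, norm_div, norm_one, Complex.norm_I,
      Complex.norm_real, Real.norm_of_nonneg h0.le]
    rw [← add_div, div_le_iff₀ h0]
    linarith

end Coordinates

/-- The constant of the estimate of Poisson brackets is not too small. -/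
theorem half_le_bracketConst (kd : Kind) {m : ℕ} (hm : 0 < m) : 1 / 2 ≤ bracketConst kd m := by
  -- The infimum of an empty set of constants would be zero; `1` is admissible by
  -- `tfNorm_poisson_le`.
  refine le_csInf ⟨1, zero_le_one, ?_⟩ ?_
  · intro n A r s ε r' s' ε' hr' hr hs' hs hε' hε f g hf hg
    rw [one_div]
    exact Scales.tfNorm_poisson_le (P := ⟨kd, A, r, s, ε, r', s', ε', hr', hs', hε'⟩) hs hε hf hg
  · rintro c ⟨hc0, hc⟩
    -- Test functions `p_j` and `q_j` without angles, with `ε = 1` and `δ = ε' ^ 2`: their bracket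
    -- is `1` and their norms multiply to at most `2`. Then `ε'` tends to `1`.
    have key : ∀ ε' : ℝ, 0 < ε' → ε' < 1 → ε' ^ 2 / 2 ≤ c := by
      intro ε' h0 h1
      set P : Scales (Fin 0) := ⟨kd, univ, 2, 2, 1, 1, 1, ε', one_pos, one_pos, h0⟩ with hP
      have h := hc 0 univ 2 2 1 1 1 ε' one_pos (by norm_num) one_pos (by norm_num) h0 h1
        (fun x => x.2.2.1 ⟨0, hm⟩) (fun x => x.2.2.2 ⟨0, hm⟩) (realAnalyticFun_p _ _)
        (realAnalyticFun_q _ _)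
      rw [poisson_p_q] at h
      have hp := Scales.tfNorm_linear_le (P := P) (m := m) (f := fun x => x.2.2.1 ⟨0, hm⟩)
        (j := ⟨0, hm⟩) two_pos one_pos (fun x => by
          rw [Scales.chart_apply]; exact pCoord_eq _ _ _)
      have hq := Scales.tfNorm_linear_le (P := P) (m := m) (f := fun x => x.2.2.2 ⟨0, hm⟩)
        (j := ⟨0, hm⟩) two_pos one_pos (fun x => by
          rw [Scales.chart_apply]; exact qCoord_eq _ _ _)
      have h1' := Scales.one_le_tfNorm_one (P := P) (m := m) (t := 1) (x := 0) (by norm_num [hP])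
        (by simpa [hP] using h1) (P.mem_dom_iff.2 ⟨⟨0, trivial, by simp [hP]⟩, fun i => i.elim0,
          fun j => by simpa [hP] using h1⟩)
      simp only [hP, one_mul] at h1' hp hq
      rw [mul_one] at hp hq
      have hp' := hp.trans (ENNReal.ofReal_le_ofReal (norm_pCoord_add_le kd))
      have hq' := hq.trans (ENNReal.ofReal_le_ofReal (norm_qCoord_add_le kd))
      have h2 := (h1'.trans h).trans (mul_le_mul' (mul_le_mul' le_rfl hp') hq')
      have hmin : min ((1 : ℝ) * 1) (ε' ^ 2) = ε' ^ 2 := by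
        rw [one_mul]; exact min_eq_right (by nlinarith)
      rw [hmin, ← ENNReal.ofReal_mul (by positivity), ← ENNReal.ofReal_mul (by positivity),
        mul_assoc, Real.mul_self_sqrt (by norm_num), ENNReal.one_le_ofReal] at h2
      rw [div_mul_eq_mul_div, le_div_iff₀ (by positivity)] at h2
      linarith
    have hlim : Tendsto (fun ε' : ℝ => ε' ^ 2 / 2) (𝓝[<] 1) (𝓝 (1 ^ 2 / 2)) :=
      Tendsto.mono_left (ContinuousAt.tendsto (by fun_prop)) nhdsWithin_le_nhds
    have := le_of_tendsto hlim (by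
      filter_upwards [Ioo_mem_nhdsLT (show (0 : ℝ) < 1 by norm_num)] with x hx
      exact key x hx.1 hx.2)
    simpa using this

end Averaging

/-! ### Back to the original coordinates: symplectic maps and displacements. -/

namespace Averaging

open ModeSystem

namespace Scales

variable {ι : Type} [Fintype ι] [DecidableEq ι] {m : ℕ} {P : Scales ι}
variable {t : ℝ} {κ : Mode ι m} {F : Mode ι m → Esp ι m → ℂ} {f g : Phase ι m → ℂ}

lemma modeNorm_conjMode (kd : Kind) (κ : Mode ι m) :
    modeNorm (conjMode kd ι m κ) = modeNorm κ := by
  have e1 : conjMode .hyperbolic ι m κ = (-κ.1, κ.2) := rfl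
  have e2 : conjMode .elliptic ι m κ = -κ := rfl
  cases kd <;> simp [modeNorm, e1, e2]

/-- In the hyperbolic case conjugation acts by `(k, l) ↦ (-k, l)`, which need not preserve a
subgroup; this is where the trivial lattice is used. In the elliptic case it is negation. -/
lemma conjMode_mem_iff {kd : Kind} {L : AddSubgroup (Mode ι m)}
    (hL : kd = Kind.hyperbolic → L = ⊥) (κ : Mode ι m) : conjMode kd ι m κ ∈ L ↔ κ ∈ L := by
  cases kd
  · rw [hL rfl, AddSubgroup.mem_bot, AddSubgroup.mem_bot, AddEquiv.map_eq_zero_iff]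
  · exact neg_mem_iff

/-- A canonical map in the original coordinates. -/
noncomputable def unchart (P : Scales ι) (Φ : Esp ι m → Esp ι m) (y : Phase ι m) : Phase ι m :=
  P.chart (Φ (P.chart.symm y))

lemma _root_.Averaging.ModeSystem.IsCanonical.realSymplecticMap {a b : ℝ} {Φ : Esp ι m → Esp ι m}
    (hΦ : (P.system m).IsCanonical a b Φ) :
    RealSymplecticMap (P.unchart Φ) (P.phaseDom m a) (P.phaseDom m b) where
  mapsTo y hy := hΦ.mapsTo (symm_mem_dom hy)
  holo := P.chart.differentiable.comp_differentiableOn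
    (hΦ.holo.comp P.chart.symm.differentiable.differentiableOn fun y hy => symm_mem_dom hy)
  injOn y hy y' hy' h := P.chart.symm.injective
    (hΦ.injOn (symm_mem_dom hy) (symm_mem_dom hy') (P.chart.injective h))
  equivariant k y hy := by
    set g : (ι → ℝ) × (Fin m → ℝ) := (fun i => 2 * Real.pi * (k i : ℝ), 0) with hg
    set v : Esp ι m := (0, fun i => (P.s' : ℂ)⁻¹ * (castC g).1 i, 0, 0) with hv
    have hact : ∀ x, (P.system m).act g x = x + v := fun x => by
      refine Prod.ext ?_ (Prod.ext ?_ (Prod.ext ?_ ?_)) <;> [ext i; funext i; funext i; funext i] <;>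
        simp [system, actC, castC, hv, hg]
    have hshift : ∀ x, P.chart (x + v) = shift k (P.chart x) := fun x => by
      rw [← hact, ← chart_actC_shift, ← castC_turn_int]
      rfl
    have h1 := hΦ.periodic g v hact (exp_phase_int k) _ (symm_mem_dom hy)
    rw [unchart, unchart, ← hshift, ← h1]
    congr 2
    apply P.chart.injective
    rw [hshift, ContinuousLinearEquiv.apply_symm_apply, ContinuousLinearEquiv.apply_symm_apply]
  real y hy hre := by
    have h1 : P.conjL (P.chart.symm y) = P.chart.symm y := by
      apply P.chart.injective
      rw [chart_conjL, ContinuousLinearEquiv.apply_symm_apply]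
      refine Prod.ext ?_ (Prod.ext ?_ (Prod.ext ?_ ?_)) <;> funext i
      · exact Complex.conj_eq_iff_im.2 (hre.1 i)
      · exact Complex.conj_eq_iff_im.2 (hre.2.1 i)
      · exact Complex.conj_eq_iff_im.2 (hre.2.2.1 i)
      · exact Complex.conj_eq_iff_im.2 (hre.2.2.2 i)
    have h2 : Φ (P.conjL (P.chart.symm y)) = P.conjL (Φ (P.chart.symm y)) :=
      hΦ.conj _ (symm_mem_dom hy)
    have h3 : P.unchart Φ y = star (P.unchart Φ y) := by
      rw [unchart, ← chart_conjL, ← h2, h1]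
    have him : ∀ a : ℂ, a = star a → a.im = 0 := fun a ha => Complex.conj_eq_iff_im.1 ha.symm
    refine ⟨fun i => him _ ?_, fun i => him _ ?_, fun i => him _ ?_, fun i => him _ ?_⟩
    · exact congrArg (fun y : Phase ι m => y.1 i) h3
    · exact congrArg (fun y : Phase ι m => y.2.1 i) h3
    · exact congrArg (fun y : Phase ι m => y.2.2.1 i) h3
    · exact congrArg (fun y : Phase ι m => y.2.2.2 i) h3
  symplectic y hy u v := by
    have h1 : HasFDerivAt (P.unchart Φ) (P.chart.toContinuousLinearMap.comp
        ((fderiv ℂ Φ (P.chart.symm y)).comp P.chart.symm.toContinuousLinearMap)) y :=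
      P.chart.hasFDerivAt.comp y ((hΦ.holo.differentiableAt
        ((P.isOpen_dom a).mem_nhds (symm_mem_dom hy))).hasFDerivAt.comp y P.chart.symm.hasFDerivAt)
    have h2 := hΦ.sympl _ (symm_mem_dom hy) (P.chart.symm u) (P.chart.symm v)
    have h3 : ∀ u v, (P.system m).Ω u v = symplForm (P.chart u) (P.chart v) := P.form_eq
    rw [h3, h3, ContinuousLinearEquiv.apply_symm_apply, ContinuousLinearEquiv.apply_symm_apply] at h2
    rw [h1.fderiv]
    exact h2

/-- Some of the actions, with the `1`-norm. -/
noncomputable def someActions (P : Scales ι) {κ : Type} [Fintype κ] (e : κ → ι) :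
    Esp ι m →L[ℂ] PiLp 1 (fun _ : κ => ℂ) :=
  LinearMap.toContinuousLinearMap
    { toFun := fun x => WithLp.toLp 1 fun i => (P.r' : ℂ) * x.1 (e i)
      map_add' := fun x y => by ext i; simp [mul_add]
      map_smul' := fun c x => by ext i; simp [mul_left_comm] }

lemma someActions_apply {κ : Type} [Fintype κ] (e : κ → ι) (x : Esp ι m) :
    P.someActions e x = WithLp.toLp 1 fun i => (P.r' : ℂ) * x.1 (e i) := rfl

/-- The action components of a Hamiltonian field are angle derivatives, whose `ℓ¹` sum is controlled
by the norm of the differential; the scaling leaves `1 / s'`. -/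
lemma norm_someActions_Jmap_le {κ : Type} [Fintype κ] {e : κ → ι} (he : Function.Injective e)
    (ℓ : Esp ι m →L[ℂ] ℂ) : ‖P.someActions e (P.Jmap ℓ)‖ ≤ P.s'⁻¹ * ‖ℓ‖ := by
  have hs := P.hs
  rw [someActions_apply, PiLp.norm_eq_of_L1]
  have h : ∀ i, ‖(P.r' : ℂ) * (P.Jmap ℓ).1 (e i)‖ = P.s'⁻¹ * ‖ℓ (eφ m (e i))‖ := fun i => by
    rw [Jmap_apply]
    simp only [norm_mul, P.norm_rs, Complex.norm_real, Real.norm_of_nonneg P.hr.le]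
    have := P.hr
    field_simp
  simp only [h, ← Finset.mul_sum]
  have h2 : ∑ i, ‖ℓ (eφ m (e i))‖ ≤ ∑ i, ‖ℓ (eφ m i)‖ := by
    refine (Finset.sum_map Finset.univ ⟨e, he⟩ fun i => ‖ℓ (eφ m i)‖).symm.le.trans ?_
    exact Finset.sum_le_sum_of_subset_of_nonneg (Finset.subset_univ _) fun _ _ _ => norm_nonneg _
  have h3 := h2.trans (sum_norm_apply_eφ_le ℓ)
  gcongr

/-- The angles. -/
noncomputable def angles (P : Scales ι) (m : ℕ) : Esp ι m →L[ℂ] (ι → ℂ) :=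
  (ContinuousLinearMap.fst ℂ _ _).comp ((ContinuousLinearMap.snd ℂ _ _).comp
    (P.chart (m := m)).toContinuousLinearMap)

/-- The coordinates `p`. -/
noncomputable def momenta (P : Scales ι) (m : ℕ) : Esp ι m →L[ℂ] (Fin m → ℂ) :=
  (ContinuousLinearMap.fst ℂ _ _).comp ((ContinuousLinearMap.snd ℂ _ _).comp
    ((ContinuousLinearMap.snd ℂ _ _).comp (P.chart (m := m)).toContinuousLinearMap))

/-- The coordinates `q`. -/
noncomputable def positions (P : Scales ι) (m : ℕ) : Esp ι m →L[ℂ] (Fin m → ℂ) :=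
  (ContinuousLinearMap.snd ℂ _ _).comp ((ContinuousLinearMap.snd ℂ _ _).comp
    ((ContinuousLinearMap.snd ℂ _ _).comp (P.chart (m := m)).toContinuousLinearMap))

lemma norm_chart_symm_dirI (i : ι) : ‖P.chart.symm (dirI m i)‖ ≤ P.r'⁻¹ := by
  have hr := P.hr
  have h0 : ∀ kd, zCoord kd 0 0 = 0 ∧ wCoord kd 0 0 = 0 := fun kd => by
    cases kd <;> simp [zCoord, wCoord]
  rw [chart_symm_apply]
  have e : ((WithLp.toLp 1 fun k => (P.r' : ℂ)⁻¹ * (dirI m i).1 k : PiLp 1 fun _ : ι => ℂ)) =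
      (P.r' : ℂ)⁻¹ • WithLp.toLp 1 (Pi.single i 1) := by
    ext k; simp [dirI, Pi.single_apply]
  rw [Prod.norm_def, Prod.norm_def, Prod.norm_def]
  simp only [e, norm_smul]
  refine max_le ?_ (max_le ?_ (max_le ?_ ?_))
  · simp [abs_of_pos hr]
  all_goals
    refine (pi_norm_le_iff_of_nonneg (by positivity)).2 fun k => ?_
    simp [dirI, h0, hr.le]

lemma norm_chart_symm_pair {v w : Fin m → ℂ}
    (hz : ∀ j, ‖zCoord P.kd (v j) (w j)‖ ≤ 1) (hw : ∀ j, ‖wCoord P.kd (v j) (w j)‖ ≤ 1) :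
    ‖P.chart.symm ((0, 0, v, w) : Phase ι m)‖ ≤ P.ε'⁻¹ := by
  have hε := P.hε
  have hn : ‖(P.ε' : ℂ)⁻¹‖ = P.ε'⁻¹ := by
    rw [norm_inv, Complex.norm_real, Real.norm_of_nonneg hε.le]
  rw [chart_symm_apply, Prod.norm_def, Prod.norm_def, Prod.norm_def]
  refine max_le ?_ (max_le ?_ (max_le ?_ ?_))
  · rw [PiLp.norm_eq_of_L1]; simp [hε.le]
  · refine (pi_norm_le_iff_of_nonneg (by positivity)).2 fun k => ?_
    simp [hε.le]
  · refine (pi_norm_le_iff_of_nonneg (by positivity)).2 fun k => ?_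
    rw [norm_mul, hn]
    exact mul_le_of_le_one_right (by positivity) (hz k)
  · refine (pi_norm_le_iff_of_nonneg (by positivity)).2 fun k => ?_
    rw [norm_mul, hn]
    exact mul_le_of_le_one_right (by positivity) (hw k)

lemma norm_zw_le (kd : Kind) {p q : ℂ} (h : ‖p‖ + ‖q‖ ≤ 1) :
    ‖zCoord kd p q‖ ≤ 1 ∧ ‖wCoord kd p q‖ ≤ 1 := by
  have hp := norm_nonneg p
  have hq := norm_nonneg q
  have h2 : (1 : ℝ) ≤ √2 := Real.one_le_sqrt.2 (by norm_num)
  have h3 : ‖p + Complex.I * q‖ ≤ 1 := by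
    refine (norm_add_le _ _).trans ?_
    simpa using h
  have h4 : ‖p - Complex.I * q‖ ≤ 1 := by
    refine (norm_sub_le _ _).trans ?_
    simpa using h
  have h5 : ‖((√2 : ℝ) : ℂ)‖ = √2 := by
    rw [Complex.norm_real, Real.norm_of_nonneg (Real.sqrt_nonneg _)]
  cases kd
  · simp only [zCoord, wCoord]
    exact ⟨by linarith, by linarith⟩
  · simp only [zCoord, wCoord, norm_div, norm_mul, Complex.norm_I, one_mul, h5]
    exact ⟨div_le_one_of_le₀ (h4.trans h2) (by positivity),
      div_le_one_of_le₀ (h3.trans h2) (by positivity)⟩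

lemma norm_chart_symm_dirp (j : Fin m) : ‖P.chart.symm (dirp ι j)‖ ≤ P.ε'⁻¹ := by
  have h : ∀ k, ‖(Pi.single j 1 : Fin m → ℂ) k‖ + ‖(0 : Fin m → ℂ) k‖ ≤ 1 := fun k => by
    by_cases hk : k = j <;> simp [hk]
  exact norm_chart_symm_pair (fun k => (norm_zw_le _ (h k)).1) fun k => (norm_zw_le _ (h k)).2

lemma norm_chart_symm_dirq (j : Fin m) : ‖P.chart.symm (dirq ι j)‖ ≤ P.ε'⁻¹ := by
  have h : ∀ k, ‖(0 : Fin m → ℂ) k‖ + ‖(Pi.single j 1 : Fin m → ℂ) k‖ ≤ 1 := fun k => by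
    by_cases hk : k = j <;> simp [hk]
  exact norm_chart_symm_pair (fun k => (norm_zw_le _ (h k)).1) fun k => (norm_zw_le _ (h k)).2

lemma norm_angles_Jmap_le (ℓ : Esp ι m →L[ℂ] ℂ) : ‖P.angles m (P.Jmap ℓ)‖ ≤ P.r'⁻¹ * ‖ℓ‖ := by
  have hr := P.hr
  have e : P.angles m (P.Jmap ℓ) = (P.chart (P.Jmap ℓ)).2.1 := rfl
  rw [e, chart_Jmap]
  refine (pi_norm_le_iff_of_nonneg (by positivity)).2 fun i => ?_
  rw [norm_neg, mul_comm]
  exact ℓ.le_opNorm_of_le (norm_chart_symm_dirI i)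

lemma norm_momenta_Jmap_le (ℓ : Esp ι m →L[ℂ] ℂ) : ‖P.momenta m (P.Jmap ℓ)‖ ≤ P.ε'⁻¹ * ‖ℓ‖ := by
  have hε := P.hε
  have e : P.momenta m (P.Jmap ℓ) = (P.chart (P.Jmap ℓ)).2.2.1 := rfl
  rw [e, chart_Jmap]
  refine (pi_norm_le_iff_of_nonneg (by positivity)).2 fun i => ?_
  rw [mul_comm]
  exact ℓ.le_opNorm_of_le (norm_chart_symm_dirq i)

lemma norm_positions_Jmap_le (ℓ : Esp ι m →L[ℂ] ℂ) :
    ‖P.positions m (P.Jmap ℓ)‖ ≤ P.ε'⁻¹ * ‖ℓ‖ := by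
  have hε := P.hε
  have e : P.positions m (P.Jmap ℓ) = (P.chart (P.Jmap ℓ)).2.2.2 := rfl
  rw [e, chart_Jmap]
  refine (pi_norm_le_iff_of_nonneg (by positivity)).2 fun i => ?_
  rw [norm_neg, mul_comm]
  exact ℓ.le_opNorm_of_le (norm_chart_symm_dirp i)

/-- Modes independent of an angle do not move the conjugate action. -/
lemma ModeFun.someActions_ham {G : Esp ι m → ℂ} (hG : P.ModeFun t κ G) {α : Type} [Fintype α]
    {e : α → ι} (hκ : ∀ i, κ.1 (e i) = 0) {x : Esp ι m} (hx : x ∈ P.dom m t) :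
    P.someActions e (P.Jmap (fderiv ℂ G x)) = 0 := by
  rw [someActions_apply, Jmap_apply]
  ext i
  -- The unit vector of the angle `e i` is a generator of the torus on which the index `κ` vanishes.
  have h := hG.fderiv_gen (Pi.single (e i) (P.s' : ℂ), 0) hx
  have e1 : P.gen (Pi.single (e i) (P.s' : ℂ), 0) x = eφ m (e i) := by
    refine Prod.ext rfl (Prod.ext ?_ (Prod.ext ?_ ?_))
    · funext k
      by_cases hk : k = e i
      · subst hk; simp [gen, eφ, P.s_ne]
      · simp [gen, eφ, Pi.single_eq_of_ne hk]
    · funext k; simp [gen, eφ]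
    · funext k; simp [gen, eφ]
  have e2 : phase (Pi.single (e i) (P.s' : ℂ), 0) κ = 0 := by
    simp [phase, Pi.single_apply, hκ]
  rw [e1, e2, mul_zero, zero_mul] at h
  simp [h]

lemma unchart_sub (Φ : Esp ι m → Esp ι m) (y : Phase ι m) :
    P.unchart Φ y - y = P.chart (Φ (P.chart.symm y) - P.chart.symm y) := by
  rw [map_sub, ContinuousLinearEquiv.apply_symm_apply, unchart]

variable {d : Mode ι m → Esp ι m → ℂ} {N : Set (Mode ι m)} {Φ : Esp ι m → Esp ι m} {C β : ℝ}

/-- Modes whose frequencies vanish in the chosen directions do not move these actions, so their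
divisors are exempt from the lower bound `β`. With the indices of `I₁` this allows `β = α₁`. -/
lemma actions_displacement (hΦ : (P.system m).DisplacedBy d N t Φ C) (hβ : 0 < β) {α : Type}
    [Fintype α] {e : α → ι} (he : Function.Injective e)
    (hd : ∀ κ ∈ N, (∀ x ∈ P.dom m 0, β ≤ ‖d κ x‖) ∨ ∀ i, κ.1 (e i) = 0) {y : Phase ι m}
    (hy : y ∈ P.phaseDom m t) :
    β * P.s' * ∑ i, ‖(P.unchart Φ y).1 (e i) - y.1 (e i)‖ ≤ C := by
  have hs := P.hs
  have h := hΦ _ (P.someActions e) P.s'⁻¹ β hβ (by positivity) (norm_someActions_Jmap_le he)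
    (fun κ hκ => (hd κ hκ).imp id fun h t _ G hG hm x hx =>
      ModeFun.someActions_ham (κ := κ) ⟨hG, hm⟩ h hx) _ (symm_mem_dom hy)
  rw [someActions_apply, PiLp.norm_eq_of_L1] at h
  have e1 : ∀ i, (P.unchart Φ y).1 (e i) - y.1 (e i) =
      P.r' * (Φ (P.chart.symm y) - P.chart.symm y).1 (e i) := fun i =>
    congrArg (fun z : Phase ι m => z.1 (e i)) (unchart_sub Φ y)
  simp only [e1]
  calc _ ≤ β * P.s' * (P.s'⁻¹ * (C / β)) := by gcongr
    _ = C := by field_simp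

lemma angles_displacement (hΦ : (P.system m).DisplacedBy d N t Φ C) (hβ : 0 < β)
    (hd : ∀ κ ∈ N, ∀ x ∈ P.dom m 0, β ≤ ‖d κ x‖) {y : Phase ι m} (hy : y ∈ P.phaseDom m t) :
    β * P.r' * ‖(P.unchart Φ y).2.1 - y.2.1‖ ≤ C := by
  have hr := P.hr
  have h := hΦ _ (P.angles m) P.r'⁻¹ β hβ (by positivity) norm_angles_Jmap_le
    (fun κ hκ => .inl (hd κ hκ)) _ (symm_mem_dom hy)
  have e1 : (P.unchart Φ y).2.1 - y.2.1 = P.angles m (Φ (P.chart.symm y) - P.chart.symm y) :=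
    congrArg (fun z : Phase ι m => z.2.1) (unchart_sub Φ y)
  rw [e1]
  calc _ ≤ β * P.r' * (P.r'⁻¹ * (C / β)) := by gcongr
    _ = C := by field_simp

lemma momenta_displacement (hΦ : (P.system m).DisplacedBy d N t Φ C) (hβ : 0 < β)
    (hd : ∀ κ ∈ N, ∀ x ∈ P.dom m 0, β ≤ ‖d κ x‖) {y : Phase ι m} (hy : y ∈ P.phaseDom m t) :
    β * P.ε' * ‖(P.unchart Φ y).2.2.1 - y.2.2.1‖ ≤ C := by
  have hε := P.hε
  have h := hΦ _ (P.momenta m) P.ε'⁻¹ β hβ (by positivity) norm_momenta_Jmap_le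
    (fun κ hκ => .inl (hd κ hκ)) _ (symm_mem_dom hy)
  have e1 : (P.unchart Φ y).2.2.1 - y.2.2.1 = P.momenta m (Φ (P.chart.symm y) - P.chart.symm y) :=
    congrArg (fun z : Phase ι m => z.2.2.1) (unchart_sub Φ y)
  rw [e1]
  calc _ ≤ β * P.ε' * (P.ε'⁻¹ * (C / β)) := by gcongr
    _ = C := by field_simp

lemma positions_displacement (hΦ : (P.system m).DisplacedBy d N t Φ C) (hβ : 0 < β)
    (hd : ∀ κ ∈ N, ∀ x ∈ P.dom m 0, β ≤ ‖d κ x‖) {y : Phase ι m} (hy : y ∈ P.phaseDom m t) :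
    β * P.ε' * ‖(P.unchart Φ y).2.2.2 - y.2.2.2‖ ≤ C := by
  have hε := P.hε
  have h := hΦ _ (P.positions m) P.ε'⁻¹ β hβ (by positivity) norm_positions_Jmap_le
    (fun κ hκ => .inl (hd κ hκ)) _ (symm_mem_dom hy)
  have e1 : (P.unchart Φ y).2.2.2 - y.2.2.2 =
      P.positions m (Φ (P.chart.symm y) - P.chart.symm y) :=
    congrArg (fun z : Phase ι m => z.2.2.2) (unchart_sub Φ y)
  rw [e1]
  calc _ ≤ β * P.ε' * (P.ε'⁻¹ * (C / β)) := by gcongr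
    _ = C := by field_simp

end Scales

end Averaging

/-! ### The exponential remainder. -/

namespace Averaging

open ModeSystem

/-- The two contributions to the remainder of the normal form add up to `e^{-X/4} η`. -/
lemma normal_form_exp_le {X μ η : ℝ} (hX : 8 * Real.log 2 ≤ X) (hμX : 4 * X * μ ≤ 1)
    (hη : 0 ≤ η) : 1 / 20 * Real.exp (-(X / 4)) * η + Real.exp (-(X / 2)) * (η + 5 / 4 * μ * η) ≤
      Real.exp (-(X / 4)) * η := by
  have hlog := Real.log_two_gt_d9
  -- The hypothesis `X ≥ 8 log 2` is exactly what makes one of the two factors `e^{-X/4}` in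
  -- `e^{-X/2}` at most `1/4`; it absorbs the sizes of `f` and of the remainder.
  have h1 : Real.exp (-(X / 4)) ≤ 1 / 4 := by
    have h2 : Real.exp (-(2 * Real.log 2)) = 1 / 4 := by
      rw [Real.exp_neg, mul_comm, Real.exp_mul, Real.exp_log two_pos]; norm_num
    rw [← h2]
    exact Real.exp_le_exp.2 (by linarith)
  have h3 : Real.exp (-(X / 2)) = Real.exp (-(X / 4)) * Real.exp (-(X / 4)) := by
    rw [← Real.exp_add]; congr 1; ring
  have hμ : μ ≤ 1 / 20 := by
    by_contra h
    push Not at h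
    nlinarith
  have hE := Real.exp_pos (-(X / 4))
  have h4 : Real.exp (-(X / 4)) * (η + 5 / 4 * μ * η) ≤ 1 / 4 * (η + 5 / 4 * (1 / 20) * η) := by
    have h5 : η + 5 / 4 * μ * η ≤ η + 5 / 4 * (1 / 20) * η := by nlinarith
    have h6 : 0 ≤ η + 5 / 4 * (1 / 20) * η := by positivity
    exact (mul_le_mul_of_nonneg_left h5 hE.le).trans (mul_le_mul_of_nonneg_right h1 h6)
  calc _ = Real.exp (-(X / 4)) * (1 / 20 * η + Real.exp (-(X / 4)) * (η + 5 / 4 * μ * η)) := by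
        rw [h3]; ring
    _ ≤ Real.exp (-(X / 4)) * η := by
        refine mul_le_mul_of_nonneg_left ?_ hE.le
        linarith

namespace Scales

variable {ι : Type} [Fintype ι] [DecidableEq ι] {m : ℕ} {P : Scales ι}

lemma nrm_four_indicator_le {F : Mode ι m → Esp ι m → ℂ} (hF : (P.system m).IsFam (7 / 2) F)
    (hε : 4 * P.ε' < P.ε) {K σ : ℝ} (hσ0 : 0 ≤ σ) (hσs : σ ≤ P.s') (hσε : σ ≤ P.ε' / P.ε) :
    (P.system m).nrm 4 ({κ | modeNorm κ ≤ K}ᶜ.indicator F) ≤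
      ENNReal.ofReal (Real.exp (-(K * σ / 2))) * (P.system m).nrm (7 / 2) F := by
  rw [nrm, nrm, ← ENNReal.tsum_mul_left]
  refine ENNReal.tsum_le_tsum fun κ => ?_
  by_cases h : modeNorm κ ≤ K
  · rw [Set.indicator_of_notMem (by simpa using h)]
    simp [supN]
  · rw [Set.indicator_of_mem (by simpa using h)]
    exact (IsFam.modeFun hF κ).supN_four_le hε (not_le.1 h).le hσ0 hσs hσε

end Scales

end Averaging

end

/-! ### The averaging theorem. -/

set_option maxHeartbeats 2000000 in
open Averaging in
theorem mainTheorem5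
    (kd : Kind) (n₁ n₂ m : ℕ) (hm : 0 < m)
    (A : Set (Fin n₁ ⊕ Fin n₂ → ℝ))
    (L : AddSubgroup (Mode (Fin n₁ ⊕ Fin n₂) m))
    -- the lattice is arbitrary for elliptic coordinates, trivial for hyperbolic ones
    (hkd : kd = Kind.hyperbolic → m = 1 ∧ L = ⊥)
    (K r s ε r' s' ε' α₁ α₂ σ δ : ℝ) (hK : 0 < K)
    (hr' : 0 < r') (hr : r' < r / 4) (hs' : 0 < s') (hs : s' < s / 4)
    (hε' : 0 < ε') (hε : ε' < ε / 4)
    (hσ : σ = min s' (ε' / ε)) (hδ : δ = min (r' * s') (ε' ^ 2))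
    (hα₂ : 0 < α₂) (hα : α₂ ≤ α₁)
    (h : (Fin n₁ ⊕ Fin n₂ → ℂ) × (Fin m → ℂ) → ℂ)
    (f : Phase (Fin n₁ ⊕ Fin n₂) m → ℂ)
    (hh : RealAnalyticIntegrable h (actionDomain A m r ε))
    (hf : RealAnalyticFun f (domain kd A r s ε))
    (hfin : tfNorm kd A r s ε f ≠ ⊤)
    -- non-resonance up to order `K`
    (hnr : ∀ κ : Mode (Fin n₁ ⊕ Fin n₂) m, κ ∉ L → modeNorm κ ≤ K →
      ∀ u ∈ baseDomain kd A r ε,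
        ((∃ i, κ.1 (Sum.inl i) ≠ 0) → α₁ ≤ ‖divisor kd h κ u‖) ∧
        ((∀ i, κ.1 (Sum.inl i) = 0) → α₂ ≤ ‖divisor kd h κ u‖))
    -- smallness
    (hKσ : 8 * Real.log 2 ≤ K * σ)
    (hsmall : 2 ^ 3 * bracketConst kd m * K * σ / (α₂ * δ) * (tfNorm kd A r s ε f).toReal < 1) :
    ∃ (Φ : Phase (Fin n₁ ⊕ Fin n₂) m → Phase (Fin n₁ ⊕ Fin n₂) m)
      (g fstar : Phase (Fin n₁ ⊕ Fin n₂) m → ℂ),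
      RealSymplecticMap Φ (domain kd A (r - 4 * r') (s - 4 * s') (ε - 4 * ε'))
        (domain kd A r s ε) ∧
      RealAnalyticFun g (domain kd A (r - 4 * r') (s - 4 * s') (ε - 4 * ε')) ∧
      RealAnalyticFun fstar (domain kd A (r - 4 * r') (s - 4 * s') (ε - 4 * ε')) ∧
      -- the conjugation `H ∘ Φ = h + g + f_*`
      (∀ x ∈ domain kd A (r - 4 * r') (s - 4 * s') (ε - 4 * ε'),
        h ((Φ x).1, actions kd (Φ x).2.2) + f (Φ x) =
          h (x.1, actions kd x.2.2) + g x + fstar x) ∧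
      InNormalForm kd K L g (domain kd A (r - 4 * r') (s - 4 * s') (ε - 4 * ε')) ∧
      tfNorm kd A (r - 4 * r') (s - 4 * s') (ε - 4 * ε')
          (fun x => g x - latticeProj kd L (truncation kd K f) x) ≤
        ENNReal.ofReal (8 * bracketConst kd m / (α₂ * δ)) * tfNorm kd A r s ε f ^ 2 ∧
      tfNorm kd A (r - 4 * r') (s - 4 * s') (ε - 4 * ε') fstar ≤
        ENNReal.ofReal (Real.exp (-(K * σ / 4))) * tfNorm kd A r s ε f ∧
      -- distance of `Φ` from the identity
      ∀ x ∈ domain kd A (r - 4 * r') (s - 4 * s') (ε - 4 * ε'),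
        α₁ * s' * (∑ i, ‖(Φ x).1 (Sum.inl i) - x.1 (Sum.inl i)‖) ≤
          2 * bracketConst kd m * (tfNorm kd A r s ε f).toReal ∧
        α₂ * s' * (∑ i, ‖(Φ x).1 (Sum.inr i) - x.1 (Sum.inr i)‖) ≤
          2 * bracketConst kd m * (tfNorm kd A r s ε f).toReal ∧
        α₂ * r' * ‖(Φ x).2.1 - x.2.1‖ ≤
          2 * bracketConst kd m * (tfNorm kd A r s ε f).toReal ∧
        α₂ * ε' * ‖(Φ x).2.2.1 - x.2.2.1‖ ≤
          2 * bracketConst kd m * (tfNorm kd A r s ε f).toReal ∧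
        α₂ * ε' * ‖(Φ x).2.2.2 - x.2.2.2‖ ≤
          2 * bracketConst kd m * (tfNorm kd A r s ε f).toReal := by
  set P : Scales (Fin n₁ ⊕ Fin n₂) := ⟨kd, A, r, s, ε, r', s', ε', hr', hs', hε'⟩ with hP
  set S := P.system m with hS
  have hδ0 : 0 < δ := hδ ▸ P.δ_pos
  have hε0 : 0 < ε := by linarith
  have hσ0 : 0 ≤ σ := hσ ▸ le_min hs'.le (div_nonneg hε'.le hε0.le)
  -- The averaging works with the constant `1` in the bracket estimate. Since `c ≥ 1/2`, the
  -- hypothesis with `8 c` gives the smallness condition with `4`, and the bounds with `8 c` and `2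
  -- c` follow from those with `5/4` and `1`.
  have hc := half_le_bracketConst kd hm
  set c := bracketConst kd m with hcdef
  set η := (tfNorm kd A r s ε f).toReal with hη
  have hη0 : 0 ≤ η := ENNReal.toReal_nonneg
  have hηf : ENNReal.ofReal η = tfNorm kd A r s ε f := ENNReal.ofReal_toReal hfin
  have hαδ : 0 < α₂ * δ := mul_pos hα₂ hδ0
  -- the modes of `f`
  have d0 : domain kd A r s ε = P.phaseDom m 0 := by simp [Scales.phaseDom, hP]
  have n0 : tfNorm kd A r s ε f = tfNorm P.kd P.A (P.r - 0 * P.r') (P.s - 0 * P.s')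
      (P.ε - 0 * P.ε') f := by simp [hP]
  have hs0 : 0 < P.s - 0 * P.s' := by simp only [hP]; linarith
  have hε00 : 0 < P.ε - 0 * P.ε' := by simp only [hP]; linarith
  have hs4 : 0 < P.s - 4 * P.s' := by simp only [hP]; linarith
  have hε4 : 0 < P.ε - 4 * P.ε' := by simp only [hP]; linarith
  rw [d0] at hf ⊢
  set F := P.modeCoeff (fun x => f (P.chart x)) with hFdef
  have hnF : S.nrm 0 F = ENNReal.ofReal η := by
    rw [hηf, n0, Scales.tfNorm_eq_nrm_modeCoeff hs0 hε00 hf.periodicFun]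
  have hnF' : S.nrm 0 F ≠ ⊤ := by rw [hnF]; exact ENNReal.ofReal_ne_top
  obtain ⟨hF, hfF⟩ := hf.isFam hnF'
  -- sets of modes
  have hL : kd = Kind.hyperbolic → L = ⊥ := fun h => (hkd h).2
  set T : Set (Mode (Fin n₁ ⊕ Fin n₂) m) := {κ | modeNorm κ ≤ K} with hT
  set N : Set (Mode (Fin n₁ ⊕ Fin n₂) m) := (L : Set _)ᶜ ∩ T with hN
  set B : Set (Mode (Fin n₁ ⊕ Fin n₂) m) := (L : Set _) ∩ T with hB
  have hσL : ∀ κ, S.σ κ ∈ (L : Set (Mode (Fin n₁ ⊕ Fin n₂) m)) ↔ κ ∈ (L : Set _) :=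
    fun κ => Scales.conjMode_mem_iff hL κ
  have hσT : ∀ κ, S.σ κ ∈ T ↔ κ ∈ T := fun κ =>
    iff_of_eq (congrArg (· ≤ K) (Scales.modeNorm_conjMode kd κ))
  have hσN : ∀ κ, S.σ κ ∈ N ↔ κ ∈ N := fun κ => and_congr (not_congr (hσL κ)) (hσT κ)
  have hσB : ∀ κ, S.σ κ ∈ B ↔ κ ∈ B := fun κ => and_congr (hσL κ) (hσT κ)
  -- the averaging theorem
  set d := P.divC h with hd
  have hdiv : ∀ κ x, ‖d κ x‖ = ‖divisor kd h κ ((P.chart x).1, (P.chart x).2.2)‖ := fun κ x => by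
    rw [hd, Scales.divC, norm_mul, norm_neg, Complex.norm_I, one_mul]
  have hbase : ∀ x ∈ P.dom m 0, ((P.chart x).1, (P.chart x).2.2) ∈ baseDomain kd A r ε := by
    intro x hx
    have := Scales.chart_mem_baseDomain hx
    simpa [hP] using this
  have hdα₂ : ∀ κ ∈ N, ∀ x ∈ P.dom m 0, α₂ ≤ ‖d κ x‖ := by
    intro κ hκ x hx
    have h1 := hnr κ hκ.1 hκ.2 _ (hbase x hx)
    rw [hdiv]
    by_cases h2 : ∃ i, κ.1 (Sum.inl i) ≠ 0
    · exact hα.trans (h1.1 h2)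
    · push Not at h2
      exact h1.2 h2
  have hdα₁ : ∀ κ ∈ N, (∀ x ∈ P.dom m 0, α₁ ≤ ‖d κ x‖) ∨ ∀ i, κ.1 (Sum.inl i) = 0 := by
    intro κ hκ
    by_cases h2 : ∃ i, κ.1 (Sum.inl i) ≠ 0
    · left
      intro x hx
      rw [hdiv]
      exact (hnr κ hκ.1 hκ.2 _ (hbase x hx)).1 h2
    · push Not at h2
      exact .inr h2
  set μ := η / (α₂ * δ) with hμ
  have hμ0 : 0 ≤ μ := div_nonneg hη0 hαδ.le
  have hX : 5.545 ≤ K * σ := by linarith [Real.log_two_gt_d9]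
  have hμX : 4 * (K * σ) * μ ≤ 1 := by
    have e : 2 ^ 3 * c * K * σ / (α₂ * δ) * η = 8 * c * ((K * σ) * μ) := by
      rw [hμ]; ring
    rw [e] at hsmall
    have : 0 ≤ (K * σ) * μ := mul_nonneg (by linarith) hμ0
    nlinarith
  have hγ : S.γ * η ≤ μ * α₂ := by
    have e : S.γ = δ⁻¹ := by rw [hδ]; rfl
    rw [e, hμ]
    refine le_of_eq ?_
    field_simp
  obtain ⟨Φ, R, hΦ, hR, hnR, hnNR, heq, hdisp⟩ := ModeSystem.exists_averaging (P.unperturbed hh) hσN hα₂ hdα₂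
    hη0 hγ hμ0 hX hμX hF hnF.le
  -- the normal form and the remainder
  have h72 : (7 / 2 : ℝ) ≤ 4 := by norm_num
  have h04 : (0 : ℝ) ≤ 4 := by norm_num
  have h07 : (0 : ℝ) ≤ 7 / 2 := by norm_num
  have hnR' : S.nrm (7 / 2) R ≠ ⊤ := ne_top_of_le_ne_top ENNReal.ofReal_ne_top hnR
  have hnR4 : S.nrm 4 R ≠ ⊤ := ne_top_of_le_ne_top hnR' (ModeSystem.nrm_anti h72 R)
  have hnF4 : S.nrm 4 F ≠ ⊤ := ne_top_of_le_ne_top hnF' (ModeSystem.nrm_anti h04 F)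
  have hσNc : ∀ κ, S.σ κ ∈ Nᶜ ↔ κ ∈ Nᶜ := fun κ => not_congr (hσN κ)
  have hσBc : ∀ κ, S.σ κ ∈ Bᶜ ↔ κ ∈ Bᶜ := fun κ => not_congr (hσB κ)
  -- All that is left besides the integrable part. Its modes in `B`, resonant and of order at most
  -- `K`, form `g`, and the others form the remainder.
  set Q := Nᶜ.indicator F + R with hQ
  have hnNF4 : S.nrm 4 (Nᶜ.indicator F) ≠ ⊤ := ne_top_of_le_ne_top hnF4 (ModeSystem.nrm_indicator_le _ _)
  have hQfam : S.IsFam 4 Q := ((hF.anti h04).indicator hσNc).add (hR.anti h72)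
  have hnQ : S.nrm 4 Q ≠ ⊤ := ne_top_of_le_ne_top (ENNReal.add_ne_top.2 ⟨hnNF4, hnR4⟩)
    (ModeSystem.nrm_add_le _ _)
  have hGfam := hQfam.indicator hσB
  have hEfam := hQfam.indicator hσBc
  have hnG : S.nrm 4 (B.indicator Q) ≠ ⊤ := ne_top_of_le_ne_top hnQ (ModeSystem.nrm_indicator_le _ _)
  have hnE : S.nrm 4 (Bᶜ.indicator Q) ≠ ⊤ := ne_top_of_le_ne_top hnQ (ModeSystem.nrm_indicator_le _ _)
  set g : Phase (Fin n₁ ⊕ Fin n₂) m → ℂ := fun y => fsum (B.indicator Q) (P.chart.symm y) with hg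
  set e : Phase (Fin n₁ ⊕ Fin n₂) m → ℂ := fun y => fsum (Bᶜ.indicator Q) (P.chart.symm y) with he
  have hgG : Set.EqOn (fun x => g (P.chart x)) (fsum (B.indicator Q)) (P.dom m 4) := fun x _ => by
    simp [hg]
  have heE : Set.EqOn (fun x => e (P.chart x)) (fsum (Bᶜ.indicator Q)) (P.dom m 4) := fun x _ => by
    simp [he]
  have hBN : B ⊆ Nᶜ := fun κ hκ hκ' => hκ'.1 hκ.1
  -- `B` is disjoint from `N`, so the contribution of `F` to `g` is exactly the truncated projection
  -- of `f`, and the error of `g` is the `B`-part of `R`.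
  have hBQ : B.indicator Q = B.indicator F + B.indicator R := by
    rw [hQ, Set.indicator_add', Set.indicator_indicator, Set.inter_eq_left.2 hBN]
  have hBT : (L : Set (Mode (Fin n₁ ⊕ Fin n₂) m)).indicator (T.indicator F) = B.indicator F := by
    rw [Set.indicator_indicator]
  have hfF4 : Set.EqOn (fun x => f (P.chart x)) (fsum F) (P.dom m 4) :=
    hfF.mono (S.anti h04)
  have htrunc : ∀ {u : Phase (Fin n₁ ⊕ Fin n₂) m → ℂ}
      {U : Mode (Fin n₁ ⊕ Fin n₂) m → Esp (Fin n₁ ⊕ Fin n₂) m → ℂ}, S.IsFam 4 U →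
      S.nrm 4 U ≠ ⊤ → Set.EqOn (fun x => u (P.chart x)) (fsum U) (P.dom m 4) → ∀ x ∈ P.dom m 4,
      latticeProj kd L (truncation kd K u) (P.chart x) =
        fsum ((L : Set (Mode (Fin n₁ ⊕ Fin n₂) m)).indicator (T.indicator U)) x := by
    intro u U hU hnU huU x hx
    refine Scales.harmonicProj_chart (P := P) hs4 (hU.indicator hσT)
      (ne_top_of_le_ne_top hnU (ModeSystem.nrm_indicator_le _ _)) (fun y hy => ?_) _ hx
    exact Scales.harmonicProj_chart (P := P) hs4 hU hnU huU T hy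
  have hmem : ∀ y ∈ P.phaseDom m 4, P.chart.symm y ∈ P.dom m 4 := fun y hy =>
    Scales.symm_mem_dom hy
  have hη2 : η ≤ 2 * c * η := by nlinarith
  refine ⟨P.unchart Φ, g, e, (hΦ.anti h72 le_rfl).realSymplecticMap,
    Scales.IsFam.realAnalyticFun hGfam hnG hgG, Scales.IsFam.realAnalyticFun hEfam hnE heE,
    ?_, ?_, ?_, ?_, ?_⟩
  · intro y hy
    have hx := hmem y hy
    set x := P.chart.symm y with hxdef
    have hy' : y = P.chart x := by simp [hxdef]
    have hx7 : x ∈ P.dom m (7 / 2) := S.anti h72 hx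
    have h1 := heq x hx7
    have hH : ∀ x, P.hamC h x = h ((P.chart x).1, actions kd (P.chart x).2.2) := fun x => by
      rw [Scales.hamC, Scales.actionMap_eq]
    have h2 := hfF (hΦ.mapsTo hx7)
    have h3 := ModeSystem.fsum_add hnNF4 hnR4 hx
    have h4 := ModeSystem.fsum_indicator_add hnQ B hx
    simp only at h2
    rw [hH, hH, ← h2, add_assoc, ← h3, ← hQ, ← h4, ← add_assoc, ← hy'] at h1
    exact h1
  · intro y hy
    have hx := hmem y hy
    have h1 := htrunc hGfam hnG hgG _ hx
    rw [ContinuousLinearEquiv.apply_symm_apply] at h1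
    rw [h1, Set.indicator_indicator, Set.indicator_indicator]
    have e2 : (L : Set (Mode (Fin n₁ ⊕ Fin n₂) m)) ∩ T ∩ B = B := by rw [hB, Set.inter_self]
    rw [e2]
  · have hBR : S.IsFam 4 (B.indicator R) := (hR.anti h72).indicator hσB
    have hnBR : S.nrm 4 (B.indicator R) ≠ ⊤ := ne_top_of_le_ne_top hnR4 (ModeSystem.nrm_indicator_le _ _)
    have h1 := Scales.tfNorm_eq_nrm (P := P) (t := 4)
      (f := fun x => g x - latticeProj kd L (truncation kd K f) x) hs4 hε4 hBR hnBR ?_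
    · refine h1.le.trans (((ModeSystem.nrm_indicator_le _ _).trans (ModeSystem.nrm_anti h72 R)).trans (hnR.trans ?_))
      rw [← hηf, ← ENNReal.ofReal_pow hη0, ← ENNReal.ofReal_mul (by positivity)]
      apply ENNReal.ofReal_le_ofReal
      have e1 : 8 * c / (α₂ * δ) * η ^ 2 = 8 * c * (μ * η) := by rw [hμ]; ring
      rw [e1, mul_assoc]
      exact mul_le_mul_of_nonneg_right (by linarith) (mul_nonneg hμ0 hη0)
    · intro x hx
      have h2 := htrunc (hF.anti h04) hnF4 hfF4 x hx
      have h3 := hgG hx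
      simp only at h3 ⊢
      rw [h2, h3, hBT, hBQ, ModeSystem.fsum_add (S := S) (ne_top_of_le_ne_top hnF4 (ModeSystem.nrm_indicator_le _ _)) hnBR
        hx, add_sub_cancel_left]
  · have h1 := Scales.tfNorm_eq_nrm (P := P) (t := 4) (f := e) hs4 hε4 hEfam hnE heE
    refine h1.le.trans ?_
    -- In `N` the modes of `F` have been removed and only the exponentially small part of `R` is
    -- left. Beyond order `K` all of `F + R` remains, to be damped by passing from level `7/2` to
    -- level `4`.
    have hsplit : Bᶜ.indicator Q = N.indicator R + Tᶜ.indicator (F + R) := by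
      funext κ
      by_cases hκT : κ ∈ T
      · by_cases hκL : κ ∈ (L : Set (Mode (Fin n₁ ⊕ Fin n₂) m))
        · simp [hB, hN, hκT, hκL]
        · simp [hB, hN, hQ, hκT, hκL]
      · simp [hB, hN, hQ, hκT]
    have hFR : S.IsFam (7 / 2) (F + R) := (hF.anti h07).add hR
    have h2 : S.nrm 4 (Tᶜ.indicator (F + R)) ≤
        ENNReal.ofReal (Real.exp (-(K * σ / 2)) * (η + 5 / 4 * μ * η)) := by
      refine (Scales.nrm_four_indicator_le (P := P) hFR (by simp only [hP]; linarith) hσ0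
        (hσ ▸ min_le_left _ _) (hσ ▸ min_le_right _ _)).trans ?_
      rw [ENNReal.ofReal_mul (Real.exp_pos _).le]
      gcongr
      rw [ENNReal.ofReal_add hη0 (by positivity)]
      exact (ModeSystem.nrm_add_le _ _).trans (add_le_add ((ModeSystem.nrm_anti h07 F).trans hnF.le) hnR)
    rw [hsplit, ← hηf, ← ENNReal.ofReal_mul (Real.exp_pos _).le]
    refine (ModeSystem.nrm_add_le _ _).trans ((add_le_add ((ModeSystem.nrm_anti h72 _).trans hnNR) h2).trans ?_)
    rw [← ENNReal.ofReal_add (by positivity) (by positivity)]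
    exact ENNReal.ofReal_le_ofReal (normal_form_exp_le hKσ hμX hη0)
  · intro y hy
    have hy7 : y ∈ P.phaseDom m (7 / 2) := by
      have := S.anti h72 (hmem y hy)
      have h2 : P.chart (P.chart.symm y) ∈ P.phaseDom m (7 / 2) := this
      rwa [ContinuousLinearEquiv.apply_symm_apply] at h2
    exact ⟨(Scales.actions_displacement hdisp (hα₂.trans_le hα) Sum.inl_injective hdα₁ hy7).trans hη2,
      (Scales.actions_displacement hdisp hα₂ Sum.inr_injective
        (fun κ hκ => .inl (hdα₂ κ hκ)) hy7).trans hη2,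
      (Scales.angles_displacement hdisp hα₂ hdα₂ hy7).trans hη2,
      (Scales.momenta_displacement hdisp hα₂ hdα₂ hy7).trans hη2,
      (Scales.positions_displacement hdisp hα₂ hdα₂ hy7).trans hη2⟩
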